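/- **Setting.** A complex Lie superalgebra $\mathfrak g=\mathfrak g_{\bar 0}\oplus\mathfrak g_{\bar 1}$ is finite-dimensional; $U(\mathfrak g)$ is its universal enveloping algebra. Let $\theta$ be an involutive automorphism of $\mathfrak g$, with $\pm1$-eigenspaces $\mathfrak k$ and $\mathfrak p$. An *even Cartan subspace* is a commutative subspace $\mathfrak a\subset\mathfrak p\cap\mathfrak g_{\bar 0}$ which is reductive in $\mathfrak g$ (that is, acts diagonalisably) and equals its own centraliser in $\mathfrak p$. For $\alpha\in\mathfrak a^*$ put $\mathfrak g_\alpha=\{x:[h,x]=\alpha(h)x\ \forall h\in\mathfrak a\}$; the restricted root system is $R(X)=\{\alpha\ne0:\mathfrak g_\alpha\neq0\}$, with multiplicities $\mu_\alpha=\dim(\mathfrak g_\alpha)_{\bar 0}-\dim(\mathfrak g_\alpha)_{\bar 1}$. Zonal functions are the linear functionals $f$ on $U(\mathfrak g)$ with $f(xu)=f(ux)=0$ for $x\in\mathfrak k$, $u\in U(\mathfrak g)$; they form the space $\mathcal Z(X)$. After the choice of a basis $e_1,\dots,e_N$ of $\mathfrak a$ the dual $S(\mathfrak a)^*$ is identified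 with $\mathbb C[[x_1,\dots,x_N]]$ by $f\mapsto\sum_M f\big(\prod_i e_i^{m_i}/m_i!\big)x^M$; $S(\mathfrak a)^*_{loc}$ is its localisation at the multiplicative set generated by $e^{2\alpha}-1$, $\alpha\in R(X)$, and $i^*:\mathcal Z(X)\to S(\mathfrak a)^*\to S(\mathfrak a)^*_{loc}$ is the restriction. **1.** If $\mathfrak a$ is an even Cartan subspace of $(\mathfrak g,\theta)$, then $U(\mathfrak g)=S(\mathfrak a)+\mathfrak kU(\mathfrak g)+U(\mathfrak g)\mathfrak k$, where $S(\mathfrak a)=U(\mathfrak a)$ is mapped to $U(\mathfrak g)$ in the natural way. **2.** Let moreover $(\,,)$ be a non-degenerate even supersymmetric invariant bilinear form on $\mathfrak g$ whose restriction to $\mathfrak a$ is non-degenerate, and assume that $\mathfrak g$ is simple or that the form is $\theta$-invariant. Let $\mathcal C_2=\sum_i b_ib^i\in U(\mathfrak g)$ be the quadratic Casimir element, where $(b_i)$ is a basis of $\mathfrak g$ and $(b^i,b_j)=\delta_{ij}$, and let $(\mathfrak Lf)(x)=f(x\mathcal C_2)$ be the Laplace–Beltrami operator. Then $\mathfrak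 L$ maps $\mathcal Z(X)$ to itself, and $i^*(\mathfrak Lf)=\mathfrak L_{rad}(i^*f)$ for all $f\in\mathcal Z(X)$, where $$\mathfrak L_{rad}=\Delta+\sum_{\alpha\in R_+(X)}\mu_\alpha\frac{e^{2\alpha}+1}{e^{2\alpha}-1}\,\partial_\alpha,\qquad \Delta e^\lambda=(\lambda,\lambda)e^\lambda,\quad \partial_\alpha e^\lambda=(\alpha,\lambda)e^\lambda,$$ and $R_+(X)$ contains exactly one of $\alpha,-\alpha$ for each restricted root $\alpha$. **3.** For each of the following pairs $(\mathfrak g,\mathfrak k)$ there is an even Cartan subspace $\mathfrak a$, with coordinates $x_1,\dots,x_n,y_1,\dots,y_m$, and a form as in 2, $\theta$-invariant and proportional to the supertrace form $\operatorname{str}(xy)$, such that $\Psi\,\mathfrak L_{rad}\,\Psi^{-1}=-(L+\mathrm{const})$ with $\Psi=\prod_{\alpha\in R_+(X)}(e^\alpha-e^{-\alpha})^{\mu_\alpha/2}$, the conjugation being taken in a suitable extension of $S(\mathfrak a)^*_{loc}$ as a ring with commuting derivations, where $L$ is a deformed CMS operator. Write $\Delta_n=\sum\partial_{x_i}^2$,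 $\Delta_m=\sum\partial_{y_j}^2$. (a) $(\mathfrak{gl}(n,2m),\mathfrak{osp}(n,2m))$: $L$ is the operator of type $A(n-1,m-1)$ with $k=-\tfrac12$, $$L=-\Delta_n-k\Delta_m+\sum_{i<j}^n\frac{2k(k+1)}{\sinh^2(x_i-x_j)}+\sum_{i<j}^m\frac{2(k^{-1}+1)}{\sinh^2(y_i-y_j)}+\sum_{i=1}^n\sum_{j=1}^m\frac{2(k+1)}{\sinh^2(x_i-y_j)}.$$ Moreover $\mathfrak L_{rad}=4\mathcal L$, where in the coordinates $X_i=e^{2x_i}$, $Y_j=e^{2y_j}$, with $D_i=X_i\partial_{X_i}$, $D'_j=Y_j\partial_{Y_j}$ and $k=-\frac12$, $$\mathcal L=\sum_i D_i^2+k\sum_j D_j'^2-k\sum_{i<j}\frac{X_i+X_j}{X_i-X_j}(D_i-D_j)-\sum_{i<j}\frac{Y_i+Y_j}{Y_i-Y_j}(D'_i-D'_j)-\sum_{i,j}\frac{X_i+Y_j}{X_i-Y_j}(D_i-kD'_j).$$ In the remaining cases $L$ is the operator of type $BC(n,m)$, $$\begin{aligned}L=&-\Delta_n-k\Delta_m+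\sum_{i<j}^{n}\Big(\tfrac{2k(k+1)}{\sinh^2(x_i-x_j)}+\tfrac{2k(k+1)}{\sinh^2(x_i+x_j)}\Big)+\sum_{i<j}^{m}\Big(\tfrac{2(k^{-1}+1)}{\sinh^2(y_i-y_j)}+\tfrac{2(k^{-1}+1)}{\sinh^2(y_i+y_j)}\Big)\\&+\sum_{i=1}^n\sum_{j=1}^m\Big(\tfrac{2(k+1)}{\sinh^2(x_i-y_j)}+\tfrac{2(k+1)}{\sinh^2(x_i+y_j)}\Big)+\sum_{i=1}^n\Big(\tfrac{p(p+2q+1)}{\sinh^2x_i}+\tfrac{4q(q+1)}{\sinh^22x_i}\Big)+\sum_{j=1}^m\Big(\tfrac{kr(r+2s+1)}{\sinh^2y_j}+\tfrac{4ks(s+1)}{\sinh^22y_j}\Big),\end{aligned}$$ with the following parameters. (b) $(\mathfrak{gl}(n_1+n_2,m_1+m_2),\mathfrak{gl}(n_1,m_1)\oplus\mathfrak{gl}(n_2,m_2))$ with $(n_1-n_2)(m_1-m_2)\ge0$: $n=\min(n_1,n_2)$, $m=\min(m_1,m_2)$, $k=-1$, $p=|m_1-m_2|-|n_1-n_2|=-r$,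 $q=s=-\frac12$. (c) $(\mathfrak{osp}(n_1+n_2,2m_1+2m_2),\mathfrak{osp}(n_1,2m_1)\oplus\mathfrak{osp}(n_2,2m_2))$ with $(n_1-n_2)(m_1-m_2)\ge0$: $n=\min(n_1,n_2)$, $m=\min(m_1,m_2)$, $k=-\frac12$, $p=|m_1-m_2|-\frac12|n_1-n_2|=-\frac12r$, $q=0$, $s=-\frac32$. (d) $(\mathfrak{osp}(2l,2m),\mathfrak{gl}(l,m))$: $k=-2$, $q=s=-\frac12$, with $p=r=0$ if $l=2n$, and $p=-2$, $r=1$ if $l=2n+1$. -/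

import Mathlib

noncomputable section

set_option linter.unusedSectionVars false

namespace RadialPart

/-! ### Lie superalgebras, involutions, enveloping algebras -/

/-- The Koszul sign `(-1)^{ij}`. -/
def koszul (i j : ZMod 2) : ℂ := if i = 1 ∧ j = 1 then -1 else 1

/-- The structure of a complex Lie superalgebra on a complex vector space `g`: a decomposition
`g = part 0 ⊕ part 1` and an even bracket, super skew-symmetric and satisfying the super Jacobi
identity. -/
structure LieSuperalgebra (g : Type*) [AddCommGroup g] [Module ℂ g] where
  part : ZMod 2 → Submodule ℂ g
  isCompl : IsCompl (part 0) (part 1)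
  bracket : g →ₗ[ℂ] g →ₗ[ℂ] g
  bracket_mem : ∀ {i j : ZMod 2} {x y : g}, x ∈ part i → y ∈ part j →
    bracket x y ∈ part (i + j)
  skew : ∀ {i j : ZMod 2} {x y : g}, x ∈ part i → y ∈ part j →
    bracket x y = -(koszul i j • bracket y x)
  jacobi : ∀ {i j : ZMod 2} {x y : g}, x ∈ part i → y ∈ part j → ∀ z : g,
    bracket x (bracket y z) = bracket (bracket x y) z + koszul i j • bracket y (bracket x z)

namespace LieSuperalgebra

section general

variable {g : Type*} [AddCommGroup g] [Module ℂ g] (L : LieSuperalgebra g)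

/-- `θ` is an automorphism of the Lie superalgebra with `θ ∘ θ = 1`. -/
structure IsInvolution (θ : g →ₗ[ℂ] g) : Prop where
  map_part : ∀ {i : ZMod 2} {x : g}, x ∈ L.part i → θ x ∈ L.part i
  map_bracket : ∀ x y : g, θ (L.bracket x y) = L.bracket (θ x) (θ y)
  involutive : ∀ x : g, θ (θ x) = x

/-- Simplicity: the bracket is not zero and there are no proper nonzero graded ideals. -/
def IsSimple : Prop :=
  (∃ x y : g, L.bracket x y ≠ 0) ∧
    ∀ I : Submodule ℂ g, I = (I ⊓ L.part 0) ⊔ (I ⊓ L.part 1) →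
      (∀ x : g, ∀ y ∈ I, L.bracket x y ∈ I) → I = ⊥ ∨ I = ⊤

/-- An even, supersymmetric, invariant bilinear form. -/
structure IsInvariantForm (B : LinearMap.BilinForm ℂ g) : Prop where
  even : ∀ {i j : ZMod 2} {x y : g}, x ∈ L.part i → y ∈ L.part j → i ≠ j → B x y = 0
  supersymm : ∀ {i j : ZMod 2} {x y : g}, x ∈ L.part i → y ∈ L.part j →
    B x y = koszul i j * B y x
  invariant : ∀ x y z : g, B (L.bracket x y) z = B x (L.bracket y z)

/-- The subspace of `g` on which `a` acts through the linear functional `α`. -/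
def weightSpace (a : Submodule ℂ g) (α : Module.Dual ℂ a) : Submodule ℂ g where
  carrier := {x | ∀ h : a, L.bracket (h : g) x = α h • x}
  add_mem' := fun {x y} hx hy h => by
    have hx' : L.bracket (h : g) x = α h • x := hx h
    have hy' : L.bracket (h : g) y = α h • y := hy h
    change L.bracket (h : g) (x + y) = α h • (x + y)
    rw [map_add, hx', hy', smul_add]
  zero_mem' := fun h => by simp
  smul_mem' := fun c x hx h => by
    have hx' : L.bracket (h : g) x = α h • x := hx h
    change L.bracket (h : g) (c • x) = α h • (c • x)
    rw [map_smul, hx', smul_comm]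

/-- `a` is an even Cartan subspace of the symmetric Lie superalgebra `(g, θ)`, where `p` is the
`-1` eigenspace of `θ`: a commutative subalgebra of `p` consisting of even elements, equal to its
centraliser in `p`, and reductive in `g` (for a commutative even `a` and finite-dimensional `g`
over `ℂ` this says that `g` is the sum of the simultaneous eigenspaces of `a`). -/
structure IsEvenCartanSubspace (θ : g →ₗ[ℂ] g) (a : Submodule ℂ g) : Prop where
  even : a ≤ L.part 0
  neg : ∀ x ∈ a, θ x = -x
  comm : ∀ x ∈ a, ∀ y ∈ a, L.bracket x y = 0
  centralizer : ∀ x : g, θ x = -x → (∀ h ∈ a, L.bracket h x = 0) → x ∈ a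
  reductive : ⨆ α : Module.Dual ℂ a, L.weightSpace a α = ⊤

/-- The restricted root system `R(X)`. -/
def restrictedRoots (a : Submodule ℂ g) : Set (Module.Dual ℂ a) :=
  {α | α ≠ 0 ∧ L.weightSpace a α ≠ ⊥}

/-- The dimension of the part of parity `d` of a restricted root space. -/
def rootDim (a : Submodule ℂ g) (d : ZMod 2) (α : Module.Dual ℂ a) : ℕ :=
  Module.finrank ℂ ↥(L.weightSpace a α ⊓ L.part d)

/-- The multiplicity `μ_α`, the superdimension of the restricted root space. -/
def multiplicity (a : Submodule ℂ g) (α : Module.Dual ℂ a) : ℤ :=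
  (L.rootDim a 0 α : ℤ) - (L.rootDim a 1 α : ℤ)

/-- `P` contains exactly one of `α`, `-α` for every restricted root `α`, and nothing else. Every
system of positive restricted roots is of this kind. -/
def IsPositiveHalf (a : Submodule ℂ g) (P : Finset (Module.Dual ℂ a)) : Prop :=
  (∀ α ∈ P, α ∈ L.restrictedRoots a) ∧ ∀ α ∈ L.restrictedRoots a, Xor (α ∈ P) (-α ∈ P)

/-- The defining relations `x y = (-1)^{p(x)p(y)} y x + [x, y]` of the enveloping algebra. -/
inductive EnvelopingRel : TensorAlgebra ℂ g → TensorAlgebra ℂ g → Prop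
  | comm {i j : ZMod 2} {x y : g} (hx : x ∈ L.part i) (hy : y ∈ L.part j) :
      EnvelopingRel (TensorAlgebra.ι ℂ x * TensorAlgebra.ι ℂ y)
        (koszul i j • (TensorAlgebra.ι ℂ y * TensorAlgebra.ι ℂ x) +
          TensorAlgebra.ι ℂ (L.bracket x y))

/-- The universal enveloping algebra `U(g)`. -/
abbrev Enveloping : Type _ := RingQuot L.EnvelopingRel

/-- The canonical map `g → U(g)`. -/
def toEnv : g →ₗ[ℂ] L.Enveloping :=
  (RingQuot.mkAlgHom ℂ L.EnvelopingRel).toLinearMap ∘ₗ TensorAlgebra.ι ℂ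

theorem toEnv_mul {i j : ZMod 2} {x y : g} (hx : x ∈ L.part i) (hy : y ∈ L.part j) :
    L.toEnv x * L.toEnv y = koszul i j • (L.toEnv y * L.toEnv x) + L.toEnv (L.bracket x y) := by
  have h := RingQuot.mkAlgHom_rel ℂ (EnvelopingRel.comm (L := L) hx hy)
  simpa [toEnv] using h

/-- A linear map with commuting values extends to the symmetric algebra. -/
def symLift {M A : Type*} [AddCommGroup M] [Module ℂ M] [Ring A] [Algebra ℂ A]
    (f : M →ₗ[ℂ] A) (hf : ∀ x y, f x * f y = f y * f x) : SymmetricAlgebra ℂ M →ₐ[ℂ] A :=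
  RingCon.liftₐEquiv (TensorAlgebra.symRingCon ℂ M) ⟨TensorAlgebra.lift ℂ f, by
    refine RingCon.ringConGen_le.2 (fun x y h' => ?_)
    induction h' with | mul_comm x y
    rw [RingCon.ker_apply]
    simp [hf]⟩

theorem symLift_ι {M A : Type*} [AddCommGroup M] [Module ℂ M] [Ring A] [Algebra ℂ A]
    (f : M →ₗ[ℂ] A) (hf : ∀ x y, f x * f y = f y * f x) (x : M) :
    symLift f hf (SymmetricAlgebra.ι ℂ M x) = f x :=
  TensorAlgebra.lift_ι_apply f x

variable {L}

theorem IsEvenCartanSubspace.toEnv_comm {θ : g →ₗ[ℂ] g} {a : Submodule ℂ g}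
    (ha : L.IsEvenCartanSubspace θ a) (x y : a) :
    (L.toEnv ∘ₗ a.subtype) x * (L.toEnv ∘ₗ a.subtype) y =
      (L.toEnv ∘ₗ a.subtype) y * (L.toEnv ∘ₗ a.subtype) x := by
  have h := L.toEnv_mul (ha.even x.2) (ha.even y.2)
  rw [ha.comm x x.2 y y.2] at h
  simpa [koszul] using h

/-- The algebra map `i : S(a) = U(a) → U(g)` induced by the inclusion of `a` in `g`. -/
def IsEvenCartanSubspace.symToEnv {θ : g →ₗ[ℂ] g} {a : Submodule ℂ g}
    (ha : L.IsEvenCartanSubspace θ a) : SymmetricAlgebra ℂ a →ₐ[ℂ] L.Enveloping :=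
  symLift (L.toEnv ∘ₗ a.subtype) ha.toEnv_comm

variable (L)

/-- The subspace `Y = k U(g) + U(g) k` of `U(g)`, where `k` is the fixed subspace of `θ`. -/
def kSpan (θ : g →ₗ[ℂ] g) : Submodule ℂ L.Enveloping :=
  Submodule.span ℂ {z | ∃ x : g, θ x = x ∧ ∃ u : L.Enveloping, z = L.toEnv x * u} ⊔
    Submodule.span ℂ {z | ∃ x : g, θ x = x ∧ ∃ u : L.Enveloping, z = u * L.toEnv x}

/-- Zonal functions: two-sided `k`-invariant linear functionals on `U(g)`. -/
def IsZonal (θ : g →ₗ[ℂ] g) (f : Module.Dual ℂ L.Enveloping) : Prop :=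
  ∀ x : g, θ x = x → ∀ u : L.Enveloping, f (L.toEnv x * u) = 0 ∧ f (u * L.toEnv x) = 0

/-- The quadratic Casimir element `∑ b_i b^i`, where `(b^i, b_j) = δ_{ij}`. This is the image in
`U(g)` of the element of `g ⊗ g` which represents the form, so it does not depend on the basis. -/
def casimir {κ : Type*} [Fintype κ] [DecidableEq κ] (B : LinearMap.BilinForm ℂ g)
    (hB : B.Nondegenerate) (b : Module.Basis κ ℂ g) : L.Enveloping :=
  ∑ i, L.toEnv (b i) * L.toEnv (B.dualBasis hB b i)

variable {L}

/-- The Laplace–Beltrami operator `(𝔏 f)(x) = f (x C)` of an element `C` of `U(g)`. -/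
def laplaceBeltrami (C : L.Enveloping) (f : Module.Dual ℂ L.Enveloping) :
    Module.Dual ℂ L.Enveloping :=
  f ∘ₗ LinearMap.mulRight ℂ C

end general

end LieSuperalgebra

/-! ### Formal power series, localisation, differential operators -/

section series

variable {ι : Type*} [Fintype ι]

/-- The power series `f̂ = ∑ f(e_M) x^M`, `e_M = ∏ e_i ^ {m_i} / m_i!`, of a functional `f` on
`S(V)`. -/
def hat {V : Type*} [AddCommGroup V] [Module ℂ V] (e : Module.Basis ι ℂ V)
    (f : Module.Dual ℂ (SymmetricAlgebra ℂ V)) : MvPowerSeries ι ℂ :=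
  fun M => f ((∏ i, ((M i).factorial : ℂ))⁻¹ • ∏ i, SymmetricAlgebra.ι ℂ V (e i) ^ M i)

/-- The power series `e^λ` of the linear form `λ = ∑ c_i x_i`. -/
def expSeries (c : ι → ℂ) : MvPowerSeries ι ℂ :=
  fun M => ∏ i, c i ^ M i / ((M i).factorial : ℂ)

end series

section localisation

variable {R : Type*} [CommRing R] [Algebra ℂ R] (S : Submonoid R) (d : Derivation ℂ R R)

/-- A derivation as a ring homomorphism to the square-zero extension of a localisation. -/
def derivHom : R →+* TrivSqZeroExt (Localization S) (Localization S) where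
  toFun r := TrivSqZeroExt.inl (algebraMap R _ r) + TrivSqZeroExt.inr (algebraMap R _ (d r))
  map_one' := by ext <;> simp
  map_zero' := by ext <;> simp
  map_add' r s := by ext <;> simp [Algebra.smul_def]
  map_mul' r s := by
    ext
    · simp
    · simp only [TrivSqZeroExt.snd_add, TrivSqZeroExt.snd_inl, TrivSqZeroExt.snd_inr,
        TrivSqZeroExt.snd_mul, TrivSqZeroExt.fst_add, TrivSqZeroExt.fst_inl,
        TrivSqZeroExt.fst_inr, Derivation.leibniz, map_add, map_mul, smul_eq_mul,
        op_smul_eq_smul, zero_add, add_zero]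

theorem derivHom_isUnit (s : S) : IsUnit (derivHom S d s) := by
  rw [TrivSqZeroExt.isUnit_iff_isUnit_fst]
  simpa [derivHom] using IsLocalization.map_units (Localization S) s

/-- The ring homomorphism `x ↦ x + (d x) ε` on a localisation. -/
def derivHomLoc : Localization S →+* TrivSqZeroExt (Localization S) (Localization S) :=
  IsLocalization.lift (M := S) (derivHom_isUnit S d)

theorem derivHomLoc_algebraMap (r : R) :
    derivHomLoc S d (algebraMap R _ r) = derivHom S d r :=
  IsLocalization.lift_eq _ r

theorem fst_derivHomLoc (x : Localization S) : (derivHomLoc S d x).fst = x := by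
  have h : ((TrivSqZeroExt.fstHom ℂ (Localization S) (Localization S)).toRingHom.comp
      (derivHomLoc S d)) = RingHom.id _ := by
    refine IsLocalization.ringHom_ext S ?_
    ext r
    simp [derivHomLoc_algebraMap, derivHom]
  exact congrArg (fun F => F x) h

/-- The extension of a derivation to a localisation (the quotient rule). -/
def localizeDerivation : Derivation ℂ (Localization S) (Localization S) :=
  Derivation.mk'
    { toFun := fun x => (derivHomLoc S d x).snd
      map_add' := fun x y => by simp
      map_smul' := fun c x => by
        have h : derivHomLoc S d (algebraMap ℂ _ c) = algebraMap ℂ _ c := by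
          rw [IsScalarTower.algebraMap_apply ℂ R (Localization S), derivHomLoc_algebraMap]
          ext <;> simp [derivHom, TrivSqZeroExt.algebraMap_eq_inl',
            IsScalarTower.algebraMap_apply ℂ R (Localization S)]
        rw [Algebra.smul_def, map_mul, h]
        simp [TrivSqZeroExt.algebraMap_eq_inl', Algebra.smul_def] }
    (fun x y => by
      change (derivHomLoc S d (x * y)).snd = _
      rw [map_mul]
      simp [fst_derivHomLoc, mul_comm])

theorem localizeDerivation_algebraMap (r : R) :
    localizeDerivation S d (algebraMap R _ r) = algebraMap R _ (d r) := by
  change (derivHomLoc S d (algebraMap R _ r)).snd = _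
  rw [derivHomLoc_algebraMap]
  change (TrivSqZeroExt.inl _ + TrivSqZeroExt.inr _ :
    TrivSqZeroExt (Localization S) (Localization S)).snd = _
  rw [TrivSqZeroExt.snd_add, TrivSqZeroExt.snd_inl, TrivSqZeroExt.snd_inr, zero_add]

end localisation

/-- A differential operator `∑ c₂ i j ∂_i ∂_j + ∑ c₁ i ∂_i + c₀` with coefficients in `A`. -/
structure DiffOp (ι A : Type*) where
  c₂ : ι → ι → A
  c₁ : ι → A
  c₀ : A

/-- The action of a differential operator on an `A`-algebra with given derivations `∂_i`. -/
def DiffOp.apply {ι A K : Type*} [Fintype ι] [CommRing A] [CommRing K] [Algebra ℂ K] [Algebra A K]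
    (T : DiffOp ι A) (D : ι → Derivation ℂ K K) (f : K) : K :=
  ∑ i, ∑ j, T.c₂ i j • D i (D j f) + ∑ i, T.c₁ i • D i f + T.c₀ • f

/-- The operator `T` is conjugate to `-(Q + const)` by a function `Ψ` with `Ψ² = num / den`:
in some ring `K` of functions which extends `A` together with its derivations `d i` and contains
such a `Ψ`, one has `Ψ ∘ T ∘ Ψ⁻¹ = -(Q + const)`. -/
def IsConjugate {ι A : Type} [Fintype ι] [CommRing A] [Algebra ℂ A]
    (d : ι → Derivation ℂ A A) (T Q : DiffOp ι A) (num den : A) : Prop :=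
  ∃ (K : Type) (_ : CommRing K) (_ : Algebra ℂ K) (_ : Algebra A K) (_ : IsScalarTower ℂ A K)
    (D : ι → Derivation ℂ K K) (Ψ : Kˣ) (c : ℂ),
    Function.Injective (algebraMap A K) ∧
    (∀ i x, D i (algebraMap A K x) = algebraMap A K (d i x)) ∧
    (∀ i j f, D i (D j f) = D j (D i f)) ∧
    (Ψ : K) ^ 2 * algebraMap A K den = algebraMap A K num ∧
    ∀ f : K, (Ψ : K) * T.apply D (((Ψ⁻¹ : Kˣ) : K) * f) = -(Q.apply D f + c • f)

/-! ### The radial part -/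

namespace LieSuperalgebra

section radial

variable {g : Type*} [AddCommGroup g] [Module ℂ g] (L : LieSuperalgebra g)
variable {ι : Type*} [Fintype ι] {a : Submodule ℂ g} (e : Module.Basis ι ℂ a)

/-- The multiplicative set generated by `e^{2α} - 1`, `α ∈ R(X)`. -/
def denominators : Submonoid (MvPowerSeries ι ℂ) :=
  Submonoid.closure {s | ∃ α ∈ L.restrictedRoots a, s = expSeries (fun i => 2 * α (e i)) - 1}

/-- The localisation `S(a)^*_loc` of `S(a)^* = ℂ[[x]]`. -/
abbrev Loc : Type _ := Localization (L.denominators e)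

/-- The function `e^λ`, `λ = ∑ c_i x_i`, in `S(a)^*_loc`. -/
def expLoc (c : ι → ℂ) : L.Loc e := algebraMap (MvPowerSeries ι ℂ) _ (expSeries c)

/-- The partial derivatives `∂/∂x_i` of `S(a)^*_loc`. -/
def locDeriv (i : ι) : Derivation ℂ (L.Loc e) (L.Loc e) :=
  localizeDerivation (L.denominators e) (MvPowerSeries.pderiv ℂ i)

/-- The inverse Gram matrix of the form on `a`, i.e. the matrix of the dual form on `a^*`. -/
def invGram [DecidableEq ι] (B : LinearMap.BilinForm ℂ g) : Matrix ι ι ℂ :=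
  (Matrix.of fun i j => B (e i : g) (e j : g))⁻¹

/-- The operator `Δ + ∑_{α ∈ P} μ_α (e^{2α} + 1) / (e^{2α} - 1) ∂_α`, where `Δ e^λ = (λ, λ) e^λ`
and `∂_α e^λ = (α, λ) e^λ`. The elements `e^{2α} - 1` are units of `S(a)^*_loc`. -/
def radialPart [DecidableEq ι] (B : LinearMap.BilinForm ℂ g) (P : Finset (Module.Dual ℂ a)) :
    DiffOp ι (L.Loc e) where
  c₂ i j := algebraMap ℂ _ (invGram e B i j)
  c₁ i := ∑ α ∈ P, (L.multiplicity a α : L.Loc e) *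
    ((L.expLoc e (fun k => 2 * α (e k)) + 1) *
      Ring.inverse (L.expLoc e (fun k => 2 * α (e k)) - 1)) *
    algebraMap ℂ _ (∑ j, invGram e B i j * α (e j))
  c₀ := 0

variable {L}

/-- The restriction `i^* f` of a functional on `U(g)` to `S(a)`, in `S(a)^*_loc`. -/
def restriction {θ : g →ₗ[ℂ] g} (ha : L.IsEvenCartanSubspace θ a)
    (f : Module.Dual ℂ L.Enveloping) : L.Loc e :=
  algebraMap (MvPowerSeries ι ℂ) _ (hat e (f ∘ₗ ha.symToEnv.toLinearMap))

end radial

section conjugation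

variable {g : Type} [AddCommGroup g] [Module ℂ g] (L : LieSuperalgebra g)
variable {ι : Type} [Fintype ι] [DecidableEq ι]

/-- The vectors `H_i` form a basis of an even Cartan subspace `a` of `(g, θ)`, the form `B` is an
even, invariant, supersymmetric, `θ`-invariant form, non-degenerate on `g` and on `a`, and in the
coordinates dual to the `H_i` the radial part is conjugate, by
`Ψ = ∏_{α > 0} (e^α - e^{-α}) ^ {μ_α / 2}`, to the operator `Q` up to sign and a constant.
The operator `Q` is given by its expression in the exponentials of linear forms. -/
def HasConjugateRadialPart (θ : g →ₗ[ℂ] g) (B : LinearMap.BilinForm ℂ g) (H : ι → g)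
    (Q : ∀ (A : Type) [CommRing A] [Algebra ℂ A], ((ι → ℂ) → A) → DiffOp ι A) : Prop :=
  L.IsInvolution θ ∧ L.IsInvariantForm B ∧ (∀ x y, B (θ x) (θ y) = B x y) ∧ B.Nondegenerate ∧
  L.IsEvenCartanSubspace θ (Submodule.span ℂ (Set.range H)) ∧
  (B.restrict (Submodule.span ℂ (Set.range H))).Nondegenerate ∧
  ∃ e : Module.Basis ι ℂ (Submodule.span ℂ (Set.range H)), (∀ i, (e i : g) = H i) ∧
    ∀ P : Finset (Module.Dual ℂ (Submodule.span ℂ (Set.range H))),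
      L.IsPositiveHalf _ P →
      IsConjugate (L.locDeriv e) (L.radialPart e B P) (Q _ (L.expLoc e))
        (∏ α ∈ P, (L.expLoc e (fun i => α (e i)) - L.expLoc e (fun i => -α (e i))) ^
          L.rootDim _ 0 α)
        (∏ α ∈ P, (L.expLoc e (fun i => α (e i)) - L.expLoc e (fun i => -α (e i))) ^
          L.rootDim _ 1 α)

end conjugation

end LieSuperalgebra

/-! ### Deformed CMS operators -/

section cms

variable {n m : ℕ} {A : Type} [CommRing A] [Algebra ℂ A]

/-- The linear form `x_i`. -/
def xForm (i : Fin n) : Fin n ⊕ Fin m → ℂ := Pi.single (Sum.inl i) 1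

/-- The linear form `y_j`. -/
def yForm (j : Fin m) : Fin n ⊕ Fin m → ℂ := Pi.single (Sum.inr j) 1

/-- `1 / sinh² λ`, where `sinh λ = (e^λ - e^{-λ}) / 2`. For the radial parts below `sinh λ` is a
unit of `S(a)^*_loc` whenever `1 / sinh² λ` occurs with a non-zero coefficient. -/
def invSinhSq {ι : Type} (E : (ι → ℂ) → A) (c : ι → ℂ) : A :=
  Ring.inverse (((1 / 2 : ℂ) • (E c - E (-c))) ^ 2)

variable (n m) in
/-- The deformed CMS operator of type `A(n-1, m-1)` with parameter `k`. -/
def cmsA (k : ℂ) (E : (Fin n ⊕ Fin m → ℂ) → A) : DiffOp (Fin n ⊕ Fin m) A where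
  c₂ := fun i j => if i = j then algebraMap ℂ A (Sum.elim (fun _ => -1) (fun _ => -k) i) else 0
  c₁ := fun _ => 0
  c₀ := (∑ i : Fin n, ∑ j ∈ Finset.Ioi i,
        (2 * k * (k + 1)) • invSinhSq E (xForm i - xForm j)) +
    (∑ i : Fin m, ∑ j ∈ Finset.Ioi i,
        (2 * (k⁻¹ + 1)) • invSinhSq E (yForm i - yForm j)) +
    ∑ i : Fin n, ∑ j : Fin m, (2 * (k + 1)) • invSinhSq E (xForm i - yForm j)

variable (n m) in
/-- The deformed CMS operator of type `A(n-1, m-1)` in the exponential coordinates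
`X_i = e^{2 x_i}`, `Y_j = e^{2 y_j}`, in its polynomial gauge:
`∑ (X_i ∂_{X_i})² + k ∑ (Y_j ∂_{Y_j})²
  - k ∑_{i<j} (X_i + X_j) / (X_i - X_j) (X_i ∂_{X_i} - X_j ∂_{X_j})
  - ∑_{i<j} (Y_i + Y_j) / (Y_i - Y_j) (Y_i ∂_{Y_i} - Y_j ∂_{Y_j})
  - ∑_{i,j} (X_i + Y_j) / (X_i - Y_j) (X_i ∂_{X_i} - k Y_j ∂_{Y_j})`,
where `X_i ∂_{X_i}` is `(1/2) ∂/∂x_i` and `Y_j ∂_{Y_j}` is `(1/2) ∂/∂y_j`. -/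
def cmsAExp (k : ℂ) (E : (Fin n ⊕ Fin m → ℂ) → A)
    (D : Fin n ⊕ Fin m → Derivation ℂ A A) (f : A) : A :=
  let X : Fin n → A := fun i => E ((2 : ℂ) • xForm i)
  let Y : Fin m → A := fun j => E ((2 : ℂ) • yForm j)
  let DX : Fin n → A → A := fun i u => (1 / 2 : ℂ) • D (Sum.inl i) u
  let DY : Fin m → A → A := fun j u => (1 / 2 : ℂ) • D (Sum.inr j) u
  (∑ i, DX i (DX i f)) + k • (∑ j, DY j (DY j f)) -
    k • (∑ i : Fin n, ∑ j ∈ Finset.Ioi i,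
      (X i + X j) * Ring.inverse (X i - X j) * (DX i f - DX j f)) -
    (∑ i : Fin m, ∑ j ∈ Finset.Ioi i,
      (Y i + Y j) * Ring.inverse (Y i - Y j) * (DY i f - DY j f)) -
    ∑ i : Fin n, ∑ j : Fin m,
      (X i + Y j) * Ring.inverse (X i - Y j) * (DX i f - k • DY j f)

variable (n m) in
/-- The deformed CMS operator of type `BC(n, m)` with parameters `k, p, q, r, s`. -/
def cmsBC (k p q r s : ℂ) (E : (Fin n ⊕ Fin m → ℂ) → A) : DiffOp (Fin n ⊕ Fin m) A where
  c₂ := fun i j => if i = j then algebraMap ℂ A (Sum.elim (fun _ => -1) (fun _ => -k) i) else 0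
  c₁ := fun _ => 0
  c₀ := (∑ i : Fin n, ∑ j ∈ Finset.Ioi i, (2 * k * (k + 1)) •
        (invSinhSq E (xForm i - xForm j) + invSinhSq E (xForm i + xForm j))) +
    (∑ i : Fin m, ∑ j ∈ Finset.Ioi i, (2 * (k⁻¹ + 1)) •
        (invSinhSq E (yForm i - yForm j) + invSinhSq E (yForm i + yForm j))) +
    (∑ i : Fin n, ∑ j : Fin m, (2 * (k + 1)) •
        (invSinhSq E (xForm i - yForm j) + invSinhSq E (xForm i + yForm j))) +
    (∑ i : Fin n, ((p * (p + 2 * q + 1)) • invSinhSq E (xForm i) +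
        (4 * q * (q + 1)) • invSinhSq E ((2 : ℂ) • xForm i))) +
    ∑ j : Fin m, ((k * r * (r + 2 * s + 1)) • invSinhSq E (yForm j) +
        (4 * k * s * (s + 1)) • invSinhSq E ((2 : ℂ) • yForm j))

end cms

/-! ### General linear and orthosymplectic Lie superalgebras -/

section matrices

variable {I : Type} [Fintype I] [DecidableEq I] (p : I → ZMod 2)

/-- Matrices of parity `d`, for the parity function `p` on the indices. -/
def matrixPart (d : ZMod 2) : Submodule ℂ (Matrix I I ℂ) where
  carrier := {x | ∀ i j, p i + p j ≠ d → x i j = 0}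
  add_mem' := fun {x y} hx hy i j h => by
    simp [hx i j h, hy i j h]
  zero_mem' := fun i j _ => rfl
  smul_mem' := fun c x hx i j h => by simp [hx i j h]

/-- The supercommutator of matrices, `x y - (-1)^{p(x)p(y)} y x` for homogeneous `x, y`. -/
def superBracket : Matrix I I ℂ →ₗ[ℂ] Matrix I I ℂ →ₗ[ℂ] Matrix I I ℂ :=
  LinearMap.mk₂ ℂ
    (fun x y => Matrix.of fun i j =>
      ∑ k, (x i k * y k j - koszul (p i + p k) (p k + p j) * (y i k * x k j)))
    (fun x x' y => by
      ext i j
      simp only [Matrix.of_apply, Matrix.add_apply, ← Finset.sum_add_distrib]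
      exact Finset.sum_congr rfl fun k _ => by ring)
    (fun c x y => by
      ext i j
      simp only [Matrix.of_apply, Matrix.smul_apply, smul_eq_mul, Finset.mul_sum]
      exact Finset.sum_congr rfl fun k _ => by ring)
    (fun x y y' => by
      ext i j
      simp only [Matrix.of_apply, Matrix.add_apply, ← Finset.sum_add_distrib]
      exact Finset.sum_congr rfl fun k _ => by ring)
    (fun c x y => by
      ext i j
      simp only [Matrix.of_apply, Matrix.smul_apply, smul_eq_mul, Finset.mul_sum]
      exact Finset.sum_congr rfl fun k _ => by ring)

variable {p}

theorem superBracket_apply (x y : Matrix I I ℂ) (i j : I) :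
    superBracket p x y i j =
      ∑ k, (x i k * y k j - koszul (p i + p k) (p k + p j) * (y i k * x k j)) := rfl

theorem superBracket_eq {a b : ZMod 2} {x y : Matrix I I ℂ} (hx : x ∈ matrixPart p a)
    (hy : y ∈ matrixPart p b) : superBracket p x y = x * y - koszul a b • (y * x) := by
  ext i j
  rw [superBracket_apply]
  simp only [Matrix.sub_apply, Matrix.smul_apply, Matrix.mul_apply, smul_eq_mul, Finset.mul_sum,
    ← Finset.sum_sub_distrib]
  refine Finset.sum_congr rfl fun k _ => ?_
  by_cases h1 : p i + p k = b
  · by_cases h2 : p k + p j = a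
    · rw [h1, h2]
      simp only [koszul, and_comm]
    · rw [hx k j h2]; ring
  · rw [hy i k h1]; ring

theorem mul_mem_matrixPart {a b : ZMod 2} {x y : Matrix I I ℂ} (hx : x ∈ matrixPart p a)
    (hy : y ∈ matrixPart p b) : x * y ∈ matrixPart p (a + b) := by
  intro i j h
  rw [Matrix.mul_apply]
  refine Finset.sum_eq_zero fun k _ => ?_
  by_cases h1 : p i + p k = a
  · by_cases h2 : p k + p j = b
    · refine absurd ?_ h
      rw [← h1, ← h2]
      generalize p i = u, p j = v, p k = w
      revert u v w
      decide
    · rw [hy k j h2, mul_zero]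
  · rw [hx i k h1, zero_mul]

theorem zmod_two_cases (a : ZMod 2) : a = 0 ∨ a = 1 := by
  revert a
  decide

theorem superBracket_mem {a b : ZMod 2} {x y : Matrix I I ℂ} (hx : x ∈ matrixPart p a)
    (hy : y ∈ matrixPart p b) : superBracket p x y ∈ matrixPart p (a + b) := by
  rw [superBracket_eq hx hy]
  refine Submodule.sub_mem _ (mul_mem_matrixPart hx hy) (Submodule.smul_mem _ _ ?_)
  rw [add_comm]
  exact mul_mem_matrixPart hy hx

theorem matrixPart_isCompl : IsCompl (matrixPart p 0) (matrixPart p 1) := by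
  constructor
  · rw [Submodule.disjoint_def]
    intro x h0 h1
    ext i j
    rcases zmod_two_cases (p i + p j) with h | h
    · exact h1 i j (by rw [h]; decide)
    · exact h0 i j (by rw [h]; decide)
  · rw [codisjoint_iff, eq_top_iff]
    intro x _
    refine Submodule.mem_sup.2 ⟨Matrix.of fun i j => if p i + p j = 0 then x i j else 0, ?_,
      Matrix.of fun i j => if p i + p j = 1 then x i j else 0, ?_, ?_⟩
    · intro i j h
      simp [h]
    · intro i j h
      simp [h]
    · ext i j
      rcases zmod_two_cases (p i + p j) with h | h <;> simp [h]

variable (p)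

/-- The general linear Lie superalgebra on the superspace with basis `I` and parities `p`. -/
def glSuper : LieSuperalgebra (Matrix I I ℂ) where
  part := matrixPart p
  isCompl := matrixPart_isCompl
  bracket := superBracket p
  bracket_mem := superBracket_mem
  skew := fun {i j x y} hx hy => by
    rw [superBracket_eq hx hy, superBracket_eq hy hx]
    rcases zmod_two_cases i with rfl | rfl <;> rcases zmod_two_cases j with rfl | rfl <;>
      simp [koszul, add_comm]
  jacobi := fun {i j x y} hx hy z => by
    obtain ⟨z0, h0, z1, h1, rfl⟩ := Submodule.mem_sup.1
      (show z ∈ matrixPart p 0 ⊔ matrixPart p 1 by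
        rw [matrixPart_isCompl.sup_eq_top]; exact Submodule.mem_top)
    have key : ∀ {l : ZMod 2} {z : Matrix I I ℂ}, z ∈ matrixPart p l →
        superBracket p x (superBracket p y z) = superBracket p (superBracket p x y) z +
          koszul i j • superBracket p y (superBracket p x z) := by
      intro l z hz
      rw [superBracket_eq hx (superBracket_mem hy hz), superBracket_eq hy (superBracket_mem hx hz),
        superBracket_eq (superBracket_mem hx hy) hz, superBracket_eq hx hy,
        superBracket_eq hx hz, superBracket_eq hy hz]
      rcases zmod_two_cases i with rfl | rfl <;> rcases zmod_two_cases j with rfl | rfl <;>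
        rcases zmod_two_cases l with rfl | rfl <;>
        simp [koszul, mul_sub, sub_mul, mul_add, add_mul, mul_assoc,
          show (1 + 1 : ZMod 2) = 0 from rfl] <;> abel
    simp only [map_add, key h0, key h1, smul_add]
    abel

/-- The supertrace. -/
def superTrace : Matrix I I ℂ →ₗ[ℂ] ℂ :=
  ∑ i, (if p i = 1 then (-1 : ℂ) else 1) • Matrix.entryLinearMap ℂ ℂ i i

/-- The form `(x, y) = c str(x y)`. -/
def strForm (c : ℂ) : LinearMap.BilinForm ℂ (Matrix I I ℂ) :=
  (LinearMap.mul ℂ (Matrix I I ℂ)).compr₂ (c • superTrace p)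

/-- A non-degenerate even supersymmetric form on the superspace with basis `I`:
`(v_i, v_{τ i}) = ε_i = ±1` and all other products of basis vectors are zero. -/
structure SuperForm where
  τ : I → I
  ε : I → ℂ
  τ_τ : ∀ i, τ (τ i) = i
  parity : ∀ i, p (τ i) = p i
  ε_sq : ∀ i, ε i * ε i = 1
  supersymm : ∀ i, ε (τ i) = koszul (p i) (p i) * ε i

variable {p}

/-- The involution `θ` of the general linear superalgebra given by
`(θ(x) v, w) + (-1)^{p(x)p(v)} (v, x w) = 0`. -/
def SuperForm.theta (F : SuperForm p) : Matrix I I ℂ →ₗ[ℂ] Matrix I I ℂ where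
  toFun x := Matrix.of fun i j =>
    -(F.ε i * F.ε j * koszul (p i + p j) (p j) * x (F.τ j) (F.τ i))
  map_add' x y := by
    ext i j
    simp only [Matrix.of_apply, Matrix.add_apply]
    ring
  map_smul' c x := by
    ext i j
    simp only [Matrix.of_apply, Matrix.smul_apply, smul_eq_mul, RingHom.id_apply]
    ring

/-- Conjugation by a diagonal matrix with entries `d i = ±1`. -/
def signConj (d : I → ℂ) : Matrix I I ℂ →ₗ[ℂ] Matrix I I ℂ where
  toFun x := Matrix.of fun i j => d i * d j * x i j
  map_add' x y := by
    ext i j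
    simp only [Matrix.of_apply, Matrix.add_apply]
    ring
  map_smul' c x := by
    ext i j
    simp only [Matrix.of_apply, Matrix.smul_apply, smul_eq_mul, RingHom.id_apply]
    ring

theorem SuperForm.theta_isInvolution (F : SuperForm p) : (glSuper p).IsInvolution F.theta where
  map_part := by
    intro d x hx i j h
    change -(F.ε i * F.ε j * koszul (p i + p j) (p j) * x (F.τ j) (F.τ i)) = 0
    rw [hx _ _ (by rw [F.parity, F.parity, add_comm]; exact h)]
    ring
  map_bracket := by
    intro x y
    ext i j
    change -(F.ε i * F.ε j * koszul (p i + p j) (p j) *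
      superBracket p x y (F.τ j) (F.τ i)) = superBracket p (F.theta x) (F.theta y) i j
    rw [superBracket_apply, superBracket_apply]
    have hτ : Function.Bijective F.τ := Function.Involutive.bijective F.τ_τ
    rw [← Function.Bijective.sum_comp hτ, Finset.mul_sum, ← Finset.sum_neg_distrib]
    refine Finset.sum_congr rfl fun k _ => ?_
    change _ = -(F.ε i * F.ε k * koszul (p i + p k) (p k) * x (F.τ k) (F.τ i)) *
        -(F.ε k * F.ε j * koszul (p k + p j) (p j) * y (F.τ j) (F.τ k)) -
      koszul (p i + p k) (p k + p j) *
        (-(F.ε i * F.ε k * koszul (p i + p k) (p k) * y (F.τ k) (F.τ i)) *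
          -(F.ε k * F.ε j * koszul (p k + p j) (p j) * x (F.τ j) (F.τ k)))
    rw [F.parity, F.parity, F.parity]
    have h := F.ε_sq k
    generalize x (F.τ k) (F.τ i) = x1, x (F.τ j) (F.τ k) = x2, y (F.τ k) (F.τ i) = y1,
      y (F.τ j) (F.τ k) = y2
    have e1 : koszul (p i + p j) (p j) * koszul (p j + p k) (p k + p i) =
        koszul (p i + p k) (p k) * koszul (p k + p j) (p j) := by
      generalize p i = u, p j = v, p k = w
      rcases zmod_two_cases u with rfl | rfl <;> rcases zmod_two_cases v with rfl | rfl <;>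
        rcases zmod_two_cases w with rfl | rfl <;>
        simp [koszul, show (1 + 1 : ZMod 2) = 0 from rfl]
    have e2 : koszul (p i + p j) (p j) = koszul (p i + p k) (p k + p j) *
        (koszul (p i + p k) (p k) * koszul (p k + p j) (p j)) := by
      generalize p i = u, p j = v, p k = w
      rcases zmod_two_cases u with rfl | rfl <;> rcases zmod_two_cases v with rfl | rfl <;>
        rcases zmod_two_cases w with rfl | rfl <;>
        simp [koszul, show (1 + 1 : ZMod 2) = 0 from rfl]
    linear_combination (F.ε i * F.ε j * y2 * x1) * e1 - (F.ε i * F.ε j * x2 * y1) * e2 +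
      (-(F.ε i * F.ε j * koszul (p i + p k) (p k) * koszul (p k + p j) (p j) * x1 * y2) +
        F.ε i * F.ε j * koszul (p i + p k) (p k + p j) * koszul (p i + p k) (p k) *
          koszul (p k + p j) (p j) * x2 * y1) * h
  involutive := by
    intro x
    ext i j
    change -(F.ε i * F.ε j * koszul (p i + p j) (p j) *
      -(F.ε (F.τ j) * F.ε (F.τ i) * koszul (p (F.τ j) + p (F.τ i)) (p (F.τ i)) *
        x (F.τ (F.τ i)) (F.τ (F.τ j)))) = x i j
    rw [F.τ_τ, F.τ_τ, F.parity, F.parity, F.supersymm, F.supersymm]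
    have hi := F.ε_sq i
    have hj := F.ε_sq j
    have e : koszul (p i + p j) (p j) * koszul (p j + p i) (p i) * koszul (p i) (p i) *
        koszul (p j) (p j) = 1 := by
      generalize p i = u, p j = v
      rcases zmod_two_cases u with rfl | rfl <;> rcases zmod_two_cases v with rfl | rfl <;>
        simp [koszul, show (1 + 1 : ZMod 2) = 0 from rfl]
    linear_combination (F.ε i * F.ε i * F.ε j * F.ε j * x i j) * e +
      (F.ε j * F.ε j * x i j) * hi + x i j * hj

end matrices

/-- The fixed subalgebra of an involution of a Lie superalgebra. -/
def LieSuperalgebra.fixed {g : Type*} [AddCommGroup g] [Module ℂ g] (L : LieSuperalgebra g)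
    {θ : g →ₗ[ℂ] g} (hθ : L.IsInvolution θ) :
    LieSuperalgebra (LinearMap.eqLocus θ LinearMap.id) where
  part d := (L.part d).comap (Submodule.subtype _)
  isCompl := by
    constructor
    · rw [Submodule.disjoint_def]
      intro x h0 h1
      exact Subtype.ext (Submodule.disjoint_def.1 L.isCompl.disjoint _ h0 h1)
    · rw [codisjoint_iff, eq_top_iff]
      rintro ⟨x, hx⟩ _
      obtain ⟨x0, h0, x1, h1, rfl⟩ := Submodule.mem_sup.1
        (show x ∈ L.part 0 ⊔ L.part 1 by
          rw [L.isCompl.sup_eq_top]; exact Submodule.mem_top)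
      have hx' : θ x0 + θ x1 = x0 + x1 := by simpa using hx
      have e : θ x0 - x0 = x1 - θ x1 := by
        rw [sub_eq_sub_iff_add_eq_add, hx', add_comm]
      have z0 : θ x0 - x0 = 0 := Submodule.disjoint_def.1 L.isCompl.disjoint _
        (Submodule.sub_mem _ (hθ.map_part h0) h0)
        (e ▸ Submodule.sub_mem _ h1 (hθ.map_part h1))
      have z1 : θ x1 = x1 := (sub_eq_zero.1 (e.symm.trans z0)).symm
      exact Submodule.mem_sup.2 ⟨⟨x0, sub_eq_zero.1 z0⟩, h0, ⟨x1, z1⟩, h1, rfl⟩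
  bracket := LinearMap.mk₂ ℂ
    (fun x y => ⟨L.bracket x y, by
      change θ _ = L.bracket x y
      rw [hθ.map_bracket, show θ x = x from x.2, show θ y = y from y.2]⟩)
    (fun x x' y => Subtype.ext (by simp))
    (fun c x y => Subtype.ext (by simp))
    (fun x y y' => Subtype.ext (by simp))
    (fun c x y => Subtype.ext (by simp))
  bracket_mem := fun hx hy => L.bracket_mem hx hy
  skew := fun hx hy => Subtype.ext (L.skew hx hy)
  jacobi := fun hx hy z => Subtype.ext (L.jacobi hx hy z)

section osp

variable {I : Type} [Fintype I] [DecidableEq I] {p : I → ZMod 2} (F : SuperForm p)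

/-- The vector space of the orthosymplectic Lie superalgebra of a form. -/
abbrev ospSpace : Submodule ℂ (Matrix I I ℂ) := LinearMap.eqLocus F.theta LinearMap.id

/-- The orthosymplectic Lie superalgebra `{x : θ(x) = x}` of a form. -/
def osp : LieSuperalgebra (ospSpace F) := (glSuper p).fixed F.theta_isInvolution

/-- Conjugation by a diagonal sign matrix which preserves the form up to sign, restricted to the
orthosymplectic superalgebra. -/
def ospSignConj (d : I → ℂ) (hd : ∀ i j, d (F.τ j) * d (F.τ i) = d i * d j) :
    ospSpace F →ₗ[ℂ] ospSpace F :=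
  (signConj d).restrict fun x hx => by
    have hx' : F.theta x = x := hx
    change F.theta (signConj d x) = signConj d x
    ext i j
    have h := congrFun (congrFun hx' i) j
    change -(F.ε i * F.ε j * koszul (p i + p j) (p j) * x (F.τ j) (F.τ i)) = x i j at h
    change -(F.ε i * F.ε j * koszul (p i + p j) (p j) *
      (d (F.τ j) * d (F.τ i) * x (F.τ j) (F.τ i))) = d i * d j * x i j
    rw [hd, ← h]
    ring

theorem single_neg_entry (i j : I) (c : ℂ) :
    Matrix.single i j (-c) = -Matrix.single i j c := by
  ext u v
  by_cases h : i = u ∧ j = v <;> simp [h]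

theorem SuperForm.theta_single (i j : I) (c : ℂ) :
    F.theta (Matrix.single i j c) = Matrix.single (F.τ j) (F.τ i)
      (-(F.ε (F.τ j) * F.ε (F.τ i) * koszul (p j + p i) (p i) * c)) := by
  ext u v
  change -(F.ε u * F.ε v * koszul (p u + p v) (p v) * Matrix.single i j c (F.τ v) (F.τ u)) = _
  by_cases h : i = F.τ v ∧ j = F.τ u
  · obtain ⟨rfl, rfl⟩ := h
    simp [F.τ_τ, F.parity]
  · rw [Matrix.single_apply_of_ne _ _ _ _ _ h, Matrix.single_apply_of_ne]
    · ring
    · rintro ⟨rfl, rfl⟩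
      exact h ⟨(F.τ_τ i).symm, (F.τ_τ j).symm⟩

end osp

/-! ### The four classical series -/

section seriesAI

variable (n m : ℕ)

/-- Indices of the superspace of dimension `(n | 2m)`. -/
abbrev AIIndex : Type := Fin n ⊕ (Fin m ⊕ Fin m)

/-- The parity of the indices. -/
def parityAI : AIIndex n m → ZMod 2 := Sum.elim (fun _ => 0) (fun _ => 1)

/-- The form which is Euclidean on the even part and the standard symplectic form on the odd
part. -/
def formAI : SuperForm (parityAI n m) where
  τ := Sum.elim (fun i => Sum.inl i) (fun j => Sum.inr j.swap)
  ε := Sum.elim (fun _ => 1) (Sum.elim (fun _ => 1) (fun _ => -1))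
  τ_τ := by rintro (i | j | j) <;> rfl
  parity := by rintro (i | j | j) <;> rfl
  ε_sq := by rintro (i | j | j) <;> simp
  supersymm := by rintro (i | j | j) <;> simp [koszul, parityAI]

/-- The coordinate vectors of the diagonal Cartan subspace
`{diag(x_1, …, x_n, y_1, …, y_m, y_1, …, y_m)}` of `gl(n, 2m)`. -/
def vectorsAI : Fin n ⊕ Fin m → Matrix (AIIndex n m) (AIIndex n m) ℂ :=
  Sum.elim (fun i => Matrix.single (Sum.inl i) (Sum.inl i) 1)
    (fun j => Matrix.single (Sum.inr (Sum.inl j)) (Sum.inr (Sum.inl j)) 1 +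
      Matrix.single (Sum.inr (Sum.inr j)) (Sum.inr (Sum.inr j)) 1)

end seriesAI

/-- The sign `+1` on the first and `-1` on the second summand. -/
def blockSign {I J : Type} : I ⊕ J → ℂ := Sum.elim (fun _ => 1) (fun _ => -1)

/-- The matrix `√-1 (E_{uv} - E_{vu})`, with `u` in the first and `v` in the second block. -/
def rotation {I J : Type} [DecidableEq I] [DecidableEq J] (u : I) (v : J) :
    Matrix (I ⊕ J) (I ⊕ J) ℂ :=
  Matrix.single (Sum.inl u) (Sum.inr v) Complex.I -
    Matrix.single (Sum.inr v) (Sum.inl u) Complex.I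

section seriesAIII

variable (n₁ m₁ n₂ m₂ : ℕ)

/-- Indices of the superspace `V₁ ⊕ V₂`, `dim V_i = (n_i | m_i)`. -/
abbrev AIIIIndex : Type := (Fin n₁ ⊕ Fin m₁) ⊕ (Fin n₂ ⊕ Fin m₂)

/-- The parity of the indices. -/
def parityAIII : AIIIIndex n₁ m₁ n₂ m₂ → ZMod 2 :=
  Sum.elim (Sum.elim (fun _ => 0) (fun _ => 1)) (Sum.elim (fun _ => 0) (fun _ => 1))

/-- The coordinate vectors of a Cartan subspace of the pair
`(gl(V₁ ⊕ V₂), gl(V₁) ⊕ gl(V₂))`. -/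
def vectorsAIII : Fin (min n₁ n₂) ⊕ Fin (min m₁ m₂) →
    Matrix (AIIIIndex n₁ m₁ n₂ m₂) (AIIIIndex n₁ m₁ n₂ m₂) ℂ :=
  Sum.elim
    (fun i => rotation (Sum.inl (i.castLE (min_le_left _ _)))
      (Sum.inl (i.castLE (min_le_right _ _))))
    (fun j => rotation (Sum.inr (j.castLE (min_le_left _ _)))
      (Sum.inr (j.castLE (min_le_right _ _))))

end seriesAIII

section seriesBDI

variable (n₁ m₁ n₂ m₂ : ℕ)

/-- Indices of the superspace `V₁ ⊕ V₂`, `dim V_i = (n_i | 2m_i)`. -/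
abbrev BDIIndex : Type := AIIndex n₁ m₁ ⊕ AIIndex n₂ m₂

/-- The parity of the indices. -/
def parityBDI : BDIIndex n₁ m₁ n₂ m₂ → ZMod 2 := Sum.elim (parityAI n₁ m₁) (parityAI n₂ m₂)

/-- The orthogonal sum of the standard forms of `V₁` and `V₂`. -/
def formBDI : SuperForm (parityBDI n₁ m₁ n₂ m₂) where
  τ := Sum.map (formAI n₁ m₁).τ (formAI n₂ m₂).τ
  ε := Sum.elim (formAI n₁ m₁).ε (formAI n₂ m₂).ε
  τ_τ := by rintro (i | i) <;> simp [SuperForm.τ_τ]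
  parity := by rintro (i | i) <;> simp [parityBDI, SuperForm.parity]
  ε_sq := by rintro (i | i) <;> simp [SuperForm.ε_sq]
  supersymm := by rintro (i | i) <;> simp [parityBDI, SuperForm.supersymm]

/-- The involution of `osp(V₁ ⊕ V₂)` with fixed subalgebra `osp(V₁) ⊕ osp(V₂)`: conjugation by
`1` on `V₁` and `-1` on `V₂`. -/
def thetaBDI : ospSpace (formBDI n₁ m₁ n₂ m₂) →ₗ[ℂ] ospSpace (formBDI n₁ m₁ n₂ m₂) :=
  ospSignConj _ blockSign (by rintro (i | i) (j | j) <;> simp [formBDI, blockSign])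

/-- The coordinate vectors of a Cartan subspace of the pair
`(osp(V₁ ⊕ V₂), osp(V₁) ⊕ osp(V₂))`. -/
def vectorsBDI : Fin (min n₁ n₂) ⊕ Fin (min m₁ m₂) → ospSpace (formBDI n₁ m₁ n₂ m₂) :=
  Sum.elim
    (fun i => ⟨rotation (Sum.inl (i.castLE (min_le_left _ _)))
      (Sum.inl (i.castLE (min_le_right _ _))), by
        change (formBDI n₁ m₁ n₂ m₂).theta _ = _
        rw [rotation, map_sub, SuperForm.theta_single, SuperForm.theta_single]
        simp [formBDI, formAI, parityBDI, parityAI, koszul, Matrix.single_neg, sub_eq_add_neg,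
          add_comm]⟩)
    (fun j => ⟨rotation (Sum.inr (Sum.inl (j.castLE (min_le_left _ _))))
        (Sum.inr (Sum.inl (j.castLE (min_le_right _ _)))) +
      rotation (Sum.inr (Sum.inr (j.castLE (min_le_left _ _))))
        (Sum.inr (Sum.inr (j.castLE (min_le_right _ _)))), by
        change (formBDI n₁ m₁ n₂ m₂).theta _ = _
        rw [rotation, rotation, map_add, map_sub, map_sub, SuperForm.theta_single,
          SuperForm.theta_single, SuperForm.theta_single, SuperForm.theta_single]
        simp [formBDI, formAI, parityBDI, parityAI, koszul]
        simp only [single_neg_entry]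
        abel⟩)

end seriesBDI

section seriesDIII

variable (l m : ℕ)

/-- Indices of the superspace `V ⊕ V^*`, `dim V = (l | m)`. -/
abbrev DIIIIndex : Type := (Fin l ⊕ Fin m) ⊕ (Fin l ⊕ Fin m)

/-- The parity of the indices. -/
def parityDIII : DIIIIndex l m → ZMod 2 :=
  Sum.elim (Sum.elim (fun _ => 0) (fun _ => 1)) (Sum.elim (fun _ => 0) (fun _ => 1))

/-- The form on `V ⊕ V^*` given by the pairing of `V` and `V^*`. -/
def formDIII : SuperForm (parityDIII l m) where
  τ := Sum.swap
  ε := Sum.elim (fun _ => 1) (Sum.elim (fun _ => 1) (fun _ => -1))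
  τ_τ := by rintro (i | i) <;> rfl
  parity := by rintro ((i | i) | (i | i)) <;> rfl
  ε_sq := by rintro ((i | i) | (i | i)) <;> simp
  supersymm := by rintro ((i | i) | (i | i)) <;> simp [koszul, parityDIII]

/-- The involution of `osp(V ⊕ V^*) = osp(2l, 2m)` with fixed subalgebra `gl(V) = gl(l, m)`:
conjugation by `1` on `V` and `-1` on `V^*`. -/
def thetaDIII : ospSpace (formDIII l m) →ₗ[ℂ] ospSpace (formDIII l m) :=
  ospSignConj _ blockSign (by rintro (i | i) (j | j) <;> simp [formDIII, blockSign])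

variable {l} {n : ℕ}

/-- The coordinate vectors of a Cartan subspace of the pair `(osp(2l, 2m), gl(l, m))`, where
`n` is the integer part of `l / 2`. -/
def vectorsDIII (h : 2 * n ≤ l) : Fin n ⊕ Fin m → ospSpace (formDIII l m) :=
  Sum.elim
    (fun i => by
      let u : Fin l := ⟨2 * i, by omega⟩
      let v : Fin l := ⟨2 * i + 1, by omega⟩
      exact ⟨Matrix.single (Sum.inl (Sum.inl u)) (Sum.inr (Sum.inl v)) 1 -
        Matrix.single (Sum.inl (Sum.inl v)) (Sum.inr (Sum.inl u)) 1 -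
        Matrix.single (Sum.inr (Sum.inl u)) (Sum.inl (Sum.inl v)) 1 +
        Matrix.single (Sum.inr (Sum.inl v)) (Sum.inl (Sum.inl u)) 1, by
        change (formDIII l m).theta _ = _
        rw [map_add, map_sub, map_sub, SuperForm.theta_single,
          SuperForm.theta_single, SuperForm.theta_single, SuperForm.theta_single]
        simp [formDIII, parityDIII, koszul]
        simp only [single_neg_entry]
        abel⟩)
    (fun j => ⟨Matrix.single (Sum.inl (Sum.inr j)) (Sum.inr (Sum.inr j)) 1 +
        Matrix.single (Sum.inr (Sum.inr j)) (Sum.inl (Sum.inr j)) 1, by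
        change (formDIII l m).theta _ = _
        rw [map_add, SuperForm.theta_single, SuperForm.theta_single]
        simp [formDIII, parityDIII, koszul]⟩)

end seriesDIII

end RadialPart

end

/-! The proof works with functionals instead of elements of the enveloping algebra. A functional `f`
on `U(g)` and an element `W` define the functional `u ↦ f (u W)` on `S(a)`, hence a power series.
Moving an element of `a` past a vector of weight `α` translates `S(a)` by `α`, and translation acts
on power series as multiplication by `e^α` (`hat_comp_symShift`). For zonal `f`, a vector `z` of `g`
standing at the left or right end of a product may be replaced by `-θ z`, and `θ` exchanges the
weights `α` and `-α`.

Decomposition. Were the sum of `S(a)` and `kSpan` a proper subspace, a nonzero zonal functional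
would vanish on `S(a)`. Such a functional is zero, by induction on the number of factors. For a root
vector `z`, reflecting on the left, moving to the right end modulo shorter products, and reflecting
there shows that `u ↦ f (u z W)` is invariant under translation by `2α`. Its series is then
annihilated by `e^{2α} - 1`, and power series form a domain. A vector of weight zero is half the sum
of an element of `k` and an element of `a`.

Radial part. The Casimir element is central, so zonality is preserved. The same reflections, applied
to a product of opposite root vectors `x`, `w`, give `(e^{2α} - 1) F(x w) = e^{2α} F([x, w])`
(`zonalHat_root_mul_root`), and `F([x, w])` is `(x, w)` times the derivative along the vector dual
to `α`. Summing over dual bases of homogeneous weight vectors produces the multiplicities as signed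
counts; weight zero produces the Laplacian, and joining `α` with `-α` produces the hyperbolic
cotangent. For simple `g`, invariance of the form under `θ` is a Schur argument.

Conjugation. A square root `Ψ` of `∏ (e^α - e^{-α})^{μ_α}` is adjoined formally by a quadratic
extension. With `l_i` the logarithmic derivatives of `Ψ`, conjugation removes the first order terms
and leaves the potential `∑ G_ij (∂_i l_j + l_i l_j)`, where `G` is the inverse Gram matrix
(`apply_conj_of_logDeriv`). It remains to see that this is the deformed CMS potential up to a
constant.

Potential. The restricted roots enter only through sums of even functions over positive roots. In
all four series these sums have one uniform shape, `IsRootSumA` or `IsRootSumBC`, with weights `w_i`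
equal to `1` on the `x_i` and `k⁻¹` on the `y_j`; the deformation sits in these weights alone. The
constancy statements `sum_typeA_sub_mem` and `sum_typeBC_sub_mem` hold for arbitrary nonzero
constant weights and rest on a cyclic three-term identity, for `coth` in type `A` and for rational
functions of `cosh 2z` in type `BC`.

Multiplicities. They are computed as traces of projections, from the weight decomposition of the
defining superspace. For `gl` a block contributes the product of two superdimensions. For `osp` one
averages over the involution defining `osp`, and its trace is a supertrace (`trace_sandwich_theta`).
In the `BC` cases the coordinate vectors satisfy `H³ = H` and annihilate one another, so everything
is determined by `str(H²)`; they are given by pairings between two blocks of basis vectors, and the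
centraliser condition is a comparison of matrix entries. -/

noncomputable section

set_option linter.unusedSectionVars false

namespace RadialPart

/-! ### Exponential series and functionals on symmetric algebras -/

section seriesLemmas

variable {ι : Type*}

/-- A set of power series without constant terms which is stable under the partial derivatives
contains only `0`. -/
theorem eq_zero_of_pderiv_mem {X : Set (MvPowerSeries ι ℂ)}
    (h0 : ∀ F ∈ X, MvPowerSeries.constantCoeff F = 0)
    (hd : ∀ F ∈ X, ∀ i, MvPowerSeries.pderiv ℂ i F ∈ X) {F : MvPowerSeries ι ℂ} (hF : F ∈ X) :
    F = 0 := by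
  have key : ∀ (N : ℕ) (n : ι →₀ ℕ), n.degree = N → ∀ F ∈ X, MvPowerSeries.coeff n F = 0 := by
    intro N
    induction N with
    | zero =>
      intro n hn F hF
      rw [(Finsupp.degree_eq_zero_iff n).1 hn]
      exact h0 F hF
    | succ N ih =>
      intro n hn F hF
      have hne : n ≠ 0 := by rintro rfl; simp at hn
      obtain ⟨i, hi : n i ≠ 0⟩ := Finsupp.ne_iff.1 hne
      have hle : Finsupp.single i 1 ≤ n := by
        rw [Finsupp.single_le_iff]; omega
      -- Up to the positive integer factor `n i`, the coefficient at `n` is the coefficient of `∂_i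
      -- F` at an exponent of smaller degree.
      have e := ih (n - Finsupp.single i 1) (by
        have := congrArg Finsupp.degree (tsub_add_cancel_of_le hle)
        rw [map_add, Finsupp.degree_single, hn] at this
        omega) _ (hd F hF i)
      rw [MvPowerSeries.coeff_pderiv, tsub_add_cancel_of_le hle] at e
      exact (mul_eq_zero.1 e).resolve_right (Nat.cast_add_one_ne_zero _)
  ext n
  rw [key _ n rfl F hF, map_zero]

theorem pderiv_comm (i j : ι) (F : MvPowerSeries ι ℂ) :
    MvPowerSeries.pderiv ℂ i (MvPowerSeries.pderiv ℂ j F) =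
      MvPowerSeries.pderiv ℂ j (MvPowerSeries.pderiv ℂ i F) := by
  classical
  ext n
  simp only [MvPowerSeries.coeff_pderiv, Finsupp.add_apply, Finsupp.single_apply]
  rw [add_right_comm]
  by_cases h : i = j
  · subst h; ring
  · simp [h, Ne.symm h]; ring

variable [Fintype ι]

theorem coeff_expSeries (c : ι → ℂ) (n : ι →₀ ℕ) :
    MvPowerSeries.coeff n (expSeries c) = ∏ i, c i ^ n i / ((n i).factorial : ℂ) := rfl

theorem constantCoeff_expSeries (c : ι → ℂ) :
    MvPowerSeries.constantCoeff (expSeries c) = 1 := by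
  rw [← MvPowerSeries.coeff_zero_eq_constantCoeff_apply, coeff_expSeries]
  simp

theorem prod_add_single [DecidableEq ι] {M : Type*} [CommMonoid M] (F : ι → ℕ → M) (n : ι →₀ ℕ)
    (i : ι) : ∏ j, F j ((n + Finsupp.single i 1 : ι →₀ ℕ) j) =
      F i (n i + 1) * ∏ j ∈ Finset.univ.erase i, F j (n j) := by
  rw [← Finset.mul_prod_erase _ _ (Finset.mem_univ i)]
  congr 1
  · simp
  · refine Finset.prod_congr rfl fun j hj => ?_
    simp [(Finset.ne_of_mem_erase hj).symm]

theorem pderiv_expSeries (c : ι → ℂ) (i : ι) :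
    MvPowerSeries.pderiv ℂ i (expSeries c) = c i • expSeries c := by
  classical
  ext n
  rw [MvPowerSeries.coeff_pderiv, MvPowerSeries.coeff_smul, coeff_expSeries, coeff_expSeries,
    prod_add_single (fun j k => c j ^ k / (k.factorial : ℂ)),
    ← Finset.mul_prod_erase _ _ (Finset.mem_univ i)]
  have h1 : ((n i).factorial : ℂ) ≠ 0 := by exact_mod_cast Nat.factorial_ne_zero _
  have h2 : (n i + 1 : ℂ) ≠ 0 := by exact Nat.cast_add_one_ne_zero _
  rw [Nat.factorial_succ]
  push_cast
  field_simp
  ring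

theorem expSeries_zero : expSeries (0 : ι → ℂ) = 1 := by
  refine MvPowerSeries.pderiv.ext (fun i => ?_) ?_
  · rw [pderiv_expSeries, MvPowerSeries.pderiv_one, Pi.zero_apply, zero_smul]
  · rw [constantCoeff_expSeries, map_one]

/-- The difference of the two sides has no constant term, and each partial derivative multiplies it
by a scalar. The line it spans is therefore stable under the derivatives, and
`eq_zero_of_pderiv_mem` applies. -/
theorem expSeries_add (c c' : ι → ℂ) : expSeries (c + c') = expSeries c * expSeries c' := by
  refine sub_eq_zero.1 (eq_zero_of_pderiv_mem
    (X := Set.range fun t : ℂ => t • (expSeries (c + c') - expSeries c * expSeries c')) ?_ ?_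
    ⟨1, one_smul _ _⟩)
  · rintro _ ⟨t, rfl⟩
    simp [MvPowerSeries.constantCoeff_smul, constantCoeff_expSeries]
  · rintro _ ⟨t, rfl⟩ i
    refine ⟨t * (c i + c' i), ?_⟩
    simp only [Derivation.map_smul, map_sub, Derivation.leibniz, pderiv_expSeries, Pi.add_apply]
    simp only [MvPowerSeries.smul_eq_C_mul, smul_eq_mul, map_mul, map_add]
    ring

/-- The constant term of `∂_i e^c` is `c i`, so the exponent can be read off from the derivatives.
-/
theorem expSeries_eq_one {c : ι → ℂ} (h : expSeries c = 1) : c = 0 := by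
  funext i
  have e := pderiv_expSeries c i
  rw [h, MvPowerSeries.pderiv_one] at e
  have := congrArg (MvPowerSeries.constantCoeff (σ := ι) (R := ℂ)) e
  simpa [MvPowerSeries.constantCoeff_smul] using this.symm

variable {V : Type*} [AddCommGroup V] [Module ℂ V] (e : Module.Basis ι ℂ V)

theorem coeff_hat (f : Module.Dual ℂ (SymmetricAlgebra ℂ V)) (M : ι →₀ ℕ) :
    MvPowerSeries.coeff M (hat e f) =
      f ((∏ i, ((M i).factorial : ℂ))⁻¹ • ∏ i, SymmetricAlgebra.ι ℂ V (e i) ^ M i) := rfl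

theorem constantCoeff_hat (f : Module.Dual ℂ (SymmetricAlgebra ℂ V)) :
    MvPowerSeries.constantCoeff (hat e f) = f 1 := by
  rw [← MvPowerSeries.coeff_zero_eq_constantCoeff_apply, coeff_hat]
  simp

theorem hat_add (f f' : Module.Dual ℂ (SymmetricAlgebra ℂ V)) :
    hat e (f + f') = hat e f + hat e f' := rfl

theorem hat_smul (c : ℂ) (f : Module.Dual ℂ (SymmetricAlgebra ℂ V)) :
    hat e (c • f) = c • hat e f := rfl

/-- The factorials in the definition of `hat` are chosen for this: differentiation of the series is
dual to multiplication by the basis vector in the symmetric algebra. -/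
theorem pderiv_hat (f : Module.Dual ℂ (SymmetricAlgebra ℂ V)) (i : ι) :
    MvPowerSeries.pderiv ℂ i (hat e f) =
      hat e (f ∘ₗ LinearMap.mulRight ℂ (SymmetricAlgebra.ι ℂ V (e i))) := by
  classical
  ext n
  rw [MvPowerSeries.coeff_pderiv, coeff_hat, coeff_hat,
    prod_add_single (fun j k => SymmetricAlgebra.ι ℂ V (e j) ^ k),
    prod_add_single (fun j k => (k.factorial : ℂ))]
  simp only [map_smul, smul_eq_mul, LinearMap.comp_apply, LinearMap.mulRight_apply]
  rw [← Finset.mul_prod_erase Finset.univ (fun i => ((n i).factorial : ℂ)) (Finset.mem_univ i),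
    ← Finset.mul_prod_erase Finset.univ (fun i => SymmetricAlgebra.ι ℂ V (e i) ^ n i)
      (Finset.mem_univ i), pow_succ,
    mul_right_comm (SymmetricAlgebra.ι ℂ V (e i) ^ n i) (SymmetricAlgebra.ι ℂ V (e i))]
  have h2 : (n i + 1 : ℂ) ≠ 0 := Nat.cast_add_one_ne_zero _
  rw [Nat.factorial_succ, Nat.cast_mul, Nat.cast_succ, mul_assoc ((n i : ℂ) + 1), mul_inv,
    mul_right_comm, mul_comm _ ((n i : ℂ) + 1), mul_inv_cancel_left₀ h2]

/-- The coefficients are the values on monomials in the basis, divided by nonzero factorials, and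
these monomials form a basis of the symmetric algebra. -/
theorem hat_injective : Function.Injective (hat e) := by
  intro f f' h
  refine (e.symmetricAlgebra).ext fun M => ?_
  have hM := congrArg (MvPowerSeries.coeff M) h
  rw [coeff_hat, coeff_hat, map_smul, map_smul] at hM
  have e1 : e.symmetricAlgebra M = ∏ i, SymmetricAlgebra.ι ℂ V (e i) ^ M i := by
    rw [Module.Basis.symmetricAlgebra, Module.Basis.map_apply, MvPolynomial.coe_basisMonomials,
      show (fun s => MvPolynomial.monomial s (1 : ℂ)) M = MvPolynomial.monomial M 1 from rfl,
      MvPolynomial.monomial_eq, Finsupp.prod_fintype _ _ (fun i => pow_zero _)]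
    simp
  rw [e1]
  refine smul_right_injective ℂ (inv_ne_zero ?_) hM
  exact Finset.prod_ne_zero_iff.2 fun i _ => by exact_mod_cast Nat.factorial_ne_zero _

/-- The translation `h ↦ h + α(h)` of `S(V)`. -/
def symShift (α : Module.Dual ℂ V) : SymmetricAlgebra ℂ V →ₐ[ℂ] SymmetricAlgebra ℂ V :=
  SymmetricAlgebra.lift (SymmetricAlgebra.ι ℂ V + (Algebra.linearMap ℂ _) ∘ₗ α)

theorem symShift_ι (α : Module.Dual ℂ V) (v : V) :
    symShift α (SymmetricAlgebra.ι ℂ V v) =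
      SymmetricAlgebra.ι ℂ V v + algebraMap ℂ _ (α v) := by
  simp [symShift]

theorem symShift_symShift (α β : Module.Dual ℂ V) (u : SymmetricAlgebra ℂ V) :
    symShift α (symShift β u) = symShift (α + β) u := by
  have h : (symShift α).comp (symShift β) = symShift (α + β) := by
    refine SymmetricAlgebra.algHom_ext ?_
    ext v
    simp [symShift_ι, add_assoc]
  exact congrArg (fun F => F u) h

/-- Taylor's formula in dual form. The differences of `e^{-α}` times the left side and `hat e f`,
for all `f` at once, have no constant term and are permuted by the derivatives: `∂_i` replaces `f`
by its composition with multiplication by `e i`, the extra term from the shift being cancelled by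
the derivative of `e^{-α}`. -/
theorem hat_comp_symShift (α : Module.Dual ℂ V) (f : Module.Dual ℂ (SymmetricAlgebra ℂ V)) :
    hat e (f ∘ₗ (symShift α).toLinearMap) = expSeries (fun i => α (e i)) * hat e f := by
  set c : ι → ℂ := fun i => α (e i) with hc
  have hinv : expSeries c * expSeries (-c) = 1 := by
    rw [← expSeries_add, add_neg_cancel, expSeries_zero]
  have key : expSeries (-c) * hat e (f ∘ₗ (symShift α).toLinearMap) = hat e f := by
    refine sub_eq_zero.1 (eq_zero_of_pderiv_mem
      (X := Set.range fun f : Module.Dual ℂ (SymmetricAlgebra ℂ V) =>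
        expSeries (-c) * hat e (f ∘ₗ (symShift α).toLinearMap) - hat e f) ?_ ?_ ⟨f, rfl⟩)
    · rintro _ ⟨f, rfl⟩
      simp [constantCoeff_expSeries, constantCoeff_hat]
    · rintro _ ⟨f, rfl⟩ i
      refine ⟨f ∘ₗ LinearMap.mulRight ℂ (SymmetricAlgebra.ι ℂ V (e i)), ?_⟩
      have h1 : (f ∘ₗ (symShift α).toLinearMap) ∘ₗ
          LinearMap.mulRight ℂ (SymmetricAlgebra.ι ℂ V (e i)) =
          (f ∘ₗ LinearMap.mulRight ℂ (SymmetricAlgebra.ι ℂ V (e i))) ∘ₗ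
            (symShift α).toLinearMap + c i • (f ∘ₗ (symShift α).toLinearMap) := by
        ext u
        simp [symShift_ι, mul_add, hc, Algebra.algebraMap_eq_smul_one]
      simp only [map_sub, Derivation.leibniz, pderiv_hat, pderiv_expSeries, h1, hat_add, hat_smul,
        smul_eq_mul, MvPowerSeries.smul_eq_C_mul, Pi.neg_apply, map_neg]
      ring
  rw [← key, ← mul_assoc, hinv, one_mul]

/-- A functional on `S(V)` which is invariant under a non-zero translation is zero. -/
theorem eq_zero_of_comp_symShift_eq (e : Module.Basis ι ℂ V) {α : Module.Dual ℂ V} (hα : α ≠ 0)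
    {f : Module.Dual ℂ (SymmetricAlgebra ℂ V)} (h : f ∘ₗ (symShift α).toLinearMap = f) : f = 0 := by
  refine hat_injective e (show hat e f = 0 from ?_)
  have h1 := hat_comp_symShift e α f
  rw [h] at h1
  have h2 : (expSeries (fun i => α (e i)) - 1) * hat e f = 0 := by
    rw [sub_mul, one_mul, ← h1, sub_self]
  -- Power series have no zero divisors, and `e^α = 1` would force `α = 0`.
  refine (mul_eq_zero.1 h2).resolve_left fun h3 => hα (e.ext fun i => ?_)
  exact congrFun (expSeries_eq_one (sub_eq_zero.1 h3)) i

end seriesLemmas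

namespace LieSuperalgebra

/-! ### Weight vectors and zonal functions -/

section zonal

variable {g : Type*} [AddCommGroup g] [Module ℂ g] {L : LieSuperalgebra g}
variable {θ : g →ₗ[ℂ] g} {a : Submodule ℂ g}

theorem koszul_zero_left (j : ZMod 2) : koszul 0 j = 1 := by simp [koszul]

theorem koszul_comm (i j : ZMod 2) : koszul i j = koszul j i := by simp [koszul, and_comm]

theorem koszul_mul_self (i j : ZMod 2) : koszul i j * koszul i j = 1 := by
  unfold koszul; split_ifs <;> norm_num

variable (L) in
theorem exists_parts (x : g) : ∃ x₀ ∈ L.part 0, ∃ x₁ ∈ L.part 1, x₀ + x₁ = x :=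
  Submodule.mem_sup.1 (by rw [L.isCompl.sup_eq_top]; exact Submodule.mem_top)

theorem eq_zero_of_mem_parts {x : g} (h0 : x ∈ L.part 0) (h1 : x ∈ L.part 1) : x = 0 :=
  Submodule.disjoint_def.1 L.isCompl.disjoint x h0 h1

theorem bracket_mem_part_of_even {h x : g} (hh : h ∈ L.part 0) {d : ZMod 2} (hx : x ∈ L.part d) :
    L.bracket h x ∈ L.part d := by
  simpa using L.bracket_mem hh hx

theorem bracket_swap_of_even {h : g} (hh : h ∈ L.part 0) (x : g) :
    L.bracket x h = -L.bracket h x := by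
  obtain ⟨x0, h0, x1, h1, rfl⟩ := L.exists_parts x
  simp [L.skew h0 hh, L.skew h1 hh, koszul_comm _ 0, koszul_zero_left, add_comm]

theorem toEnv_mul_of_even {h : g} (hh : h ∈ L.part 0) (x : g) :
    L.toEnv h * L.toEnv x = L.toEnv x * L.toEnv h + L.toEnv (L.bracket h x) := by
  obtain ⟨x0, h0, x1, h1, rfl⟩ := L.exists_parts x
  simp only [map_add, mul_add, add_mul, L.toEnv_mul hh h0, L.toEnv_mul hh h1, koszul_zero_left,
    one_smul]
  abel

/-- The homogeneous components of a weight vector are weight vectors. -/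
theorem parts_mem_weightSpace (ha : a ≤ L.part 0) {α : Module.Dual ℂ a} {x₀ x₁ : g}
    (h0 : x₀ ∈ L.part 0) (h1 : x₁ ∈ L.part 1) (hx : x₀ + x₁ ∈ L.weightSpace a α) :
    x₀ ∈ L.weightSpace a α ∧ x₁ ∈ L.weightSpace a α := by
  have key : ∀ h : a, L.bracket (h : g) x₀ - α h • x₀ = 0 ∧
      L.bracket (h : g) x₁ - α h • x₁ = 0 := by
    intro h
    have e : L.bracket (h : g) (x₀ + x₁) = α h • (x₀ + x₁) := hx h
    rw [map_add, smul_add] at e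
    have e' : L.bracket (h : g) x₀ - α h • x₀ = -(L.bracket (h : g) x₁ - α h • x₁) := by
      rw [neg_sub, sub_eq_sub_iff_add_eq_add, e, add_comm]
    have m0 := Submodule.sub_mem _ (bracket_mem_part_of_even (ha h.2) h0)
      (Submodule.smul_mem _ (α h) h0)
    have m1 := Submodule.sub_mem _ (bracket_mem_part_of_even (ha h.2) h1)
      (Submodule.smul_mem _ (α h) h1)
    have z := eq_zero_of_mem_parts m0 (e' ▸ Submodule.neg_mem _ m1)
    refine ⟨z, ?_⟩
    rw [z] at e'
    exact neg_eq_zero.1 e'.symm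
  exact ⟨fun h => sub_eq_zero.1 (key h).1, fun h => sub_eq_zero.1 (key h).2⟩

theorem iSup_weightSpace_inf_part (ha : a ≤ L.part 0)
    (hred : ⨆ α : Module.Dual ℂ a, L.weightSpace a α = ⊤) :
    ⨆ i : Module.Dual ℂ a × ZMod 2, L.weightSpace a i.1 ⊓ L.part i.2 = ⊤ := by
  rw [eq_top_iff, ← hred]
  refine iSup_le fun α x hx => ?_
  obtain ⟨x0, h0, x1, h1, rfl⟩ := L.exists_parts x
  obtain ⟨w0, w1⟩ := parts_mem_weightSpace ha h0 h1 hx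
  exact Submodule.add_mem _
    (Submodule.mem_iSup_of_mem (p := fun i : Module.Dual ℂ a × ZMod 2 =>
      L.weightSpace a i.1 ⊓ L.part i.2) (α, 0) ⟨w0, h0⟩)
    (Submodule.mem_iSup_of_mem (p := fun i : Module.Dual ℂ a × ZMod 2 =>
      L.weightSpace a i.1 ⊓ L.part i.2) (α, 1) ⟨w1, h1⟩)

/-- The bracket adds weights. -/
theorem bracket_mem_weightSpace (ha : a ≤ L.part 0) {α β : Module.Dual ℂ a} {x y : g}
    (hx : x ∈ L.weightSpace a α) (hy : y ∈ L.weightSpace a β) :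
    L.bracket x y ∈ L.weightSpace a (α + β) := by
  intro h
  obtain ⟨x0, h0, x1, h1, rfl⟩ := L.exists_parts x
  obtain ⟨w0, w1⟩ := parts_mem_weightSpace ha h0 h1 hx
  have hy' : L.bracket (h : g) y = β h • y := hy h
  have w0' : L.bracket (h : g) x0 = α h • x0 := w0 h
  have w1' : L.bracket (h : g) x1 = α h • x1 := w1 h
  simp only [map_add, LinearMap.add_apply, L.jacobi (ha h.2) h0, L.jacobi (ha h.2) h1,
    koszul_zero_left, one_smul, w0', w1', hy', map_smul, LinearMap.smul_apply]
  module

/-- `θ` is `-1` on `a`, so applying it to the eigenvalue equation reverses the sign of the weight.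
-/
theorem theta_mem_weightSpace (hθ : L.IsInvolution θ) (ha : L.IsEvenCartanSubspace θ a)
    {α : Module.Dual ℂ a} {x : g} (hx : x ∈ L.weightSpace a α) :
    θ x ∈ L.weightSpace a (-α) := by
  intro h
  have e := congrArg θ (hx h)
  rw [hθ.map_bracket, ha.neg h h.2, map_smul, map_neg, LinearMap.neg_apply] at e
  rw [LinearMap.neg_apply, neg_smul, ← e, neg_neg]

theorem IsEvenCartanSubspace.symToEnv_ι (ha : L.IsEvenCartanSubspace θ a) (h : a) :
    ha.symToEnv (SymmetricAlgebra.ι ℂ a h) = L.toEnv h :=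
  symLift_ι _ _ h

/-- On generators this is `h z = z (h + α(h))`, without sign since `a` is even; both sides are
multiplicative in `u`. -/
theorem symToEnv_mul_toEnv (ha : L.IsEvenCartanSubspace θ a) {α : Module.Dual ℂ a} {z : g}
    (hz : z ∈ L.weightSpace a α) (u : SymmetricAlgebra ℂ a) :
    ha.symToEnv u * L.toEnv z = L.toEnv z * ha.symToEnv (symShift α u) := by
  induction u using SymmetricAlgebra.induction with
  | algebraMap r => simp only [AlgHom.commutes]; exact Algebra.commutes r _
  | ι h =>
    have hz' : L.bracket (h : g) z = α h • z := hz h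
    rw [symShift_ι, map_add, AlgHom.commutes, ha.symToEnv_ι, toEnv_mul_of_even (ha.even h.2), hz',
      mul_add, map_smul, ← Algebra.commutes, ← Algebra.smul_def]
  | mul u v hu hv => rw [map_mul, mul_assoc, hv, ← mul_assoc, hu, mul_assoc, map_mul, map_mul]
  | add u v hu hv => rw [map_add, add_mul, hu, hv, map_add, map_add, mul_add]

theorem toEnv_mul_symToEnv (ha : L.IsEvenCartanSubspace θ a) {α : Module.Dual ℂ a} {z : g}
    (hz : z ∈ L.weightSpace a (-α)) (u : SymmetricAlgebra ℂ a) :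
    L.toEnv z * ha.symToEnv u = ha.symToEnv (symShift α u) * L.toEnv z := by
  rw [symToEnv_mul_toEnv ha hz, symShift_symShift, neg_add_cancel]
  congr 2
  have h : symShift (0 : Module.Dual ℂ a) = AlgHom.id ℂ _ := by
    refine SymmetricAlgebra.algHom_ext ?_
    ext v
    simp [symShift_ι]
  rw [h, AlgHom.id_apply]

/-- For a zonal function a factor on the right may be replaced by its image under `-θ`. -/
theorem IsZonal.mul_theta (hθ : L.IsInvolution θ) {f : Module.Dual ℂ L.Enveloping}
    (hf : L.IsZonal θ f) (u : L.Enveloping) (z : g) :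
    f (u * L.toEnv (θ z)) = -f (u * L.toEnv z) := by
  have h := (hf (z + θ z) (by rw [map_add, hθ.involutive, add_comm]) u).2
  rw [map_add, mul_add, map_add] at h
  linear_combination h

theorem IsZonal.theta_mul (hθ : L.IsInvolution θ) {f : Module.Dual ℂ L.Enveloping}
    (hf : L.IsZonal θ f) (u : L.Enveloping) (z : g) :
    f (L.toEnv (θ z) * u) = -f (L.toEnv z * u) := by
  have h := (hf (z + θ z) (by rw [map_add, hθ.involutive, add_comm]) u).1
  rw [map_add, add_mul, map_add] at h
  linear_combination h

/-- Moving a factor of weight `α` around a zonal function: reflecting it on the left. -/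
theorem IsZonal.symToEnv_mul_toEnv_mul (hθ : L.IsInvolution θ)
    (ha : L.IsEvenCartanSubspace θ a) {f : Module.Dual ℂ L.Enveloping} (hf : L.IsZonal θ f)
    {α : Module.Dual ℂ a} {z : g} (hz : z ∈ L.weightSpace a α) (u : SymmetricAlgebra ℂ a)
    (W : L.Enveloping) :
    f (ha.symToEnv u * (L.toEnv z * W)) =
      -f (ha.symToEnv (symShift (α + α) u) * (L.toEnv (θ z) * W)) := by
  rw [← mul_assoc, symToEnv_mul_toEnv ha hz, mul_assoc, ← symShift_symShift,
    ← mul_assoc (ha.symToEnv _) (L.toEnv (θ z)),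
    ← toEnv_mul_symToEnv ha (theta_mem_weightSpace hθ ha hz), mul_assoc, hf.theta_mul hθ, neg_neg]

theorem add_self_ne_zero {α : Module.Dual ℂ a} (hα : α ≠ 0) : α + α ≠ 0 := by
  rw [← two_smul ℂ]
  exact smul_ne_zero two_ne_zero hα

/-- A zonal function vanishes on `S(a) z W` for a restricted root vector `z` which can be moved
past `W`. -/
theorem IsZonal.eq_zero_of_root (hθ : L.IsInvolution θ) (ha : L.IsEvenCartanSubspace θ a)
    [FiniteDimensional ℂ a] {f : Module.Dual ℂ L.Enveloping} (hf : L.IsZonal θ f)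
    {α : Module.Dual ℂ a} (hα : α ≠ 0) {z : g} (hz : z ∈ L.weightSpace a α) {W : L.Enveloping}
    {s : ℂ} (h1 : ∀ u, f (ha.symToEnv u * (L.toEnv z * W)) =
      s * f (ha.symToEnv u * (W * L.toEnv z)))
    (h2 : ∀ u, f (ha.symToEnv u * (L.toEnv (θ z) * W)) =
      s * f (ha.symToEnv u * (W * L.toEnv (θ z)))) (u : SymmetricAlgebra ℂ a) :
    f (ha.symToEnv u * (L.toEnv z * W)) = 0 := by
  let φ : Module.Dual ℂ (SymmetricAlgebra ℂ a) :=
    (f ∘ₗ LinearMap.mulRight ℂ (L.toEnv z * W)) ∘ₗ ha.symToEnv.toLinearMap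
  -- Reflecting `z` on the left costs a minus sign and a translation by `2α`. Then `θ z` goes to the
  -- right end with factor `s`, is reflected there with a second minus sign, and `z` returns with
  -- the same factor. The signs cancel.
  have hφ : φ ∘ₗ (symShift (α + α)).toLinearMap = φ := by
    ext v
    change f (ha.symToEnv (symShift (α + α) v) * (L.toEnv z * W)) =
      f (ha.symToEnv v * (L.toEnv z * W))
    rw [hf.symToEnv_mul_toEnv_mul hθ ha hz v, h2, h1, ← mul_assoc _ W (L.toEnv (θ z)),
      hf.mul_theta hθ, mul_assoc]
    ring
  have := eq_zero_of_comp_symShift_eq (Module.finBasis ℂ a) (add_self_ne_zero hα) hφ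
  exact congrArg (fun F => F u) this

theorem IsZonal.eq_zero_of_root_right (hθ : L.IsInvolution θ) (ha : L.IsEvenCartanSubspace θ a)
    [FiniteDimensional ℂ a] {f : Module.Dual ℂ L.Enveloping} (hf : L.IsZonal θ f)
    {α : Module.Dual ℂ a} (hα : α ≠ 0) {z : g} (hz : z ∈ L.weightSpace a α)
    (u : SymmetricAlgebra ℂ a) : f (ha.symToEnv u * L.toEnv z) = 0 := by
  have := hf.eq_zero_of_root hθ ha hα hz (W := 1) (s := 1) (by simp) (by simp) u
  simpa using this

end zonal

/-! ### The decomposition of the enveloping algebra -/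

section decomposition

variable {g : Type*} [AddCommGroup g] [Module ℂ g] (L : LieSuperalgebra g)
variable {θ : g →ₗ[ℂ] g} {a : Submodule ℂ g}

/-- The span of the products of `d` homogeneous elements of `g`. -/
def homProducts (d : ℕ) : Submodule ℂ L.Enveloping :=
  Submodule.span ℂ {w | ∃ l : List g, (∀ x ∈ l, ∃ i, x ∈ L.part i) ∧ l.length = d ∧
    w = (l.map L.toEnv).prod}

variable {L}

theorem prod_mem_homProducts {l : List g} (hl : ∀ x ∈ l, ∃ i, x ∈ L.part i) :
    (l.map L.toEnv).prod ∈ L.homProducts l.length :=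
  Submodule.subset_span ⟨l, hl, rfl, rfl⟩

theorem toEnv_mul_mem_homProducts {i : ZMod 2} {x : g} (hx : x ∈ L.part i) {d : ℕ}
    {w : L.Enveloping} (hw : w ∈ L.homProducts d) : L.toEnv x * w ∈ L.homProducts (d + 1) := by
  induction hw using Submodule.span_induction with
  | mem w h =>
    obtain ⟨l, hl, rfl, rfl⟩ := h
    have := prod_mem_homProducts (L := L) (l := x :: l) (by
      rintro y hy
      rcases List.mem_cons.1 hy with rfl | hy
      · exact ⟨i, hx⟩
      · exact hl y hy)
    simpa using this
  | zero => simp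
  | add w w' _ _ h h' => rw [mul_add]; exact Submodule.add_mem _ h h'
  | smul c w _ h => rw [mul_smul_comm]; exact Submodule.smul_mem _ _ h

/-- A homogeneous factor can be moved past a product, up to sign and modulo shorter products. -/
theorem exists_sign_mul_prod (i : ZMod 2) {l : List g} (hl : ∀ x ∈ l, ∃ i, x ∈ L.part i) :
    ∃ s : ℂ, ∀ z ∈ L.part i, L.toEnv z * (l.map L.toEnv).prod -
      s • ((l.map L.toEnv).prod * L.toEnv z) ∈ L.homProducts l.length := by
  induction l with
  | nil => exact ⟨1, fun z _ => by simp⟩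
  | cons y l ih =>
    obtain ⟨s, hs⟩ := ih fun x hx => hl x (List.mem_cons_of_mem _ hx)
    obtain ⟨j, hy⟩ := hl y List.mem_cons_self
    refine ⟨koszul i j * s, fun z hz => ?_⟩
    -- Passing the first factor `y` leaves the commutator term with `[z, y]` in place of `y`; it has
    -- as many factors as `y :: l`, which the bound permits.
    have e : L.toEnv z * ((y :: l).map L.toEnv).prod -
        (koszul i j * s) • (((y :: l).map L.toEnv).prod * L.toEnv z) =
        koszul i j • (L.toEnv y * (L.toEnv z * (l.map L.toEnv).prod -
          s • ((l.map L.toEnv).prod * L.toEnv z))) +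
        L.toEnv (L.bracket z y) * (l.map L.toEnv).prod := by
      rw [List.map_cons, List.prod_cons, ← mul_assoc, L.toEnv_mul hz hy]
      simp only [add_mul, smul_mul_assoc, mul_sub, mul_smul_comm, smul_sub, smul_smul, mul_assoc]
      abel
    rw [e]
    refine Submodule.add_mem _ (Submodule.smul_mem _ _ (toEnv_mul_mem_homProducts hy (hs z hz))) ?_
    exact toEnv_mul_mem_homProducts (L.bracket_mem hz hy)
      (prod_mem_homProducts fun x hx => hl x (List.mem_cons_of_mem _ hx))

/-- The span of the products contains `1` and is stable under left multiplication by `g`, hence by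
the image of the whole tensor algebra. -/
theorem iSup_homProducts : ⨆ d, L.homProducts d = ⊤ := by
  set S := ⨆ d, L.homProducts d with hS
  have mem : ∀ {d w}, w ∈ L.homProducts d → w ∈ S := fun h =>
    Submodule.mem_iSup_of_mem (p := L.homProducts) _ h
  have hmul : ∀ x : g, ∀ w ∈ S, L.toEnv x * w ∈ S := by
    intro x w hw
    obtain ⟨x0, h0, x1, h1, rfl⟩ := L.exists_parts x
    induction hw using Submodule.iSup_induction' with
    | mem d w hw =>
      rw [map_add, add_mul]
      exact Submodule.add_mem _ (mem (toEnv_mul_mem_homProducts h0 hw))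
        (mem (toEnv_mul_mem_homProducts h1 hw))
    | zero => simp
    | add w w' _ _ h h' => rw [mul_add]; exact Submodule.add_mem _ h h'
  have key : ∀ t : TensorAlgebra ℂ g, ∀ w ∈ S,
      RingQuot.mkAlgHom ℂ L.EnvelopingRel t * w ∈ S := by
    intro t
    induction t using TensorAlgebra.induction with
    | algebraMap r =>
      intro w hw
      rw [AlgHom.commutes, ← Algebra.smul_def]
      exact Submodule.smul_mem _ _ hw
    | ι x => exact hmul x
    | mul t t' h h' => intro w hw; rw [map_mul, mul_assoc]; exact h _ (h' _ hw)
    | add t t' h h' => intro w hw; rw [map_add, add_mul]; exact Submodule.add_mem _ (h _ hw) (h' _ hw)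
  rw [eq_top_iff]
  intro w _
  obtain ⟨t, rfl⟩ := RingQuot.mkAlgHom_surjective ℂ L.EnvelopingRel w
  have one : (1 : L.Enveloping) ∈ S := mem (by
    simpa using prod_mem_homProducts (L := L) (l := []) (by simp))
  simpa using key t 1 one

/-- A zonal function which vanishes on `S(a)` is zero. -/
theorem IsZonal.eq_zero (hθ : L.IsInvolution θ) (ha : L.IsEvenCartanSubspace θ a)
    [FiniteDimensional ℂ a] {f : Module.Dual ℂ L.Enveloping} (hf : L.IsZonal θ f)
    (h0 : ∀ u, f (ha.symToEnv u) = 0) : f = 0 := by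
  -- The statement carries an arbitrary element of `S(a)` on the left, so that translations and the
  -- absorption of factors from `a` stay within the induction hypothesis.
  have key : ∀ d, ∀ w ∈ L.homProducts d, ∀ u, f (ha.symToEnv u * w) = 0 := by
    intro d
    induction d with
    | zero =>
      intro w hw u
      induction hw using Submodule.span_induction with
      | mem w h =>
        obtain ⟨l, -, hl, rfl⟩ := h
        rw [List.length_eq_zero_iff.1 hl]
        simpa using h0 u
      | zero => simp
      | add w w' _ _ h h' => rw [mul_add, map_add, h, h', add_zero]
      | smul c w _ h => rw [mul_smul_comm, map_smul, h, smul_zero]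
    | succ d ih =>
      intro w hw u
      induction hw using Submodule.span_induction with
      | zero => simp
      | add w w' _ _ h h' => rw [mul_add, map_add, h, h', add_zero]
      | smul c w _ h => rw [mul_smul_comm, map_smul, h, smul_zero]
      | mem w h =>
        obtain ⟨l, hl, hd, rfl⟩ := h
        rcases l with _ | ⟨z, l⟩
        · simp at hd
        have hl' : ∀ x ∈ l, ∃ i, x ∈ L.part i := fun x hx => hl x (List.mem_cons_of_mem _ hx)
        have hd' : l.length = d := by simpa using hd
        rw [List.map_cons, List.prod_cons]
        have hz : z ∈ ⨆ i : Module.Dual ℂ a × ZMod 2, L.weightSpace a i.1 ⊓ L.part i.2 := by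
          rw [iSup_weightSpace_inf_part ha.even ha.reductive]; exact Submodule.mem_top
        clear hl hd
        induction hz using Submodule.iSup_induction' with
        | zero => simp
        | add z z' _ _ h h' => rw [map_add, add_mul, mul_add, map_add, h, h', add_zero]
        | mem i z hz =>
          obtain ⟨α, i⟩ := i
          obtain ⟨hzα, hzi⟩ := hz
          -- The factor `s` depends on the parity of `z` only, so it serves both `z` and `θ z`.
          obtain ⟨s, hs⟩ := exists_sign_mul_prod (L := L) i hl'
          rw [hd'] at hs
          have hs' : ∀ z ∈ L.part i, ∀ u, f (ha.symToEnv u *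
              (L.toEnv z * (l.map L.toEnv).prod)) =
              s * f (ha.symToEnv u * ((l.map L.toEnv).prod * L.toEnv z)) := by
            intro z hz u
            have := ih _ (hs z hz) u
            rw [mul_sub, map_sub, mul_smul_comm, map_smul, smul_eq_mul] at this
            exact sub_eq_zero.1 this
          -- In weight zero, `z + θ z` lies in `k` and dies after being moved to the right end,
          -- while `z - θ z` lies in `p` and centralises `a`, hence belongs to `a` and can be
          -- absorbed into `u`.
          by_cases hα : α = 0
          · subst hα
            have hk : f (ha.symToEnv u * (L.toEnv (z + θ z) * (l.map L.toEnv).prod)) = 0 := by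
              rw [hs' _ (Submodule.add_mem _ hzi (hθ.map_part hzi)), ← mul_assoc,
                (hf _ (by rw [map_add, hθ.involutive, add_comm]) _).2, mul_zero]
            have hmem : z - θ z ∈ a := by
              refine ha.centralizer _ (by rw [map_sub, hθ.involutive, neg_sub]) fun h hh => ?_
              have e1 : L.bracket h z = (0 : Module.Dual ℂ a) ⟨h, hh⟩ • z := hzα ⟨h, hh⟩
              have e2 : L.bracket h (θ z) = (-0 : Module.Dual ℂ a) ⟨h, hh⟩ • θ z :=
                theta_mem_weightSpace hθ ha hzα ⟨h, hh⟩
              rw [map_sub, e1, e2]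
              simp
            have hp : f (ha.symToEnv u * (L.toEnv (z - θ z) * (l.map L.toEnv).prod)) = 0 := by
              have := ih _ (hd' ▸ prod_mem_homProducts hl')
                (u * SymmetricAlgebra.ι ℂ a ⟨z - θ z, hmem⟩)
              rw [map_mul ha.symToEnv, ha.symToEnv_ι, mul_assoc] at this
              exact this
            have e : L.toEnv z = (1 / 2 : ℂ) • (L.toEnv (z + θ z) + L.toEnv (z - θ z)) := by
              rw [← map_add, ← map_smul]
              congr 1
              module
            rw [e, smul_mul_assoc, mul_smul_comm, map_smul, add_mul, mul_add, map_add, hk, hp,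
              add_zero, smul_zero]
          · exact hf.eq_zero_of_root hθ ha hα hzα (hs' z hzi) (hs' _ (hθ.map_part hzi)) u
  refine LinearMap.ext fun w => ?_
  have hw : w ∈ ⨆ d, L.homProducts d := by rw [iSup_homProducts]; exact Submodule.mem_top
  induction hw using Submodule.iSup_induction' with
  | mem d w hw => simpa using key d w hw 1
  | zero => simp
  | add w w' _ _ h h' => rw [map_add, h, h', map_add]

/-- A proper subspace lies in the kernel of a nonzero functional. Vanishing on `kSpan` makes that
functional zonal, and vanishing on `S(a)` then makes it zero by `IsZonal.eq_zero`. -/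
theorem range_symToEnv_sup_kSpan (hθ : L.IsInvolution θ) (ha : L.IsEvenCartanSubspace θ a)
    [FiniteDimensional ℂ a] :
    LinearMap.range ha.symToEnv.toLinearMap ⊔ L.kSpan θ = ⊤ := by
  by_contra h
  obtain ⟨f, hf0, hf⟩ := Submodule.exists_le_ker_of_lt_top _ (lt_top_iff_ne_top.2 h)
  refine hf0 (IsZonal.eq_zero hθ ha (f := f) (fun x hx u => ?_) fun u => ?_)
  · exact ⟨hf (Submodule.mem_sup_right (Submodule.mem_sup_left
        (Submodule.subset_span ⟨x, hx, u, rfl⟩))),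
      hf (Submodule.mem_sup_right (Submodule.mem_sup_right
        (Submodule.subset_span ⟨x, hx, u, rfl⟩)))⟩
  · exact hf (Submodule.mem_sup_left ⟨u, rfl⟩)

end decomposition

end LieSuperalgebra

namespace LieSuperalgebra

/-! ### Bases of homogeneous weight vectors -/

section weightBasis

variable {g : Type*} [AddCommGroup g] [Module ℂ g] (L : LieSuperalgebra g)

/-- The parity operator, `1` on the even and `-1` on the odd part. -/
def parityOp : Module.End ℂ g :=
  LinearMap.ofIsCompl L.isCompl (L.part 0).subtype (-(L.part 1).subtype)

variable {L}

theorem parityOp_of_mem {d : ZMod 2} {x : g} (hx : x ∈ L.part d) :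
    L.parityOp x = koszul d d • x := by
  rcases zmod_two_cases d with rfl | rfl
  · simpa [koszul, parityOp] using LinearMap.ofIsCompl_apply_left L.isCompl
      (φ := (L.part 0).subtype) (ψ := -(L.part 1).subtype) ⟨x, hx⟩
  · simpa [koszul, parityOp] using LinearMap.ofIsCompl_apply_right L.isCompl
      (φ := (L.part 0).subtype) (ψ := -(L.part 1).subtype) ⟨x, hx⟩

variable {θ : g →ₗ[ℂ] g} {a : Submodule ℂ g}

/-- These are joint eigenspaces of the commuting operators `ad h`, `h ∈ a`, and the parity operator,
and distinct pairs of weight and parity give distinct systems of eigenvalues. -/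
theorem iSupIndep_weightSpace_inf_part (ha : L.IsEvenCartanSubspace θ a) :
    iSupIndep fun i : Module.Dual ℂ a × ZMod 2 => L.weightSpace a i.1 ⊓ L.part i.2 := by
  let F : Option a → Module.End ℂ g := fun h => h.elim L.parityOp fun h => L.bracket h
  have hpar : ∀ h : a, Commute L.parityOp (L.bracket (h : g)) := by
    intro h
    refine LinearMap.ext fun x => ?_
    change L.parityOp (L.bracket h x) = L.bracket h (L.parityOp x)
    obtain ⟨x0, h0, x1, h1, rfl⟩ := L.exists_parts x
    simp only [map_add, parityOp_of_mem h0, parityOp_of_mem h1, map_smul,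
      parityOp_of_mem (bracket_mem_part_of_even (ha.even h.2) h0),
      parityOp_of_mem (bracket_mem_part_of_even (ha.even h.2) h1)]
  have hcomm : ∀ i j, Commute (F i) (F j) := by
    rintro (_ | h) (_ | h')
    · exact Commute.refl _
    · exact hpar h'
    · exact (hpar h).symm
    · refine LinearMap.ext fun x => ?_
      change L.bracket h (L.bracket h' x) = L.bracket h' (L.bracket h x)
      rw [L.jacobi (ha.even h.2) (ha.even h'.2), ha.comm _ h.2 _ h'.2]
      simp [koszul_zero_left]
  have ind := Module.End.independent_iInf_maxGenEigenspace_of_forall_mapsTo F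
    (fun i j φ => Module.End.mapsTo_maxGenEigenspace_of_comm (hcomm j i) φ)
  let χ : Module.Dual ℂ a × ZMod 2 → Option a → ℂ := fun i h =>
    h.elim (koszul i.2 i.2) fun h => i.1 h
  have hχ : Function.Injective χ := by
    rintro ⟨α, d⟩ ⟨α', d'⟩ h
    have h1 : koszul d d = koszul d' d' := congrFun h none
    have h2 : α = α' := LinearMap.ext fun x => congrFun h (some x)
    subst h2
    have h3 : d = d' := by
      rcases zmod_two_cases d with rfl | rfl <;> rcases zmod_two_cases d' with rfl | rfl <;>
        first | rfl | norm_num [koszul] at h1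
    rw [h3]
  refine (ind.comp hχ).mono fun i x hx => ?_
  rw [Function.comp_apply, Submodule.mem_iInf]
  rintro (_ | h)
  · refine Module.End.mem_maxGenEigenspace _ _ _ |>.2 ⟨1, ?_⟩
    simpa [F, χ, sub_eq_zero] using parityOp_of_mem hx.2
  · refine Module.End.mem_maxGenEigenspace _ _ _ |>.2 ⟨1, ?_⟩
    simpa [F, χ, sub_eq_zero] using hx.1 h

/-- In such a basis the root multiplicities are signed counts of basis vectors, which is how they
arise from the Casimir sum. -/
theorem exists_weightBasis {g : Type u} [AddCommGroup g] [Module ℂ g] {L : LieSuperalgebra g}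
    [FiniteDimensional ℂ g] {θ : g →ₗ[ℂ] g} {a : Submodule ℂ g}
    (ha : L.IsEvenCartanSubspace θ a) :
    ∃ (κ : Type u) (_ : Fintype κ) (_ : DecidableEq κ) (b : Module.Basis κ ℂ g)
      (wt : κ → Module.Dual ℂ a) (par : κ → ZMod 2),
      (∀ i, b i ∈ L.weightSpace a (wt i)) ∧ (∀ i, b i ∈ L.part (par i)) ∧
      ∀ [DecidableEq (Module.Dual ℂ a)] (α : Module.Dual ℂ a),
        (L.multiplicity a α : ℂ) = ∑ i with wt i = α, koszul (par i) (par i) := by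
  classical
  have hinternal := DirectSum.isInternal_submodule_of_iSupIndep_of_iSup_eq_top
    (iSupIndep_weightSpace_inf_part ha) (iSup_weightSpace_inf_part ha.even ha.reductive)
  let b := hinternal.collectedBasis fun i => Module.finBasis ℂ ↥(L.weightSpace a i.1 ⊓ L.part i.2)
  let _ : Fintype (Σ i : Module.Dual ℂ a × ZMod 2,
    Fin (Module.finrank ℂ ↥(L.weightSpace a i.1 ⊓ L.part i.2))) :=
    FiniteDimensional.fintypeBasisIndex b
  refine ⟨_, inferInstance, inferInstance, b, fun i => i.1.1, fun i => i.1.2,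
    fun i => (hinternal.collectedBasis_mem _ i).1, fun i => (hinternal.collectedBasis_mem _ i).2, ?_⟩
  intro _ α
  have hcard : ∀ d : ZMod 2, (Finset.univ.filter fun i : (Σ i : Module.Dual ℂ a × ZMod 2,
      Fin (Module.finrank ℂ ↥(L.weightSpace a i.1 ⊓ L.part i.2))) => i.1 = (α, d)).card =
      L.rootDim a d α := by
    intro d
    rw [← Fintype.card_subtype, Fintype.card_congr (Equiv.sigmaSubtype (α, d)), Fintype.card_fin]
    rfl
  have hsplit : ∀ i : (Σ i : Module.Dual ℂ a × ZMod 2,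
      Fin (Module.finrank ℂ ↥(L.weightSpace a i.1 ⊓ L.part i.2))),
      (if i.1.1 = α then koszul i.1.2 i.1.2 else 0) =
        (if i.1 = (α, 0) then 1 else 0) - (if i.1 = (α, 1) then (1 : ℂ) else 0) := by
    rintro ⟨⟨β, d⟩, j⟩
    by_cases h : β = α
    · subst h
      rcases zmod_two_cases d with rfl | rfl <;> simp [koszul]
    · simp [h]
  rw [Finset.sum_filter, Finset.sum_congr rfl fun i _ => hsplit i, Finset.sum_sub_distrib,
    Finset.sum_boole, Finset.sum_boole, hcard, hcard, multiplicity]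
  push_cast
  rfl

/-- `θ` is an even isomorphism from `g_α` onto `g_{-α}`. -/
theorem rootDim_neg (hθ : L.IsInvolution θ) (ha : L.IsEvenCartanSubspace θ a) (d : ZMod 2)
    (α : Module.Dual ℂ a) : L.rootDim a d (-α) = L.rootDim a d α := by
  have h : L.weightSpace a (-α) ⊓ L.part d =
      (L.weightSpace a α ⊓ L.part d).map
        (LinearEquiv.ofInvolutive θ hθ.involutive : g →ₗ[ℂ] g) := by
    ext x
    rw [Submodule.mem_map]
    constructor
    · rintro ⟨h1, h2⟩
      refine ⟨θ x, ⟨?_, hθ.map_part h2⟩, hθ.involutive x⟩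
      simpa using theta_mem_weightSpace hθ ha h1
    · rintro ⟨y, ⟨h1, h2⟩, rfl⟩
      exact ⟨theta_mem_weightSpace hθ ha h1, hθ.map_part h2⟩
  rw [rootDim, h, LinearEquiv.finrank_map_eq, rootDim]

theorem multiplicity_neg (hθ : L.IsInvolution θ) (ha : L.IsEvenCartanSubspace θ a)
    (α : Module.Dual ℂ a) : L.multiplicity a (-α) = L.multiplicity a α := by
  rw [multiplicity, multiplicity, rootDim_neg hθ ha, rootDim_neg hθ ha]

theorem multiplicity_eq_zero {α : Module.Dual ℂ a} (h : L.weightSpace a α = ⊥) :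
    L.multiplicity a α = 0 := by
  have h' : ∀ d, L.weightSpace a α ⊓ L.part d = ⊥ := fun d => by rw [h, bot_inf_eq]
  rw [multiplicity, rootDim, rootDim, h', h', sub_self]

/-- Sums over a weighted family of weights which represents the multiplicities are sums over
the positive restricted roots. -/
theorem sum_smul_weights (hθ : L.IsInvolution θ) (ha : L.IsEvenCartanSubspace θ a)
    [DecidableEq (Module.Dual ℂ a)] {P : Finset (Module.Dual ℂ a)} (hP : L.IsPositiveHalf a P)
    {κ : Type*} [Fintype κ] (wt : κ → Module.Dual ℂ a) (m : κ → ℂ)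
    (hm : ∀ α ≠ 0, (L.multiplicity a α : ℂ) = ∑ i with wt i = α, m i)
    {M : Type*} [AddCommGroup M] [Module ℂ M] (F : Module.Dual ℂ a → M) (hF : F 0 = 0) :
    ∑ i, m i • F (wt i) = ∑ α ∈ P, (L.multiplicity a α : ℂ) • (F α + F (-α)) := by
  have hne : ∀ α ∈ P, α ≠ 0 := fun α hα => (hP.1 α hα).1
  have hdisj : Disjoint P (P.image fun α => -α) := by
    rw [Finset.disjoint_left]
    intro α hα h'
    obtain ⟨β, hβ, rfl⟩ := Finset.mem_image.1 h'
    rcases hP.2 β (hP.1 β hβ) with h | h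
    · exact h.2 hα
    · exact h.2 hβ
  -- `T` contains `P`, `-P` and all occurring weights. On the members outside `P ∪ -P` either the
  -- weight is zero, where `F` vanishes, or it is not a root and its multiplicity is zero.
  set T := (P ∪ P.image fun α => -α) ∪ Finset.univ.image wt with hT
  rw [← Finset.sum_fiberwise_of_maps_to (t := T) (g := wt) (fun i _ =>
    Finset.mem_union_right _ (Finset.mem_image_of_mem _ (Finset.mem_univ i)))]
  have h1 : ∀ α ∈ T, ∑ i with wt i = α, m i • F (wt i) =
      (L.multiplicity a α : ℂ) • F α := by
    intro α _
    by_cases h0 : α = 0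
    · subst h0
      rw [hF, smul_zero]
      refine Finset.sum_eq_zero fun i hi => ?_
      rw [(Finset.mem_filter.1 hi).2, hF, smul_zero]
    · rw [hm α h0, Finset.sum_smul]
      refine Finset.sum_congr rfl fun i hi => ?_
      rw [(Finset.mem_filter.1 hi).2]
  rw [Finset.sum_congr rfl h1, ← Finset.sum_subset (s₁ := P ∪ P.image fun α => -α)
    Finset.subset_union_left]
  · rw [Finset.sum_union hdisj, Finset.sum_image (fun _ _ _ _ h => neg_injective h),
      ← Finset.sum_add_distrib]
    refine Finset.sum_congr rfl fun α _ => ?_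
    rw [multiplicity_neg hθ ha, smul_add]
  · intro α _ hα
    by_cases h0 : α = 0
    · rw [h0, hF, smul_zero]
    · by_cases h : L.weightSpace a α = ⊥
      · rw [multiplicity_eq_zero h, Int.cast_zero, zero_smul]
      · exfalso
        rcases hP.2 α ⟨h0, h⟩ with h | h
        · exact hα (Finset.mem_union_left _ h.1)
        · exact hα (Finset.mem_union_right _ (Finset.mem_image.2 ⟨-α, h.1, neg_neg α⟩))

end weightBasis

/-! ### Invariant forms and the Casimir element -/

section casimir

variable {g : Type*} [AddCommGroup g] [Module ℂ g] {L : LieSuperalgebra g}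
variable {B : LinearMap.BilinForm ℂ g} {hB : B.Nondegenerate}
variable {κ : Type*} [Fintype κ] [DecidableEq κ] (b : Module.Basis κ ℂ g)

theorem sum_dualBasis_smul (y : g) : ∑ i, B y (b i) • B.dualBasis hB b i = y := by
  conv_rhs => rw [← (B.dualBasis hB b).sum_repr y]
  simp

theorem sum_smul_basis (x : g) : ∑ i, B (B.dualBasis hB b i) x • b i = x := by
  have h : ∑ i, (B (B.dualBasis hB b i)).smulRight (b i) = LinearMap.id := by
    refine b.ext fun j => ?_
    simp [LinearMap.sum_apply, LinearMap.BilinForm.apply_dualBasis_left]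
  simpa [LinearMap.sum_apply] using congrArg (fun F => F x) h

/-- The tensor `∑ b_i ⊗ b^i` does not depend on the basis. -/
theorem sum_apply_dualBasis_eq {κ' : Type*} [Fintype κ'] [DecidableEq κ']
    (b' : Module.Basis κ' ℂ g) {M : Type*} [AddCommGroup M] [Module ℂ M]
    (β : g →ₗ[ℂ] g →ₗ[ℂ] M) :
    ∑ i, β (b i) (B.dualBasis hB b i) = ∑ j, β (b' j) (B.dualBasis hB b' j) := by
  calc ∑ i, β (b i) (B.dualBasis hB b i)
      = ∑ i, ∑ j, β (b' j) (B (B.dualBasis hB b' j) (b i) • B.dualBasis hB b i) := by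
        refine Finset.sum_congr rfl fun i _ => ?_
        conv_lhs => rw [← sum_smul_basis (hB := hB) b' (b i)]
        simp [LinearMap.sum_apply]
    _ = ∑ j, β (b' j) (∑ i, B (B.dualBasis hB b' j) (b i) • B.dualBasis hB b i) := by
        rw [Finset.sum_comm]
        simp only [map_sum]
    _ = _ := by simp only [sum_dualBasis_smul]

/-- The multiplication `(x, y) ↦ x y` of `U(g)` on `g`. -/
def envMul (L : LieSuperalgebra g) : g →ₗ[ℂ] g →ₗ[ℂ] L.Enveloping :=
  (LinearMap.mul ℂ L.Enveloping).compl₁₂ L.toEnv L.toEnv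

theorem casimir_eq_casimir {κ' : Type*} [Fintype κ'] [DecidableEq κ']
    (b' : Module.Basis κ' ℂ g) : L.casimir B hB b = L.casimir B hB b' :=
  sum_apply_dualBasis_eq b b' L.envMul

theorem IsInvariantForm.symm_of_even (hinv : L.IsInvariantForm B) {h : g} (hh : h ∈ L.part 0)
    (x : g) : B h x = B x h := by
  obtain ⟨x0, h0, x1, h1, rfl⟩ := L.exists_parts x
  simp [hinv.supersymm hh h0, hinv.supersymm hh h1, koszul_zero_left]

/-- The dual basis vectors of homogeneous basis vectors are homogeneous. -/
theorem IsInvariantForm.dualBasis_mem_part (hinv : L.IsInvariantForm B) {par : κ → ZMod 2}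
    (hb : ∀ i, b i ∈ L.part (par i)) (i : κ) : B.dualBasis hB b i ∈ L.part (par i) := by
  obtain ⟨y0, h0, y1, h1, hy⟩ := L.exists_parts (B.dualBasis hB b i)
  have key : ∀ (d d' : ZMod 2) (y y' : g), y ∈ L.part d → y' ∈ L.part d' → d ≠ d' →
      y + y' = B.dualBasis hB b i → par i = d → y' = 0 := by
    intro d d' y y' hy hy' hd hs hi
    refine hB.1 y' fun z => ?_
    have : B y' = 0 := by
      refine b.ext fun j => ?_
      by_cases hj : par j = d'
      · have hval : B y (b j) + B y' (b j) = if j = i then 1 else 0 := by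
          rw [← LinearMap.BilinForm.apply_dualBasis_left hB b i j, ← hs, map_add,
            LinearMap.add_apply]
        rw [hinv.even hy (hb j) (by rw [hj]; exact hd), zero_add, if_neg] at hval
        · exact hval
        · rintro rfl; exact hd (hi.symm.trans hj)
      · exact hinv.even hy' (hb j) (Ne.symm hj)
    rw [this, LinearMap.zero_apply]
  rcases zmod_two_cases (par i) with h | h
  · have := key 0 1 y0 y1 h0 h1 (by decide) hy h
    rw [this, add_zero] at hy
    rw [h, ← hy]; exact h0
  · have := key 1 0 y1 y0 h1 h0 (by decide) (by rw [add_comm]; exact hy) h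
    rw [this, zero_add] at hy
    rw [h, ← hy]; exact h1

/-- A basis of homogeneous vectors. -/
theorem exists_homogeneous_basis {g : Type u} [AddCommGroup g] [Module ℂ g]
    (L : LieSuperalgebra g) [FiniteDimensional ℂ g] :
    ∃ (κ : Type) (_ : Fintype κ) (_ : DecidableEq κ) (b : Module.Basis κ ℂ g)
      (par : κ → ZMod 2), ∀ i, b i ∈ L.part (par i) := by
  let b := ((Module.finBasis ℂ (L.part 0)).prod (Module.finBasis ℂ (L.part 1))).map
    (Submodule.prodEquivOfIsCompl _ _ L.isCompl)
  refine ⟨_, inferInstance, inferInstance, b, Sum.elim (fun _ => 0) (fun _ => 1), ?_⟩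
  rintro (i | i) <;> simp [b]

/-- The Casimir element is central. -/
theorem toEnv_mul_casimir [FiniteDimensional ℂ g] (hinv : L.IsInvariantForm B) (x : g) :
    L.toEnv x * L.casimir B hB b = L.casimir B hB b * L.toEnv x := by
  obtain ⟨κ', _, _, b', par, hb⟩ := L.exists_homogeneous_basis
  rw [casimir_eq_casimir b b']
  have key : ∀ (d : ZMod 2) (x : g), x ∈ L.part d →
      L.toEnv x * L.casimir B hB b' = L.casimir B hB b' * L.toEnv x := by
    intro d x hx
    set c := B.dualBasis hB b' with hc
    have hcp : ∀ i, c i ∈ L.part (par i) := hinv.dualBasis_mem_part b' hb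
    have h1 : ∀ i, L.toEnv x * (L.toEnv (b' i) * L.toEnv (c i)) =
        L.toEnv (b' i) * L.toEnv (c i) * L.toEnv x +
        (L.toEnv (L.bracket x (b' i)) * L.toEnv (c i) +
          koszul d (par i) • (L.toEnv (b' i) * L.toEnv (L.bracket x (c i)))) := by
      intro i
      rw [← mul_assoc, L.toEnv_mul hx (hb i), add_mul, smul_mul_assoc, mul_assoc,
        L.toEnv_mul hx (hcp i), mul_add, mul_smul_comm, smul_add, smul_smul, koszul_mul_self,
        one_smul, mul_assoc]
      abel
    -- Expanding `[x, b_i]` in the basis and `[x, b^i]` in the dual basis, invariance of the form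
    -- gives coefficient matrices that are negatives of each other after exchanging summation
    -- indices. The Koszul sign from commuting past `b_i` cancels the one from super skew-symmetry.
    have h2 : ∑ i, (L.toEnv (L.bracket x (b' i)) * L.toEnv (c i) +
        koszul d (par i) • (L.toEnv (b' i) * L.toEnv (L.bracket x (c i)))) = 0 := by
      rw [Finset.sum_add_distrib]
      have e1 : ∀ i, L.toEnv (L.bracket x (b' i)) * L.toEnv (c i) =
          ∑ k, B (c k) (L.bracket x (b' i)) • (L.toEnv (b' k) * L.toEnv (c i)) := by
        intro i
        conv_lhs => rw [← sum_smul_basis (hB := hB) b' (L.bracket x (b' i))]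
        simp [Finset.sum_mul, hc]
      have e2 : ∀ i, koszul d (par i) • (L.toEnv (b' i) * L.toEnv (L.bracket x (c i))) =
          ∑ k, -(B (c i) (L.bracket x (b' k)) • (L.toEnv (b' i) * L.toEnv (c k))) := by
        intro i
        conv_lhs => rw [← sum_dualBasis_smul (hB := hB) b' (L.bracket x (c i))]
        rw [map_sum, Finset.mul_sum, Finset.smul_sum]
        refine Finset.sum_congr rfl fun k _ => ?_
        rw [map_smul, mul_smul_comm, smul_smul, L.skew hx (hcp i), map_neg, LinearMap.neg_apply,
          map_smul, LinearMap.smul_apply, smul_eq_mul, mul_neg, ← mul_assoc, koszul_mul_self,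
          one_mul, hinv.invariant, neg_smul]
      rw [Finset.sum_congr rfl fun i _ => e1 i, Finset.sum_congr rfl fun i _ => e2 i,
        Finset.sum_comm, ← Finset.sum_add_distrib]
      simp
    rw [casimir, Finset.mul_sum, Finset.sum_congr rfl fun i _ => h1 i, Finset.sum_add_distrib, h2,
      add_zero, Finset.sum_mul]
  obtain ⟨x0, h0, x1, h1, rfl⟩ := L.exists_parts x
  rw [map_add, add_mul, mul_add, key 0 x0 h0, key 1 x1 h1]

/-- Only the vanishing on `U(g) k` needs centrality; the vanishing on `k U(g)` is not affected by
multiplication on the right. -/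
theorem IsZonal.laplaceBeltrami_casimir [FiniteDimensional ℂ g] (hinv : L.IsInvariantForm B)
    {θ : g →ₗ[ℂ] g} {f : Module.Dual ℂ L.Enveloping} (hf : L.IsZonal θ f) :
    L.IsZonal θ (laplaceBeltrami (L.casimir B hB b) f) := by
  intro x hx u
  constructor
  · change f (L.toEnv x * u * L.casimir B hB b) = 0
    rw [mul_assoc]
    exact (hf x hx _).1
  · change f (u * L.toEnv x * L.casimir B hB b) = 0
    rw [mul_assoc, toEnv_mul_casimir b hinv, ← mul_assoc]
    exact (hf x hx _).2

/-- On a simple Lie superalgebra every invariant form is preserved by an involution with a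
Cartan subspace on which the form is non-degenerate. -/
theorem IsSimple.theta_invariant [FiniteDimensional ℂ g] (hs : L.IsSimple)
    {θ : g →ₗ[ℂ] g} (hθ : L.IsInvolution θ) {a : Submodule ℂ g}
    (ha : L.IsEvenCartanSubspace θ a) (hB : B.Nondegenerate) (hinv : L.IsInvariantForm B)
    (hBa : (B.restrict a).Nondegenerate) (x y : g) : B (θ x) (θ y) = B x y := by
  -- If `a = 0`, every `x - θ x` lies in `p` and trivially centralises `a`, so it lies in `a`: then
  -- `θ` is the identity.
  by_cases ha0 : a = ⊥
  · have hid : ∀ x, θ x = x := by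
      intro x
      have : x - θ x ∈ a := ha.centralizer _ (by rw [map_sub, hθ.involutive, neg_sub]) (by
        intro h hh
        rw [ha0, Submodule.mem_bot] at hh
        simp [hh])
      rw [ha0, Submodule.mem_bot, sub_eq_zero] at this
      exact this.symm
    rw [hid, hid]
  · let B' : LinearMap.BilinForm ℂ g := B.compl₁₂ θ θ
    -- `T` compares the form transported by `θ` with `B`: `B (T x) y = B (θ x) (θ y)`. It preserves
    -- parity and commutes with brackets from the right, so its eigenspaces are graded ideals and
    -- simplicity makes it a scalar `c`.
    let T : Module.End ℂ g := B'.symmCompOfNondegenerate B hB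
    have hT : ∀ x y, B (T x) y = B (θ x) (θ y) := fun x y =>
      LinearMap.BilinForm.symmCompOfNondegenerate_left_apply B' hB y x
    have hTb : ∀ x y, T (L.bracket x y) = L.bracket (T x) y := by
      intro x y
      refine sub_eq_zero.1 (hB.1 _ fun z => ?_)
      rw [map_sub, LinearMap.sub_apply, hT, hθ.map_bracket, hinv.invariant, hinv.invariant, hT,
        hθ.map_bracket, sub_self]
    have hTp : ∀ (d : ZMod 2) (x : g), x ∈ L.part d → T x ∈ L.part d := by
      intro d x hx
      have key : ∀ d d' : ZMod 2, ∀ x y y' : g, x ∈ L.part d → y ∈ L.part d → y' ∈ L.part d' →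
          d ≠ d' → (∀ c, c = d ∨ c = d') → y + y' = T x → y' = 0 := by
        intro d d' x y y' hx hy hy' hd hc hs
        refine hB.1 y' fun z => ?_
        have hz : ∀ c, ∀ z ∈ L.part c, B y' z = 0 := by
          intro c z hz
          rcases hc c with rfl | rfl
          · exact hinv.even hy' hz (Ne.symm hd)
          · have e : B (y + y') z = B (θ x) (θ z) := by rw [hs, hT]
            rw [map_add, LinearMap.add_apply, hinv.even hy hz hd,
              hinv.even (hθ.map_part hx) (hθ.map_part hz) hd, zero_add] at e
            exact e
        obtain ⟨z0, h0, z1, h1, rfl⟩ := L.exists_parts z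
        rw [map_add, hz 0 z0 h0, hz 1 z1 h1, add_zero]
      obtain ⟨y0, h0, y1, h1, hy⟩ := L.exists_parts (T x)
      rcases zmod_two_cases d with rfl | rfl
      · rw [← hy, key 0 1 x y0 y1 hx h0 h1 (by decide) zmod_two_cases hy, add_zero]
        exact h0
      · rw [← hy, key 1 0 x y1 y0 hx h1 h0 (by decide) (fun c => (zmod_two_cases c).symm)
          (by rw [add_comm]; exact hy), zero_add]
        exact h1
    have : Nontrivial g := by
      obtain ⟨x, y, hxy⟩ := hs.1
      exact ⟨_, _, hxy⟩
    obtain ⟨c, hc⟩ := Module.End.exists_eigenvalue T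
    have hgr : ∀ x ∈ T.eigenspace c, ∀ x0 ∈ L.part 0, ∀ x1 ∈ L.part 1, x0 + x1 = x →
        x0 ∈ T.eigenspace c ∧ x1 ∈ T.eigenspace c := by
      intro x hx x0 h0 x1 h1 he
      rw [Module.End.mem_eigenspace_iff] at hx
      rw [← he, map_add, smul_add] at hx
      have e' : T x0 - c • x0 = -(T x1 - c • x1) := by
        rw [neg_sub, sub_eq_sub_iff_add_eq_add, hx, add_comm]
      have m0 := Submodule.sub_mem _ (hTp 0 _ h0) (Submodule.smul_mem _ c h0)
      have m1 := Submodule.sub_mem _ (hTp 1 _ h1) (Submodule.smul_mem _ c h1)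
      have z := eq_zero_of_mem_parts m0 (e' ▸ Submodule.neg_mem _ m1)
      rw [Module.End.mem_eigenspace_iff, Module.End.mem_eigenspace_iff]
      refine ⟨sub_eq_zero.1 z, ?_⟩
      rw [z] at e'
      exact sub_eq_zero.1 (neg_eq_zero.1 e'.symm)
    have htop : T.eigenspace c = ⊤ := by
      refine (hs.2 (T.eigenspace c) ?_ ?_).resolve_left hc
      · refine le_antisymm (fun x hx => ?_) (sup_le inf_le_left inf_le_left)
        obtain ⟨x0, h0, x1, h1, he⟩ := L.exists_parts x
        obtain ⟨k0, k1⟩ := hgr x hx x0 h0 x1 h1 he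
        rw [← he]
        exact Submodule.add_mem_sup ⟨k0, h0⟩ ⟨k1, h1⟩
      -- `T` acts in the first argument of the bracket; stability under brackets from the left
      -- follows by skew-symmetry on homogeneous components.
      · have hr : ∀ x, ∀ y ∈ T.eigenspace c, L.bracket y x ∈ T.eigenspace c := by
          intro x y hy
          rw [Module.End.mem_eigenspace_iff] at hy ⊢
          rw [hTb, hy, map_smul, LinearMap.smul_apply]
        intro x y hy
        obtain ⟨y0, h0, y1, h1, he⟩ := L.exists_parts y
        obtain ⟨k0, k1⟩ := hgr y hy y0 h0 y1 h1 he
        obtain ⟨x0, l0, x1, l1, rfl⟩ := L.exists_parts x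
        have hl : ∀ (i j : ZMod 2) (x y : g), x ∈ L.part i → y ∈ L.part j →
            y ∈ T.eigenspace c → L.bracket x y ∈ T.eigenspace c := by
          intro i j x y hx hy hy'
          rw [L.skew hx hy]
          exact Submodule.neg_mem _ (Submodule.smul_mem _ _ (hr x y hy'))
        rw [← he]
        simp only [map_add, LinearMap.add_apply]
        exact Submodule.add_mem _
          (Submodule.add_mem _ (hl _ _ _ _ l0 h0 k0) (hl _ _ _ _ l1 h0 k0))
          (Submodule.add_mem _ (hl _ _ _ _ l0 h1 k1) (hl _ _ _ _ l1 h1 k1))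
    have hTc : ∀ x, T x = c • x := fun x =>
      Module.End.mem_eigenspace_iff.1 (htop ▸ Submodule.mem_top)
    -- Since `θ = -1` on `a`, the two forms coincide there, and the form is nondegenerate on the
    -- nonzero space `a`.
    have hc1 : c = 1 := by
      obtain ⟨h, hh, hne⟩ := Submodule.exists_mem_ne_zero_of_ne_bot ha0
      by_contra hc1
      refine hne ?_
      have : (⟨h, hh⟩ : a) = 0 := by
        refine hBa.1 _ fun h' => ?_
        have e := hT h h'
        rw [hTc, ha.neg h hh, ha.neg h' h'.2, map_smul, LinearMap.smul_apply] at e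
        simp only [map_neg, LinearMap.neg_apply, neg_neg, smul_eq_mul] at e
        have e' : (c - 1) * B h h' = 0 := by linear_combination e
        exact (mul_eq_zero.1 e').resolve_left (sub_ne_zero.2 hc1)
      exact congrArg Subtype.val this
    rw [← hT, hTc, hc1, one_smul]

end casimir

end LieSuperalgebra

namespace LieSuperalgebra

/-! ### The localised ring of functions -/

section loc

variable {g : Type*} [AddCommGroup g] [Module ℂ g] {L : LieSuperalgebra g}
variable {ι : Type*} [Fintype ι] {a : Submodule ℂ g} (e : Module.Basis ι ℂ a)

theorem expSeries_two_mul_sub_one_ne_zero {α : Module.Dual ℂ a} (hα : α ≠ 0) :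
    expSeries (fun i => 2 * α (e i)) - 1 ≠ 0 := by
  intro h
  refine hα (e.ext fun i => ?_)
  have := congrFun (expSeries_eq_one (sub_eq_zero.1 h)) i
  simpa using this

variable (L) in
theorem denominators_le : L.denominators e ≤ nonZeroDivisors (MvPowerSeries ι ℂ) := by
  rw [denominators, Submonoid.closure_le]
  rintro _ ⟨α, hα, rfl⟩
  exact mem_nonZeroDivisors_of_ne_zero (expSeries_two_mul_sub_one_ne_zero e hα.1)

instance : IsDomain (MvPowerSeries ι ℂ) := NoZeroDivisors.to_isDomain _

instance : IsDomain (L.Loc e) := IsLocalization.isDomain_localization (L.denominators_le e)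

variable (L) in
theorem algebraMap_loc_injective : Function.Injective (algebraMap (MvPowerSeries ι ℂ) (L.Loc e)) :=
  IsLocalization.injective _ (L.denominators_le e)

theorem expLoc_zero : L.expLoc e 0 = 1 := by rw [expLoc, expSeries_zero, map_one]

theorem expLoc_add (c c' : ι → ℂ) : L.expLoc e (c + c') = L.expLoc e c * L.expLoc e c' := by
  rw [expLoc, expSeries_add, map_mul, expLoc, expLoc]

theorem expLoc_eq_one {c : ι → ℂ} (h : L.expLoc e c = 1) : c = 0 :=
  expSeries_eq_one (L.algebraMap_loc_injective e (h.trans (map_one _).symm))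

theorem isUnit_expLoc_sub_one {α : Module.Dual ℂ a} (hα : α ∈ L.restrictedRoots a) :
    IsUnit (L.expLoc e (fun i => 2 * α (e i)) - 1) := by
  have := IsLocalization.map_units (L.Loc e) (⟨expSeries (fun i => 2 * α (e i)) - 1,
    Submonoid.subset_closure ⟨α, hα, rfl⟩⟩ : L.denominators e)
  simpa [expLoc] using this

theorem locDeriv_algebraMap (i : ι) (F : MvPowerSeries ι ℂ) :
    L.locDeriv e i (algebraMap _ _ F) = algebraMap _ _ (MvPowerSeries.pderiv ℂ i F) :=
  localizeDerivation_algebraMap _ _ F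

theorem algebraMap_smul_series (c : ℂ) (F : MvPowerSeries ι ℂ) :
    algebraMap (MvPowerSeries ι ℂ) (L.Loc e) (c • F) = c • algebraMap _ _ F :=
  map_smul (IsScalarTower.toAlgHom ℂ (MvPowerSeries ι ℂ) (L.Loc e)) c F

theorem locDeriv_expLoc (i : ι) (c : ι → ℂ) :
    L.locDeriv e i (L.expLoc e c) = c i • L.expLoc e c := by
  rw [expLoc, locDeriv_algebraMap, pderiv_expSeries, algebraMap_smul_series]

/-- The commutator of two derivations is a derivation; it vanishes on power series, and therefore on
their fractions. -/
theorem locDeriv_comm (i j : ι) (x : L.Loc e) :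
    L.locDeriv e i (L.locDeriv e j x) = L.locDeriv e j (L.locDeriv e i x) := by
  have h0 : ∀ F, ⁅L.locDeriv e i, L.locDeriv e j⁆ (algebraMap (MvPowerSeries ι ℂ) _ F) = 0 := by
    intro F
    rw [Derivation.commutator_apply, locDeriv_algebraMap, locDeriv_algebraMap,
      locDeriv_algebraMap, locDeriv_algebraMap, pderiv_comm, sub_self]
  obtain ⟨⟨r, s⟩, hx⟩ := IsLocalization.surj (L.denominators e) x
  have h1 := congrArg (fun y => (⁅L.locDeriv e i, L.locDeriv e j⁆ :
    Derivation ℂ (L.Loc e) (L.Loc e)) y) hx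
  simp only at h1
  rw [Derivation.leibniz, h0, h0, smul_zero, zero_add, smul_eq_mul] at h1
  have h2 := (IsUnit.mul_right_eq_zero (IsLocalization.map_units (L.Loc e) s)).1 h1
  rw [Derivation.commutator_apply] at h2
  exact sub_eq_zero.1 h2

end loc

/-! ### The radial part of the Laplace–Beltrami operator -/

section radialPart

variable {g : Type*} [AddCommGroup g] [Module ℂ g] {L : LieSuperalgebra g}
variable {θ : g →ₗ[ℂ] g} {a : Submodule ℂ g}
variable {ι : Type*} [Fintype ι] (e : Module.Basis ι ℂ a)

/-- The power series of the functional `u ↦ f (u W)` on `S(a)`. -/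
def zonalHat (ha : L.IsEvenCartanSubspace θ a) (f : Module.Dual ℂ L.Enveloping) :
    L.Enveloping →ₗ[ℂ] MvPowerSeries ι ℂ where
  toFun W := hat e ((f ∘ₗ LinearMap.mulRight ℂ W) ∘ₗ ha.symToEnv.toLinearMap)
  map_add' W W' := by
    rw [← hat_add]
    congr 1
    refine LinearMap.ext fun u => ?_
    simp [mul_add]
  map_smul' c W := by
    rw [RingHom.id_apply, ← hat_smul]
    congr 1
    refine LinearMap.ext fun u => ?_
    simp

variable (ha : L.IsEvenCartanSubspace θ a) (f : Module.Dual ℂ L.Enveloping)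

theorem zonalHat_apply (W : L.Enveloping) : zonalHat e ha f W =
    hat e ((f ∘ₗ LinearMap.mulRight ℂ W) ∘ₗ ha.symToEnv.toLinearMap) := rfl

theorem zonalHat_eq_of_forall {W W' : L.Enveloping}
    (h : ∀ u, f (ha.symToEnv u * W) = f (ha.symToEnv u * W')) :
    zonalHat e ha f W = zonalHat e ha f W' := by
  rw [zonalHat_apply, zonalHat_apply]
  exact congrArg (hat e) (LinearMap.ext h)

theorem zonalHat_eq_zero_of_forall {W : L.Enveloping} (h : ∀ u, f (ha.symToEnv u * W) = 0) :
    zonalHat e ha f W = 0 := by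
  rw [zonalHat_eq_of_forall e ha f (W' := 0) fun u => by rw [h, mul_zero, map_zero], map_zero]

theorem zonalHat_one : zonalHat e ha f 1 = hat e (f ∘ₗ ha.symToEnv.toLinearMap) := by
  rw [zonalHat_apply]
  exact congrArg (hat e) (LinearMap.ext fun u => by simp)

theorem zonalHat_toEnv_mul (i : ι) (W : L.Enveloping) :
    zonalHat e ha f (L.toEnv (e i) * W) = MvPowerSeries.pderiv ℂ i (zonalHat e ha f W) := by
  rw [zonalHat_apply, zonalHat_apply, pderiv_hat]
  refine congrArg (hat e) (LinearMap.ext fun u => ?_)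
  simp [ha.symToEnv_ι, mul_assoc]

variable {f} in
/-- The effect of reflecting the left factor, in terms of power series. -/
theorem zonalHat_theta_mul (hθ : L.IsInvolution θ) (hf : L.IsZonal θ f) {α : Module.Dual ℂ a}
    {z : g} (hz : z ∈ L.weightSpace a α) (W : L.Enveloping) :
    zonalHat e ha f (L.toEnv z * W) =
      -(expSeries (fun i => 2 * α (e i)) * zonalHat e ha f (L.toEnv (θ z) * W)) := by
  have h : (f ∘ₗ LinearMap.mulRight ℂ (L.toEnv z * W)) ∘ₗ ha.symToEnv.toLinearMap =
      (-1 : ℂ) • (((f ∘ₗ LinearMap.mulRight ℂ (L.toEnv (θ z) * W)) ∘ₗ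
        ha.symToEnv.toLinearMap) ∘ₗ (symShift (α + α)).toLinearMap) := by
    refine LinearMap.ext fun u => ?_
    simpa [mul_assoc] using hf.symToEnv_mul_toEnv_mul hθ ha hz u W
  rw [zonalHat_apply, zonalHat_apply, h, hat_smul, hat_comp_symShift, neg_one_smul]
  congr 2
  congr 1
  funext i
  simp [two_mul]

variable {f} in
theorem zonalHat_root (hθ : L.IsInvolution θ) (hf : L.IsZonal θ f) {α : Module.Dual ℂ a}
    (hα : α ≠ 0) {z : g} (hz : z ∈ L.weightSpace a α) : zonalHat e ha f (L.toEnv z) = 0 := by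
  have : FiniteDimensional ℂ a := e.finiteDimensional_of_finite
  exact zonalHat_eq_zero_of_forall e ha f fun u => hf.eq_zero_of_root_right hθ ha hα hz u

variable {f} in
/-- The contribution of a pair of opposite restricted root vectors. -/
theorem zonalHat_root_mul_root (hθ : L.IsInvolution θ) (hf : L.IsZonal θ f)
    {α : Module.Dual ℂ a} (hα : α ≠ 0) {d : ZMod 2} {x w : g} (hx : x ∈ L.weightSpace a α)
    (hw : w ∈ L.weightSpace a (-α)) (hxd : x ∈ L.part d) (hwd : w ∈ L.part d) :
    (expSeries (fun i => 2 * α (e i)) - 1) * zonalHat e ha f (L.toEnv x * L.toEnv w) =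
      expSeries (fun i => 2 * α (e i)) * zonalHat e ha f (L.toEnv (L.bracket x w)) := by
  have hθw : θ w ∈ L.weightSpace a α := by simpa using theta_mem_weightSpace hθ ha hw
  -- Reflection of `w` on the right turns `x w` into `-x (θ w)`, where both factors have weight `α`.
  -- Exchanging them costs a bracket of weight `2α`, which contributes nothing. Reflecting `θ w` on
  -- the left then brings back `w x` with the factor `e^{2α}`, and comparison with the ordinary
  -- commutation of `x` and `w` gives the claim.
  have h1 : zonalHat e ha f (L.toEnv x * L.toEnv w) =
      -zonalHat e ha f (L.toEnv x * L.toEnv (θ w)) := by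
    rw [← neg_one_smul ℂ, ← map_smul]
    refine zonalHat_eq_of_forall e ha f fun u => ?_
    rw [mul_smul_comm, map_smul, ← mul_assoc, ← mul_assoc, hf.mul_theta hθ, neg_one_smul, neg_neg]
  have h2 : zonalHat e ha f (L.toEnv x * L.toEnv (θ w)) =
      koszul d d • zonalHat e ha f (L.toEnv (θ w) * L.toEnv x) := by
    rw [L.toEnv_mul hxd (hθ.map_part hwd), map_add, map_smul,
      zonalHat_root e ha hθ hf (add_self_ne_zero hα) (bracket_mem_weightSpace ha.even hx hθw),
      add_zero]
  have h3 := zonalHat_theta_mul e ha hθ hf hθw (L.toEnv x)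
  rw [hθ.involutive] at h3
  have h4 : zonalHat e ha f (L.toEnv x * L.toEnv w) =
      koszul d d • zonalHat e ha f (L.toEnv w * L.toEnv x) +
        zonalHat e ha f (L.toEnv (L.bracket x w)) := by
    rw [L.toEnv_mul hxd hwd, map_add, map_smul]
  rw [h3] at h2
  rw [h2, smul_neg, neg_neg, ← mul_smul_comm] at h1
  linear_combination expSeries (fun i => 2 * α (e i)) * h4 - h1

variable [DecidableEq ι] {B : LinearMap.BilinForm ℂ g}

theorem invGram_mul_gram (hBa : (B.restrict a).Nondegenerate) :
    invGram e B * (Matrix.of fun i j => B (e i : g) (e j : g)) = 1 := by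
  refine Matrix.nonsing_inv_mul _ (isUnit_iff_ne_zero.2 ?_)
  have := (LinearMap.BilinForm.nondegenerate_iff_det_ne_zero e).1 hBa
  convert this
  ext i j
  simp [LinearMap.BilinForm.toMatrix_apply]

variable (B) in
/-- The orthogonal projection of `g` to `a`. -/
def cartanProj : g →ₗ[ℂ] g :=
  ∑ j, (∑ i, invGram e B j i • B (e i : g)).smulRight (e j : g)

theorem cartanProj_apply (x : g) :
    cartanProj e B x = ∑ j, (∑ i, invGram e B j i * B (e i : g) x) • (e j : g) := by
  simp [cartanProj, LinearMap.sum_apply]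

theorem cartanProj_of_mem (hBa : (B.restrict a).Nondegenerate) {h : g} (hh : h ∈ a) :
    cartanProj e B h = h := by
  have key : (cartanProj e B) ∘ₗ a.subtype = a.subtype := by
    refine e.ext fun k => ?_
    have hk : ∀ j, ∑ i, invGram e B j i * B (e i : g) (e k : g) = if j = k then 1 else 0 := by
      intro j
      have := congrFun (congrFun (invGram_mul_gram e hBa) j) k
      rwa [Matrix.mul_apply, Matrix.one_apply] at this
    simp [cartanProj_apply, hk]
  exact congrArg (fun F => F ⟨h, hh⟩) key

/-- A `θ`-invariant form makes the eigenspaces of `θ` orthogonal, and `a` lies in the `-1`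
eigenspace. -/
theorem cartanProj_of_fixed (ha : L.IsEvenCartanSubspace θ a)
    (hBθ : ∀ x y, B (θ x) (θ y) = B x y) {x : g} (hx : θ x = x) : cartanProj e B x = 0 := by
  rw [cartanProj_apply]
  refine Finset.sum_eq_zero fun j _ => ?_
  rw [Finset.sum_eq_zero, zero_smul]
  intro i _
  have h := hBθ (e i) x
  rw [ha.neg _ (e i).2, hx, map_neg, LinearMap.neg_apply] at h
  have : B (e i : g) x = 0 := by linear_combination -(1 / 2 : ℂ) * h
  rw [this, mul_zero]

/-- Root vectors are orthogonal to `a`: by invariance `α(h) (e_i, x) = ([e_i, h], x) = 0` for all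
`h`. -/
theorem cartanProj_of_root (ha : L.IsEvenCartanSubspace θ a) (hinv : L.IsInvariantForm B)
    {α : Module.Dual ℂ a} (hα : α ≠ 0) {x : g} (hx : x ∈ L.weightSpace a α) :
    cartanProj e B x = 0 := by
  rw [cartanProj_apply]
  refine Finset.sum_eq_zero fun j _ => ?_
  rw [Finset.sum_eq_zero, zero_smul]
  intro i _
  obtain ⟨h, hh⟩ : ∃ h, α h ≠ 0 := by
    by_contra hc
    push Not at hc
    exact hα (LinearMap.ext hc)
  have h1 := hinv.invariant (e i) h x
  have h2 : L.bracket (h : g) x = α h • x := hx h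
  rw [ha.comm _ (e i).2 _ h.2, h2, map_zero, LinearMap.zero_apply, map_smul, smul_eq_mul] at h1
  rw [(mul_eq_zero.1 h1.symm).resolve_left hh, mul_zero]

theorem cartanProj_mem (x : g) : cartanProj e B x ∈ a := by
  rw [cartanProj_apply]
  exact Submodule.sum_mem _ fun j _ => Submodule.smul_mem _ _ (e j).2

/-- A vector of weight `0` is the sum of its projection to `a` and a vector fixed by `θ`. -/
theorem theta_sub_cartanProj (hθ : L.IsInvolution θ) (ha : L.IsEvenCartanSubspace θ a)
    (hBθ : ∀ x y, B (θ x) (θ y) = B x y) (hBa : (B.restrict a).Nondegenerate) {x : g}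
    (hx : x ∈ L.weightSpace a 0) : θ (x - cartanProj e B x) = x - cartanProj e B x := by
  have hmem : x - θ x ∈ a := by
    refine ha.centralizer _ (by rw [map_sub, hθ.involutive, neg_sub]) fun h hh => ?_
    have e1 : L.bracket h x = (0 : Module.Dual ℂ a) ⟨h, hh⟩ • x := hx ⟨h, hh⟩
    have e2 : L.bracket h (θ x) = (-0 : Module.Dual ℂ a) ⟨h, hh⟩ • θ x :=
      theta_mem_weightSpace hθ ha hx ⟨h, hh⟩
    rw [map_sub, e1, e2]
    simp
  have hp : cartanProj e B x = (1 / 2 : ℂ) • (x - θ x) := by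
    have h1 : x = (1 / 2 : ℂ) • (x + θ x) + (1 / 2 : ℂ) • (x - θ x) := by module
    have h2 := cartanProj_of_fixed e (B := B) ha hBθ (x := x + θ x)
      (by rw [map_add, hθ.involutive, add_comm])
    conv_lhs => rw [h1]
    rw [map_add, map_smul, map_smul, h2, cartanProj_of_mem e hBa hmem, smul_zero, zero_add]
  rw [hp, map_sub, map_smul, map_sub, hθ.involutive]
  module

variable {f}

/-- The difference between `x` and its projection is fixed by `θ`, so a zonal function annihilates
it at the right end. -/
theorem zonalHat_weight_zero (hθ : L.IsInvolution θ) (hf : L.IsZonal θ f)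
    (hBθ : ∀ x y, B (θ x) (θ y) = B x y) (hBa : (B.restrict a).Nondegenerate) {x : g}
    (hx : x ∈ L.weightSpace a 0) (W : L.Enveloping) :
    zonalHat e ha f (W * L.toEnv x) = zonalHat e ha f (W * L.toEnv (cartanProj e B x)) := by
  refine zonalHat_eq_of_forall e ha f fun u => ?_
  have := (hf _ (theta_sub_cartanProj e hθ ha hBθ hBa hx) (ha.symToEnv u * W)).2
  rw [map_sub, mul_sub, map_sub, sub_eq_zero] at this
  rw [← mul_assoc, ← mul_assoc, this]

/-- The derivative along the vector of `a` dual to `α`. -/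
def dualDeriv (B : LinearMap.BilinForm ℂ g) (α : Module.Dual ℂ a) (F : MvPowerSeries ι ℂ) :
    MvPowerSeries ι ℂ :=
  ∑ j, (∑ i, invGram e B j i * α (e i)) • MvPowerSeries.pderiv ℂ j F

/-- `[x, w]` has weight zero, and invariance gives `(h, [x, w]) = α(h) (x, w)` for `h ∈ a`. Its
projection to `a` is thus `(x, w)` times the vector dual to `α`, and elements of `a` act on the
series as derivatives. -/
theorem zonalHat_bracket (hθ : L.IsInvolution θ) (hf : L.IsZonal θ f)
    (hinv : L.IsInvariantForm B) (hBθ : ∀ x y, B (θ x) (θ y) = B x y)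
    (hBa : (B.restrict a).Nondegenerate) {α : Module.Dual ℂ a} {x w : g}
    (hx : x ∈ L.weightSpace a α) (hw : w ∈ L.weightSpace a (-α)) :
    zonalHat e ha f (L.toEnv (L.bracket x w)) =
      B x w • dualDeriv e B α (zonalHat e ha f 1) := by
  have h0 : L.bracket x w ∈ L.weightSpace a 0 := by
    simpa using bracket_mem_weightSpace ha.even hx hw
  have h1 := zonalHat_weight_zero e ha hθ hf hBθ hBa h0 1
  rw [one_mul, one_mul] at h1
  have h2 : ∀ i, B (e i : g) (L.bracket x w) = B x w * α (e i) := by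
    intro i
    have : L.bracket (e i : g) x = α (e i) • x := hx (e i)
    rw [← hinv.invariant, this, map_smul, LinearMap.smul_apply, smul_eq_mul, mul_comm]
  rw [h1, cartanProj_apply, map_sum, map_sum, dualDeriv, Finset.smul_sum]
  refine Finset.sum_congr rfl fun j _ => ?_
  have h3 := zonalHat_toEnv_mul e ha f j 1
  rw [mul_one] at h3
  rw [map_smul, map_smul, h3, smul_smul, Finset.mul_sum]
  congr 1
  refine Finset.sum_congr rfl fun i _ => ?_
  rw [h2]
  ring

/-- Projection is possible only at the right end. Once `y` has been projected to `a` it commutes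
with `x`, so `x` can be brought to the right end and projected as well. -/
theorem zonalHat_weight_zero_mul (hθ : L.IsInvolution θ) (hf : L.IsZonal θ f)
    (hBθ : ∀ x y, B (θ x) (θ y) = B x y) (hBa : (B.restrict a).Nondegenerate) {x y : g}
    (hx : x ∈ L.weightSpace a 0) (hy : y ∈ L.weightSpace a 0) :
    zonalHat e ha f (L.toEnv x * L.toEnv y) =
      zonalHat e ha f (L.toEnv (cartanProj e B x) * L.toEnv (cartanProj e B y)) := by
  have hcomm : ∀ h ∈ a, ∀ x ∈ L.weightSpace a 0,
      L.toEnv h * L.toEnv x = L.toEnv x * L.toEnv h := by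
    intro h hh x hx
    have e1 : L.bracket h x = (0 : Module.Dual ℂ a) ⟨h, hh⟩ • x := hx ⟨h, hh⟩
    rw [toEnv_mul_of_even (ha.even hh), e1]
    simp
  have h0 : cartanProj e B x ∈ L.weightSpace a 0 := by
    intro h
    rw [ha.comm _ h.2 _ (cartanProj_mem e x)]
    simp
  rw [zonalHat_weight_zero e ha hθ hf hBθ hBa hy, ← hcomm _ (cartanProj_mem e y) _ hx,
    zonalHat_weight_zero e ha hθ hf hBθ hBa hx, hcomm _ (cartanProj_mem e y) _ h0]

/-- The second order part of the radial part. -/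
theorem sum_zonalHat_cartanProj (hinv : L.IsInvariantForm B) {hB : B.Nondegenerate}
    (hBa : (B.restrict a).Nondegenerate)
    {κ : Type*} [Fintype κ] [DecidableEq κ] (b : Module.Basis κ ℂ g) :
    ∑ k, zonalHat e ha f (L.toEnv (cartanProj e B (b k)) *
        L.toEnv (cartanProj e B (B.dualBasis hB b k))) =
      ∑ i, ∑ j, invGram e B i j •
        MvPowerSeries.pderiv ℂ i (MvPowerSeries.pderiv ℂ j (zonalHat e ha f 1)) := by
  set F := zonalHat e ha f 1 with hF
  have h1 : ∀ j l, zonalHat e ha f (L.toEnv (e j) * L.toEnv (e l)) =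
      MvPowerSeries.pderiv ℂ j (MvPowerSeries.pderiv ℂ l F) := by
    intro j l
    rw [zonalHat_toEnv_mul, ← mul_one (L.toEnv (e l : g)), zonalHat_toEnv_mul]
  have h2 : ∀ i k, ∑ q, B (e i : g) (b q) * B (e k : g) (B.dualBasis hB b q) =
      B (e i : g) (e k) := by
    intro i k
    conv_rhs => rw [← sum_smul_basis (hB := hB) b (e k : g)]
    rw [map_sum]
    refine Finset.sum_congr rfl fun q _ => ?_
    rw [map_smul, smul_eq_mul, hinv.symm_of_even (ha.even (e k).2), mul_comm]
  -- Summation over dual bases of `g` replaces the two pairings by the Gram matrix `G` of `a`, so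
  -- the coefficients form `G⁻¹ G G⁻¹ = G⁻¹`.
  have h3 : ∀ j l, ∑ q, (∑ i, invGram e B j i * B (e i : g) (b q)) *
      (∑ k, invGram e B l k * B (e k : g) (B.dualBasis hB b q)) = invGram e B l j := by
    intro j l
    have hG := invGram_mul_gram e hBa
    calc ∑ q, (∑ i, invGram e B j i * B (e i : g) (b q)) *
          (∑ k, invGram e B l k * B (e k : g) (B.dualBasis hB b q))
        = ∑ q, ∑ k, ∑ i, invGram e B j i * invGram e B l k *
            (B (e i : g) (b q) * B (e k : g) (B.dualBasis hB b q)) := by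
          refine Finset.sum_congr rfl fun q _ => ?_
          rw [Finset.mul_sum]
          refine Finset.sum_congr rfl fun k _ => ?_
          rw [Finset.sum_mul]
          exact Finset.sum_congr rfl fun i _ => by ring
      _ = ∑ k, invGram e B l k * ∑ i, invGram e B j i * B (e i : g) (e k) := by
          rw [Finset.sum_comm]
          refine Finset.sum_congr rfl fun k _ => ?_
          rw [Finset.sum_comm, Finset.mul_sum]
          refine Finset.sum_congr rfl fun i _ => ?_
          rw [← Finset.mul_sum, h2]
          ring
      _ = ∑ k, invGram e B l k * (1 : Matrix ι ι ℂ) j k := by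
          refine Finset.sum_congr rfl fun k _ => ?_
          rw [← hG, Matrix.mul_apply]
          rfl
      _ = invGram e B l j := by simp [Matrix.one_apply]
  calc ∑ k, zonalHat e ha f (L.toEnv (cartanProj e B (b k)) *
        L.toEnv (cartanProj e B (B.dualBasis hB b k)))
      = ∑ q, ∑ l, ∑ j, ((∑ i, invGram e B j i * B (e i : g) (b q)) *
          (∑ k, invGram e B l k * B (e k : g) (B.dualBasis hB b q))) •
            MvPowerSeries.pderiv ℂ j (MvPowerSeries.pderiv ℂ l F) := by
        refine Finset.sum_congr rfl fun q _ => ?_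
        rw [cartanProj_apply, cartanProj_apply, map_sum, map_sum, Finset.mul_sum, map_sum]
        refine Finset.sum_congr rfl fun l _ => ?_
        rw [Finset.sum_mul, map_sum]
        refine Finset.sum_congr rfl fun j _ => ?_
        rw [map_smul, map_smul, smul_mul_smul_comm, map_smul, h1]
    _ = ∑ l, ∑ j, invGram e B l j •
          MvPowerSeries.pderiv ℂ j (MvPowerSeries.pderiv ℂ l F) := by
        rw [Finset.sum_comm]
        refine Finset.sum_congr rfl fun l _ => ?_
        rw [Finset.sum_comm]
        refine Finset.sum_congr rfl fun j _ => ?_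
        rw [← Finset.sum_smul, h3]
    _ = _ := by
        refine Finset.sum_congr rfl fun l _ => Finset.sum_congr rfl fun j _ => ?_
        rw [pderiv_comm]

/-- The dual basis vectors of weight vectors have the opposite weights. -/
theorem dualBasis_mem_weightSpace (ha : L.IsEvenCartanSubspace θ a)
    (hinv : L.IsInvariantForm B) {hB : B.Nondegenerate}
    {κ : Type*} [Fintype κ] [DecidableEq κ] (b : Module.Basis κ ℂ g) {wt : κ → Module.Dual ℂ a}
    (hb : ∀ i, b i ∈ L.weightSpace a (wt i)) (i : κ) :
    B.dualBasis hB b i ∈ L.weightSpace a (-wt i) := by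
  intro h
  refine sub_eq_zero.1 (hB.1 _ fun z => ?_)
  have : B (L.bracket h (B.dualBasis hB b i) - (-wt i) h • B.dualBasis hB b i) = 0 := by
    refine b.ext fun j => ?_
    have hj : L.bracket (h : g) (b j) = wt j h • b j := hb j h
    rw [map_sub, LinearMap.sub_apply, map_smul, LinearMap.smul_apply,
      show L.bracket (h : g) (B.dualBasis hB b i) = -L.bracket (B.dualBasis hB b i) h by
        rw [bracket_swap_of_even (ha.even h.2), neg_neg],
      map_neg, LinearMap.neg_apply, hinv.invariant, hj, map_smul,
      LinearMap.BilinForm.apply_dualBasis_left]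
    by_cases hij : j = i
    · subst hij; simp
    · simp [hij]
  rw [this, LinearMap.zero_apply]

/-- The Casimir sum is evaluated in a basis of homogeneous weight vectors. Terms of weight zero
project to `a` and give the Laplacian. A term of weight `α ≠ 0` gives, up to its parity sign,
`e^{2α} / (e^{2α} - 1) ∂_α`; the signs add up to `μ_α`, and the contributions of `α` and `-α`
combine to `(e^{2α} + 1) / (e^{2α} - 1) ∂_α`. -/
theorem restriction_laplaceBeltrami [FiniteDimensional ℂ g] (hθ : L.IsInvolution θ)
    (hf : L.IsZonal θ f) (hinv : L.IsInvariantForm B) (hB : B.Nondegenerate)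
    (hBθ : ∀ x y, B (θ x) (θ y) = B x y) (hBa : (B.restrict a).Nondegenerate)
    {κ : Type*} [Fintype κ] [DecidableEq κ] (b : Module.Basis κ ℂ g)
    {P : Finset (Module.Dual ℂ a)} (hP : L.IsPositiveHalf a P) :
    restriction e ha (laplaceBeltrami (L.casimir B hB b) f) =
      (L.radialPart e B P).apply (L.locDeriv e) (restriction e ha f) := by
  classical
  obtain ⟨κ', _, _, b', wt, par, hwt, hpar, hmult⟩ := exists_weightBasis ha
  set c := B.dualBasis hB b' with hc
  set F := zonalHat e ha f 1 with hF
  have hcw : ∀ i, c i ∈ L.weightSpace a (-wt i) := dualBasis_mem_weightSpace ha hinv b' hwt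
  have hcp : ∀ i, c i ∈ L.part (par i) := hinv.dualBasis_mem_part b' hpar
  -- The dual basis is normalised with the dual vector on the left, whereas `zonalHat_bracket` needs
  -- it on the right. Exchanging the two produces the sign that makes multiplicities
  -- superdimensions.
  have hBc : ∀ i, B (b' i) (c i) = koszul (par i) (par i) := by
    intro i
    rw [hinv.supersymm (hpar i) (hcp i), hc, LinearMap.BilinForm.apply_dualBasis_left, if_pos rfl,
      mul_one]
  let φ : Module.Dual ℂ a → L.Loc e := fun α =>
    L.expLoc e (fun i => 2 * α (e i)) * Ring.inverse (L.expLoc e (fun i => 2 * α (e i)) - 1) *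
      algebraMap _ _ (dualDeriv e B α F)
  have hφ0 : φ 0 = 0 := by simp [φ, dualDeriv]
  have hterm : ∀ i, algebraMap (MvPowerSeries ι ℂ) (L.Loc e)
      (zonalHat e ha f (L.toEnv (b' i) * L.toEnv (c i))) =
      algebraMap _ _ (zonalHat e ha f (L.toEnv (cartanProj e B (b' i)) *
        L.toEnv (cartanProj e B (c i)))) + koszul (par i) (par i) • φ (wt i) := by
    intro i
    by_cases h0 : wt i = 0
    · have h1 := hwt i
      have h2 := hcw i
      rw [h0] at h1 h2
      rw [neg_zero] at h2
      rw [zonalHat_weight_zero_mul e ha hθ hf hBθ hBa h1 h2, h0, hφ0, smul_zero, add_zero]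
    · have hroot : wt i ∈ L.restrictedRoots a :=
        ⟨h0, fun hbot => b'.ne_zero i (by simpa [hbot] using hwt i)⟩
      have hu := isUnit_expLoc_sub_one e hroot
      have h1 := congrArg (algebraMap (MvPowerSeries ι ℂ) (L.Loc e))
        (zonalHat_root_mul_root e ha hθ hf h0 (hwt i) (hcw i) (hpar i) (hcp i))
      rw [zonalHat_bracket e ha hθ hf hinv hBθ hBa (hwt i) (hcw i), hBc,
        RingHom.map_mul, RingHom.map_mul, map_sub, map_one, algebraMap_smul_series] at h1
      rw [cartanProj_of_root e ha hinv h0 (hwt i), map_zero, zero_mul, map_zero, map_zero,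
        zero_add]
      change (L.expLoc e (fun j => 2 * wt i (e j)) - 1) * _ =
        L.expLoc e (fun j => 2 * wt i (e j)) * _ at h1
      have h2 := congrArg
        (fun t => Ring.inverse (L.expLoc e (fun j => 2 * wt i (e j)) - 1) * t) h1
      simp only [← mul_assoc, Ring.inverse_mul_cancel _ hu, one_mul] at h2
      rw [h2]
      simp only [φ]
      rw [mul_comm (Ring.inverse _), mul_smul_comm]
  have hpair : ∀ α ∈ P, φ α + φ (-α) =
      (L.expLoc e (fun k => 2 * α (e k)) + 1) *
        Ring.inverse (L.expLoc e (fun k => 2 * α (e k)) - 1) *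
          algebraMap _ _ (dualDeriv e B α F) := by
    intro α hα
    have hu := isUnit_expLoc_sub_one e (hP.1 α hα)
    have hneg : -α ∈ L.restrictedRoots a := by
      refine ⟨neg_ne_zero.2 (hP.1 α hα).1, fun hbot => (hP.1 α hα).2 ?_⟩
      rw [eq_bot_iff] at hbot ⊢
      intro x hx
      have := hbot (theta_mem_weightSpace hθ ha hx)
      rw [Submodule.mem_bot] at this ⊢
      rw [← hθ.involutive x, this, map_zero]
    have hu' := isUnit_expLoc_sub_one e hneg
    have hd : dualDeriv e B (-α) F = -dualDeriv e B α F := by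
      simp [dualDeriv]
    have hE : L.expLoc e (fun k => 2 * α (e k)) * L.expLoc e (fun k => 2 * (-α) (e k)) = 1 := by
      rw [← expLoc_add, ← expLoc_zero e]
      congr 1
      funext k
      simp
    simp only [φ, hd, map_neg]
    set X := L.expLoc e (fun k => 2 * α (e k))
    set Y := L.expLoc e (fun k => 2 * (-α) (e k))
    have i1 := Ring.mul_inverse_cancel _ hu
    have i2 := Ring.mul_inverse_cancel _ hu'
    set p := Ring.inverse (X - 1)
    set q := Ring.inverse (Y - 1)
    -- This is `e^{-2α} / (e^{-2α} - 1) = -1 / (e^{2α} - 1)`.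
    have hq : Y * q = -p := by
      have : (X - 1) * (Y * q) = (X - 1) * (-p) := by
        linear_combination q * hE - i2 + i1
      exact hu.mul_left_cancel this
    linear_combination (-algebraMap (MvPowerSeries ι ℂ) (L.Loc e) (dualDeriv e B α F)) * hq
  have hC : restriction e ha (laplaceBeltrami (L.casimir B hB b) f) =
      algebraMap _ _ (zonalHat e ha f (L.casimir B hB b)) := rfl
  rw [hC, casimir_eq_casimir b b', casimir, map_sum, map_sum,
    Finset.sum_congr rfl fun i _ => hterm i, Finset.sum_add_distrib, ← map_sum,
    sum_zonalHat_cartanProj e ha hinv hBa b',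
    sum_smul_weights hθ ha hP wt (fun i => koszul (par i) (par i)) (fun α _ => hmult α) φ hφ0]
  have hR : restriction e ha f = algebraMap _ _ F := by
    rw [hF, zonalHat_one]; rfl
  have hD : ∀ α, algebraMap (MvPowerSeries ι ℂ) (L.Loc e) (dualDeriv e B α F) =
      ∑ j, algebraMap ℂ (L.Loc e) (∑ i, invGram e B j i * α (e i)) *
        L.locDeriv e j (algebraMap _ _ F) := by
    intro α
    rw [dualDeriv, map_sum]
    refine Finset.sum_congr rfl fun j _ => ?_
    rw [algebraMap_smul_series, locDeriv_algebraMap, Algebra.smul_def]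
  rw [DiffOp.apply, hR]
  simp only [radialPart, zero_smul, add_zero]
  congr 1
  · rw [map_sum]
    refine Finset.sum_congr rfl fun i _ => ?_
    rw [map_sum]
    refine Finset.sum_congr rfl fun j _ => ?_
    rw [algebraMap_smul_series, locDeriv_algebraMap, locDeriv_algebraMap, Algebra.smul_def,
      smul_eq_mul]
  · simp only [Finset.sum_smul]
    rw [Finset.sum_comm]
    refine Finset.sum_congr rfl fun α hα => ?_
    rw [hpair α hα, hD, Finset.mul_sum, Finset.smul_sum]
    refine Finset.sum_congr rfl fun j _ => ?_
    rw [Algebra.smul_def, smul_eq_mul, map_intCast]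
    ring

end radialPart

end LieSuperalgebra

/-! ### Conjugation of differential operators by a square root -/

section conjugation

variable {A : Type} [CommRing A] [Algebra ℂ A]

/-- The extension of a derivation `d` of `A` to `A[ω]`, `ω² = q`, with `D ω = l ω`. -/
def quadraticDerivation {q : A} (d : Derivation ℂ A A) (l : A) (h : d q = 2 * l * q) :
    Derivation ℂ (QuadraticAlgebra A q 0) (QuadraticAlgebra A q 0) :=
  Derivation.mk'
    { toFun := fun z => ⟨d z.re, d z.im + l * z.im⟩
      map_add' := fun z w => by
        ext
        · simp
        · simp; ring
      map_smul' := fun c z => by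
        ext
        · simp
        · simp }
    (fun z w => by
      ext
      · simp only [LinearMap.coe_mk, AddHom.coe_mk, smul_eq_mul, QuadraticAlgebra.re_mul,
          QuadraticAlgebra.re_add, map_add, Derivation.leibniz, h]
        ring
      · simp only [LinearMap.coe_mk, AddHom.coe_mk, smul_eq_mul, QuadraticAlgebra.im_mul,
          QuadraticAlgebra.im_add, map_add, Derivation.leibniz, map_zero, zero_mul]
        ring)

theorem quadraticDerivation_apply {q : A} (d : Derivation ℂ A A) (l : A) (h : d q = 2 * l * q)
    (z : QuadraticAlgebra A q 0) :
    quadraticDerivation d l h z = ⟨d z.re, d z.im + l * z.im⟩ := rfl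

open QuadraticAlgebra in
theorem quadraticDerivation_algebraMap {q : A} (d : Derivation ℂ A A) (l : A)
    (h : d q = 2 * l * q) (x : A) :
    quadraticDerivation d l h (algebraMap A (QuadraticAlgebra A q 0) x) =
      algebraMap A (QuadraticAlgebra A q 0) (d x) := by
  rw [quadraticDerivation_apply]
  ext <;> simp

open QuadraticAlgebra in
theorem quadraticDerivation_root {q : A} (d : Derivation ℂ A A) (l : A)
    (h : d q = 2 * l * q) :
    quadraticDerivation d l h (⟨0, 1⟩ : QuadraticAlgebra A q 0) =
      algebraMap A (QuadraticAlgebra A q 0) l * ⟨0, 1⟩ := by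
  rw [quadraticDerivation_apply]
  ext <;> simp

open QuadraticAlgebra in
theorem quadraticAlgebra_root_mul (q : Aˣ) :
    (⟨0, 1⟩ : QuadraticAlgebra A (q : A) 0) * ⟨0, ((q⁻¹ : Aˣ) : A)⟩ = 1 := by
  ext <;> simp

open QuadraticAlgebra in
theorem quadraticAlgebra_root_sq (q : A) :
    (⟨0, 1⟩ : QuadraticAlgebra A q 0) ^ 2 = algebraMap A (QuadraticAlgebra A q 0) q := by
  rw [pow_two]
  ext <;> simp

/-- Conjugation by `ω` replaces each `D i` by `D i - l i`. The cross terms of the second order part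
cancel the first order part of `T`, whose coefficients are `2 ∑ G l` by assumption, and what remains
besides `∑ G D D` is minus the sum of `G_ij (d i (l j) + l i * l j)`. -/
theorem apply_conj_of_logDeriv {ι K : Type*} [Fintype ι] [CommRing K] [Algebra ℂ K] [Algebra A K]
    [IsScalarTower ℂ A K] {d : ι → Derivation ℂ A A} {D : ι → Derivation ℂ K K}
    (hDmap : ∀ i x, D i (algebraMap A K x) = algebraMap A K (d i x)) {T Q : DiffOp ι A}
    {ω ω' : K} (hωω' : ω * ω' = 1) (l : ι → A) (hDω : ∀ i, D i ω = algebraMap A K (l i) * ω)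
    (G : ι → ι → ℂ) (hG : ∀ i j, G i j = G j i)
    (hT₂ : ∀ i j, T.c₂ i j = algebraMap ℂ A (G i j))
    (hT₁ : ∀ i, T.c₁ i = 2 * ∑ j, algebraMap ℂ A (G i j) * l j) (hT₀ : T.c₀ = 0)
    (hQ₂ : ∀ i j, Q.c₂ i j = -algebraMap ℂ A (G i j)) (hQ₁ : ∀ i, Q.c₁ i = 0) (c : ℂ)
    (hQ₀ : Q.c₀ + algebraMap ℂ A c =
      ∑ i, ∑ j, algebraMap ℂ A (G i j) * (d i (l j) + l i * l j)) (f : K) :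
    ω * T.apply D (ω' * f) = -(Q.apply D f + c • f) := by
  have hDω' : ∀ i, D i ω' = -(algebraMap A K (l i) * ω') := by
    intro i
    have h1 : D i (ω * ω') = 0 := by rw [hωω', Derivation.map_one_eq_zero]
    rw [Derivation.leibniz, smul_eq_mul, smul_eq_mul, hDω] at h1
    linear_combination ω' * h1 - (D i ω' + algebraMap A K (l i) * ω') * hωω'
  have hDf : ∀ i f, D i (ω' * f) = ω' * (D i f - algebraMap A K (l i) * f) := by
    intro i f
    rw [Derivation.leibniz, smul_eq_mul, smul_eq_mul, hDω']
    ring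
  have h2 : ∀ i j, D i (D j (ω' * f)) = ω' * (D i (D j f) - algebraMap A K (d i (l j)) * f -
      algebraMap A K (l j) * D i f - algebraMap A K (l i) * D j f +
      algebraMap A K (l i * l j) * f) := by
    intro i j
    rw [hDf, hDf, map_sub, Derivation.leibniz, smul_eq_mul, smul_eq_mul, hDmap, map_mul]
    ring
  have h3 := congrArg (algebraMap A K) hQ₀
  rw [map_add, map_sum] at h3
  rw [DiffOp.apply, DiffOp.apply, hT₀, zero_smul, add_zero]
  have e1 : ∑ i, ∑ j, T.c₂ i j • D i (D j (ω' * f)) =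
      ω' * (∑ i, ∑ j, algebraMap A K (algebraMap ℂ A (G i j)) * D i (D j f)
        - ∑ i, ∑ j, algebraMap A K (algebraMap ℂ A (G i j) * (d i (l j) + l i * l j)) * f
        - 2 * ∑ i, ∑ j, algebraMap A K (algebraMap ℂ A (G i j) * l j) * D i f
        + 2 * ∑ i, ∑ j, algebraMap A K (algebraMap ℂ A (G i j) * (l i * l j)) * f) := by
    have sw : ∑ i, ∑ j, algebraMap A K (algebraMap ℂ A (G i j) * l j) * D i f =
        ∑ i, ∑ j, algebraMap A K (algebraMap ℂ A (G i j) * l i) * D j f := by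
      rw [Finset.sum_comm]
      refine Finset.sum_congr rfl fun i _ => Finset.sum_congr rfl fun j _ => ?_
      rw [hG]
    rw [two_mul (∑ i, ∑ j, algebraMap A K (algebraMap ℂ A (G i j) * l j) * D i f)]
    conv_rhs =>
      enter [2, 1, 2, 2]
      rw [sw]
    simp only [← Finset.sum_add_distrib, ← Finset.sum_sub_distrib, Finset.mul_sum]
    refine Finset.sum_congr rfl fun i _ => Finset.sum_congr rfl fun j _ => ?_
    rw [h2, hT₂, Algebra.smul_def]
    simp only [map_mul, map_add]
    ring
  have e2 : ∑ i, T.c₁ i • D i (ω' * f) =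
      ω' * (2 * ∑ i, ∑ j, algebraMap A K (algebraMap ℂ A (G i j) * l j) * D i f
        - 2 * ∑ i, ∑ j, algebraMap A K (algebraMap ℂ A (G i j) * (l i * l j)) * f) := by
    simp only [← Finset.sum_sub_distrib, Finset.mul_sum]
    refine Finset.sum_congr rfl fun i _ => ?_
    rw [hDf, hT₁, Algebra.smul_def, map_mul, map_sum, Finset.mul_sum, Finset.sum_mul]
    refine Finset.sum_congr rfl fun j _ => ?_
    simp only [map_mul, map_ofNat]
    ring
  have e3 : ∑ i, ∑ j, Q.c₂ i j • D i (D j f) =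
      -∑ i, ∑ j, algebraMap A K (algebraMap ℂ A (G i j)) * D i (D j f) := by
    simp only [← Finset.sum_neg_distrib]
    refine Finset.sum_congr rfl fun i _ => Finset.sum_congr rfl fun j _ => ?_
    rw [hQ₂, Algebra.smul_def, map_neg]
    ring
  have e4 : ∑ i, Q.c₁ i • D i f = 0 := Finset.sum_eq_zero fun i _ => by rw [hQ₁, zero_smul]
  have e5 : Q.c₀ • f + c • f =
      ∑ i, ∑ j, algebraMap A K (algebraMap ℂ A (G i j) * (d i (l j) + l i * l j)) * f := by
    rw [Algebra.smul_def, Algebra.smul_def, IsScalarTower.algebraMap_apply ℂ A K, ← add_mul, h3,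
      Finset.sum_mul]
    refine Finset.sum_congr rfl fun i _ => ?_
    rw [map_sum, Finset.sum_mul]
  rw [e1, e2, e3, e4]
  linear_combination (∑ i, ∑ j, algebraMap A K (algebraMap ℂ A (G i j)) * D i (D j f)
        - ∑ i, ∑ j, algebraMap A K (algebraMap ℂ A (G i j) * (d i (l j) + l i * l j)) * f) * hωω'
    + e5

/-- The extension is `A[ω]` with `ω² = q`, taken formally whether or not `q` is already a square.
Since `q` is a unit, so is `ω`, with inverse `q⁻¹ ω`. The extended derivations commute because the
logarithmic derivatives are closed, which is the hypothesis `hlc`. -/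
theorem isConjugate_of_logDeriv {ι : Type} [Fintype ι] {d : ι → Derivation ℂ A A}
    (hd : ∀ i j x, d i (d j x) = d j (d i x)) {T Q : DiffOp ι A} {num den : A}
    (q : Aˣ) (hq : (q : A) * den = num) (l : ι → A) (hl : ∀ i, d i q = 2 * l i * q)
    (hlc : ∀ i j, d i (l j) = d j (l i)) (G : ι → ι → ℂ) (hG : ∀ i j, G i j = G j i)
    (hT₂ : ∀ i j, T.c₂ i j = algebraMap ℂ A (G i j))
    (hT₁ : ∀ i, T.c₁ i = 2 * ∑ j, algebraMap ℂ A (G i j) * l j) (hT₀ : T.c₀ = 0)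
    (hQ₂ : ∀ i j, Q.c₂ i j = -algebraMap ℂ A (G i j)) (hQ₁ : ∀ i, Q.c₁ i = 0) (c : ℂ)
    (hQ₀ : Q.c₀ + algebraMap ℂ A c =
      ∑ i, ∑ j, algebraMap ℂ A (G i j) * (d i (l j) + l i * l j)) :
    IsConjugate d T Q num den := by
  have hωω' := quadraticAlgebra_root_mul q
  refine ⟨QuadraticAlgebra A (q : A) 0, inferInstance, inferInstance, inferInstance, inferInstance,
    fun i => quadraticDerivation (d i) (l i) (hl i),
    ⟨⟨0, 1⟩, ⟨0, ((q⁻¹ : Aˣ) : A)⟩, hωω', by rw [mul_comm, hωω']⟩, c,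
    QuadraticAlgebra.algebraMap_injective, fun i => quadraticDerivation_algebraMap _ _ _, ?_, ?_,
    ?_⟩
  · intro i j z
    simp only [quadraticDerivation_apply]
    ext
    · exact hd i j _
    · simp only [map_add, Derivation.leibniz, smul_eq_mul]
      rw [hd i j, hlc i j]
      ring
  · rw [← hq, map_mul]
    exact congrArg (· * _) (quadraticAlgebra_root_sq (q : A))
  · exact apply_conj_of_logDeriv (fun i => quadraticDerivation_algebraMap _ _ _) hωω' l
      (fun i => quadraticDerivation_root _ _ _) G hG hT₂ hT₁ hT₀ hQ₂ hQ₁ c hQ₀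

end conjugation

/-- The logarithmic derivative `u ↦ u⁻¹ d(u)` as a homomorphism. -/
def logDeriv {A : Type*} [CommRing A] [Algebra ℂ A] (d : Derivation ℂ A A) :
    Aˣ →* Multiplicative A where
  toFun u := Multiplicative.ofAdd (((u⁻¹ : Aˣ) : A) * d u)
  map_one' := by simp
  map_mul' u v := by
    rw [← ofAdd_add]
    congr 1
    rw [Units.val_mul, Derivation.leibniz, smul_eq_mul, smul_eq_mul, mul_inv, Units.val_mul]
    linear_combination (((v⁻¹ : Aˣ) : A) * d v) * u.inv_mul + (((u⁻¹ : Aˣ) : A) * d u) * v.inv_mul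

theorem logDeriv_eq_iff {A : Type*} [CommRing A] [Algebra ℂ A] {d : Derivation ℂ A A} {u : Aˣ}
    {x : A} : logDeriv d u = Multiplicative.ofAdd x ↔ d u = x * u := by
  change Multiplicative.ofAdd (((u⁻¹ : Aˣ) : A) * d u) = _ ↔ _
  rw [Multiplicative.ofAdd.injective.eq_iff, Units.inv_mul_eq_iff_eq_mul, mul_comm]

/-- Logarithmic derivatives turn products into sums, and for units this covers negative exponents
too; multiplicities may be negative. -/
theorem derivation_prod_zpow {A κ : Type*} [CommRing A] [Algebra ℂ A] {d : Derivation ℂ A A}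
    {P : Finset κ} {u : κ → Aˣ} {v : κ → A} (h : ∀ α ∈ P, d (u α) = v α * u α) (μ : κ → ℤ) :
    d ((∏ α ∈ P, u α ^ μ α : Aˣ) : A) =
      (∑ α ∈ P, (μ α : A) * v α) * ((∏ α ∈ P, u α ^ μ α : Aˣ) : A) := by
  rw [← logDeriv_eq_iff, map_prod, ofAdd_sum]
  refine Finset.prod_congr rfl fun α hα => ?_
  rw [map_zpow, logDeriv_eq_iff.2 (h α hα), ← ofAdd_zsmul, zsmul_eq_mul]

namespace LieSuperalgebra

section hyperbolic

variable {g : Type*} [AddCommGroup g] [Module ℂ g] {L : LieSuperalgebra g}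
variable {ι : Type} [Fintype ι] {a : Submodule ℂ g} (e : Module.Basis ι ℂ a)

variable (L) in
/-- The hyperbolic cotangent of the linear form `∑ c_i x_i`. -/
def cothLoc (c : ι → ℂ) : L.Loc e :=
  (L.expLoc e (fun k => 2 * c k) + 1) * Ring.inverse (L.expLoc e (fun k => 2 * c k) - 1)

theorem expLoc_neg_mul (c : ι → ℂ) : L.expLoc e (-c) * L.expLoc e c = 1 := by
  rw [← expLoc_add, neg_add_cancel, expLoc_zero]

theorem expLoc_two_mul (c : ι → ℂ) : L.expLoc e (fun k => 2 * c k) = L.expLoc e c ^ 2 := by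
  rw [pow_two, ← expLoc_add]
  congr 1
  ext k
  simp [two_mul]

variable {e}

theorem expLoc_sub_expLoc_neg (c : ι → ℂ) :
    L.expLoc e c - L.expLoc e (-c) =
      L.expLoc e (-c) * (L.expLoc e (fun k => 2 * c k) - 1) := by
  rw [expLoc_two_mul]
  linear_combination (-L.expLoc e c) * expLoc_neg_mul e c

theorem isUnit_expLoc (c : ι → ℂ) : IsUnit (L.expLoc e c) :=
  IsUnit.of_mul_eq_one_right _ (expLoc_neg_mul e c)

theorem isUnit_expLoc_sub_expLoc_neg {c : ι → ℂ}
    (hc : IsUnit (L.expLoc e (fun k => 2 * c k) - 1)) :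
    IsUnit (L.expLoc e c - L.expLoc e (-c)) := by
  rw [expLoc_sub_expLoc_neg]
  exact (isUnit_expLoc _).mul hc

theorem locDeriv_expLoc_sub {c : ι → ℂ} (hc : IsUnit (L.expLoc e (fun k => 2 * c k) - 1)) (i : ι) :
    L.locDeriv e i (L.expLoc e c - L.expLoc e (-c)) =
      algebraMap ℂ _ (c i) * L.cothLoc e c * (L.expLoc e c - L.expLoc e (-c)) := by
  rw [map_sub, locDeriv_expLoc, locDeriv_expLoc, Pi.neg_apply,
    Algebra.smul_def, Algebra.smul_def, map_neg, expLoc_sub_expLoc_neg, cothLoc]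
  have h1 := Ring.inverse_mul_cancel _ hc
  rw [expLoc_two_mul] at h1 ⊢
  linear_combination (-algebraMap ℂ _ (c i) * (L.expLoc e c ^ 2 + 1) * L.expLoc e (-c)) * h1
    - algebraMap ℂ _ (c i) * L.expLoc e c * expLoc_neg_mul e c

/-- This is `1 / sinh² = 4X / (X - 1)²` with `X = e^{2λ}`, in a form without denominators so that it
can enter polynomial identities in the localisation. -/
theorem invSinhSq_expLoc {c : ι → ℂ} (hc : IsUnit (L.expLoc e (fun k => 2 * c k) - 1)) :
    invSinhSq (L.expLoc e) c * (L.expLoc e (fun k => 2 * c k) - 1) ^ 2 =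
      4 * L.expLoc e (fun k => 2 * c k) := by
  have hu : IsUnit (((1 / 2 : ℂ) • (L.expLoc e c - L.expLoc e (-c))) ^ 2) := by
    refine IsUnit.pow 2 ?_
    rw [Algebra.smul_def]
    exact ((isUnit_iff_ne_zero.2 (by norm_num)).map _).mul (isUnit_expLoc_sub_expLoc_neg hc)
  have h1 := Ring.inverse_mul_cancel _ hu
  rw [invSinhSq]
  generalize Ring.inverse (((1 / 2 : ℂ) • (L.expLoc e c - L.expLoc e (-c))) ^ 2) = y at h1 ⊢
  have h2 : (2 : L.Loc e) * algebraMap ℂ _ (1 / 2) = 1 := by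
    rw [← map_ofNat (algebraMap ℂ (L.Loc e)) 2, ← map_mul]
    norm_num
  rw [Algebra.smul_def, expLoc_sub_expLoc_neg] at h1
  have h3 := expLoc_neg_mul (L := L) e c
  have h4 : L.expLoc e (-c) ^ 2 * L.expLoc e (fun k => 2 * c k) = 1 := by
    rw [expLoc_two_mul]; linear_combination (L.expLoc e (-c) * L.expLoc e c + 1) * h3
  generalize L.expLoc e (fun k => 2 * c k) = X at *
  generalize algebraMap ℂ (L.Loc e) (1 / 2) = hlf at *
  linear_combination 4 * X * h1 - (y * (X - 1) ^ 2 * 4 * hlf ^ 2) * h4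
    - (y * (X - 1) ^ 2) * (2 * hlf + 1) * h2

/-- Differentiate `coth · (X - 1) = X + 1` and multiply once more by the unit `X - 1`. -/
theorem locDeriv_cothLoc {c : ι → ℂ} (hc : IsUnit (L.expLoc e (fun k => 2 * c k) - 1)) (i : ι) :
    L.locDeriv e i (L.cothLoc e c) = -(algebraMap ℂ _ (c i) * invSinhSq (L.expLoc e) c) := by
  have h1 : L.cothLoc e c * (L.expLoc e (fun k => 2 * c k) - 1) =
      L.expLoc e (fun k => 2 * c k) + 1 := by
    rw [cothLoc, mul_assoc, Ring.inverse_mul_cancel _ hc, mul_one]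
  have h2 := congrArg (L.locDeriv e i) h1
  have h3 := invSinhSq_expLoc hc
  rw [Derivation.leibniz, smul_eq_mul, smul_eq_mul, map_sub, map_add, Derivation.map_one_eq_zero,
    sub_zero, add_zero, locDeriv_expLoc, Algebra.smul_def, map_mul, map_ofNat] at h2
  refine (hc.pow 2).mul_left_injective ?_
  change _ * _ = _ * _
  generalize L.expLoc e (fun k => 2 * c k) = X at *
  linear_combination (X - 1) * h2 - 2 * algebraMap ℂ _ (c i) * X * h1 + algebraMap ℂ _ (c i) * h3

end hyperbolic

section conjugation

variable {g : Type} [AddCommGroup g] [Module ℂ g] {L : LieSuperalgebra g}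
variable {ι : Type} [Fintype ι] [DecidableEq ι] {a : Submodule ℂ g} (e : Module.Basis ι ℂ a)

variable (L) in
/-- Half of the sum of `μ_α α_i coth α` over the positive restricted roots. -/
def halfCothSum (P : Finset (Module.Dual ℂ a)) (i : ι) : L.Loc e :=
  ∑ α ∈ P, (L.multiplicity a α : L.Loc e) *
    (algebraMap ℂ _ (1 / 2 * α (e i)) * L.cothLoc e fun k => α (e k))

theorem locDeriv_halfCothSum {P : Finset (Module.Dual ℂ a)} (hP : L.IsPositiveHalf a P) (i j : ι) :
    L.locDeriv e i (L.halfCothSum e P j) = -∑ α ∈ P, (L.multiplicity a α : L.Loc e) *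
      (algebraMap ℂ _ (1 / 2 * α (e j) * α (e i)) * invSinhSq (L.expLoc e) fun k => α (e k)) := by
  rw [halfCothSum, map_sum, ← Finset.sum_neg_distrib]
  refine Finset.sum_congr rfl fun α hα => ?_
  rw [Derivation.leibniz, Derivation.leibniz, Derivation.map_intCast, Derivation.map_algebraMap,
    locDeriv_cothLoc (isUnit_expLoc_sub_one e (hP.1 α hα)), map_mul _ _ (α (e i))]
  simp only [smul_eq_mul]
  ring

theorem radialPart_c₁ (B : LinearMap.BilinForm ℂ g) (P : Finset (Module.Dual ℂ a)) (i : ι) :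
    (L.radialPart e B P).c₁ i =
      2 * ∑ j, algebraMap ℂ _ (invGram e B i j) * L.halfCothSum e P j := by
  change ∑ α ∈ P, _ = _
  simp only [halfCothSum, Finset.mul_sum]
  rw [Finset.sum_comm]
  refine Finset.sum_congr rfl fun α _ => ?_
  rw [map_sum, Finset.mul_sum]
  refine Finset.sum_congr rfl fun j _ => ?_
  have h2 : (2 : L.Loc e) * algebraMap ℂ _ (1 / 2) = 1 := by
    rw [← map_ofNat (algebraMap ℂ (L.Loc e)) 2, ← map_mul]
    norm_num
  rw [map_mul, map_mul _ (1 / 2), cothLoc]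
  linear_combination (-(L.multiplicity a α : L.Loc e) * algebraMap ℂ _ (invGram e B i j) *
    algebraMap ℂ _ (α (e j)) * (L.expLoc e (fun k => 2 * α (e k)) + 1) *
      Ring.inverse (L.expLoc e (fun k => 2 * α (e k)) - 1)) * h2

/-- Here `Ψ²` is the unit `∏ (e^α - e^{-α})^{μ_α}`, whose logarithmic derivatives are twice
`halfCothSum`. The first order part of the radial part matches them automatically, so for a given
`Q` only the equality of potentials `hQ₀` has to be checked. -/
theorem isConjugate_radialPart {P : Finset (Module.Dual ℂ a)} (hP : L.IsPositiveHalf a P)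
    (B : LinearMap.BilinForm ℂ g) (hG : ∀ i j, invGram e B i j = invGram e B j i)
    {Q : DiffOp ι (L.Loc e)}
    (hQ₂ : ∀ i j, Q.c₂ i j = -algebraMap ℂ _ (invGram e B i j)) (hQ₁ : ∀ i, Q.c₁ i = 0) (c : ℂ)
    (hQ₀ : Q.c₀ + algebraMap ℂ _ c =
      ∑ i, ∑ j, algebraMap ℂ _ (invGram e B i j) * (L.locDeriv e i (L.halfCothSum e P j) +
        L.halfCothSum e P i * L.halfCothSum e P j)) :
    IsConjugate (L.locDeriv e) (L.radialPart e B P) Q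
      (∏ α ∈ P, (L.expLoc e (fun i => α (e i)) - L.expLoc e (fun i => -α (e i))) ^
        L.rootDim a 0 α)
      (∏ α ∈ P, (L.expLoc e (fun i => α (e i)) - L.expLoc e (fun i => -α (e i))) ^
        L.rootDim a 1 α) := by
  classical
  have hu : ∀ α : Module.Dual ℂ a, ∃ u : (L.Loc e)ˣ, α ∈ P →
      (u : L.Loc e) = L.expLoc e (fun i => α (e i)) - L.expLoc e (fun i => -α (e i)) := by
    intro α
    by_cases hα : α ∈ P
    · obtain ⟨u, hu⟩ := isUnit_expLoc_sub_expLoc_neg (isUnit_expLoc_sub_one e (hP.1 α hα))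
      exact ⟨u, fun _ => hu⟩
    · exact ⟨1, fun h => absurd h hα⟩
  choose u hu using hu
  refine isConjugate_of_logDeriv (locDeriv_comm e) (∏ α ∈ P, u α ^ L.multiplicity a α) ?_
    (L.halfCothSum e P) ?_ ?_ (invGram e B) hG (fun i j => rfl) ?_ rfl hQ₂ hQ₁ c hQ₀
  · have hd : ∀ d : ZMod 2, ∏ α ∈ P, (L.expLoc e (fun i => α (e i)) -
        L.expLoc e (fun i => -α (e i))) ^ L.rootDim a d α =
        ∏ α ∈ P, (u α : L.Loc e) ^ L.rootDim a d α := fun d =>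
      Finset.prod_congr rfl fun α hα => by rw [← hu α hα]
    rw [hd, hd]
    simp only [← Units.val_pow_eq_pow_val, ← Units.coe_prod, ← Units.val_mul]
    congr 1
    rw [← Finset.prod_mul_distrib]
    refine Finset.prod_congr rfl fun α _ => ?_
    rw [← zpow_natCast, ← zpow_natCast, ← zpow_add, multiplicity, sub_add_cancel]
  · intro i
    rw [derivation_prod_zpow (v := fun α =>
      algebraMap ℂ _ (α (e i)) * L.cothLoc e fun k => α (e k))]
    · congr 1
      rw [halfCothSum, Finset.mul_sum]
      refine Finset.sum_congr rfl fun α _ => ?_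
      have h2 : (2 : L.Loc e) * algebraMap ℂ _ (1 / 2) = 1 := by
        rw [← map_ofNat (algebraMap ℂ (L.Loc e)) 2, ← map_mul]
        norm_num
      rw [map_mul _ (1 / 2)]
      linear_combination (-(L.multiplicity a α : L.Loc e) * algebraMap ℂ _ (α (e i)) *
        L.cothLoc e fun k => α (e k)) * h2
    · intro α hα
      rw [hu α hα]
      exact locDeriv_expLoc_sub (isUnit_expLoc_sub_one e (hP.1 α hα)) i
  · intro i j
    rw [locDeriv_halfCothSum e hP, locDeriv_halfCothSum e hP]
    refine congrArg _ (Finset.sum_congr rfl fun α _ => ?_)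
    rw [mul_right_comm]
  · exact radialPart_c₁ e B P

end conjugation

end LieSuperalgebra

/-! ### Rational identities -/

section identities

variable {𝔽 ι : Type*} [Field 𝔽] [CharZero 𝔽] [Fintype ι]

theorem sum_rotate {M : Type*} [AddCommMonoid M] (f : ι → ι → ι → M) :
    ∑ i, ∑ j, ∑ l, f j l i = ∑ i, ∑ j, ∑ l, f i j l := by
  rw [Finset.sum_comm]
  exact Finset.sum_congr rfl fun i _ => Finset.sum_comm

/-- A double sum with constant symmetrised terms is constant. -/
theorem sum_mem_of_symm (S : Subfield 𝔽) {T : ι → ι → 𝔽} (h : ∀ i j, T i j + T j i ∈ S) :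
    ∑ i, ∑ j, T i j ∈ S := by
  have h2 : ∑ i, ∑ j, T i j = (2 : 𝔽)⁻¹ * ∑ i, ∑ j, (T i j + T j i) := by
    simp only [Finset.sum_add_distrib]
    rw [Finset.sum_comm (f := fun i j => T j i)]
    ring
  rw [h2]
  exact S.mul_mem (S.inv_mem (ofNat_mem S 2)) (sum_mem fun i _ => sum_mem fun j _ => h i j)

/-- A triple sum whose cyclically symmetrised terms are constant up to terms supported on the
partial diagonals. -/
theorem sum_sub_mem_of_cyclic [DecidableEq ι] (S : Subfield 𝔽) {f : ι → ι → ι → 𝔽}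
    {h : ι → ι → 𝔽}
    (hf : ∀ i j l, f i j l + f j l i + f l i j - ((if j = l then h i j else 0) +
      (if l = i then h j l else 0) + (if i = j then h l i else 0)) ∈ S) :
    ∑ i, ∑ j, ∑ l, f i j l - ∑ i, ∑ j, h i j ∈ S := by
  have key : ∑ i, ∑ j, ∑ l, f i j l - ∑ i, ∑ j, h i j = (3 : 𝔽)⁻¹ *
      ∑ i, ∑ j, ∑ l, (f i j l + f j l i + f l i j - ((if j = l then h i j else 0) +
      (if l = i then h j l else 0) + (if i = j then h l i else 0))) := by
    simp only [Finset.sum_add_distrib, Finset.sum_sub_distrib]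
    have e1 : ∑ i, ∑ j, ∑ l, (if j = l then h i j else 0) = ∑ i, ∑ j, h i j := by simp
    rw [sum_rotate f, ← sum_rotate (fun i j l => f l i j),
      sum_rotate (fun i j l => if j = l then h i j else 0),
      ← sum_rotate (fun i j l => if i = j then h l i else 0), e1]
    ring
  rw [key]
  exact S.mul_mem (S.inv_mem (ofNat_mem S 3))
    (sum_mem fun i _ => sum_mem fun j _ => sum_mem fun l _ => hf i j l)

/-- Put `A_ij = coth(z_i - z_j)`, `X_i = e^{2 z_i}`. The squares of the first order coefficients
give a triple sum of `w_i w_j w_l A_ij A_il`. For distinct indices the identity `A_ij A_il + A_jl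
A_ji + A_li A_lj = 1` makes its cyclic symmetrisation constant; on the diagonal `j = l`, `coth² = 1
+ 1/sinh²` yields a potential term. The remaining double sum vanishes after symmetrisation, which is
what singles out the coefficient `k (k w_i w_j + 1)(w_i + w_j)`. -/
theorem sum_typeA_sub_mem (S : Subfield 𝔽) {w X : ι → 𝔽} {k : 𝔽} (hk : k ∈ S)
    (hw : ∀ i, w i ∈ S) (hw0 : ∀ i, w i ≠ 0) (hX : Function.Injective X) :
    ∑ i, (w i)⁻¹ * ((-k * w i * ∑ j, w j * ((X i + X j) / (X i - X j))) ^ 2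
        - 2⁻¹ * (-2 * k * w i * ∑ j, w j * (4 * X i * X j / (X i - X j) ^ 2)))
      - 2⁻¹ * ∑ i, ∑ j, k * (k * w i * w j + 1) * (w i + w j) *
        (4 * X i * X j / (X i - X j) ^ 2) ∈ S := by
  classical
  let A : ι → ι → 𝔽 := fun i j => if i = j then 0 else (X i + X j) / (X i - X j)
  -- Division by zero returns `0`, so the terms `i = j` drop out of the sums without being excluded.
  have hA : ∀ i j, (X i + X j) / (X i - X j) = A i j := by
    intro i j
    by_cases h : i = j
    · simp [A, h]
    · simp [A, h]
  let s : ι → ι → 𝔽 := fun i j => 4 * X i * X j / (X i - X j) ^ 2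
  have hs : ∀ i j, s i j = s j i := fun i j => by
    simp only [s]
    rw [show (X i - X j) ^ 2 = (X j - X i) ^ 2 by ring]
    ring
  have hAA : ∀ i j, A i j ^ 2 = s i j + if i = j then 0 else 1 := by
    intro i j
    by_cases h : i = j
    · simp [A, s, h]
    · have : X i - X j ≠ 0 := sub_ne_zero.2 fun h' => h (hX h')
      simp only [A, s, h, if_false]
      field_simp
      ring
  have h1 : ∑ i, (w i)⁻¹ * ((-k * w i * ∑ j, w j * ((X i + X j) / (X i - X j))) ^ 2
        - 2⁻¹ * (-2 * k * w i * ∑ j, w j * (4 * X i * X j / (X i - X j) ^ 2)))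
      - 2⁻¹ * ∑ i, ∑ j, k * (k * w i * w j + 1) * (w i + w j) *
        (4 * X i * X j / (X i - X j) ^ 2) =
      k ^ 2 * (∑ i, ∑ j, ∑ l, w i * w j * w l * (A i j * A i l)
        - ∑ i, ∑ j, w i * w j * w j * s i j)
      + ∑ i, ∑ j, (k ^ 2 * (w i * w j * w j * s i j) + k * w j * s i j -
        2⁻¹ * (k * (k * w i * w j + 1) * (w i + w j) * s i j)) := by
    simp only [Finset.sum_add_distrib, Finset.sum_sub_distrib, ← Finset.mul_sum]
    have e1 : ∀ i, (w i)⁻¹ * ((-k * w i * ∑ j, w j * ((X i + X j) / (X i - X j))) ^ 2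
        - 2⁻¹ * (-2 * k * w i * ∑ j, w j * (4 * X i * X j / (X i - X j) ^ 2))) =
        k ^ 2 * (∑ j, ∑ l, w i * w j * w l * (A i j * A i l)) + ∑ j, k * w j * s i j := by
      intro i
      have e2 : ∑ j, ∑ l, w i * w j * w l * (A i j * A i l) =
          w i * ((∑ j, w j * A i j) * ∑ j, w j * A i j) := by
        rw [Finset.sum_mul_sum, Finset.mul_sum]
        refine Finset.sum_congr rfl fun j _ => ?_
        rw [Finset.mul_sum]
        exact Finset.sum_congr rfl fun l _ => by ring
      have e3 : ∑ j, k * w j * s i j = k * ∑ j, w j * s i j := by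
        rw [Finset.mul_sum]
        exact Finset.sum_congr rfl fun l _ => by ring
      rw [e2, e3]
      simp only [hA]
      change (w i)⁻¹ * (_ - 2⁻¹ * (-2 * k * w i * ∑ j, w j * s i j)) = _
      generalize ∑ j, w j * s i j = U
      have := hw0 i
      field_simp
      ring
    rw [Finset.sum_congr rfl fun i _ => e1 i, Finset.sum_add_distrib, ← Finset.mul_sum]
    ring
  rw [h1]
  refine S.add_mem (S.mul_mem (S.pow_mem hk 2) (sum_sub_mem_of_cyclic S ?_)) (sum_mem_of_symm S ?_)
  · intro i j l
    have hswap : ∀ i j, A i j = -A j i := by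
      intro i j
      by_cases h : i = j
      · simp [A, h]
      · simp only [A, h, Ne.symm h, if_false]
        rw [← neg_sub, div_neg, add_comm]
    have h0 : ∀ i, A i i = 0 := fun i => by simp [A]
    have hc := S.mul_mem (S.mul_mem (hw i) (hw j)) (hw l)
    by_cases hij : i = j
    · subst hij
      by_cases hil : i = l
      · subst hil
        simp [h0, s, S.zero_mem]
      · rw [if_neg hil, if_neg (Ne.symm hil), if_pos rfl, h0]
        convert hc using 1
        have := hAA l i
        rw [if_neg (Ne.symm hil)] at this
        linear_combination w i * w i * w l * this
    · by_cases hil : l = i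
      · subst hil
        rw [if_neg (Ne.symm hij), if_pos rfl, if_neg hij, h0]
        convert hc using 1
        have := hAA j l
        rw [if_neg (Ne.symm hij)] at this
        linear_combination w l * w l * w j * this
      · by_cases hjl : j = l
        · subst hjl
          rw [if_pos rfl, if_neg hil, if_neg hij, h0]
          convert hc using 1
          have := hAA i j
          rw [if_neg hij] at this
          linear_combination (w i * w j * w j) * this
        · rw [if_neg hjl, if_neg hil, if_neg hij]
          convert hc using 1
          have h1 : X i - X j ≠ 0 := sub_ne_zero.2 fun h' => hij (hX h')
          have h2 : X l - X i ≠ 0 := sub_ne_zero.2 fun h' => hil (hX h')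
          have h3 : X j - X l ≠ 0 := sub_ne_zero.2 fun h' => hjl (hX h')
          rw [hswap i l, hswap j i, hswap l j]
          simp only [A, hjl, hil, hij, if_false]
          field_simp
          ring
  · intro i j
    convert S.zero_mem using 1
    rw [hs j i]
    ring

/-- Here `t_i = cosh 2 z_i`, and `t_i² - 1` is the square of the common factor `sinh 2 z_i` of the
first order coefficients. For distinct indices the triple sum is governed by the cyclic identity for
`(t_i² - 1) / ((t_i - t_j)(t_i - t_l))`, whose cyclic sum is `1`. The cross terms with the
one-variable part, together with the diagonal `j = l`, become constant when symmetrised over pairs;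
the purely one-variable terms give the `1/sinh²` terms of the potential and constants. -/
theorem sum_typeBC_sub_mem (S : Subfield 𝔽) {w t : ι → 𝔽} {k a β : 𝔽} (hk : k ∈ S) (ha : a ∈ S)
    (hβ : β ∈ S) (hw : ∀ i, w i ∈ S) (hw0 : ∀ i, w i ≠ 0) (ht : Function.Injective t)
    (ht1 : ∀ i, t i - 1 ≠ 0) (ht2 : ∀ i, t i + 1 ≠ 0) :
    ∑ i, (w i)⁻¹ * ((t i ^ 2 - 1) * (-2 * k * w i * ∑ j, w j / (t i - t j) +
          a * w i / 2 / (t i - 1) + w i * (β - k * w i) * t i / (t i ^ 2 - 1)) ^ 2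
        - 2⁻¹ * (-2 * k * w i * ∑ j, w j * (4 * (t i * t j - 1) / (t i - t j) ^ 2) +
          a * w i * (2 / (t i - 1)) + 4 * w i * (β - k * w i) / (t i ^ 2 - 1)))
      - (2⁻¹ * ∑ i, ∑ j, k * (k * w i * w j + 1) * (w i + w j) *
          (4 * (t i * t j - 1) / (t i - t j) ^ 2)
        + ∑ i, (a / 2 * (a * w i / 2 - 1 + w i * (β - k * w i)) * (2 / (t i - 1)) +
          (β - k * w i) * (w i * (β - k * w i) - 2) / (t i ^ 2 - 1))) ∈ S := by
  classical
  let s : ι → ι → 𝔽 := fun i j => 4 * (t i * t j - 1) / (t i - t j) ^ 2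
  let A : ι → ι → 𝔽 := fun i j => 1 / (t i - t j)
  let M : ι → 𝔽 := fun i => a / 2 * (t i + 1) + (β - k * w i) * t i
  have h1 : ∑ i, (w i)⁻¹ * ((t i ^ 2 - 1) * (-2 * k * w i * ∑ j, w j / (t i - t j) +
          a * w i / 2 / (t i - 1) + w i * (β - k * w i) * t i / (t i ^ 2 - 1)) ^ 2
        - 2⁻¹ * (-2 * k * w i * ∑ j, w j * (4 * (t i * t j - 1) / (t i - t j) ^ 2) +
          a * w i * (2 / (t i - 1)) + 4 * w i * (β - k * w i) / (t i ^ 2 - 1)))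
      - (2⁻¹ * ∑ i, ∑ j, k * (k * w i * w j + 1) * (w i + w j) *
          (4 * (t i * t j - 1) / (t i - t j) ^ 2)
        + ∑ i, (a / 2 * (a * w i / 2 - 1 + w i * (β - k * w i)) * (2 / (t i - 1)) +
          (β - k * w i) * (w i * (β - k * w i) - 2) / (t i ^ 2 - 1))) =
      4 * k ^ 2 * (∑ i, ∑ j, ∑ l, w i * w j * w l * ((t i ^ 2 - 1) * (A i j * A i l))
        - ∑ i, ∑ j, w i * w j * w j * ((t i ^ 2 - 1) * A i j ^ 2))
      + ∑ i, ∑ j, (4 * k ^ 2 * (w i * w j * w j * ((t i ^ 2 - 1) * A i j ^ 2)) -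
          4 * k * w i * w j * M i * A i j + k * w j * s i j -
        2⁻¹ * (k * (k * w i * w j + 1) * (w i + w j) * s i j))
      + ∑ i, w i * (a / 2 + β - k * w i) ^ 2 := by
    simp only [Finset.sum_add_distrib, Finset.sum_sub_distrib, ← Finset.mul_sum]
    have e1 : ∀ i, (w i)⁻¹ * ((t i ^ 2 - 1) * (-2 * k * w i * ∑ j, w j / (t i - t j) +
          a * w i / 2 / (t i - 1) + w i * (β - k * w i) * t i / (t i ^ 2 - 1)) ^ 2
        - 2⁻¹ * (-2 * k * w i * ∑ j, w j * (4 * (t i * t j - 1) / (t i - t j) ^ 2) +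
          a * w i * (2 / (t i - 1)) + 4 * w i * (β - k * w i) / (t i ^ 2 - 1))) =
        4 * k ^ 2 * (∑ j, ∑ l, w i * w j * w l * ((t i ^ 2 - 1) * (A i j * A i l)))
        - ∑ j, 4 * k * w i * w j * M i * A i j + ∑ j, k * w j * s i j +
        (a / 2 * (a * w i / 2 - 1 + w i * (β - k * w i)) * (2 / (t i - 1)) +
          (β - k * w i) * (w i * (β - k * w i) - 2) / (t i ^ 2 - 1)) +
          w i * (a / 2 + β - k * w i) ^ 2 := by
      intro i
      have e2 : ∑ j, ∑ l, w i * w j * w l * ((t i ^ 2 - 1) * (A i j * A i l)) =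
          w i * (t i ^ 2 - 1) * ((∑ j, w j / (t i - t j)) * ∑ j, w j / (t i - t j)) := by
        rw [Finset.sum_mul_sum, Finset.mul_sum]
        refine Finset.sum_congr rfl fun j _ => ?_
        rw [Finset.mul_sum]
        exact Finset.sum_congr rfl fun l _ => by simp only [A]; ring
      have e3 : ∑ j, k * w j * s i j =
          k * ∑ j, w j * (4 * (t i * t j - 1) / (t i - t j) ^ 2) := by
        rw [Finset.mul_sum]
        exact Finset.sum_congr rfl fun l _ => by simp only [s]; ring
      have e4 : ∑ j, 4 * k * w i * w j * M i * A i j =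
          4 * k * w i * M i * ∑ j, w j / (t i - t j) := by
        rw [Finset.mul_sum]
        exact Finset.sum_congr rfl fun l _ => by simp only [A]; ring
      rw [e2, e3, e4]
      generalize ∑ j, w j / (t i - t j) = U
      generalize ∑ j, w j * (4 * (t i * t j - 1) / (t i - t j) ^ 2) = V
      have := hw0 i
      have h1 := ht1 i
      have h2 := ht2 i
      simp only [M]
      rw [show t i ^ 2 - 1 = (t i - 1) * (t i + 1) by ring]
      field_simp
      ring
    rw [Finset.sum_congr rfl fun i _ => e1 i]
    simp only [Finset.sum_add_distrib, Finset.sum_sub_distrib, ← Finset.mul_sum, s]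
    ring
  have hmem : ∀ i, a / 2 + β - k * w i ∈ S := fun i =>
    S.sub_mem (S.add_mem (S.div_mem ha (ofNat_mem S 2)) hβ) (S.mul_mem hk (hw i))
  rw [h1]
  refine S.add_mem (S.add_mem (S.mul_mem (S.mul_mem (ofNat_mem S 4) (S.pow_mem hk 2))
    (sum_sub_mem_of_cyclic S ?_)) (sum_mem_of_symm S ?_))
    (sum_mem fun i _ => S.mul_mem (hw i) (S.pow_mem (hmem i) 2))
  · intro i j l
    have h0 : ∀ i, A i i = 0 := fun i => by simp [A]
    have hswap : ∀ i j, A i j = -A j i := by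
      intro i j
      simp only [A]
      rw [← neg_sub, div_neg]
    have hc := S.mul_mem (S.mul_mem (hw i) (hw j)) (hw l)
    by_cases hij : i = j
    · subst hij
      convert S.zero_mem using 1
      by_cases hil : i = l
      · subst hil
        simp [h0]
      · rw [if_neg hil, if_neg (Ne.symm hil), if_pos rfl, h0]
        ring
    · by_cases hil : l = i
      · subst hil
        convert S.zero_mem using 1
        rw [if_neg (Ne.symm hij), if_pos rfl, if_neg hij, h0]
        ring
      · by_cases hjl : j = l
        · subst hjl
          convert S.zero_mem using 1
          rw [if_pos rfl, if_neg hil, if_neg hij, h0]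
          ring
        · rw [if_neg hjl, if_neg hil, if_neg hij]
          convert hc using 1
          have h1 : t i - t j ≠ 0 := sub_ne_zero.2 fun h' => hij (ht h')
          have h2 : t l - t i ≠ 0 := sub_ne_zero.2 fun h' => hil (ht h')
          have h3 : t j - t l ≠ 0 := sub_ne_zero.2 fun h' => hjl (ht h')
          rw [hswap i l, hswap j i, hswap l j]
          simp only [A]
          field_simp
          ring
  · intro i j
    by_cases hij : i = j
    · subst hij
      convert S.zero_mem using 1
      simp [A, s]
    · have h1 : t i - t j ≠ 0 := sub_ne_zero.2 fun h' => hij (ht h')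
      have h2 : t j - t i = -(t i - t j) := by ring
      -- The value of the symmetrised pair: all poles cancel, since the numerator over `t_i - t_j`
      -- is a constant multiple of `t_i - t_j`.
      have : 4 * k ^ 2 * w i * w j * (w i + w j) - 4 * k * w i * w j * (a / 2 + β) ∈ S :=
        S.sub_mem (S.mul_mem (S.mul_mem (S.mul_mem (S.mul_mem (ofNat_mem S 4) (S.pow_mem hk 2))
          (hw i)) (hw j)) (S.add_mem (hw i) (hw j)))
          (S.mul_mem (S.mul_mem (S.mul_mem (S.mul_mem (ofNat_mem S 4) hk) (hw i)) (hw j))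
            (S.add_mem (S.div_mem ha (ofNat_mem S 2)) hβ))
      convert this using 1
      simp only [A, s, M]
      rw [h2]
      field_simp
      ring

end identities

/-! ### Hyperbolic functions of the exponentials -/

section hyperbolic

variable {𝔽 : Type*} [Field 𝔽]

/-- `coth z` as a function of `x = e^{2z}`. -/
def cothRat (x : 𝔽) : 𝔽 := (x + 1) / (x - 1)

/-- `1 / sinh² z` as a function of `x = e^{2z}`. -/
def invSinhSqRat (x : 𝔽) : 𝔽 := 4 * x / (x - 1) ^ 2

theorem cothRat_one : cothRat (1 : 𝔽) = 0 := by simp [cothRat]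

theorem invSinhSqRat_one : invSinhSqRat (1 : 𝔽) = 0 := by simp [invSinhSqRat]

theorem cothRat_inv {x : 𝔽} (hx : x ≠ 0) : cothRat x⁻¹ = -cothRat x := by
  by_cases h : x = 1
  · simp [h, cothRat]
  · have h1 : x - 1 ≠ 0 := sub_ne_zero.2 h
    have h2 : 1 - x ≠ 0 := sub_ne_zero.2 (Ne.symm h)
    simp only [cothRat]
    rw [show x⁻¹ - 1 = (1 - x) / x by field_simp]
    field_simp
    ring

theorem invSinhSqRat_inv {x : 𝔽} (hx : x ≠ 0) : invSinhSqRat x⁻¹ = invSinhSqRat x := by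
  by_cases h : x = 1
  · simp [h]
  · have h1 : x - 1 ≠ 0 := sub_ne_zero.2 h
    have h2 : 1 - x ≠ 0 := sub_ne_zero.2 (Ne.symm h)
    simp only [invSinhSqRat]
    rw [show x⁻¹ - 1 = (1 - x) / x by field_simp]
    field_simp
    ring

theorem cothRat_div {x y : 𝔽} (hy : y ≠ 0) : cothRat (x / y) = (x + y) / (x - y) := by
  simp only [cothRat]
  rw [show x / y + 1 = (x + y) / y by field_simp, show x / y - 1 = (x - y) / y by field_simp,
    div_div_div_cancel_right₀ hy]

theorem invSinhSqRat_div {x y : 𝔽} (hy : y ≠ 0) :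
    invSinhSqRat (x / y) = 4 * x * y / (x - y) ^ 2 := by
  simp only [invSinhSqRat]
  rw [show x / y - 1 = (x - y) / y by field_simp]
  by_cases h : x - y = 0
  · simp [h]
  · field_simp

variable [CharZero 𝔽]

/-- `cosh 2z` as a function of `x = e^{2z}`. -/
def coshRat (x : 𝔽) : 𝔽 := (x + x⁻¹) / 2

/-- `sinh 2z` as a function of `x = e^{2z}`. -/
def sinhRat (x : 𝔽) : 𝔽 := (x - x⁻¹) / 2

theorem sinhRat_sq {x : 𝔽} (hx : x ≠ 0) : sinhRat x ^ 2 = coshRat x ^ 2 - 1 := by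
  simp only [sinhRat, coshRat]
  field_simp
  ring

theorem coshRat_sub_one {x : 𝔽} (hx : x ≠ 0) : coshRat x - 1 = (x - 1) ^ 2 / (2 * x) := by
  simp only [coshRat]
  field_simp
  ring

theorem coshRat_add_one {x : 𝔽} (hx : x ≠ 0) : coshRat x + 1 = (x + 1) ^ 2 / (2 * x) := by
  simp only [coshRat]
  field_simp
  ring

theorem coshRat_sub {x y : 𝔽} (hx : x ≠ 0) (hy : y ≠ 0) :
    coshRat x - coshRat y = (x - y) * (x * y - 1) / (2 * x * y) := by
  simp only [coshRat]
  field_simp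
  ring

theorem sinhRat_eq {x : 𝔽} (hx : x ≠ 0) : sinhRat x = (x - 1) * (x + 1) / (2 * x) := by
  simp only [sinhRat]
  field_simp
  ring

theorem cothRat_eq {x : 𝔽} (hx : x ≠ 0) (h1 : x - 1 ≠ 0) (h2 : x + 1 ≠ 0) :
    cothRat x = sinhRat x / (coshRat x - 1) := by
  rw [sinhRat_eq hx, coshRat_sub_one hx, cothRat]
  field_simp

theorem cothRat_sq_eq {x : 𝔽} (hx : x ≠ 0) (h1 : x - 1 ≠ 0) (h2 : x + 1 ≠ 0) :
    cothRat (x * x) = sinhRat x * coshRat x / (coshRat x ^ 2 - 1) := by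
  rw [show coshRat x ^ 2 - 1 = (coshRat x - 1) * (coshRat x + 1) by ring, sinhRat_eq hx,
    coshRat_sub_one hx, coshRat_add_one hx, cothRat, coshRat,
    show x * x - 1 = (x - 1) * (x + 1) by ring]
  field_simp

theorem invSinhSqRat_eq {x : 𝔽} (hx : x ≠ 0) (h1 : x - 1 ≠ 0) :
    invSinhSqRat x = 2 / (coshRat x - 1) := by
  rw [coshRat_sub_one hx, invSinhSqRat]
  field_simp
  ring

theorem invSinhSqRat_sq_eq {x : 𝔽} (hx : x ≠ 0) (h1 : x - 1 ≠ 0) (h2 : x + 1 ≠ 0) :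
    invSinhSqRat (x * x) = 1 / (coshRat x ^ 2 - 1) := by
  rw [show coshRat x ^ 2 - 1 = (coshRat x - 1) * (coshRat x + 1) by ring,
    coshRat_sub_one hx, coshRat_add_one hx, invSinhSqRat,
    show x * x - 1 = (x - 1) * (x + 1) by ring]
  field_simp
  ring

/-- This is why type `BC` becomes rational in `cosh 2z`: in the sum of the two cotangents the second
variable survives only through its `cosh`. -/
theorem cothRat_add_cothRat {x y : 𝔽} (hx : x ≠ 0) (hy : y ≠ 0) (h1 : x - y ≠ 0)
    (h2 : x * y - 1 ≠ 0) :
    cothRat (x / y) + cothRat (x * y) = 2 * sinhRat x * (1 / (coshRat x - coshRat y)) := by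
  rw [coshRat_sub hx hy, sinhRat_eq hx, cothRat_div hy, cothRat]
  field_simp
  ring

theorem invSinhSqRat_add_invSinhSqRat {x y : 𝔽} (hx : x ≠ 0) (hy : y ≠ 0) (h1 : x - y ≠ 0)
    (h2 : x * y - 1 ≠ 0) :
    invSinhSqRat (x / y) + invSinhSqRat (x * y) =
      4 * (coshRat x * coshRat y - 1) / (coshRat x - coshRat y) ^ 2 := by
  rw [coshRat_sub hx hy, invSinhSqRat_div hy, invSinhSqRat, coshRat, coshRat]
  field_simp
  ring

end hyperbolic

/-! ### The coordinate forms -/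

section forms

variable {ι : Type*} [Fintype ι] [DecidableEq ι]

/-- The `i`-th coordinate form. -/
abbrev coordForm (i : ι) : ι → ℂ := Pi.single i 1

theorem coordForm_sub_eq {a b i j : ι} (hab : a ≠ b)
    (h : coordForm i - coordForm j = coordForm a - coordForm b) : i = a ∧ j = b := by
  have h1 := congrFun h a
  have h2 := congrFun h b
  simp only [coordForm, Pi.sub_apply, Pi.single_apply, if_neg hab, if_neg hab.symm, if_true] at h1 h2
  constructor
  · by_contra hc
    rw [if_neg (Ne.symm hc)] at h1
    split_ifs at h1 <;> norm_num at h1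
  · by_contra hc
    rw [if_neg (Ne.symm hc)] at h2
    split_ifs at h2 <;> norm_num at h2

theorem coordForm_add_eq {a b i j : ι} (hab : a ≠ b)
    (h : coordForm i + coordForm j = coordForm a + coordForm b) :
    (i = a ∧ j = b) ∨ (i = b ∧ j = a) := by
  have h1 := congrFun h a
  have h2 := congrFun h b
  simp only [coordForm, Pi.add_apply, Pi.single_apply, if_neg hab, if_neg hab.symm, if_true] at h1 h2
  by_cases hi : a = i
  · subst hi
    left
    refine ⟨rfl, ?_⟩
    by_contra hc
    rw [if_neg hab.symm, if_neg (Ne.symm hc)] at h2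
    norm_num at h2
  · rw [if_neg hi] at h1
    by_cases hj : a = j
    · subst hj
      right
      refine ⟨?_, rfl⟩
      by_contra hc
      rw [if_neg hab.symm, if_neg (Ne.symm hc)] at h2
      norm_num at h2
    · rw [if_neg hj] at h1
      norm_num at h1

theorem sum_coordForm (i : ι) : ∑ k, coordForm i k = 1 := by simp [coordForm]

/-- The indicator function of `{v, -v}`. -/
def signIndicator (v c : ι → ℂ) : ℂ := open Classical in if c = v ∨ c = -v then 1 else 0

theorem signIndicator_neg (v c : ι → ℂ) : signIndicator v (-c) = signIndicator v c := by
  have h : (-c = v ∨ -c = -v) ↔ (c = v ∨ c = -v) := by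
    rw [neg_inj, neg_eq_iff_eq_neg, or_comm]
  simp only [signIndicator, h]

theorem signIndicator_of_sum {v c : ι → ℂ} (h1 : ∑ k, c k ≠ ∑ k, v k)
    (h2 : ∑ k, c k ≠ -∑ k, v k) : signIndicator v c = 0 := by
  rw [signIndicator, if_neg]
  rintro (rfl | rfl)
  · exact h1 rfl
  · exact h2 (by simp)

theorem signIndicator_zero {v : ι → ℂ} (hv : v ≠ 0) : signIndicator v 0 = 0 := by
  rw [signIndicator, if_neg]
  rintro (h | h)
  · exact hv h.symm
  · exact hv (neg_eq_zero.1 h.symm)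

theorem signIndicator_sub {b c : ι} (hbc : b ≠ c) (i j : ι) :
    signIndicator (coordForm b - coordForm c) (coordForm i - coordForm j) =
      (if i = b then if j = c then (1 : ℂ) else 0 else 0) +
        (if i = c then if j = b then (1 : ℂ) else 0 else 0) := by
  by_cases h1 : (i = b ∧ j = c) ∨ (i = c ∧ j = b)
  · rcases h1 with ⟨rfl, rfl⟩ | ⟨rfl, rfl⟩
    · simp [signIndicator, hbc]
    · simp [signIndicator, hbc.symm]
  · rw [signIndicator, if_neg]
    · push Not at h1
      by_cases hi : i = b
      · subst hi
        simp [h1.1 rfl, hbc]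
      · by_cases hi' : i = c
        · subst hi'
          simp [h1.2 rfl, hi]
        · simp [hi, hi']
    · rintro (h2 | h2)
      · exact h1 (Or.inl (coordForm_sub_eq hbc h2))
      · rw [neg_sub] at h2
        exact h1 (Or.inr (coordForm_sub_eq hbc.symm h2))

end forms

namespace LieSuperalgebra

/-! ### Passage to the field of fractions -/

section fraction

variable {g : Type} [AddCommGroup g] [Module ℂ g] {L : LieSuperalgebra g}
variable {ι : Type} [Fintype ι] {a : Submodule ℂ g} (e : Module.Basis ι ℂ a)

instance : CharZero (FractionRing (L.Loc e)) :=
  charZero_of_injective_algebraMap (algebraMap ℂ (FractionRing (L.Loc e))).injective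

variable (L) in
/-- The exponential `e^{2λ}`, `λ = ∑ c_i x_i`, in the field of fractions. -/
def expFrac (c : ι → ℂ) : FractionRing (L.Loc e) :=
  algebraMap (L.Loc e) _ (L.expLoc e fun k => 2 * c k)

theorem expFrac_add (c c' : ι → ℂ) : L.expFrac e (c + c') = L.expFrac e c * L.expFrac e c' := by
  rw [expFrac, expFrac, expFrac, ← map_mul, ← expLoc_add]
  congr 2
  ext k
  simp [mul_add]

theorem expFrac_zero : L.expFrac e 0 = 1 := by
  rw [expFrac]
  simp only [Pi.zero_apply, mul_zero]
  rw [show (fun _ : ι => (0 : ℂ)) = 0 from rfl, expLoc_zero, map_one]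

theorem expFrac_ne_zero (c : ι → ℂ) : L.expFrac e c ≠ 0 := by
  intro h
  have := expFrac_add (L := L) e c (-c)
  rw [add_neg_cancel, expFrac_zero, h, zero_mul] at this
  exact one_ne_zero this

theorem expFrac_neg (c : ι → ℂ) : L.expFrac e (-c) = (L.expFrac e c)⁻¹ := by
  refine eq_inv_of_mul_eq_one_left ?_
  rw [← expFrac_add, neg_add_cancel, expFrac_zero]

theorem expFrac_sub (c c' : ι → ℂ) : L.expFrac e (c - c') = L.expFrac e c / L.expFrac e c' := by
  rw [sub_eq_add_neg, expFrac_add, expFrac_neg, div_eq_mul_inv]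

theorem expFrac_eq_one {c : ι → ℂ} (h : L.expFrac e c = 1) : c = 0 := by
  have h1 := expLoc_eq_one (L := L) e (IsFractionRing.injective (L.Loc e) (FractionRing (L.Loc e))
    (h.trans (map_one _).symm))
  ext k
  simpa using congrFun h1 k

variable {e}

theorem algebraMap_cothLoc {c : ι → ℂ} (hc : IsUnit (L.expLoc e (fun k => 2 * c k) - 1)) :
    algebraMap _ (FractionRing (L.Loc e)) (L.cothLoc e c) = cothRat (L.expFrac e c) := by
  have h0 : L.expFrac e c - 1 ≠ 0 := by
    have := (hc.map (algebraMap _ (FractionRing (L.Loc e)))).ne_zero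
    rwa [map_sub, map_one] at this
  have h := congrArg (algebraMap _ (FractionRing (L.Loc e))) (Ring.inverse_mul_cancel _ hc)
  rw [cothRat, eq_div_iff h0, cothLoc]
  rw [map_mul, map_sub, map_one] at h
  change _ * (L.expFrac e c - 1) = 1 at h
  rw [map_mul, mul_assoc, h, map_add, map_one, mul_one, expFrac]

theorem algebraMap_invSinhSq {c : ι → ℂ} (hc : IsUnit (L.expLoc e (fun k => 2 * c k) - 1)) :
    algebraMap _ (FractionRing (L.Loc e)) (invSinhSq (L.expLoc e) c) =
      invSinhSqRat (L.expFrac e c) := by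
  have h0 : L.expFrac e c - 1 ≠ 0 := by
    have := (hc.map (algebraMap _ (FractionRing (L.Loc e)))).ne_zero
    rwa [map_sub, map_one] at this
  have h := congrArg (algebraMap _ (FractionRing (L.Loc e))) (invSinhSq_expLoc hc)
  rw [invSinhSqRat, eq_div_iff (pow_ne_zero 2 h0)]
  rw [map_mul, map_pow, map_sub, map_one, map_mul, map_ofNat] at h
  exact h

/-- The element for `c` is `-e^{2c}` times the element for `-c`. -/
theorem isUnit_expLoc_sub_one_neg {c : ι → ℂ}
    (hc : IsUnit (L.expLoc e (fun k => 2 * (-c) k) - 1)) :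
    IsUnit (L.expLoc e (fun k => 2 * c k) - 1) := by
  have h : L.expLoc e (fun k => 2 * c k) - 1 =
      -(L.expLoc e (fun k => 2 * c k) * (L.expLoc e (fun k => 2 * (-c) k) - 1)) := by
    have h1 := expLoc_neg_mul (L := L) e (fun k => 2 * c k)
    have h2 : (-fun k => 2 * c k) = fun k => 2 * (-c) k := by ext k; simp
    rw [h2] at h1
    linear_combination h1
  rw [h]
  exact ((isUnit_expLoc _).mul hc).neg

/-- A form on which the multiplicities do not vanish is a restricted root up to sign. -/
theorem isUnit_of_sum_ne_zero {P : Finset (Module.Dual ℂ a)} (hP : L.IsPositiveHalf a P)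
    {v : ι → ℂ} (h : ∑ α ∈ P, (L.multiplicity a α : ℂ) • signIndicator v (fun i => α (e i)) ≠ 0) :
    IsUnit (L.expLoc e (fun k => 2 * v k) - 1) := by
  obtain ⟨α, hα, h'⟩ := Finset.exists_ne_zero_of_sum_ne_zero h
  have hu := isUnit_expLoc_sub_one e (hP.1 α hα)
  rw [signIndicator] at h'
  split_ifs at h' with hv
  · rcases hv with hv | hv
    · rw [← hv]; exact hu
    · refine isUnit_expLoc_sub_one_neg ?_
      rw [← hv]; exact hu
  · exact absurd (smul_zero _) h'

variable (L e) in
/-- The function `λ ↦ λ_i coth(λ) / 2`. -/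
def cothTerm (i : ι) (c : ι → ℂ) : FractionRing (L.Loc e) :=
  (1 / 2 * c i) • cothRat (L.expFrac e c)

variable (L e) in
/-- The function `λ ↦ λ_i² / sinh²(λ)`. -/
def invSinhSqTerm (i : ι) (c : ι → ℂ) : FractionRing (L.Loc e) :=
  (c i * c i) • invSinhSqRat (L.expFrac e c)

theorem algebraMap_halfCothSum {P : Finset (Module.Dual ℂ a)} (hP : L.IsPositiveHalf a P) (i : ι) :
    algebraMap _ (FractionRing (L.Loc e)) (L.halfCothSum e P i) =
      ∑ α ∈ P, (L.multiplicity a α : ℂ) •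
        L.cothTerm e i (fun k => α (e k)) := by
  rw [halfCothSum, map_sum]
  refine Finset.sum_congr rfl fun α hα => ?_
  rw [cothTerm, map_mul, map_mul, map_intCast, algebraMap_cothLoc (isUnit_expLoc_sub_one e (hP.1 α hα)),
    ← IsScalarTower.algebraMap_apply, Algebra.smul_def, Algebra.smul_def, map_intCast]

theorem algebraMap_locDeriv_halfCothSum [DecidableEq ι] {P : Finset (Module.Dual ℂ a)}
    (hP : L.IsPositiveHalf a P) (i : ι) :
    algebraMap _ (FractionRing (L.Loc e)) (L.locDeriv e i (L.halfCothSum e P i)) =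
      -(2⁻¹ * ∑ α ∈ P, (L.multiplicity a α : ℂ) •
        L.invSinhSqTerm e i (fun k => α (e k))) := by
  rw [locDeriv_halfCothSum e hP, map_neg, map_sum, Finset.mul_sum]
  refine congrArg _ (Finset.sum_congr rfl fun α hα => ?_)
  rw [invSinhSqTerm, map_mul, map_mul, map_intCast, algebraMap_invSinhSq (isUnit_expLoc_sub_one e (hP.1 α hα)),
    ← IsScalarTower.algebraMap_apply, Algebra.smul_def, Algebra.smul_def, map_intCast, mul_assoc,
    map_mul _ (1 / 2)]
  simp only [one_div, map_inv₀, map_ofNat]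
  ring

end fraction

end LieSuperalgebra

/-! ### Sums over coordinates -/

section sums

variable {𝔽 ι : Type*} [Field 𝔽] [Algebra ℂ 𝔽] [Fintype ι] [DecidableEq ι]

theorem sum_coordForm_left (T : ι → ι → 𝔽) (i : ι) :
    ∑ a, ∑ b, algebraMap ℂ 𝔽 (coordForm a i) * T a b = ∑ b, T i b := by
  simp only [← Finset.mul_sum]
  rw [Finset.sum_eq_single i]
  · simp [coordForm]
  · intro b _ hb
    simp [coordForm, Ne.symm hb]
  · simp

theorem sum_coordForm_right (T : ι → ι → 𝔽) (i : ι) :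
    ∑ a, ∑ b, algebraMap ℂ 𝔽 (coordForm b i) * T a b = ∑ a, T a i := by
  rw [Finset.sum_comm]
  exact sum_coordForm_left (fun b a => T a b) i

theorem sum_coordForm_mul (T : ι → 𝔽) (i : ι) :
    ∑ a, algebraMap ℂ 𝔽 (coordForm a i) * T a = T i := by
  rw [Finset.sum_eq_single i]
  · simp [coordForm]
  · intro b _ hb
    simp [coordForm, Ne.symm hb]
  · simp

theorem sum_Ioi_eq {n : ℕ} {M : Type*} [AddCommGroup M] [Module ℂ M] (f : Fin n → Fin n → M)
    (hf : ∀ i j, f i j = f j i) (h0 : ∀ i, f i i = 0) :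
    ∑ i, ∑ j ∈ Finset.Ioi i, f i j = (2⁻¹ : ℂ) • ∑ i, ∑ j, f i j := by
  have h1 : ∀ i, ∑ j, f i j = ∑ j ∈ Finset.Ioi i, f i j + ∑ j ∈ Finset.Iio i, f i j := by
    intro i
    rw [← Finset.sum_union]
    · symm
      refine Finset.sum_subset (Finset.subset_univ _) fun j _ hj => ?_
      rw [show j = i from by
        simp only [Finset.mem_union, Finset.mem_Ioi, Finset.mem_Iio, not_or, not_lt] at hj
        exact le_antisymm hj.1 hj.2, h0]
    · rw [Finset.disjoint_left]
      intro j hj hj'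
      exact lt_asymm (Finset.mem_Ioi.1 hj) (Finset.mem_Iio.1 hj')
  have h2 : ∑ i, ∑ j ∈ Finset.Iio i, f i j = ∑ i, ∑ j ∈ Finset.Ioi i, f i j := by
    rw [Finset.sum_comm' (t' := Finset.univ) (s' := fun j => Finset.Ioi j) (by simp)]
    exact Finset.sum_congr rfl fun i _ => Finset.sum_congr rfl fun j _ => hf j i
  rw [Finset.sum_congr rfl fun i _ => h1 i, Finset.sum_add_distrib, h2, ← two_smul ℂ, smul_smul]
  norm_num

end sums

namespace LieSuperalgebra

/-! ### Root sums of types A and BC -/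

section types

variable {g : Type} [AddCommGroup g] [Module ℂ g] {L : LieSuperalgebra g}
variable {ι : Type} [Fintype ι] [DecidableEq ι] {a : Submodule ℂ g} (e : Module.Basis ι ℂ a)

variable (L) in
/-- The sums over positive restricted roots for a deformed root system of type `A`. -/
def IsRootSumA (P : Finset (Module.Dual ℂ a)) (k : ℂ) (w : ι → ℂ) : Prop :=
  ∀ (V : Type) [AddCommGroup V] [Module ℂ V] (F : (ι → ℂ) → V), (∀ c, F (-c) = F c) → F 0 = 0 →
    ∑ α ∈ P, (L.multiplicity a α : ℂ) • F (fun i => α (e i)) =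
      ∑ i, ∑ j, (-k * w i * w j) • F (coordForm i - coordForm j)

variable (L) in
/-- The sums over positive restricted roots for a deformed root system of type `BC`. -/
def IsRootSumBC (P : Finset (Module.Dual ℂ a)) (k a₀ β : ℂ) (w : ι → ℂ) : Prop :=
  ∀ (V : Type) [AddCommGroup V] [Module ℂ V] (F : (ι → ℂ) → V), (∀ c, F (-c) = F c) → F 0 = 0 →
    ∑ α ∈ P, (L.multiplicity a α : ℂ) • F (fun i => α (e i)) =
      ∑ i, ∑ j, (-k * w i * w j) • (F (coordForm i - coordForm j) + F (coordForm i + coordForm j)) +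
      ∑ i, ((a₀ * w i) • F (coordForm i) + (β * w i) • F (coordForm i + coordForm i))

variable {e} {P : Finset (Module.Dual ℂ a)}

theorem cothTerm_neg (i : ι) (c : ι → ℂ) : L.cothTerm e i (-c) = L.cothTerm e i c := by
  rw [cothTerm, cothTerm, expFrac_neg, cothRat_inv (expFrac_ne_zero e c), Algebra.smul_def,
    Algebra.smul_def, Pi.neg_apply, mul_neg (1 / 2 : ℂ), map_neg]
  ring

theorem cothTerm_zero (i : ι) : L.cothTerm e i 0 = 0 := by simp [cothTerm]

theorem invSinhSqTerm_neg (i : ι) (c : ι → ℂ) :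
    L.invSinhSqTerm e i (-c) = L.invSinhSqTerm e i c := by
  rw [invSinhSqTerm, invSinhSqTerm, expFrac_neg, invSinhSqRat_inv (expFrac_ne_zero e c),
    Pi.neg_apply, neg_mul_neg]

theorem invSinhSqTerm_zero (i : ι) : L.invSinhSqTerm e i 0 = 0 := by simp [invSinhSqTerm]

theorem coordForm_ne_neg {i j : ι} : coordForm i ≠ -coordForm j := by
  intro h
  have := congrArg (fun c : ι → ℂ => ∑ k, c k) h
  simp only [Pi.neg_apply, Finset.sum_neg_distrib, sum_coordForm] at this
  norm_num at this

theorem expFrac_coordForm_injective :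
    Function.Injective fun i => L.expFrac e (coordForm i) := by
  intro i j hij
  have h : L.expFrac e (coordForm i - coordForm j) = 1 := by
    rw [expFrac_sub, div_eq_one_iff_eq (expFrac_ne_zero e _)]
    exact hij
  have h2 := congrFun (sub_eq_zero.1 (expFrac_eq_one e h)) i
  by_contra hne
  simp [coordForm, hne] at h2

theorem expFrac_mul_ne_one (i j : ι) :
    L.expFrac e (coordForm i) * L.expFrac e (coordForm j) - 1 ≠ 0 := by
  intro h
  rw [← expFrac_add] at h
  exact coordForm_ne_neg (eq_neg_of_add_eq_zero_left (expFrac_eq_one e (sub_eq_zero.1 h)))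

/-- Apply the root sum to the even function `λ ↦ λ_i coth(λ) / 2`. Its coefficient on `x_a - x_b` is
`δ_ai - δ_bi`, and since `coth` is odd the two halves contribute equally. -/
theorem IsRootSumA.halfCothSum (hP : L.IsPositiveHalf a P) {k : ℂ} {w : ι → ℂ}
    (h : L.IsRootSumA e P k w) (i : ι) :
    algebraMap _ (FractionRing (L.Loc e)) (L.halfCothSum e P i) =
      -algebraMap ℂ _ k * algebraMap ℂ _ (w i) * ∑ j, algebraMap ℂ _ (w j) *
        ((L.expFrac e (coordForm i) + L.expFrac e (coordForm j)) /
          (L.expFrac e (coordForm i) - L.expFrac e (coordForm j))) := by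
  rw [algebraMap_halfCothSum hP, h _ _ (cothTerm_neg i) (cothTerm_zero i)]
  let T : ι → ι → FractionRing (L.Loc e) := fun x y =>
    -algebraMap ℂ _ k * algebraMap ℂ _ (w x) * algebraMap ℂ _ (w y) *
      ((L.expFrac e (coordForm x) + L.expFrac e (coordForm y)) /
        (L.expFrac e (coordForm x) - L.expFrac e (coordForm y)))
  have hT : ∀ x y, T x y = -T y x := by
    intro x y
    simp only [T]
    rw [← neg_sub (L.expFrac e (coordForm y)), div_neg]
    ring
  have e1 : ∀ x y : ι, (-k * w x * w y) • L.cothTerm e i (coordForm x - coordForm y) =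
      2⁻¹ * (algebraMap ℂ _ (coordForm x i) * T x y - algebraMap ℂ _ (coordForm y i) * T x y) := by
    intro x y
    rw [cothTerm, expFrac_sub, cothRat_div (expFrac_ne_zero e _), Algebra.smul_def, Algebra.smul_def,
      Pi.sub_apply]
    simp only [map_mul, map_sub, map_neg, one_div, map_inv₀, map_ofNat, T]
    ring
  simp only [e1, ← Finset.mul_sum, Finset.sum_sub_distrib]
  have e2 : ∑ j, T i j = -algebraMap ℂ _ k * algebraMap ℂ _ (w i) * ∑ j, algebraMap ℂ _ (w j) *
        ((L.expFrac e (coordForm i) + L.expFrac e (coordForm j)) /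
          (L.expFrac e (coordForm i) - L.expFrac e (coordForm j))) := by
    rw [Finset.mul_sum]
    exact Finset.sum_congr rfl fun j _ => by simp only [T]; ring
  rw [sum_coordForm_mul (fun x => ∑ j, T x j), sum_coordForm_right,
    Finset.sum_congr rfl fun x _ => hT x i, Finset.sum_neg_distrib, sub_neg_eq_add, ← two_mul,
    inv_mul_cancel_left₀ two_ne_zero, e2]

theorem IsRootSumA.locDeriv_halfCothSum (hP : L.IsPositiveHalf a P) {k : ℂ} {w : ι → ℂ}
    (h : L.IsRootSumA e P k w) (i : ι) :
    algebraMap _ (FractionRing (L.Loc e)) (L.locDeriv e i (L.halfCothSum e P i)) =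
      -(2⁻¹ * (-2 * algebraMap ℂ _ k * algebraMap ℂ _ (w i) * ∑ j, algebraMap ℂ _ (w j) *
        (4 * L.expFrac e (coordForm i) * L.expFrac e (coordForm j) /
          (L.expFrac e (coordForm i) - L.expFrac e (coordForm j)) ^ 2))) := by
  rw [algebraMap_locDeriv_halfCothSum hP, h _ _ (invSinhSqTerm_neg i) (invSinhSqTerm_zero i)]
  congr 2
  let T : ι → ι → FractionRing (L.Loc e) := fun x y =>
    -algebraMap ℂ _ k * algebraMap ℂ _ (w x) * algebraMap ℂ _ (w y) *
      (4 * L.expFrac e (coordForm x) * L.expFrac e (coordForm y) /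
        (L.expFrac e (coordForm x) - L.expFrac e (coordForm y)) ^ 2)
  have hT : ∀ x y, T x y = T y x := by
    intro x y
    simp only [T]
    rw [← neg_sub (L.expFrac e (coordForm y)), neg_sq]
    ring
  have e1 : ∀ x y : ι, (-k * w x * w y) • L.invSinhSqTerm e i (coordForm x - coordForm y) =
      algebraMap ℂ _ (coordForm x i) * T x y + algebraMap ℂ _ (coordForm y i) * T x y := by
    intro x y
    rw [invSinhSqTerm]
    by_cases hxy : x = y
    · subst hxy
      simp [T]
    · have : (coordForm x - coordForm y : ι → ℂ) i * (coordForm x - coordForm y : ι → ℂ) i =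
          coordForm x i + coordForm y i := by
        simp only [coordForm, Pi.sub_apply, Pi.single_apply]
        split_ifs with h1 h2
        · exact absurd (h1.symm.trans h2) hxy
        all_goals norm_num
      rw [expFrac_sub, invSinhSqRat_div (expFrac_ne_zero e _), Algebra.smul_def, Algebra.smul_def,
        this]
      simp only [map_mul, map_add, map_neg, T]
      ring
  simp only [e1, Finset.sum_add_distrib]
  rw [sum_coordForm_left, sum_coordForm_right, Finset.sum_congr rfl fun x _ => hT x i,
    Finset.mul_sum, ← two_mul, Finset.mul_sum]
  refine Finset.sum_congr rfl fun x _ => ?_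
  simp only [T]
  ring

/-- The difference `x_b - x_c` is a restricted root. -/
theorem IsRootSumA.isUnit (hP : L.IsPositiveHalf a P) {k : ℂ} (hk : k ≠ 0) {w : ι → ℂ}
    (hw : ∀ i, w i ≠ 0) (h : L.IsRootSumA e P k w) {b c : ι} (hbc : b ≠ c) :
    IsUnit (L.expLoc e (fun i => 2 * (coordForm b - coordForm c : ι → ℂ) i) - 1) := by
  refine isUnit_of_sum_ne_zero hP ?_
  have hv : (coordForm b - coordForm c : ι → ℂ) ≠ 0 := by
    intro h0
    have := congrFun h0 b
    simp [coordForm, hbc] at this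
  -- With the indicator of `±(x_b - x_c)` as test function, the root sum evaluates to `-2 k w_b
  -- w_c`. As this is not zero, one of the positive roots must be `±(x_b - x_c)`.
  rw [h _ _ (signIndicator_neg _) (signIndicator_zero hv)]
  simp only [signIndicator_sub hbc, smul_eq_mul, mul_add, Finset.sum_add_distrib, mul_ite, mul_one, mul_zero]
  simp only [Finset.sum_ite_eq', Finset.sum_const_zero, Finset.mem_univ, if_true,
    Finset.sum_ite_irrel]
  intro h0
  have : -(2 * (k * (w b * w c))) = 0 := by linear_combination h0
  simp [hk, hw] at this

theorem gram_diag {B : LinearMap.BilinForm ℂ g} {w : ι → ℂ}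
    (hw : ∀ i, w i ≠ 0) (hB : ∀ i j, B (e i : g) (e j : g) = if i = j then w i else 0) (i j : ι) :
    invGram e B i j = if i = j then (w i)⁻¹ else 0 := by
  have h1 : (Matrix.of fun i j => B (e i : g) (e j : g)) = Matrix.diagonal w := by
    ext i j
    simp [hB, Matrix.diagonal_apply]
  rw [invGram, h1, Matrix.inv_eq_left_inv (B := Matrix.diagonal fun i => (w i)⁻¹)]
  · simp [Matrix.diagonal_apply]
  · rw [Matrix.diagonal_mul_diagonal, ← Matrix.diagonal_one]
    congr 1
    ext i
    exact inv_mul_cancel₀ (hw i)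

/-- The localisation embeds in its field of fractions over the complex numbers, so an equality up to
a constant checked there descends. -/
theorem exists_constant_of_mem {x y : L.Loc e}
    (h : algebraMap _ (FractionRing (L.Loc e)) y - algebraMap _ (FractionRing (L.Loc e)) x ∈
      (algebraMap ℂ (FractionRing (L.Loc e))).fieldRange) :
    ∃ c : ℂ, x + algebraMap ℂ _ c = y := by
  obtain ⟨c, hc⟩ := h
  refine ⟨c, IsFractionRing.injective (L.Loc e) (FractionRing (L.Loc e)) ?_⟩
  rw [map_add, ← IsScalarTower.algebraMap_apply, hc]
  ring

end types

end LieSuperalgebra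

namespace LieSuperalgebra

/-! ### The potential of type A -/

section typeA

variable {g : Type} [AddCommGroup g] [Module ℂ g] {L : LieSuperalgebra g} {n m : ℕ}
variable {a : Submodule ℂ g} {e : Module.Basis (Fin n ⊕ Fin m) ℂ a} {P : Finset (Module.Dual ℂ a)}

/-- The squared lengths of the coordinate vectors. -/
def cmsWeight (k : ℂ) : Fin n ⊕ Fin m → ℂ := Sum.elim (fun _ => 1) (fun _ => k⁻¹)

theorem cmsWeight_ne_zero {k : ℂ} (hk : k ≠ 0) (i : Fin n ⊕ Fin m) : cmsWeight k i ≠ 0 := by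
  rcases i with i | i <;> simp [cmsWeight, hk]

theorem sum_invGram_mul {k : ℂ} (hk : k ≠ 0) {B : LinearMap.BilinForm ℂ g}
    (hB : ∀ i j, B (e i : g) (e j : g) = if i = j then cmsWeight k i else 0)
    {M : Type*} [CommRing M] [Algebra ℂ M] (i : Fin n ⊕ Fin m) (f : Fin n ⊕ Fin m → M) :
    ∑ j, algebraMap ℂ M (invGram e B i j) * f j = algebraMap ℂ M (cmsWeight k i)⁻¹ * f i := by
  rw [Finset.sum_eq_single i]
  · rw [gram_diag (cmsWeight_ne_zero hk) hB, if_pos rfl]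
  · intro j _ hj
    rw [gram_diag (cmsWeight_ne_zero hk) hB, if_neg (Ne.symm hj), map_zero, zero_mul]
  · simp

theorem invGram_symm {k : ℂ} (hk : k ≠ 0) {B : LinearMap.BilinForm ℂ g}
    (hB : ∀ i j, B (e i : g) (e j : g) = if i = j then cmsWeight k i else 0)
    (i j : Fin n ⊕ Fin m) : invGram e B i j = invGram e B j i := by
  rw [gram_diag (cmsWeight_ne_zero hk) hB, gram_diag (cmsWeight_ne_zero hk) hB]
  by_cases h : i = j
  · subst h; rfl
  · rw [if_neg h, if_neg (Ne.symm h)]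

theorem cms_c₂_eq {k : ℂ} (hk : k ≠ 0) {B : LinearMap.BilinForm ℂ g}
    (hB : ∀ i j, B (e i : g) (e j : g) = if i = j then cmsWeight k i else 0)
    {M : Type*} [CommRing M] [Algebra ℂ M] (i j : Fin n ⊕ Fin m) :
    (if i = j then algebraMap ℂ M (Sum.elim (fun _ => -1) (fun _ => -k) i) else 0) =
      -algebraMap ℂ M (invGram e B i j) := by
  rw [gram_diag (cmsWeight_ne_zero hk) hB]
  split_ifs
  · rcases i with i | i <;> simp [cmsWeight]
  · simp

/-- Invertibility is demanded only when the coefficient is nonzero: a linear form with vanishing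
coefficient need not be a restricted root. -/
theorem algebraMap_smul_invSinhSq {c : Fin n ⊕ Fin m → ℂ} {x : ℂ}
    (hc : x ≠ 0 → IsUnit (L.expLoc e (fun k => 2 * c k) - 1)) :
    algebraMap _ (FractionRing (L.Loc e)) (x • invSinhSq (L.expLoc e) c) =
      algebraMap ℂ _ x * invSinhSqRat (L.expFrac e c) := by
  by_cases hx : x = 0
  · simp [hx]
  · rw [Algebra.smul_def, map_mul, ← IsScalarTower.algebraMap_apply, algebraMap_invSinhSq (hc hx)]

/-- Sums over pairs of coordinates with the coefficients of the deformed CMS operators. -/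
theorem sum_pairs_eq {n m : ℕ} {𝔽 : Type*} [Field 𝔽] [Algebra ℂ 𝔽] {k : ℂ} (hk : k ≠ 0)
    {s : Fin n ⊕ Fin m → Fin n ⊕ Fin m → 𝔽} (hs : ∀ i j, s i j = s j i) (hs0 : ∀ i, s i i = 0) :
    ∑ i : Fin n, ∑ j ∈ Finset.Ioi i, algebraMap ℂ _ (2 * k * (k + 1)) *
        s (Sum.inl i) (Sum.inl j) +
      ∑ i : Fin m, ∑ j ∈ Finset.Ioi i, algebraMap ℂ _ (2 * (k⁻¹ + 1)) *
        s (Sum.inr i) (Sum.inr j) +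
      ∑ i : Fin n, ∑ j : Fin m, algebraMap ℂ _ (2 * (k + 1)) * s (Sum.inl i) (Sum.inr j) =
    2⁻¹ * ∑ i, ∑ j, algebraMap ℂ _ k * (algebraMap ℂ _ k * algebraMap ℂ _ (cmsWeight k i) *
        algebraMap ℂ _ (cmsWeight k j) + 1) *
        (algebraMap ℂ _ (cmsWeight k i) + algebraMap ℂ _ (cmsWeight k j)) * s i j := by
  have h2 : (2 : 𝔽) ≠ 0 := by
    rw [← map_ofNat (algebraMap ℂ 𝔽) 2, Ne, map_eq_zero]
    norm_num
  have hkk : algebraMap ℂ 𝔽 k ≠ 0 := by simpa using hk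
  rw [sum_Ioi_eq _ (fun i j => by rw [hs]) (fun i => by rw [hs0, mul_zero]),
    sum_Ioi_eq _ (fun i j => by rw [hs]) (fun i => by rw [hs0, mul_zero])]
  have hyx : ∑ i : Fin m, ∑ j : Fin n, algebraMap ℂ _ (2 * (k + 1)) * s (Sum.inr i) (Sum.inl j) =
      ∑ i : Fin n, ∑ j : Fin m, algebraMap ℂ _ (2 * (k + 1)) * s (Sum.inl i) (Sum.inr j) := by
    rw [Finset.sum_comm]
    exact Finset.sum_congr rfl fun i _ => Finset.sum_congr rfl fun j _ => by rw [hs]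
  -- The single coefficient `k (k w_i w_j + 1)(w_i + w_j)` equals `2k(k+1)`, `2(k⁻¹+1)` and `2(k+1)`
  -- on pairs of type `xx`, `yy` and `xy`. The prefactor one half accounts for each pair occurring
  -- in both orders.
  have hall : ∑ i, ∑ j, algebraMap ℂ _ k * (algebraMap ℂ _ k * algebraMap ℂ _ (cmsWeight k i) *
        algebraMap ℂ _ (cmsWeight k j) + 1) *
        (algebraMap ℂ _ (cmsWeight k i) + algebraMap ℂ _ (cmsWeight k j)) * s i j =
      ∑ i : Fin n, ∑ j : Fin n, algebraMap ℂ _ (2 * k * (k + 1)) * s (Sum.inl i) (Sum.inl j) +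
      ∑ i : Fin n, ∑ j : Fin m, algebraMap ℂ _ (2 * (k + 1)) * s (Sum.inl i) (Sum.inr j) +
      (∑ i : Fin m, ∑ j : Fin n, algebraMap ℂ _ (2 * (k + 1)) * s (Sum.inr i) (Sum.inl j) +
      ∑ i : Fin m, ∑ j : Fin m, algebraMap ℂ _ (2 * (k⁻¹ + 1)) *
        s (Sum.inr i) (Sum.inr j)) := by
    simp only [Fintype.sum_sum_type, ← Finset.sum_add_distrib, cmsWeight, Sum.elim_inl,
      Sum.elim_inr, map_mul, map_add, map_one, map_ofNat, map_inv₀]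
    congr 1
    · refine Finset.sum_congr rfl fun i _ => ?_
      congr 1
      · exact Finset.sum_congr rfl fun j _ => by ring
      · exact Finset.sum_congr rfl fun j _ => by field_simp; ring
    · refine Finset.sum_congr rfl fun i _ => ?_
      congr 1
      · exact Finset.sum_congr rfl fun j _ => by field_simp; ring
      · exact Finset.sum_congr rfl fun j _ => by field_simp; ring
  rw [hall, hyx]
  simp only [Algebra.smul_def, map_inv₀, map_ofNat]
  field_simp
  ring

theorem IsRootSumA.algebraMap_c₀ (hP : L.IsPositiveHalf a P) {k : ℂ} (hk : k ≠ 0)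
    (h : L.IsRootSumA e P k (cmsWeight k)) :
    algebraMap _ (FractionRing (L.Loc e)) (cmsA n m k (L.expLoc e)).c₀ =
      2⁻¹ * ∑ i, ∑ j, algebraMap ℂ _ k * (algebraMap ℂ _ k * algebraMap ℂ _ (cmsWeight k i) *
        algebraMap ℂ _ (cmsWeight k j) + 1) *
        (algebraMap ℂ _ (cmsWeight k i) + algebraMap ℂ _ (cmsWeight k j)) *
        (4 * L.expFrac e (coordForm i) * L.expFrac e (coordForm j) /
          (L.expFrac e (coordForm i) - L.expFrac e (coordForm j)) ^ 2) := by
  have hw := cmsWeight_ne_zero (n := n) (m := m) hk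
  let s : Fin n ⊕ Fin m → Fin n ⊕ Fin m → FractionRing (L.Loc e) := fun i j =>
    4 * L.expFrac e (coordForm i) * L.expFrac e (coordForm j) /
      (L.expFrac e (coordForm i) - L.expFrac e (coordForm j)) ^ 2
  have hs : ∀ i j, s i j = s j i := by
    intro i j
    simp only [s]
    rw [← neg_sub (L.expFrac e (coordForm j)), neg_sq]
    ring
  have hs0 : ∀ i, s i i = 0 := fun i => by simp [s]
  have hterm : ∀ (i j : Fin n ⊕ Fin m) (x : ℂ), i ≠ j → algebraMap _ (FractionRing (L.Loc e))
      (x • invSinhSq (L.expLoc e) (coordForm i - coordForm j)) = algebraMap ℂ _ x * s i j := by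
    intro i j x hij
    rw [algebraMap_smul_invSinhSq fun _ => h.isUnit hP hk hw hij, expFrac_sub,
      invSinhSqRat_div (expFrac_ne_zero e _)]
  have hc : algebraMap _ (FractionRing (L.Loc e)) (cmsA n m k (L.expLoc e)).c₀ =
      ∑ i : Fin n, ∑ j ∈ Finset.Ioi i, algebraMap ℂ _ (2 * k * (k + 1)) *
        s (Sum.inl i) (Sum.inl j) +
      ∑ i : Fin m, ∑ j ∈ Finset.Ioi i, algebraMap ℂ _ (2 * (k⁻¹ + 1)) *
        s (Sum.inr i) (Sum.inr j) +
      ∑ i : Fin n, ∑ j : Fin m, algebraMap ℂ _ (2 * (k + 1)) * s (Sum.inl i) (Sum.inr j) := by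
    change algebraMap _ _ (_ + _ + _) = _
    simp only [map_add, map_sum]
    congr 1
    · congr 1
      · refine Finset.sum_congr rfl fun i _ => Finset.sum_congr rfl fun j hj => ?_
        exact hterm _ _ _ fun hij => (Finset.mem_Ioi.1 hj).ne (Sum.inl_injective hij)
      · refine Finset.sum_congr rfl fun i _ => Finset.sum_congr rfl fun j hj => ?_
        exact hterm _ _ _ fun hij => (Finset.mem_Ioi.1 hj).ne (Sum.inr_injective hij)
    · refine Finset.sum_congr rfl fun i _ => Finset.sum_congr rfl fun j hj => ?_
      exact hterm _ _ _ Sum.inl_ne_inr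
  rw [hc, sum_pairs_eq hk hs hs0]

/-- The inverse Gram matrix is diagonal with entries `w_i⁻¹`, so the potential to be compared is
exactly the sum treated in `sum_typeA_sub_mem`, over the subfield of complex constants. -/
theorem IsRootSumA.isConjugate (hP : L.IsPositiveHalf a P) {k : ℂ} (hk : k ≠ 0)
    (h : L.IsRootSumA e P k (cmsWeight k)) {B : LinearMap.BilinForm ℂ g}
    (hB : ∀ i j, B (e i : g) (e j : g) = if i = j then cmsWeight k i else 0) :
    IsConjugate (L.locDeriv e) (L.radialPart e B P) (cmsA n m k (L.expLoc e))
      (∏ α ∈ P, (L.expLoc e (fun i => α (e i)) - L.expLoc e (fun i => -α (e i))) ^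
        L.rootDim a 0 α)
      (∏ α ∈ P, (L.expLoc e (fun i => α (e i)) - L.expLoc e (fun i => -α (e i))) ^
        L.rootDim a 1 α) := by
  obtain ⟨c, hc⟩ : ∃ c : ℂ, (cmsA n m k (L.expLoc e)).c₀ + algebraMap ℂ _ c =
      ∑ i, ∑ j, algebraMap ℂ _ (invGram e B i j) * (L.locDeriv e i (L.halfCothSum e P j) +
        L.halfCothSum e P i * L.halfCothSum e P j) := by
    refine exists_constant_of_mem ?_
    rw [h.algebraMap_c₀ hP hk]
    have key := sum_typeA_sub_mem (algebraMap ℂ (FractionRing (L.Loc e))).fieldRange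
      (w := fun i => algebraMap ℂ _ (cmsWeight k i)) (k := algebraMap ℂ _ k)
      (X := fun i => L.expFrac e (coordForm i)) ⟨k, rfl⟩ (fun i => ⟨_, rfl⟩)
      (fun i => by simpa using cmsWeight_ne_zero hk i) expFrac_coordForm_injective
    convert key using 2
    rw [map_sum]
    refine Finset.sum_congr rfl fun i _ => ?_
    rw [sum_invGram_mul hk hB, map_mul, ← IsScalarTower.algebraMap_apply, map_add, map_mul,
      h.locDeriv_halfCothSum hP, h.halfCothSum hP, map_inv₀]
    ring
  exact isConjugate_radialPart e hP B (invGram_symm hk hB) (cms_c₂_eq hk hB) (fun i => rfl) c hc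

end typeA

end LieSuperalgebra

namespace LieSuperalgebra

/-! ### The radial part of type A in exponential coordinates -/

section typeA

variable {g : Type} [AddCommGroup g] [Module ℂ g] {L : LieSuperalgebra g} {n m : ℕ}
variable {a : Submodule ℂ g} {e : Module.Basis (Fin n ⊕ Fin m) ℂ a} {P : Finset (Module.Dual ℂ a)}

theorem expFrac_eq_smul (c : Fin n ⊕ Fin m → ℂ) :
    L.expFrac e c = algebraMap _ _ (L.expLoc e ((2 : ℂ) • c)) := rfl

variable (L e) in
/-- The function `coth (z_i - z_j)` in the exponential coordinates. -/
def expRatio (i j : Fin n ⊕ Fin m) : L.Loc e :=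
  (L.expLoc e ((2 : ℂ) • coordForm i) + L.expLoc e ((2 : ℂ) • coordForm j)) *
    Ring.inverse (L.expLoc e ((2 : ℂ) • coordForm i) - L.expLoc e ((2 : ℂ) • coordForm j))

theorem expRatio_self (i : Fin n ⊕ Fin m) : L.expRatio e i i = 0 := by
  simp [expRatio]

theorem IsRootSumA.algebraMap_expRatio (hP : L.IsPositiveHalf a P) {k : ℂ} (hk : k ≠ 0)
    (h : L.IsRootSumA e P k (cmsWeight k)) (i j : Fin n ⊕ Fin m) :
    algebraMap _ (FractionRing (L.Loc e)) (L.expRatio e i j) =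
      (L.expFrac e (coordForm i) + L.expFrac e (coordForm j)) /
          (L.expFrac e (coordForm i) - L.expFrac e (coordForm j)) := by
  by_cases hij : i = j
  · subst hij
    simp [expRatio_self]
  have hu : IsUnit (L.expLoc e ((2 : ℂ) • coordForm i) - L.expLoc e ((2 : ℂ) • coordForm j)) := by
    have h1 := h.isUnit hP hk (cmsWeight_ne_zero hk) hij
    have h2 : L.expLoc e ((2 : ℂ) • coordForm i) - L.expLoc e ((2 : ℂ) • coordForm j) =
        L.expLoc e ((2 : ℂ) • coordForm j) *
          (L.expLoc e (fun x => 2 * (coordForm i - coordForm j : Fin n ⊕ Fin m → ℂ) x) - 1) := by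
      rw [mul_sub, ← expLoc_add, mul_one]
      congr 2
      ext x
      simp
      ring
    rw [h2]
    exact (isUnit_expLoc _).mul h1
  have hi := congrArg (algebraMap _ (FractionRing (L.Loc e))) (Ring.inverse_mul_cancel _ hu)
  have h0 : L.expFrac e (coordForm i) - L.expFrac e (coordForm j) ≠ 0 :=
    sub_ne_zero.2 fun h' => hij (expFrac_coordForm_injective h')
  rw [eq_div_iff h0, expRatio, map_mul, mul_assoc, expFrac_eq_smul, expFrac_eq_smul, ← map_sub,
    ← map_mul, Ring.inverse_mul_cancel _ hu, map_one, mul_one, map_add]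

theorem IsRootSumA.expRatio_swap (hP : L.IsPositiveHalf a P) {k : ℂ} (hk : k ≠ 0)
    (h : L.IsRootSumA e P k (cmsWeight k)) (i j : Fin n ⊕ Fin m) :
    L.expRatio e i j = -L.expRatio e j i := by
  refine IsFractionRing.injective (L.Loc e) (FractionRing (L.Loc e)) ?_
  rw [map_neg, h.algebraMap_expRatio hP hk, h.algebraMap_expRatio hP hk,
    ← neg_sub (L.expFrac e (coordForm j)), div_neg, add_comm]

theorem IsRootSumA.halfCothSum_eq (hP : L.IsPositiveHalf a P) {k : ℂ} (hk : k ≠ 0)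
    (h : L.IsRootSumA e P k (cmsWeight k)) (i : Fin n ⊕ Fin m) :
    L.halfCothSum e P i = ∑ j, (-k * cmsWeight k i * cmsWeight k j) • L.expRatio e i j := by
  refine IsFractionRing.injective (L.Loc e) (FractionRing (L.Loc e)) ?_
  rw [h.halfCothSum hP, map_sum, Finset.mul_sum]
  refine Finset.sum_congr rfl fun j _ => ?_
  rw [Algebra.smul_def, map_mul, ← IsScalarTower.algebraMap_apply, h.algebraMap_expRatio hP hk]
  simp only [map_mul, map_neg]
  ring

/-- The radial part of type `A` in exponential coordinates. -/
theorem IsRootSumA.radialPart_apply (hP : L.IsPositiveHalf a P) {k : ℂ} (hk : k ≠ 0)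
    (h : L.IsRootSumA e P k (cmsWeight k)) {B : LinearMap.BilinForm ℂ g}
    (hB : ∀ i j, B (e i : g) (e j : g) = if i = j then cmsWeight k i else 0) (f : L.Loc e) :
    (L.radialPart e B P).apply (L.locDeriv e) f =
      4 * cmsAExp n m k (L.expLoc e) (L.locDeriv e) f := by
  have h0 : (L.radialPart e B P).c₀ • f = 0 := zero_smul _ f
  have h2 : ∑ i, ∑ j, (L.radialPart e B P).c₂ i j • L.locDeriv e i (L.locDeriv e j f) =
      ∑ i, (cmsWeight k i)⁻¹ • L.locDeriv e i (L.locDeriv e i f) := by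
    refine Finset.sum_congr rfl fun i _ => ?_
    rw [Algebra.smul_def, ← sum_invGram_mul hk hB i fun j => L.locDeriv e i (L.locDeriv e j f)]
    rfl
  have h1 : ∑ i, (L.radialPart e B P).c₁ i • L.locDeriv e i f =
      ∑ i, ∑ j, (-2 * k * cmsWeight k j) • (L.expRatio e i j * L.locDeriv e i f) := by
    refine Finset.sum_congr rfl fun i _ => ?_
    rw [radialPart_c₁, sum_invGram_mul hk hB, h.halfCothSum_eq hP hk, ← Algebra.smul_def,
      smul_eq_mul, mul_assoc, smul_mul_assoc, Finset.sum_mul, Finset.smul_sum, Finset.mul_sum]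
    refine Finset.sum_congr rfl fun j _ => ?_
    have hw := cmsWeight_ne_zero hk i
    rw [smul_mul_assoc, smul_smul, ← map_ofNat (algebraMap ℂ (L.Loc e)) 2, ← Algebra.smul_def,
      smul_smul]
    congr 1
    field_simp
  rw [DiffOp.apply, h0, add_zero, h1, h2]
  -- The ratio is antisymmetric, so its product with the difference of derivatives is symmetric. The
  -- sum over `i < j` is thus half the full double sum, in which both derivatives contribute
  -- equally.
  have hxx : ∑ i : Fin n, ∑ j ∈ Finset.Ioi i,
      L.expRatio e (Sum.inl i) (Sum.inl j) * ((1 / 2 : ℂ) • L.locDeriv e (Sum.inl i) f -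
        (1 / 2 : ℂ) • L.locDeriv e (Sum.inl j) f) =
      (1 / 2 : ℂ) • ∑ i : Fin n, ∑ j : Fin n,
        L.expRatio e (Sum.inl i) (Sum.inl j) * L.locDeriv e (Sum.inl i) f := by
    rw [sum_Ioi_eq]
    · have hsw : ∑ i : Fin n, ∑ j : Fin n, L.expRatio e (Sum.inl i) (Sum.inl j) *
          L.locDeriv e (Sum.inl j) f = -∑ i : Fin n, ∑ j : Fin n,
            L.expRatio e (Sum.inl i) (Sum.inl j) * L.locDeriv e (Sum.inl i) f := by
        rw [Finset.sum_comm, ← Finset.sum_neg_distrib]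
        refine Finset.sum_congr rfl fun i _ => ?_
        rw [← Finset.sum_neg_distrib]
        refine Finset.sum_congr rfl fun j _ => ?_
        rw [h.expRatio_swap hP hk]
        ring
      simp only [← smul_sub, mul_smul_comm, ← Finset.smul_sum, mul_sub, Finset.sum_sub_distrib]
      rw [hsw, sub_neg_eq_add, ← two_smul ℂ, smul_smul, smul_smul]
      norm_num
    · intro i j
      rw [h.expRatio_swap hP hk]
      ring
    · intro i
      rw [expRatio_self, zero_mul]
  have hyy : ∑ i : Fin m, ∑ j ∈ Finset.Ioi i,
      L.expRatio e (Sum.inr i) (Sum.inr j) * ((1 / 2 : ℂ) • L.locDeriv e (Sum.inr i) f -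
        (1 / 2 : ℂ) • L.locDeriv e (Sum.inr j) f) =
      (1 / 2 : ℂ) • ∑ i : Fin m, ∑ j : Fin m,
        L.expRatio e (Sum.inr i) (Sum.inr j) * L.locDeriv e (Sum.inr i) f := by
    rw [sum_Ioi_eq]
    · have hsw : ∑ i : Fin m, ∑ j : Fin m, L.expRatio e (Sum.inr i) (Sum.inr j) *
          L.locDeriv e (Sum.inr j) f = -∑ i : Fin m, ∑ j : Fin m,
            L.expRatio e (Sum.inr i) (Sum.inr j) * L.locDeriv e (Sum.inr i) f := by
        rw [Finset.sum_comm, ← Finset.sum_neg_distrib]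
        refine Finset.sum_congr rfl fun i _ => ?_
        rw [← Finset.sum_neg_distrib]
        refine Finset.sum_congr rfl fun j _ => ?_
        rw [h.expRatio_swap hP hk]
        ring
      simp only [← smul_sub, mul_smul_comm, ← Finset.smul_sum, mul_sub, Finset.sum_sub_distrib]
      rw [hsw, sub_neg_eq_add, ← two_smul ℂ, smul_smul, smul_smul]
      norm_num
    · intro i j
      rw [h.expRatio_swap hP hk]
      ring
    · intro i
      rw [expRatio_self, zero_mul]
  -- The part with the derivative in `y` is rewritten with the opposite ratio, which changes the
  -- sign of `k`.
  have hxy : ∑ i : Fin n, ∑ j : Fin m, L.expRatio e (Sum.inl i) (Sum.inr j) *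
      ((1 / 2 : ℂ) • L.locDeriv e (Sum.inl i) f -
        k • ((1 / 2 : ℂ) • L.locDeriv e (Sum.inr j) f)) =
      (1 / 2 : ℂ) • ∑ i : Fin n, ∑ j : Fin m,
        L.expRatio e (Sum.inl i) (Sum.inr j) * L.locDeriv e (Sum.inl i) f +
      (k * (1 / 2 : ℂ)) • ∑ i : Fin m, ∑ j : Fin n,
        L.expRatio e (Sum.inr i) (Sum.inl j) * L.locDeriv e (Sum.inr i) f := by
    rw [Finset.sum_comm (f := fun (i : Fin m) (j : Fin n) => L.expRatio e (Sum.inr i) (Sum.inl j) *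
      L.locDeriv e (Sum.inr i) f)]
    simp only [Finset.smul_sum, ← Finset.sum_add_distrib]
    refine Finset.sum_congr rfl fun i _ => Finset.sum_congr rfl fun j _ => ?_
    rw [h.expRatio_swap hP hk (Sum.inr j)]
    simp only [Algebra.smul_def, map_mul]
    ring
  have hexp : cmsAExp n m k (L.expLoc e) (L.locDeriv e) f =
      (∑ i : Fin n, (1 / 2 : ℂ) • L.locDeriv e (Sum.inl i)
        ((1 / 2 : ℂ) • L.locDeriv e (Sum.inl i) f)) +
      k • (∑ j : Fin m, (1 / 2 : ℂ) • L.locDeriv e (Sum.inr j)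
        ((1 / 2 : ℂ) • L.locDeriv e (Sum.inr j) f)) -
      k • (∑ i : Fin n, ∑ j ∈ Finset.Ioi i,
      L.expRatio e (Sum.inl i) (Sum.inl j) * ((1 / 2 : ℂ) • L.locDeriv e (Sum.inl i) f -
        (1 / 2 : ℂ) • L.locDeriv e (Sum.inl j) f)) -
      (∑ i : Fin m, ∑ j ∈ Finset.Ioi i,
      L.expRatio e (Sum.inr i) (Sum.inr j) * ((1 / 2 : ℂ) • L.locDeriv e (Sum.inr i) f -
        (1 / 2 : ℂ) • L.locDeriv e (Sum.inr j) f)) -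
      ∑ i : Fin n, ∑ j : Fin m, L.expRatio e (Sum.inl i) (Sum.inr j) *
      ((1 / 2 : ℂ) • L.locDeriv e (Sum.inl i) f -
        k • ((1 / 2 : ℂ) • L.locDeriv e (Sum.inr j) f)) := rfl
  rw [hexp, hxx, hyy, hxy]
  have h4 : (4 : L.Loc e) = algebraMap ℂ _ 4 := (map_ofNat _ 4).symm
  rw [h4, ← Algebra.smul_def]
  simp only [Fintype.sum_sum_type, cmsWeight, Sum.elim_inl, Sum.elim_inr, Finset.sum_add_distrib,
    ← Finset.smul_sum, Derivation.map_smul, inv_one, inv_inv, one_smul]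
  have hk2 : -2 * k * k⁻¹ = -2 := by field_simp
  rw [hk2]
  module

end typeA

end LieSuperalgebra

namespace LieSuperalgebra

/-! ### First order coefficients and roots of type BC -/

section typeBC

variable {g : Type} [AddCommGroup g] [Module ℂ g] {L : LieSuperalgebra g}
variable {ι : Type} [Fintype ι] [DecidableEq ι] {a : Submodule ℂ g} {e : Module.Basis ι ℂ a}
variable {P : Finset (Module.Dual ℂ a)}

variable (L e) in
/-- The function `cosh 2z_i`. -/
def coshFrac (i : ι) : FractionRing (L.Loc e) := coshRat (L.expFrac e (coordForm i))

theorem expFrac_sub_one_ne_zero (i : ι) : L.expFrac e (coordForm i) - 1 ≠ 0 := by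
  intro h
  refine expFrac_mul_ne_one (L := L) (e := e) i i ?_
  linear_combination (L.expFrac e (coordForm i) + 1) * h

theorem expFrac_add_one_ne_zero (i : ι) : L.expFrac e (coordForm i) + 1 ≠ 0 := by
  intro h
  refine expFrac_mul_ne_one (L := L) (e := e) i i ?_
  linear_combination (L.expFrac e (coordForm i) - 1) * h

theorem coshFrac_sub_ne_zero {i j : ι} (hij : i ≠ j) :
    L.coshFrac e i - L.coshFrac e j ≠ 0 := by
  rw [coshFrac, coshFrac, coshRat_sub (expFrac_ne_zero e _) (expFrac_ne_zero e _)]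
  refine div_ne_zero (mul_ne_zero (sub_ne_zero.2 fun h => hij (expFrac_coordForm_injective h))
    (expFrac_mul_ne_one i j)) ?_
  exact mul_ne_zero (mul_ne_zero two_ne_zero (expFrac_ne_zero e _)) (expFrac_ne_zero e _)

theorem coshFrac_injective : Function.Injective (L.coshFrac e) := by
  intro i j h
  by_contra hij
  exact coshFrac_sub_ne_zero hij (sub_eq_zero.2 h)

theorem coshFrac_sub_one_ne_zero (i : ι) : L.coshFrac e i - 1 ≠ 0 := by
  rw [coshFrac, coshRat_sub_one (expFrac_ne_zero e _)]
  exact div_ne_zero (pow_ne_zero 2 (expFrac_sub_one_ne_zero i))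
    (mul_ne_zero two_ne_zero (expFrac_ne_zero e _))

theorem coshFrac_add_one_ne_zero (i : ι) : L.coshFrac e i + 1 ≠ 0 := by
  rw [coshFrac, coshRat_add_one (expFrac_ne_zero e _)]
  exact div_ne_zero (pow_ne_zero 2 (expFrac_add_one_ne_zero i))
    (mul_ne_zero two_ne_zero (expFrac_ne_zero e _))

/-- Pairs of distinct coordinates combine through `cothRat_add_cothRat`. The diagonal pairs have no
such form: they contribute `-k w_i²` to the multiplicity of the doubled coordinate, so that `β` is
replaced by `β - k w_i`. -/
theorem IsRootSumBC.halfCothSum (hP : L.IsPositiveHalf a P) {k a₀ β : ℂ} {w : ι → ℂ}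
    (h : L.IsRootSumBC e P k a₀ β w) (i : ι) :
    algebraMap _ (FractionRing (L.Loc e)) (L.halfCothSum e P i) =
      sinhRat (L.expFrac e (coordForm i)) *
        (-2 * algebraMap ℂ _ k * algebraMap ℂ _ (w i) *
            ∑ j, algebraMap ℂ _ (w j) / (L.coshFrac e i - L.coshFrac e j) +
          algebraMap ℂ _ a₀ * algebraMap ℂ _ (w i) / 2 / (L.coshFrac e i - 1) +
          algebraMap ℂ _ (w i) * (algebraMap ℂ _ β - algebraMap ℂ _ k * algebraMap ℂ _ (w i)) *
            L.coshFrac e i / (L.coshFrac e i ^ 2 - 1)) := by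
  rw [algebraMap_halfCothSum hP, h _ _ (cothTerm_neg i) (cothTerm_zero i)]
  let X : ι → FractionRing (L.Loc e) := fun x => L.expFrac e (coordForm x)
  have hX0 : ∀ x, X x ≠ 0 := fun x => expFrac_ne_zero e _
  let U : ι → ι → FractionRing (L.Loc e) := fun x y =>
    -algebraMap ℂ _ k * algebraMap ℂ _ (w x) * algebraMap ℂ _ (w y) *
      (cothRat (X x / X y) + cothRat (X x * X y))
  have e1 : ∀ x y : ι, (-k * w x * w y) • (L.cothTerm e i (coordForm x - coordForm y) +
      L.cothTerm e i (coordForm x + coordForm y)) =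
      2⁻¹ * (algebraMap ℂ _ (coordForm x i) * U x y + algebraMap ℂ _ (coordForm y i) * U y x) := by
    intro x y
    have hinv : cothRat (X y / X x) = -cothRat (X x / X y) := by
      rw [← cothRat_inv (div_ne_zero (hX0 x) (hX0 y)), inv_div]
    rw [cothTerm, cothTerm, expFrac_sub, expFrac_add, Algebra.smul_def, Algebra.smul_def,
      Algebra.smul_def, Pi.sub_apply, Pi.add_apply]
    simp only [U, hinv]
    simp only [map_mul, map_sub, map_add, map_neg, one_div, map_inv₀, map_ofNat, X]
    rw [mul_comm (L.expFrac e (coordForm y))]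
    ring
  have e2 : ∀ x : ι, (a₀ * w x) • L.cothTerm e i (coordForm x) +
      (β * w x) • L.cothTerm e i (coordForm x + coordForm x) = algebraMap ℂ _ (coordForm x i) *
        (algebraMap ℂ _ (w x) * (algebraMap ℂ _ a₀ / 2 * cothRat (X x) +
          algebraMap ℂ _ β * cothRat (X x * X x))) := by
    intro x
    rw [cothTerm, cothTerm, expFrac_add, Algebra.smul_def, Algebra.smul_def, Algebra.smul_def,
      Algebra.smul_def, Pi.add_apply]
    simp only [map_mul, map_add, one_div, map_inv₀, map_ofNat, X]
    ring
  have e3 : ∀ y, U i y = -2 * algebraMap ℂ _ k * algebraMap ℂ _ (w i) * sinhRat (X i) *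
      (algebraMap ℂ _ (w y) / (L.coshFrac e i - L.coshFrac e y)) +
      if y = i then -algebraMap ℂ _ k * algebraMap ℂ _ (w i) * algebraMap ℂ _ (w i) *
        (sinhRat (X i) * L.coshFrac e i / (L.coshFrac e i ^ 2 - 1)) else 0 := by
    intro y
    by_cases hy : y = i
    · subst hy
      rw [if_pos rfl, sub_self, div_zero, mul_zero, zero_add]
      simp only [U]
      rw [div_self (hX0 y), cothRat_one, zero_add,
        cothRat_sq_eq (hX0 y) (expFrac_sub_one_ne_zero y) (expFrac_add_one_ne_zero y), coshFrac]
    · rw [if_neg hy, add_zero]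
      simp only [U]
      rw [cothRat_add_cothRat (hX0 i) (hX0 y)
        (sub_ne_zero.2 fun h => hy (expFrac_coordForm_injective h).symm) (expFrac_mul_ne_one i y),
        coshFrac, coshFrac]
      ring
  have e4 : ∑ x, ∑ y, algebraMap ℂ _ (coordForm y i) * U y x = ∑ y, U i y := by
    rw [Finset.sum_comm]
    exact sum_coordForm_left U i
  simp only [e1, e2]
  simp only [← Finset.mul_sum _ _ (2⁻¹ : FractionRing (L.Loc e)), Finset.sum_add_distrib]
  rw [sum_coordForm_left, e4, sum_coordForm_mul, ← two_mul, inv_mul_cancel_left₀ two_ne_zero]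
  simp only [e3]
  rw [Finset.sum_add_distrib, Finset.sum_ite_eq', if_pos (Finset.mem_univ i), ← Finset.mul_sum,
    cothRat_sq_eq (hX0 i) (expFrac_sub_one_ne_zero i) (expFrac_add_one_ne_zero i),
    cothRat_eq (hX0 i) (expFrac_sub_one_ne_zero i) (expFrac_add_one_ne_zero i)]
  simp only [X, ← coshFrac.eq_1]
  generalize ∑ j, algebraMap ℂ (FractionRing (L.Loc e)) (w j) / (L.coshFrac e i - L.coshFrac e j) = V
  ring

theorem IsRootSumBC.locDeriv_halfCothSum (hP : L.IsPositiveHalf a P) {k a₀ β : ℂ} {w : ι → ℂ}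
    (h : L.IsRootSumBC e P k a₀ β w) (i : ι) :
    algebraMap _ (FractionRing (L.Loc e)) (L.locDeriv e i (L.halfCothSum e P i)) =
      -(2⁻¹ * (-2 * algebraMap ℂ _ k * algebraMap ℂ _ (w i) * ∑ j, algebraMap ℂ _ (w j) *
          (4 * (L.coshFrac e i * L.coshFrac e j - 1) / (L.coshFrac e i - L.coshFrac e j) ^ 2) +
        algebraMap ℂ _ a₀ * algebraMap ℂ _ (w i) * (2 / (L.coshFrac e i - 1)) +
        4 * algebraMap ℂ _ (w i) * (algebraMap ℂ _ β - algebraMap ℂ _ k * algebraMap ℂ _ (w i)) /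
          (L.coshFrac e i ^ 2 - 1))) := by
  rw [algebraMap_locDeriv_halfCothSum hP, h _ _ (invSinhSqTerm_neg i) (invSinhSqTerm_zero i)]
  congr 2
  let X : ι → FractionRing (L.Loc e) := fun x => L.expFrac e (coordForm x)
  have hX0 : ∀ x, X x ≠ 0 := fun x => expFrac_ne_zero e _
  let U : ι → ι → FractionRing (L.Loc e) := fun x y =>
    -algebraMap ℂ _ k * algebraMap ℂ _ (w x) * algebraMap ℂ _ (w y) *
      (invSinhSqRat (X x / X y) + invSinhSqRat (X x * X y))
  have hU : ∀ x y, U y x = U x y := by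
    intro x y
    have hinv : invSinhSqRat (X y / X x) = invSinhSqRat (X x / X y) := by
      rw [← invSinhSqRat_inv (div_ne_zero (hX0 x) (hX0 y)), inv_div]
    simp only [U, hinv]
    rw [mul_comm (X y)]
    ring
  -- On the diagonal the form is `2 x_i`, whose squared coefficient is `4`; the two deltas supply
  -- only `2`, hence the correction `2 * U x x`.
  have e1 : ∀ x y : ι, (-k * w x * w y) • (L.invSinhSqTerm e i (coordForm x - coordForm y) +
      L.invSinhSqTerm e i (coordForm x + coordForm y)) =
      algebraMap ℂ _ (coordForm x i) * (U x y + if y = x then 2 * U x x else 0) +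
        algebraMap ℂ _ (coordForm y i) * U y x := by
    intro x y
    rw [invSinhSqTerm, invSinhSqTerm, expFrac_sub, expFrac_add, hU x y, Algebra.smul_def,
      Algebra.smul_def, Algebra.smul_def, Pi.sub_apply, Pi.add_apply]
    by_cases hxy : y = x
    · subst hxy
      rw [if_pos rfl]
      simp only [U, div_self (hX0 y), invSinhSqRat_one, sub_self, mul_zero, map_zero, zero_mul,
        zero_add]
      have : (coordForm y i + coordForm y i) * (coordForm y i + coordForm y i) =
          4 * coordForm y i := by
        simp only [coordForm, Pi.single_apply]
        split_ifs <;> norm_num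
      rw [this]
      simp only [map_mul, map_neg, map_ofNat, X]
      ring
    · rw [if_neg hxy, add_zero]
      have h1 : (coordForm x i - coordForm y i) * (coordForm x i - coordForm y i) =
          coordForm x i + coordForm y i := by
        simp only [coordForm, Pi.single_apply]
        split_ifs with h1 h2
        · exact absurd (h2.symm.trans h1) hxy
        all_goals norm_num
      have h2 : (coordForm x i + coordForm y i) * (coordForm x i + coordForm y i) =
          coordForm x i + coordForm y i := by
        simp only [coordForm, Pi.single_apply]
        split_ifs with h1 h2
        · exact absurd (h2.symm.trans h1) hxy
        all_goals norm_num
      rw [h1, h2]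
      simp only [map_mul, map_neg, map_add, U, X]
      ring
  have e2 : ∀ x : ι, (a₀ * w x) • L.invSinhSqTerm e i (coordForm x) +
      (β * w x) • L.invSinhSqTerm e i (coordForm x + coordForm x) = algebraMap ℂ _ (coordForm x i) *
        (algebraMap ℂ _ (w x) * (algebraMap ℂ _ a₀ * invSinhSqRat (X x) +
          4 * algebraMap ℂ _ β * invSinhSqRat (X x * X x))) := by
    intro x
    have h1 : coordForm x i * coordForm x i = coordForm x i := by
      simp only [coordForm, Pi.single_apply]
      split_ifs <;> norm_num
    have h2 : (coordForm x i + coordForm x i) * (coordForm x i + coordForm x i) =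
        4 * coordForm x i := by linear_combination 4 * h1
    rw [invSinhSqTerm, invSinhSqTerm, expFrac_add, Algebra.smul_def, Algebra.smul_def,
      Algebra.smul_def, Algebra.smul_def, Pi.add_apply, h1, h2]
    simp only [map_mul, map_ofNat, X]
    ring
  have e3 : ∀ y, U i y = -algebraMap ℂ _ k * algebraMap ℂ _ (w i) *
      (algebraMap ℂ _ (w y) * (4 * (L.coshFrac e i * L.coshFrac e y - 1) /
        (L.coshFrac e i - L.coshFrac e y) ^ 2)) +
      if y = i then -algebraMap ℂ _ k * algebraMap ℂ _ (w i) * algebraMap ℂ _ (w i) *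
        (1 / (L.coshFrac e i ^ 2 - 1)) else 0 := by
    intro y
    by_cases hy : y = i
    · subst hy
      rw [if_pos rfl, sub_self, zero_pow two_ne_zero, div_zero, mul_zero, mul_zero, zero_add]
      simp only [U]
      rw [div_self (hX0 y), invSinhSqRat_one, zero_add,
        invSinhSqRat_sq_eq (hX0 y) (expFrac_sub_one_ne_zero y) (expFrac_add_one_ne_zero y),
        coshFrac]
    · rw [if_neg hy, add_zero]
      simp only [U]
      rw [invSinhSqRat_add_invSinhSqRat (hX0 i) (hX0 y)
        (sub_ne_zero.2 fun h => hy (expFrac_coordForm_injective h).symm) (expFrac_mul_ne_one i y),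
        coshFrac, coshFrac]
      ring
  have e4 : ∑ x, ∑ y, algebraMap ℂ _ (coordForm y i) * U y x = ∑ y, U i y := by
    rw [Finset.sum_comm]
    exact sum_coordForm_left U i
  have e5 : U i i = -algebraMap ℂ _ k * algebraMap ℂ _ (w i) * algebraMap ℂ _ (w i) *
        (1 / (L.coshFrac e i ^ 2 - 1)) := by
    rw [e3, if_pos rfl, sub_self, zero_pow two_ne_zero, div_zero, mul_zero, mul_zero, zero_add]
  simp only [e1, e2]
  rw [Finset.sum_congr rfl fun x _ => Finset.sum_add_distrib, Finset.sum_add_distrib]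
  rw [sum_coordForm_left (fun x y => U x y + if y = x then 2 * U x x else 0) i, e4,
    sum_coordForm_mul, Finset.sum_add_distrib, Finset.sum_ite_eq', if_pos (Finset.mem_univ i), e5]
  simp only [e3]
  rw [Finset.sum_add_distrib, Finset.sum_ite_eq', if_pos (Finset.mem_univ i), ← Finset.mul_sum,
    invSinhSqRat_sq_eq (hX0 i) (expFrac_sub_one_ne_zero i) (expFrac_add_one_ne_zero i),
    invSinhSqRat_eq (hX0 i) (expFrac_sub_one_ne_zero i)]
  simp only [X, ← coshFrac.eq_1]
  generalize ∑ j, algebraMap ℂ (FractionRing (L.Loc e)) (w j) * _ = V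
  ring

theorem sum_coordForm_sub (i j : ι) : ∑ k, (coordForm i - coordForm j : ι → ℂ) k = 0 := by
  simp only [Pi.sub_apply, Finset.sum_sub_distrib, sum_coordForm, sub_self]

theorem sum_coordForm_add (i j : ι) : ∑ k, (coordForm i + coordForm j : ι → ℂ) k = 2 := by
  simp only [Pi.add_apply, Finset.sum_add_distrib, sum_coordForm]
  norm_num

theorem coordForm_add_ne_neg (b c i j : ι) :
    (coordForm i + coordForm j : ι → ℂ) ≠ -(coordForm b + coordForm c) := by
  intro h
  have := congrArg (fun c : ι → ℂ => ∑ k, c k) h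
  simp only [Pi.neg_apply, Finset.sum_neg_distrib, sum_coordForm_add] at this
  norm_num at this

theorem signIndicator_add {b c : ι} (hbc : b ≠ c) (i j : ι) :
    signIndicator (coordForm b + coordForm c) (coordForm i + coordForm j) =
      (if i = b then if j = c then (1 : ℂ) else 0 else 0) +
        (if i = c then if j = b then (1 : ℂ) else 0 else 0) := by
  by_cases h1 : (i = b ∧ j = c) ∨ (i = c ∧ j = b)
  · rcases h1 with ⟨rfl, rfl⟩ | ⟨rfl, rfl⟩
    · simp [signIndicator, hbc]
    · simp [signIndicator, hbc.symm, add_comm]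
  · rw [signIndicator, if_neg]
    · push Not at h1
      by_cases hi : i = b
      · subst hi
        simp [h1.1 rfl, hbc]
      · by_cases hi' : i = c
        · subst hi'
          simp [h1.2 rfl, hi]
        · simp [hi, hi']
    · rintro (h2 | h2)
      · exact h1 (coordForm_add_eq hbc h2)
      · exact coordForm_add_ne_neg _ _ _ _ h2

/-- The indicator of `±(x_b - x_c)` is used as test function in the root sum. The total of the
coefficients of a form, `0` for differences, `1` for single coordinates and `2` for sums, separates
the kinds of roots, so only the two matching differences contribute. -/
theorem IsRootSumBC.isUnit_sub (hP : L.IsPositiveHalf a P) {k a₀ β : ℂ} (hk : k ≠ 0) {w : ι → ℂ}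
    (hw : ∀ i, w i ≠ 0) (h : L.IsRootSumBC e P k a₀ β w) {b c : ι} (hbc : b ≠ c) :
    IsUnit (L.expLoc e (fun i => 2 * (coordForm b - coordForm c : ι → ℂ) i) - 1) := by
  refine isUnit_of_sum_ne_zero hP ?_
  have hv : (coordForm b - coordForm c : ι → ℂ) ≠ 0 := by
    intro h0
    have := congrFun h0 b
    simp [coordForm, hbc] at this
  rw [h _ _ (signIndicator_neg _) (signIndicator_zero hv)]
  have e2 : ∀ i j, signIndicator (coordForm b - coordForm c) (coordForm i + coordForm j) = 0 :=
    fun i j => signIndicator_of_sum (by rw [sum_coordForm_sub, sum_coordForm_add]; norm_num)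
      (by rw [sum_coordForm_sub, sum_coordForm_add]; norm_num)
  have e3 : ∀ i, signIndicator (coordForm b - coordForm c) (coordForm i) = 0 :=
    fun i => signIndicator_of_sum (by rw [sum_coordForm_sub, sum_coordForm]; norm_num)
      (by rw [sum_coordForm_sub, sum_coordForm]; norm_num)
  simp only [signIndicator_sub hbc, e2, e3, smul_eq_mul, add_zero, mul_zero, mul_add,
    Finset.sum_add_distrib, mul_ite, mul_one, Finset.sum_const_zero]
  simp only [Finset.sum_ite_eq', Finset.sum_const_zero, Finset.mem_univ, if_true,
    Finset.sum_ite_irrel]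
  intro h0
  have : -(2 * (k * (w b * w c))) = 0 := by linear_combination h0
  simp [hk, hw] at this

theorem IsRootSumBC.isUnit_add (hP : L.IsPositiveHalf a P) {k a₀ β : ℂ} (hk : k ≠ 0) {w : ι → ℂ}
    (hw : ∀ i, w i ≠ 0) (h : L.IsRootSumBC e P k a₀ β w) {b c : ι} (hbc : b ≠ c) :
    IsUnit (L.expLoc e (fun i => 2 * (coordForm b + coordForm c : ι → ℂ) i) - 1) := by
  refine isUnit_of_sum_ne_zero hP ?_
  have hv : (coordForm b + coordForm c : ι → ℂ) ≠ 0 := by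
    intro h0
    have := congrFun h0 b
    simp [coordForm, hbc] at this
  rw [h _ _ (signIndicator_neg _) (signIndicator_zero hv)]
  have e2 : ∀ i j, signIndicator (coordForm b + coordForm c) (coordForm i - coordForm j) = 0 :=
    fun i j => signIndicator_of_sum (by rw [sum_coordForm_sub, sum_coordForm_add]; norm_num)
      (by rw [sum_coordForm_sub, sum_coordForm_add]; norm_num)
  have e3 : ∀ i, signIndicator (coordForm b + coordForm c) (coordForm i) = 0 :=
    fun i => signIndicator_of_sum (by rw [sum_coordForm_add, sum_coordForm]; norm_num)
      (by rw [sum_coordForm_add, sum_coordForm]; norm_num)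
  have e4 : ∀ i, signIndicator (coordForm b + coordForm c) (coordForm i + coordForm i) = 0 := by
    intro i
    rw [signIndicator_add hbc]
    by_cases h1 : i = b
    · subst h1; simp [hbc]
    · by_cases h2 : i = c
      · subst h2; simp [h1]
      · simp [h1, h2]
  simp only [e4, e2, e3, smul_eq_mul, zero_add, mul_zero, Finset.sum_const_zero, add_zero]
  simp only [signIndicator_add hbc, mul_add, Finset.sum_add_distrib, mul_ite, mul_one, mul_zero]
  simp only [Finset.sum_ite_eq', Finset.sum_const_zero, Finset.mem_univ, if_true,
    Finset.sum_ite_irrel]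
  intro h0
  have : -(2 * (k * (w b * w c))) = 0 := by linear_combination h0
  simp [hk, hw] at this

theorem IsRootSumBC.isUnit_single (hP : L.IsPositiveHalf a P) {k a₀ β : ℂ} (ha : a₀ ≠ 0)
    {w : ι → ℂ} (hw : ∀ i, w i ≠ 0) (h : L.IsRootSumBC e P k a₀ β w) (b : ι) :
    IsUnit (L.expLoc e (fun i => 2 * (coordForm b : ι → ℂ) i) - 1) := by
  refine isUnit_of_sum_ne_zero hP ?_
  have hv : (coordForm b : ι → ℂ) ≠ 0 := by
    intro h0
    have := congrFun h0 b
    simp [coordForm] at this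
  rw [h _ _ (signIndicator_neg _) (signIndicator_zero hv)]
  have e1 : ∀ i j, signIndicator (coordForm b) (coordForm i - coordForm j) = 0 :=
    fun i j => signIndicator_of_sum (by rw [sum_coordForm_sub, sum_coordForm]; norm_num)
      (by rw [sum_coordForm_sub, sum_coordForm]; norm_num)
  have e2 : ∀ i j, signIndicator (coordForm b) (coordForm i + coordForm j) = 0 :=
    fun i j => signIndicator_of_sum (by rw [sum_coordForm_add, sum_coordForm]; norm_num)
      (by rw [sum_coordForm_add, sum_coordForm]; norm_num)
  have e3 : ∀ i, signIndicator (coordForm b) (coordForm i) = if i = b then 1 else 0 := by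
    intro i
    have : (coordForm i = coordForm b ∨ coordForm i = -coordForm b) ↔ i = b := by
      constructor
      · rintro (h | h)
        · by_contra hne
          have := congrFun h i
          simp [coordForm, hne] at this
        · exact absurd h coordForm_ne_neg
      · rintro rfl
        exact Or.inl rfl
    simp only [signIndicator, this]
  simp only [e1, e2, e3, smul_eq_mul, add_zero, mul_zero, Finset.sum_const_zero, zero_add,
    mul_ite, mul_one, Finset.sum_ite_eq', Finset.mem_univ, if_true]
  exact mul_ne_zero ha (hw b)

/-- The doubled coordinate collects `β w_b` from the one-variable sum and `-k w_b²` from the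
diagonal of the pair sum; `hb` says that the total does not vanish. -/
theorem IsRootSumBC.isUnit_double (hP : L.IsPositiveHalf a P) {k a₀ β : ℂ}
    {w : ι → ℂ} (hw : ∀ i, w i ≠ 0) (h : L.IsRootSumBC e P k a₀ β w) (b : ι)
    (hb : β - k * w b ≠ 0) :
    IsUnit (L.expLoc e (fun i => 2 * (coordForm b + coordForm b : ι → ℂ) i) - 1) := by
  refine isUnit_of_sum_ne_zero hP ?_
  have hv : (coordForm b + coordForm b : ι → ℂ) ≠ 0 := by
    intro h0
    have := congrFun h0 b
    simp [coordForm] at this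
  rw [h _ _ (signIndicator_neg _) (signIndicator_zero hv)]
  have e1 : ∀ i j, signIndicator (coordForm b + coordForm b) (coordForm i - coordForm j) = 0 :=
    fun i j => signIndicator_of_sum (by rw [sum_coordForm_sub, sum_coordForm_add]; norm_num)
      (by rw [sum_coordForm_sub, sum_coordForm_add]; norm_num)
  have e3 : ∀ i, signIndicator (coordForm b + coordForm b) (coordForm i) = 0 :=
    fun i => signIndicator_of_sum (by rw [sum_coordForm_add, sum_coordForm]; norm_num)
      (by rw [sum_coordForm_add, sum_coordForm]; norm_num)
  have e2 : ∀ i j, signIndicator (coordForm b + coordForm b) (coordForm i + coordForm j) =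
      if i = b then if j = b then 1 else 0 else 0 := by
    intro i j
    by_cases h1 : i = b ∧ j = b
    · obtain ⟨rfl, rfl⟩ := h1
      simp [signIndicator]
    · rw [signIndicator, if_neg]
      · by_cases hi : i = b
        · subst hi
          simpa using fun hj => h1 ⟨rfl, hj⟩
        · simp [hi]
      · rintro (h2 | h2)
        · have h3 := congrFun h2 b
          simp only [coordForm, Pi.add_apply, Pi.single_apply, if_true] at h3
          refine h1 ⟨?_, ?_⟩
          · by_contra hne
            rw [if_neg (Ne.symm hne)] at h3
            split_ifs at h3 <;> norm_num at h3
          · by_contra hne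
            rw [if_neg (Ne.symm hne)] at h3
            split_ifs at h3 <;> norm_num at h3
        · exact coordForm_add_ne_neg _ _ _ _ h2
  simp only [e1, e2, e3, smul_eq_mul, zero_add, mul_zero, mul_ite, mul_one]
  have e5 : ∀ i, (if i = b then if i = b then β * w i else 0 else 0) =
      if i = b then β * w i else 0 := fun i => by split_ifs <;> rfl
  simp only [e5, Finset.sum_ite_eq', Finset.sum_const_zero, Finset.mem_univ, if_true,
    Finset.sum_ite_irrel]
  intro h0
  have : w b * (β - k * w b) = 0 := by linear_combination h0
  exact mul_ne_zero (hw b) hb this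

end typeBC

/-! ### The potential of type BC -/

section conjugation

variable {g : Type} [AddCommGroup g] [Module ℂ g] {L : LieSuperalgebra g} {n m : ℕ}
variable {a : Submodule ℂ g} {e : Module.Basis (Fin n ⊕ Fin m) ℂ a} {P : Finset (Module.Dual ℂ a)}

theorem two_smul_coordForm (i : Fin n ⊕ Fin m) :
    (2 : ℂ) • coordForm i = coordForm i + coordForm i := two_smul ℂ _

/-- The parameters `p`, `q`, `r`, `s` are minus one half of the total multiplicities of `x_i`, `2
x_i`, `y_j`, `2 y_j`, which are `a₀`, `β - k`, `a₀ / k` and `(β - 1) / k`. -/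
theorem IsRootSumBC.algebraMap_c₀ (hP : L.IsPositiveHalf a P) {k a₀ β : ℂ} (hk : k ≠ 0)
    (h : L.IsRootSumBC e P k a₀ β (cmsWeight k)) :
    algebraMap _ (FractionRing (L.Loc e)) (cmsBC n m k (-a₀ / 2) (-(β - k) / 2) (-a₀ / (2 * k))
        (-(β - 1) / (2 * k)) (L.expLoc e)).c₀ =
      2⁻¹ * ∑ i, ∑ j, algebraMap ℂ _ k * (algebraMap ℂ _ k * algebraMap ℂ _ (cmsWeight k i) *
        algebraMap ℂ _ (cmsWeight k j) + 1) *
        (algebraMap ℂ _ (cmsWeight k i) + algebraMap ℂ _ (cmsWeight k j)) *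
        (4 * (L.coshFrac e i * L.coshFrac e j - 1) / (L.coshFrac e i - L.coshFrac e j) ^ 2) +
      ∑ i, (algebraMap ℂ _ a₀ / 2 * (algebraMap ℂ _ a₀ * algebraMap ℂ _ (cmsWeight k i) / 2 - 1 +
          algebraMap ℂ _ (cmsWeight k i) *
            (algebraMap ℂ _ β - algebraMap ℂ _ k * algebraMap ℂ _ (cmsWeight k i))) *
            (2 / (L.coshFrac e i - 1)) +
          (algebraMap ℂ _ β - algebraMap ℂ _ k * algebraMap ℂ _ (cmsWeight k i)) *
            (algebraMap ℂ _ (cmsWeight k i) *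
              (algebraMap ℂ _ β - algebraMap ℂ _ k * algebraMap ℂ _ (cmsWeight k i)) - 2) /
                (L.coshFrac e i ^ 2 - 1)) := by
  have hw := cmsWeight_ne_zero (n := n) (m := m) hk
  have hkk : algebraMap ℂ (FractionRing (L.Loc e)) k ≠ 0 := by simpa using hk
  let s : Fin n ⊕ Fin m → Fin n ⊕ Fin m → FractionRing (L.Loc e) := fun i j =>
    4 * (L.coshFrac e i * L.coshFrac e j - 1) / (L.coshFrac e i - L.coshFrac e j) ^ 2
  have hs : ∀ i j, s i j = s j i := by
    intro i j
    simp only [s]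
    rw [← neg_sub (L.coshFrac e j), neg_sq]
    ring
  have hs0 : ∀ i, s i i = 0 := fun i => by simp [s]
  have hterm : ∀ (i j : Fin n ⊕ Fin m) (x : ℂ), i ≠ j → algebraMap _ (FractionRing (L.Loc e))
      (x • (invSinhSq (L.expLoc e) (coordForm i - coordForm j) +
        invSinhSq (L.expLoc e) (coordForm i + coordForm j))) = algebraMap ℂ _ x * s i j := by
    intro i j x hij
    rw [smul_add, map_add, algebraMap_smul_invSinhSq fun _ => h.isUnit_sub hP hk hw hij,
      algebraMap_smul_invSinhSq fun _ => h.isUnit_add hP hk hw hij, expFrac_sub, expFrac_add,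
      ← mul_add, invSinhSqRat_add_invSinhSqRat (expFrac_ne_zero e _) (expFrac_ne_zero e _)
        (sub_ne_zero.2 fun h => hij (expFrac_coordForm_injective h)) (expFrac_mul_ne_one i j)]
    rfl
  -- If `a₀ = 0` the coordinate need not be a root, but then its coefficient vanishes as well. The
  -- same reasoning applies to the doubled coordinates in `htwo`.
  have hone : ∀ (i : Fin n ⊕ Fin m) (x : ℂ), (x ≠ 0 → a₀ ≠ 0) →
      algebraMap _ (FractionRing (L.Loc e)) (x • invSinhSq (L.expLoc e) (coordForm i)) =
        algebraMap ℂ _ x * (2 / (L.coshFrac e i - 1)) := by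
    intro i x hx
    rw [algebraMap_smul_invSinhSq fun hx' => h.isUnit_single hP (hx hx') hw i,
      invSinhSqRat_eq (expFrac_ne_zero e _) (expFrac_sub_one_ne_zero i), coshFrac]
  have htwo : ∀ (i : Fin n ⊕ Fin m) (x : ℂ), (x ≠ 0 → β - k * cmsWeight k i ≠ 0) →
      algebraMap _ (FractionRing (L.Loc e)) (x • invSinhSq (L.expLoc e) ((2 : ℂ) • coordForm i)) =
        algebraMap ℂ _ x * (1 / (L.coshFrac e i ^ 2 - 1)) := by
    intro i x hx
    rw [two_smul_coordForm, algebraMap_smul_invSinhSq fun hx' => h.isUnit_double hP hw i (hx hx'),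
      expFrac_add, invSinhSqRat_sq_eq (expFrac_ne_zero e _) (expFrac_sub_one_ne_zero i)
        (expFrac_add_one_ne_zero i), coshFrac]
  rw [← sum_pairs_eq hk hs hs0, Fintype.sum_sum_type, ← add_assoc]
  change algebraMap _ _ (_ + _ + _ + _ + _) = _
  simp only [map_add, map_sum]
  congr 1
  · congr 1
    · congr 1
      · congr 1
        · refine Finset.sum_congr rfl fun i _ => Finset.sum_congr rfl fun j hj => ?_
          exact hterm _ _ _ fun hij => (Finset.mem_Ioi.1 hj).ne (Sum.inl_injective hij)
        · refine Finset.sum_congr rfl fun i _ => Finset.sum_congr rfl fun j hj => ?_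
          exact hterm _ _ _ fun hij => (Finset.mem_Ioi.1 hj).ne (Sum.inr_injective hij)
      · refine Finset.sum_congr rfl fun i _ => Finset.sum_congr rfl fun j hj => ?_
        exact hterm _ _ _ Sum.inl_ne_inr
    · refine Finset.sum_congr rfl fun i _ => ?_
      congr 1
      · refine (hone (Sum.inl i) _ ?_).trans ?_
        · rintro hx rfl
          simp at hx
        · simp only [cmsWeight, Sum.elim_inl, map_mul, map_add, map_sub, map_neg, map_div₀,
            map_one, map_ofNat]
          ring
      · refine (htwo (Sum.inl i) _ ?_).trans ?_
        · intro hx h0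
          simp only [cmsWeight, Sum.elim_inl, mul_one] at h0
          simp [h0] at hx
        · simp only [cmsWeight, Sum.elim_inl, map_mul, map_add, map_sub, map_neg, map_div₀,
            map_one, map_ofNat]
          ring
  · refine Finset.sum_congr rfl fun i _ => ?_
    congr 1
    · refine (hone (Sum.inr i) _ ?_).trans ?_
      · rintro hx rfl
        simp at hx
      · simp only [cmsWeight, Sum.elim_inr, map_mul, map_add, map_sub, map_neg, map_div₀,
          map_one, map_ofNat, map_inv₀]
        field_simp
        ring
    · refine (htwo (Sum.inr i) _ ?_).trans ?_
      · intro hx h0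
        simp only [cmsWeight, Sum.elim_inr, mul_inv_cancel₀ hk] at h0
        simp [h0] at hx
      · simp only [cmsWeight, Sum.elim_inr, map_mul, map_add, map_sub, map_neg, map_div₀,
          map_one, map_ofNat, map_inv₀]
        field_simp
        ring

theorem IsRootSumBC.isConjugate (hP : L.IsPositiveHalf a P) {k a₀ β p q r s : ℂ} (hk : k ≠ 0)
    (hp : p = -a₀ / 2) (hq : q = -(β - k) / 2) (hr : r = -a₀ / (2 * k))
    (hs : s = -(β - 1) / (2 * k))
    (h : L.IsRootSumBC e P k a₀ β (cmsWeight k)) {B : LinearMap.BilinForm ℂ g}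
    (hB : ∀ i j, B (e i : g) (e j : g) = if i = j then cmsWeight k i else 0) :
    IsConjugate (L.locDeriv e) (L.radialPart e B P) (cmsBC n m k p q r s (L.expLoc e))
      (∏ α ∈ P, (L.expLoc e (fun i => α (e i)) - L.expLoc e (fun i => -α (e i))) ^
        L.rootDim a 0 α)
      (∏ α ∈ P, (L.expLoc e (fun i => α (e i)) - L.expLoc e (fun i => -α (e i))) ^
        L.rootDim a 1 α) := by
  subst hp hq hr hs
  obtain ⟨c, hc⟩ : ∃ c : ℂ, (cmsBC n m k (-a₀ / 2) (-(β - k) / 2) (-a₀ / (2 * k))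
        (-(β - 1) / (2 * k)) (L.expLoc e)).c₀ + algebraMap ℂ _ c =
      ∑ i, ∑ j, algebraMap ℂ _ (invGram e B i j) * (L.locDeriv e i (L.halfCothSum e P j) +
        L.halfCothSum e P i * L.halfCothSum e P j) := by
    refine exists_constant_of_mem ?_
    rw [h.algebraMap_c₀ hP hk]
    have key := sum_typeBC_sub_mem (algebraMap ℂ (FractionRing (L.Loc e))).fieldRange
      (w := fun i => algebraMap ℂ _ (cmsWeight k i)) (k := algebraMap ℂ _ k)
      (a := algebraMap ℂ _ a₀) (β := algebraMap ℂ _ β) (t := L.coshFrac e)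
      ⟨k, rfl⟩ ⟨a₀, rfl⟩ ⟨β, rfl⟩ (fun i => ⟨_, rfl⟩)
      (fun i => by simpa using cmsWeight_ne_zero hk i) coshFrac_injective coshFrac_sub_one_ne_zero
      coshFrac_add_one_ne_zero
    convert key using 2
    rw [map_sum]
    refine Finset.sum_congr rfl fun i _ => ?_
    rw [sum_invGram_mul hk hB, map_mul, ← IsScalarTower.algebraMap_apply, map_add, map_mul,
      h.locDeriv_halfCothSum hP, h.halfCothSum hP, map_inv₀, coshFrac,
      ← sinhRat_sq (expFrac_ne_zero e _)]
    ring
  exact isConjugate_radialPart e hP B (invGram_symm hk hB) (cms_c₂_eq hk hB) (fun i => rfl) c hc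

end conjugation

end LieSuperalgebra

/-! ### Forms and involutions on the matrix superalgebras -/

section strForm

variable {I : Type} [Fintype I] [DecidableEq I] {p : I → ZMod 2}

theorem koszul_self (d : ZMod 2) : koszul d d = if d = 1 then -1 else 1 := by simp [koszul]

theorem superTrace_apply (x : Matrix I I ℂ) :
    superTrace p x = ∑ i, koszul (p i) (p i) * x i i := by
  rw [superTrace, LinearMap.sum_apply]
  refine Finset.sum_congr rfl fun i _ => ?_
  rw [koszul_self]
  rfl

theorem strForm_apply (c : ℂ) (x y : Matrix I I ℂ) :
    strForm p c x y = c * ∑ i, ∑ j, koszul (p i) (p i) * (x i j * y j i) := by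
  change c * superTrace p (x * y) = _
  simp only [superTrace_apply, Matrix.mul_apply, Finset.mul_sum]

theorem strForm_isInvariantForm (c : ℂ) : (glSuper p).IsInvariantForm (strForm p c) where
  even := by
    intro i j x y hx hy hij
    rw [strForm_apply]
    refine mul_eq_zero_of_right _ (Finset.sum_eq_zero fun a _ => Finset.sum_eq_zero fun b _ => ?_)
    by_cases h : p a + p b = i
    · rw [hy b a (by rw [add_comm, h]; exact hij)]
      ring
    · rw [hx a b h]
      ring
  supersymm := by
    intro i j x y hx hy
    rw [strForm_apply, strForm_apply, Finset.sum_comm, mul_left_comm]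
    congr 1
    rw [Finset.mul_sum]
    refine Finset.sum_congr rfl fun a _ => ?_
    rw [Finset.mul_sum]
    refine Finset.sum_congr rfl fun b _ => ?_
    by_cases h : p b + p a = i
    · by_cases h' : p a + p b = j
      · have : koszul (p b) (p b) = koszul i j * koszul (p a) (p a) := by
          subst h h'
          generalize p a = u, p b = v
          rcases zmod_two_cases u with rfl | rfl <;> rcases zmod_two_cases v with rfl | rfl <;>
            simp [koszul, show (1 + 1 : ZMod 2) = 0 from rfl]
        rw [this]
        ring
      · rw [hy a b h']
        ring
    · rw [hx b a h]
      ring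
  invariant := by
    intro x y z
    change strForm p c (superBracket p x y) z = strForm p c x (superBracket p y z)
    rw [strForm_apply, strForm_apply]
    congr 1
    simp only [superBracket_apply, Finset.sum_mul, Finset.mul_sum, sub_mul, mul_sub,
      Finset.sum_sub_distrib]
    congr 1
    · refine Finset.sum_congr rfl fun a _ => ?_
      rw [Finset.sum_comm]
      exact Finset.sum_congr rfl fun b _ => Finset.sum_congr rfl fun d _ => by ring
    · have hrev : ∀ f : I → I → I → ℂ,
          ∑ a, ∑ b, ∑ d, f a b d = ∑ a, ∑ b, ∑ d, f d b a := by
        intro f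
        rw [← sum_rotate f]
        exact Finset.sum_congr rfl fun a _ => Finset.sum_comm
      conv_rhs => rw [hrev]
      refine Finset.sum_congr rfl fun a _ => Finset.sum_congr rfl fun b _ =>
        Finset.sum_congr rfl fun d _ => ?_
      have : koszul (p a) (p a) * koszul (p a + p d) (p d + p b) =
          koszul (p d) (p d) * koszul (p b + p a) (p a + p d) := by
        generalize p a = u, p b = v, p d = w
        rcases zmod_two_cases u with rfl | rfl <;> rcases zmod_two_cases v with rfl | rfl <;>
          rcases zmod_two_cases w with rfl | rfl <;>
          simp [koszul, show (1 + 1 : ZMod 2) = 0 from rfl]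
      linear_combination (y a d * x d b * z b a) * this

theorem strForm_single_right (c : ℂ) (x : Matrix I I ℂ) (i j : I) :
    strForm p c x (Matrix.single i j 1) = c * (koszul (p j) (p j) * x j i) := by
  rw [strForm_apply]
  congr 1
  rw [Finset.sum_eq_single j, Finset.sum_eq_single i]
  · simp
  · intro b _ hb
    simp [Ne.symm hb]
  · simp
  · intro b _ hb
    refine Finset.sum_eq_zero fun d _ => ?_
    simp [Ne.symm hb]
  · simp

theorem strForm_single_left (c : ℂ) (x : Matrix I I ℂ) (i j : I) :
    strForm p c (Matrix.single i j 1) x = c * (koszul (p i) (p i) * x j i) := by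
  rw [strForm_apply]
  congr 1
  rw [Finset.sum_eq_single i, Finset.sum_eq_single j]
  · simp
  · intro b _ hb
    simp [Ne.symm hb]
  · simp
  · intro b _ hb
    refine Finset.sum_eq_zero fun d _ => ?_
    simp [Ne.symm hb]
  · simp

theorem koszul_ne_zero (i j : ZMod 2) : koszul i j ≠ 0 := by
  unfold koszul
  split_ifs <;> norm_num

theorem strForm_nondegenerate {c : ℂ} (hc : c ≠ 0) : (strForm p c).Nondegenerate := by
  constructor
  · intro x hx
    ext i j
    have := hx (Matrix.single j i 1)
    rw [strForm_single_right] at this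
    simpa [hc, koszul_ne_zero] using this
  · intro x hx
    ext i j
    have := hx (Matrix.single j i 1)
    rw [strForm_single_left] at this
    simpa [hc, koszul_ne_zero] using this

theorem signConj_apply (d : I → ℂ) (x : Matrix I I ℂ) (i j : I) :
    signConj d x i j = d i * d j * x i j := rfl

theorem signConj_isInvolution {d : I → ℂ} (hd : ∀ i, d i * d i = 1) :
    (glSuper p).IsInvolution (signConj d) where
  map_part := by
    intro i x hx a b h
    rw [signConj_apply, hx a b h, mul_zero]
  map_bracket := by
    intro x y
    ext a b
    change d a * d b * superBracket p x y a b = superBracket p (signConj d x) (signConj d y) a b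
    simp only [superBracket_apply, Finset.mul_sum, signConj_apply]
    refine Finset.sum_congr rfl fun k _ => ?_
    linear_combination (-(d a * d b * (x a k * y k b -
      koszul (p a + p k) (p k + p b) * (y a k * x k b)))) * hd k
  involutive := by
    intro x
    ext a b
    simp only [signConj_apply]
    linear_combination (d a * d a * x a b) * hd b + x a b * hd a

theorem strForm_signConj {d : I → ℂ} (hd : ∀ i, d i * d i = 1) (c : ℂ) (x y : Matrix I I ℂ) :
    strForm p c (signConj d x) (signConj d y) = strForm p c x y := by
  simp only [strForm_apply, signConj_apply]
  congr 1
  refine Finset.sum_congr rfl fun a _ => Finset.sum_congr rfl fun b _ => ?_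
  linear_combination (koszul (p a) (p a) * x a b * y b a * d a * d a) * hd b +
    (koszul (p a) (p a) * x a b * y b a) * hd a

theorem SuperForm.theta_apply (F : SuperForm p) (x : Matrix I I ℂ) (i j : I) :
    F.theta x i j = -(F.ε i * F.ε j * koszul (p i + p j) (p j) * x (F.τ j) (F.τ i)) := rfl

theorem SuperForm.bijective (F : SuperForm p) : Function.Bijective F.τ :=
  Function.Involutive.bijective F.τ_τ

theorem strForm_theta (F : SuperForm p) (c : ℂ) (x y : Matrix I I ℂ) :
    strForm p c (F.theta x) (F.theta y) = strForm p c x y := by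
  rw [strForm_apply, strForm_apply, Finset.sum_comm]
  congr 1
  rw [← F.bijective.sum_comp (fun a => ∑ b, koszul (p a) (p a) * (x a b * y b a))]
  refine Finset.sum_congr rfl fun a _ => ?_
  rw [← F.bijective.sum_comp (fun b => koszul (p (F.τ a)) (p (F.τ a)) *
    (x (F.τ a) b * y b (F.τ a)))]
  refine Finset.sum_congr rfl fun b _ => ?_
  rw [F.theta_apply, F.theta_apply, F.parity]
  have h : koszul (p b) (p b) * koszul (p b + p a) (p a) * koszul (p a + p b) (p b) =
      koszul (p a) (p a) := by
    generalize p a = u, p b = v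
    rcases zmod_two_cases u with rfl | rfl <;> rcases zmod_two_cases v with rfl | rfl <;>
      simp [koszul, show (1 + 1 : ZMod 2) = 0 from rfl]
  rw [← h]
  linear_combination (koszul (p b) (p b) * koszul (p b + p a) (p a) * koszul (p a + p b) (p b) *
    x (F.τ a) (F.τ b) * y (F.τ b) (F.τ a)) * (F.ε a * F.ε a * F.ε_sq b + F.ε_sq a)

end strForm

namespace LieSuperalgebra

section fixed

variable {g : Type*} [AddCommGroup g] [Module ℂ g] {L : LieSuperalgebra g} {σ : g →ₗ[ℂ] g}

theorem IsInvariantForm.fixed (hσ : L.IsInvolution σ) {B : LinearMap.BilinForm ℂ g}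
    (hB : L.IsInvariantForm B) : (L.fixed hσ).IsInvariantForm (B.restrict _) where
  even := fun hx hy h => hB.even hx hy h
  supersymm := fun hx hy => hB.supersymm hx hy
  invariant := fun x y z => hB.invariant x y z

/-- For `x` fixed by `σ`, invariance gives `B x (z + σ z) = 2 B x z`, and `z + σ z` is again fixed.
Pairing `x` with fixed vectors therefore detects its pairing with all of `g`. -/
theorem nondegenerate_fixed (hσ : L.IsInvolution σ) {B : LinearMap.BilinForm ℂ g}
    (hB : B.Nondegenerate) (hBσ : ∀ x y, B (σ x) (σ y) = B x y) :
    (B.restrict (LinearMap.eqLocus σ LinearMap.id)).Nondegenerate := by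
  have hmem : ∀ z, σ (z + σ z) = z + σ z := fun z => by rw [map_add, hσ.involutive, add_comm]
  constructor
  · rintro ⟨x, hx⟩ h
    refine Subtype.ext (hB.1 x fun z => ?_)
    have h1 : B x (z + σ z) = 0 := h ⟨z + σ z, hmem z⟩
    have h2 := hBσ x z
    rw [show σ x = x from hx] at h2
    rw [map_add, h2, ← two_mul] at h1
    simpa using h1
  · rintro ⟨x, hx⟩ h
    refine Subtype.ext (hB.2 x fun z => ?_)
    have h1 : B (z + σ z) x = 0 := h ⟨z + σ z, hmem z⟩
    have h2 := hBσ z x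
    rw [show σ x = x from hx] at h2
    rw [map_add, LinearMap.add_apply, h2, ← two_mul] at h1
    simpa using h1

theorem IsInvolution.fixed (hσ : L.IsInvolution σ) {θ : g →ₗ[ℂ] g} (hθ : L.IsInvolution θ)
    (h : ∀ x ∈ LinearMap.eqLocus σ LinearMap.id, θ x ∈ LinearMap.eqLocus σ LinearMap.id) :
    (L.fixed hσ).IsInvolution (θ.restrict h) where
  map_part := fun hx => hθ.map_part hx
  map_bracket := fun x y => Subtype.ext (hθ.map_bracket x y)
  involutive := fun x => Subtype.ext (hθ.involutive x)

end fixed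

section orthogonal

variable {g : Type*} [AddCommGroup g] [Module ℂ g] {ι : Type*} [Fintype ι] [DecidableEq ι]

theorem linearIndependent_of_gram {B : LinearMap.BilinForm ℂ g} {H : ι → g} {w : ι → ℂ}
    (hw : ∀ i, w i ≠ 0) (hB : ∀ i j, B (H i) (H j) = if i = j then w i else 0) :
    LinearIndependent ℂ H := by
  rw [Fintype.linearIndependent_iff]
  intro c hc i
  have h := congrArg (B (H i)) hc
  simpa [map_sum, hB, hw] using h

theorem nondegenerate_of_gram {B : LinearMap.BilinForm ℂ g} {a : Submodule ℂ g}
    (e : Module.Basis ι ℂ a) {w : ι → ℂ}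
    (hw : ∀ i, w i ≠ 0) (hB : ∀ i j, B (e i : g) (e j : g) = if i = j then w i else 0) :
    (B.restrict a).Nondegenerate := by
  rw [LinearMap.BilinForm.nondegenerate_iff_det_ne_zero e]
  have : LinearMap.BilinForm.toMatrix e (B.restrict a) = Matrix.diagonal w := by
    ext i j
    rw [LinearMap.BilinForm.toMatrix_apply, Matrix.diagonal_apply]
    exact hB i j
  rw [this, Matrix.det_diagonal]
  exact Finset.prod_ne_zero_iff.2 fun i _ => hw i

end orthogonal

end LieSuperalgebra

/-! ### Weight decompositions of matrix superalgebras -/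

namespace LieSuperalgebra

theorem mem_weightSpace_iff {g : Type*} [AddCommGroup g] [Module ℂ g] {L : LieSuperalgebra g}
    {ι : Type*} [Fintype ι] {a : Submodule ℂ g} (e : Module.Basis ι ℂ a) {α : Module.Dual ℂ a}
    {x : g} : x ∈ L.weightSpace a α ↔ ∀ i, L.bracket (e i) x = α (e i) • x := by
  constructor
  · intro h i
    exact h (e i)
  · intro h y
    have key : (L.bracket.flip x) ∘ₗ a.subtype = α.smulRight x := e.ext fun i => by simpa using h i
    simpa using LinearMap.congr_fun key y

end LieSuperalgebra

section decomposition

variable {I : Type} [Fintype I] [DecidableEq I] {p : I → ZMod 2} {C Λ : Type} [Fintype Λ]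
  [DecidableEq Λ]

theorem trace_matrix_end (f : Matrix I I ℂ →ₗ[ℂ] Matrix I I ℂ) :
    LinearMap.trace ℂ _ f = ∑ i, ∑ j, f (Matrix.single i j 1) i j := by
  rw [LinearMap.trace_eq_matrix_trace ℂ (Matrix.stdBasis ℂ I I), Matrix.trace,
    Fintype.sum_prod_type]
  refine Finset.sum_congr rfl fun i _ => Finset.sum_congr rfl fun j _ => ?_
  rw [Matrix.diag_apply, LinearMap.toMatrix_apply, Matrix.stdBasis_eq_single]
  rfl

/-- The linear map `x ↦ u x v`. -/
def sandwich (u v : Matrix I I ℂ) : Matrix I I ℂ →ₗ[ℂ] Matrix I I ℂ :=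
  LinearMap.mulLeft ℂ u ∘ₗ LinearMap.mulRight ℂ v

theorem sandwich_apply (u v x : Matrix I I ℂ) : sandwich u v x = u * (x * v) := rfl

theorem mul_single_mul_apply (u v : Matrix I I ℂ) (i j i' j' : I) (c : ℂ) :
    (u * (Matrix.single i j c * v)) i' j' = u i' i * (c * v j j') := by
  rw [Matrix.mul_apply, Finset.sum_eq_single i]
  · rw [Matrix.single_mul_apply_same]
  · intro b _ hb
    rw [Matrix.single_mul_apply_of_ne _ _ _ _ _ hb, mul_zero]
  · simp

theorem trace_sandwich (u v : Matrix I I ℂ) :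
    LinearMap.trace ℂ _ (sandwich u v) = u.trace * v.trace := by
  rw [trace_matrix_end, Matrix.trace, Matrix.trace, Finset.sum_mul_sum]
  refine Finset.sum_congr rfl fun i _ => Finset.sum_congr rfl fun j _ => ?_
  rw [sandwich_apply, mul_single_mul_apply, one_mul]
  rfl

/-- `θ` maps the matrix unit at `(i, j)` to a multiple of the one at `(τ j, τ i)`, so the trace
collects the products `u_{i, τ j} v_{τ i, j}`, and the signs assemble into a supertrace. This yields
the correction by which `osp` multiplicities differ from half of those of `gl`. -/
theorem trace_sandwich_theta (F : SuperForm p) (u v : Matrix I I ℂ) :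
    LinearMap.trace ℂ _ (sandwich u v ∘ₗ F.theta) = superTrace p (u * F.theta v) := by
  rw [trace_matrix_end, superTrace_apply]
  refine Finset.sum_congr rfl fun i _ => ?_
  rw [Matrix.mul_apply, Finset.mul_sum, ← F.bijective.sum_comp]
  refine Finset.sum_congr rfl fun j _ => ?_
  rw [LinearMap.comp_apply, sandwich_apply, F.theta_single, mul_single_mul_apply, F.theta_apply,
    F.τ_τ, F.supersymm i, F.parity]
  ring

/-- Minus `θ` is the superadjoint, which reverses products up to a Koszul sign; with one even factor
the sign is trivial. -/
theorem SuperForm.theta_mul_of_even_left (F : SuperForm p) {x : Matrix I I ℂ}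
    (hx : x ∈ matrixPart p 0) (y : Matrix I I ℂ) :
    F.theta (x * y) = -(F.theta y * F.theta x) := by
  ext i j
  rw [Matrix.neg_apply, Matrix.mul_apply, F.theta_apply, Matrix.mul_apply,
    ← F.bijective.sum_comp, Finset.mul_sum]
  congr 1
  refine Finset.sum_congr rfl fun k _ => ?_
  rw [F.theta_apply, F.theta_apply]
  by_cases h : p j + p k = 0
  · have hjk : p j = p k := by
      generalize p j = u at *
      generalize p k = v at *
      revert u v
      decide
    rw [hjk, CharTwo.add_self_eq_zero, show koszul 0 (p k) = 1 by simp [koszul]]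
    linear_combination (-(F.ε i * F.ε j * koszul (p i + p k) (p k) * x (F.τ j) (F.τ k) *
      y (F.τ k) (F.τ i))) * F.ε_sq k
  · rw [hx (F.τ j) (F.τ k) (by rw [F.parity, F.parity]; exact h)]
    ring

theorem SuperForm.theta_mul_of_even_right (F : SuperForm p) (x : Matrix I I ℂ)
    {y : Matrix I I ℂ} (hy : y ∈ matrixPart p 0) :
    F.theta (x * y) = -(F.theta y * F.theta x) := by
  ext i j
  rw [Matrix.neg_apply, Matrix.mul_apply, F.theta_apply, Matrix.mul_apply,
    ← F.bijective.sum_comp, Finset.mul_sum]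
  congr 1
  refine Finset.sum_congr rfl fun k _ => ?_
  rw [F.theta_apply, F.theta_apply]
  by_cases h : p k + p i = 0
  · have hjk : p i = p k := by
      generalize p i = u at *
      generalize p k = v at *
      revert u v
      decide
    rw [hjk, CharTwo.add_self_eq_zero, show koszul 0 (p k) = 1 by simp [koszul]]
    linear_combination (-(F.ε i * F.ε j * koszul (p k + p j) (p j) * x (F.τ j) (F.τ k) *
      y (F.τ k) (F.τ i))) * F.ε_sq k
  · rw [hy (F.τ k) (F.τ i) (by rw [F.parity, F.parity]; exact h)]
    ring

theorem superBracket_of_even {x : Matrix I I ℂ} (hx : x ∈ matrixPart p 0) (y : Matrix I I ℂ) :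
    superBracket p x y = x * y - y * x := by
  ext i j
  rw [superBracket_apply, Matrix.sub_apply, Matrix.mul_apply, Matrix.mul_apply,
    ← Finset.sum_sub_distrib]
  refine Finset.sum_congr rfl fun k _ => ?_
  by_cases h : p k + p j = 0
  · rw [h, show koszul (p i + p k) 0 = 1 by simp [koszul], one_mul]
  · rw [hx k j h]
    ring

/-- A decomposition of the identity into orthogonal even idempotents on which the matrices `H c`
act by scalars. -/
structure WeightDecomposition (p : I → ZMod 2) (H : C → Matrix I I ℂ) (Λ : Type) [Fintype Λ]
    [DecidableEq Λ] where
  proj : Λ → Matrix I I ℂ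
  par : Λ → ZMod 2
  wt : Λ → C → ℂ
  sum_proj : ∑ l, proj l = 1
  proj_mul : ∀ l l', proj l * proj l' = if l = l' then proj l else 0
  mul_proj : ∀ c l, H c * proj l = wt l c • proj l
  proj_mul_vec : ∀ c l, proj l * H c = wt l c • proj l
  support : ∀ l i j, proj l i j ≠ 0 → p i = par l ∧ p j = par l

namespace WeightDecomposition

variable {H : C → Matrix I I ℂ} (W : WeightDecomposition p H Λ)

theorem proj_even (l : Λ) : W.proj l ∈ matrixPart p 0 := by
  intro i j h
  by_contra h0
  obtain ⟨h1, h2⟩ := W.support l i j h0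
  exact h (by rw [h1, h2, CharTwo.add_self_eq_zero])

theorem vec_eq (c : C) : H c = ∑ l, W.wt l c • W.proj l := by
  rw [← mul_one (H c), ← W.sum_proj, Finset.mul_sum]
  exact Finset.sum_congr rfl fun l _ => W.mul_proj c l

theorem vec_even (W : WeightDecomposition p H Λ) (c : C) : H c ∈ matrixPart p 0 := by
  rw [W.vec_eq c]
  exact Submodule.sum_mem _ fun l _ => Submodule.smul_mem _ _ (W.proj_even l)

theorem vec_comm (W : WeightDecomposition p H Λ) (c c' : C) : H c * H c' = H c' * H c := by
  rw [W.vec_eq c', Finset.mul_sum, Finset.sum_mul]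
  refine Finset.sum_congr rfl fun l _ => ?_
  rw [Matrix.mul_smul, Matrix.smul_mul, W.mul_proj, W.proj_mul_vec]

/-- The supertrace of a weight projection. -/
def sdim (l : Λ) : ℂ := koszul (W.par l) (W.par l) * (W.proj l).trace

theorem superTrace_proj (l : Λ) : superTrace p (W.proj l) = W.sdim l := by
  rw [superTrace_apply, sdim, Matrix.trace, Finset.mul_sum]
  refine Finset.sum_congr rfl fun i _ => ?_
  by_cases h : W.proj l i i = 0
  · rw [Matrix.diag_apply, h, mul_zero, mul_zero]
  · rw [(W.support l i i h).1, Matrix.diag_apply]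

theorem sum_sandwich (x : Matrix I I ℂ) :
    ∑ l, ∑ l', sandwich (W.proj l) (W.proj l') x = x := by
  simp only [sandwich_apply, ← Finset.mul_sum, W.sum_proj, mul_one, ← Finset.sum_mul, one_mul]

theorem bracket_sandwich (c : C) (l l' : Λ) (x : Matrix I I ℂ) :
    superBracket p (H c) (sandwich (W.proj l) (W.proj l') x) =
      (W.wt l c - W.wt l' c) • sandwich (W.proj l) (W.proj l') x := by
  rw [superBracket_of_even (W.vec_even c), sandwich_apply, ← mul_assoc, W.mul_proj, mul_assoc,
    mul_assoc, W.proj_mul_vec, sub_smul, Matrix.smul_mul, Matrix.mul_smul, Matrix.mul_smul]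

theorem sandwich_mem_part (l l' : Λ) (x : Matrix I I ℂ) :
    sandwich (W.proj l) (W.proj l') x ∈ matrixPart p (W.par l + W.par l') := by
  intro i j h
  rw [sandwich_apply, Matrix.mul_apply]
  refine Finset.sum_eq_zero fun k _ => ?_
  by_cases h1 : W.proj l i k = 0
  · rw [h1, zero_mul]
  · rw [Matrix.mul_apply, Finset.sum_eq_zero, mul_zero]
    intro k' _
    by_cases h2 : W.proj l' k' j = 0
    · rw [h2, mul_zero]
    · exact absurd (by rw [(W.support _ _ _ h1).1, (W.support _ _ _ h2).2]) h

theorem sandwich_eq_zero_of_bracket {v : C → ℂ} {x : Matrix I I ℂ}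
    (hx : ∀ c, superBracket p (H c) x = v c • x) {l l' : Λ} (h : W.wt l - W.wt l' ≠ v) :
    sandwich (W.proj l) (W.proj l') x = 0 := by
  obtain ⟨c, hc⟩ : ∃ c, W.wt l c - W.wt l' c ≠ v c := by
    by_contra! h'
    exact h (funext h')
  have h1 : sandwich (W.proj l) (W.proj l') (superBracket p (H c) x) =
      (W.wt l c - W.wt l' c) • sandwich (W.proj l) (W.proj l') x := by
    rw [superBracket_of_even (W.vec_even c), map_sub, sandwich_apply, sandwich_apply,
      sandwich_apply, mul_assoc, ← mul_assoc (W.proj l), W.proj_mul_vec, mul_assoc x, W.mul_proj,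
      sub_smul, Matrix.smul_mul, Matrix.mul_smul, Matrix.mul_smul]
  rw [hx c, map_smul, ← sub_eq_zero, ← sub_smul] at h1
  exact (smul_eq_zero.1 h1).resolve_left (sub_ne_zero.2 (Ne.symm hc))

theorem sandwich_eq_zero_of_part {d : ZMod 2} {x : Matrix I I ℂ} (hx : x ∈ matrixPart p d)
    {l l' : Λ} (h : W.par l + W.par l' ≠ d) : sandwich (W.proj l) (W.proj l') x = 0 := by
  ext i j
  rw [sandwich_apply, Matrix.mul_apply]
  refine Finset.sum_eq_zero fun k _ => ?_
  by_cases h1 : W.proj l i k = 0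
  · rw [h1, zero_mul]
  · rw [Matrix.mul_apply, Finset.sum_eq_zero, mul_zero]
    intro k' _
    by_cases h2 : W.proj l' k' j = 0
    · rw [h2, mul_zero]
    · rw [hx k k' (by rwa [(W.support _ _ _ h1).2, (W.support _ _ _ h2).1]), zero_mul]

open Classical in
/-- The projection to the part of weight `v` and parity `d`. -/
def weightProj (v : C → ℂ) (d : ZMod 2) : Matrix I I ℂ →ₗ[ℂ] Matrix I I ℂ :=
  ∑ l, ∑ l', if W.wt l - W.wt l' = v ∧ W.par l + W.par l' = d then
    sandwich (W.proj l) (W.proj l') else 0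

open Classical in
theorem weightProj_apply (v : C → ℂ) (d : ZMod 2) (x : Matrix I I ℂ) :
    W.weightProj v d x = ∑ l, ∑ l', if W.wt l - W.wt l' = v ∧ W.par l + W.par l' = d then
      sandwich (W.proj l) (W.proj l') x else 0 := by
  simp only [weightProj, LinearMap.sum_apply]
  refine Finset.sum_congr rfl fun l _ => Finset.sum_congr rfl fun l' _ => ?_
  split_ifs <;> rfl

theorem bracket_weightProj (v : C → ℂ) (d : ZMod 2) (x : Matrix I I ℂ) (c : C) :
    superBracket p (H c) (W.weightProj v d x) = v c • W.weightProj v d x := by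
  classical
  rw [weightProj_apply]
  simp only [map_sum, Finset.smul_sum]
  refine Finset.sum_congr rfl fun l _ => Finset.sum_congr rfl fun l' _ => ?_
  split_ifs with h
  · rw [W.bracket_sandwich, ← h.1, Pi.sub_apply]
  · rw [map_zero, smul_zero]

theorem weightProj_mem_part (v : C → ℂ) (d : ZMod 2) (x : Matrix I I ℂ) :
    W.weightProj v d x ∈ matrixPart p d := by
  classical
  rw [weightProj_apply]
  refine Submodule.sum_mem _ fun l _ => Submodule.sum_mem _ fun l' _ => ?_
  split_ifs with h
  · rw [← h.2]
    exact W.sandwich_mem_part l l' x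
  · exact Submodule.zero_mem _

theorem weightProj_eq_self {v : C → ℂ} {d : ZMod 2} {x : Matrix I I ℂ}
    (hx : ∀ c, superBracket p (H c) x = v c • x) (hd : x ∈ matrixPart p d) :
    W.weightProj v d x = x := by
  classical
  conv_rhs => rw [← W.sum_sandwich x]
  rw [weightProj_apply]
  refine Finset.sum_congr rfl fun l _ => Finset.sum_congr rfl fun l' _ => ?_
  split_ifs with h
  · rfl
  · rw [not_and_or] at h
    rcases h with h | h
    · rw [W.sandwich_eq_zero_of_bracket hx h]
    · rw [W.sandwich_eq_zero_of_part hd h]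

open Classical in
theorem trace_weightProj (v : C → ℂ) (d : ZMod 2) :
    LinearMap.trace ℂ _ (W.weightProj v d) =
      ∑ l, ∑ l', if W.wt l - W.wt l' = v ∧ W.par l + W.par l' = d then
        (W.proj l).trace * (W.proj l').trace else 0 := by
  simp only [weightProj, map_sum]
  refine Finset.sum_congr rfl fun l _ => Finset.sum_congr rfl fun l' _ => ?_
  split_ifs
  · exact trace_sandwich _ _
  · exact map_zero _

/-- A form under which the weight decomposition is self-dual. -/
structure IsSelfDual (F : SuperForm p) (star : Λ → Λ) : Prop where
  star_star : ∀ l, star (star l) = l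
  wt_star : ∀ l, W.wt (star l) = -W.wt l
  par_star : ∀ l, W.par (star l) = W.par l
  theta_proj : ∀ l, F.theta (W.proj l) = -W.proj (star l)

variable {W} {F : SuperForm p} {star : Λ → Λ}

theorem IsSelfDual.theta_sandwich (hF : W.IsSelfDual F star) (l l' : Λ) (x : Matrix I I ℂ) :
    F.theta (sandwich (W.proj l) (W.proj l') x) =
      sandwich (W.proj (star l')) (W.proj (star l)) (F.theta x) := by
  rw [sandwich_apply, F.theta_mul_of_even_left (W.proj_even l),
    F.theta_mul_of_even_right x (W.proj_even l'), hF.theta_proj, hF.theta_proj, sandwich_apply]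
  simp only [neg_mul, mul_neg, neg_neg, mul_assoc]

end WeightDecomposition

end decomposition

/-! ### Multiplicities from traces of projections -/

namespace WeightDecomposition

variable {I : Type} [Fintype I] [DecidableEq I] {p : I → ZMod 2} {C Λ : Type} [Fintype C]
  [Fintype Λ] [DecidableEq Λ]

section selfdual

variable {H : C → Matrix I I ℂ} {W : WeightDecomposition p H Λ} {F : SuperForm p} {star : Λ → Λ}

theorem IsSelfDual.theta_weightProj (hF : W.IsSelfDual F star) (v : C → ℂ) (d : ZMod 2)
    (x : Matrix I I ℂ) : F.theta (W.weightProj v d x) = W.weightProj v d (F.theta x) := by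
  classical
  have hb : Function.Bijective star := Function.Involutive.bijective hF.star_star
  rw [weightProj_apply, weightProj_apply, map_sum]
  conv_rhs => rw [Finset.sum_comm, ← hb.sum_comp]
  refine Finset.sum_congr rfl fun l _ => ?_
  rw [map_sum]
  conv_rhs => rw [← hb.sum_comp]
  refine Finset.sum_congr rfl fun l' _ => ?_
  rw [hF.wt_star, hF.wt_star, hF.par_star, hF.par_star, neg_sub_neg, add_comm (W.par l')]
  split_ifs with h
  · exact hF.theta_sandwich l l' x
  · exact map_zero _

open Classical in
-- By `trace_sandwich_theta` a block contributes the supertrace of `P_l θ(P_l')`, which is `-P_l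
-- P_{star l'}`; orthogonality of the projections leaves only `l = star l'`.
theorem IsSelfDual.trace_weightProj_theta (hF : W.IsSelfDual F star) (v : C → ℂ) (d : ZMod 2) :
    LinearMap.trace ℂ _ (W.weightProj v d ∘ₗ F.theta) =
      -∑ l, ∑ l', if W.wt l - W.wt l' = v ∧ W.par l + W.par l' = d then
        (if l = star l' then W.sdim l else 0) else 0 := by
  have h : W.weightProj v d ∘ₗ F.theta = ∑ l, ∑ l',
      if W.wt l - W.wt l' = v ∧ W.par l + W.par l' = d then
        sandwich (W.proj l) (W.proj l') ∘ₗ F.theta else 0 := by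
    refine LinearMap.ext fun x => ?_
    rw [LinearMap.comp_apply, weightProj_apply]
    simp only [LinearMap.sum_apply]
    refine Finset.sum_congr rfl fun l _ => Finset.sum_congr rfl fun l' _ => ?_
    split_ifs <;> rfl
  rw [h]
  simp only [map_sum, ← Finset.sum_neg_distrib]
  refine Finset.sum_congr rfl fun l _ => Finset.sum_congr rfl fun l' _ => ?_
  split_ifs with h1 h2
  · rw [trace_sandwich_theta, hF.theta_proj, mul_neg, map_neg, W.proj_mul, if_pos h2,
      W.superTrace_proj]
  · rw [trace_sandwich_theta, hF.theta_proj, mul_neg, map_neg, W.proj_mul, if_neg h2, map_zero]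
  · rw [map_zero, neg_zero]

end selfdual

theorem sum_even_sub_odd {κ : Type*} [Fintype κ] (Q : κ → Prop) [DecidablePred Q] (par : κ → ZMod 2)
    (f : κ → ℂ) :
    (∑ i, if Q i ∧ par i = 0 then f i else 0) - (∑ i, if Q i ∧ par i = 1 then f i else 0) =
      ∑ i, if Q i then koszul (par i) (par i) * f i else 0 := by
  rw [← Finset.sum_sub_distrib]
  refine Finset.sum_congr rfl fun i _ => ?_
  by_cases h : Q i
  · rcases zmod_two_cases (par i) with h' | h' <;> simp [h, h', koszul]
  · simp [h]

theorem koszul_add_self (u v : ZMod 2) :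
    koszul (u + v) (u + v) = koszul u u * koszul v v := by
  rcases zmod_two_cases u with rfl | rfl <;> rcases zmod_two_cases v with rfl | rfl <;>
    simp [koszul, show (1 + 1 : ZMod 2) = 0 from rfl]

section general

open LieSuperalgebra

variable {H : C → Matrix I I ℂ} (W : WeightDecomposition p H Λ)
  {a : Submodule ℂ (Matrix I I ℂ)} {e : Module.Basis C ℂ a}

/-- The dimension of the image of a projection is its trace, so this turns the root dimensions into
sums of products of traces. -/
theorem isProj_gl (he : ∀ c, (e c : Matrix I I ℂ) = H c) (α : Module.Dual ℂ a) (d : ZMod 2) :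
    LinearMap.IsProj ((glSuper p).weightSpace a α ⊓ (glSuper p).part d)
      (W.weightProj (fun c => α (e c)) d) where
  map_mem x := by
    refine ⟨(mem_weightSpace_iff e).2 fun c => ?_, W.weightProj_mem_part _ _ _⟩
    rw [he]
    exact W.bracket_weightProj _ _ _ c
  map_id x hx := by
    refine W.weightProj_eq_self (fun c => ?_) hx.2
    rw [← he]
    exact (mem_weightSpace_iff e).1 hx.1 c

open Classical in
-- The root space is the sum of the blocks `Hom(V_l', V_l)` with the right difference of weights,
-- and superdimension is multiplicative.
theorem multiplicity_gl (he : ∀ c, (e c : Matrix I I ℂ) = H c) (α : Module.Dual ℂ a) :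
    ((glSuper p).multiplicity a α : ℂ) =
      ∑ i : Λ × Λ, if W.wt i.1 - W.wt i.2 = (fun c => α (e c)) then W.sdim i.1 * W.sdim i.2
        else 0 := by
  have h : ∀ d, ((glSuper p).rootDim a d α : ℂ) = ∑ i : Λ × Λ,
      if W.wt i.1 - W.wt i.2 = (fun c => α (e c)) ∧ W.par i.1 + W.par i.2 = d then
        (W.proj i.1).trace * (W.proj i.2).trace else 0 := by
    intro d
    rw [rootDim, ← (W.isProj_gl he α d).trace, W.trace_weightProj, Fintype.sum_prod_type]
    exact Finset.sum_congr rfl fun l _ => Finset.sum_congr rfl fun l' _ => by congr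
  rw [LieSuperalgebra.multiplicity]
  push_cast
  rw [h, h, sum_even_sub_odd (fun i : Λ × Λ => W.wt i.1 - W.wt i.2 = fun c => α (e c))
    (fun i => W.par i.1 + W.par i.2) (fun i => (W.proj i.1).trace * (W.proj i.2).trace)]
  refine Finset.sum_congr rfl fun i _ => ?_
  rw [koszul_add_self, sdim, sdim]
  split_ifs
  · ring
  · rfl

theorem reductive_gl (W : WeightDecomposition p H Λ) (he : ∀ c, (e c : Matrix I I ℂ) = H c) :
    ⨆ α : Module.Dual ℂ a, (glSuper p).weightSpace a α = ⊤ := by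
  rw [eq_top_iff]
  intro x _
  rw [← W.sum_sandwich x]
  refine Submodule.sum_mem _ fun l _ => Submodule.sum_mem _ fun l' _ => ?_
  refine Submodule.mem_iSup_of_mem (e.constr ℂ (W.wt l - W.wt l')) ?_
  refine (mem_weightSpace_iff e).2 fun c => ?_
  rw [he, e.constr_basis]
  exact W.bracket_sandwich c l l' x

end general

section orthosymplectic

open LieSuperalgebra

variable {F : SuperForm p} {H : C → ospSpace F}
  {W : WeightDecomposition p (fun c => (H c : Matrix I I ℂ)) Λ} {star : Λ → Λ}
  {a : Submodule ℂ (ospSpace F)} {e : Module.Basis C ℂ a}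

/-- The average `(1 + θ) / 2` projects all matrices onto `osp` and commutes with the weight
projections by self-duality, so the composite projects onto the root space of `osp`, viewed inside
the matrices. -/
theorem IsSelfDual.isProj_osp (hF : W.IsSelfDual F star) (he : ∀ c, (e c : ospSpace F) = H c)
    (α : Module.Dual ℂ a) (d : ZMod 2) :
    LinearMap.IsProj (((osp F).weightSpace a α ⊓ (osp F).part d).map (ospSpace F).subtype)
      (W.weightProj (fun c => α (e c)) d ∘ₗ ((1 / 2 : ℂ) • (LinearMap.id + F.theta))) where
  map_mem x := by
    have hfix : F.theta ((1 / 2 : ℂ) • (x + F.theta x)) = (1 / 2 : ℂ) • (x + F.theta x) := by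
      rw [map_smul, map_add, F.theta_isInvolution.involutive, add_comm]
    refine ⟨⟨W.weightProj (fun c => α (e c)) d ((1 / 2 : ℂ) • (x + F.theta x)), ?_⟩, ⟨?_, ?_⟩, rfl⟩
    · change F.theta _ = _
      rw [hF.theta_weightProj, hfix]
      rfl
    · refine (mem_weightSpace_iff e).2 fun c => Subtype.ext ?_
      rw [he]
      exact W.bracket_weightProj _ _ _ c
    · exact W.weightProj_mem_part _ _ _
  map_id := by
    rintro _ ⟨x, hx, rfl⟩
    have hfix : F.theta (x : Matrix I I ℂ) = x := x.2
    have h1 : ((1 / 2 : ℂ) • (LinearMap.id + F.theta) : Matrix I I ℂ →ₗ[ℂ] Matrix I I ℂ) x = x := by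
      change (1 / 2 : ℂ) • ((x : Matrix I I ℂ) + F.theta x) = x
      rw [hfix, ← two_smul ℂ, smul_smul]
      norm_num
    change W.weightProj _ d (((1 / 2 : ℂ) • (LinearMap.id + F.theta) : Matrix I I ℂ →ₗ[ℂ] Matrix I I ℂ) x) = x
    rw [h1]
    refine W.weightProj_eq_self (fun c => ?_) hx.2
    have := (mem_weightSpace_iff e).1 hx.1 c
    rw [he] at this
    exact congrArg Subtype.val this

open Classical in
-- Averaging over `θ` halves the `gl` contribution, and the trace of `θ` itself enters only on
-- blocks with `l = star l'`, which `θ` maps to themselves.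
theorem IsSelfDual.multiplicity_osp (hF : W.IsSelfDual F star)
    (he : ∀ c, (e c : ospSpace F) = H c) (α : Module.Dual ℂ a) :
    ((osp F).multiplicity a α : ℂ) =
      ∑ i : Λ × Λ, if W.wt i.1 - W.wt i.2 = (fun c => α (e c)) then
        1 / 2 * (W.sdim i.1 * W.sdim i.2 - if i.1 = star i.2 then W.sdim i.1 else 0) else 0 := by
  have h : ∀ d, ((osp F).rootDim a d α : ℂ) = ∑ i : Λ × Λ,
      if W.wt i.1 - W.wt i.2 = (fun c => α (e c)) ∧ W.par i.1 + W.par i.2 = d then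
        1 / 2 * ((W.proj i.1).trace * (W.proj i.2).trace -
          if i.1 = star i.2 then W.sdim i.1 else 0) else 0 := by
    intro d
    rw [rootDim, ← Submodule.finrank_map_subtype_eq, ← (hF.isProj_osp he α d).trace,
      LinearMap.comp_smul, LinearMap.comp_add, LinearMap.comp_id, map_smul, map_add,
      W.trace_weightProj, hF.trace_weightProj_theta, ← sub_eq_add_neg, ← Fintype.sum_prod_type',
      ← Fintype.sum_prod_type', ← Finset.sum_sub_distrib, smul_eq_mul, Finset.mul_sum]
    refine Finset.sum_congr rfl fun i _ => ?_
    split_ifs <;> ring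
  rw [LieSuperalgebra.multiplicity]
  push_cast
  rw [h, h, sum_even_sub_odd (fun i : Λ × Λ => W.wt i.1 - W.wt i.2 = fun c => α (e c))
    (fun i => W.par i.1 + W.par i.2)
    (fun i => 1 / 2 * ((W.proj i.1).trace * (W.proj i.2).trace -
          if i.1 = star i.2 then W.sdim i.1 else 0))]
  refine Finset.sum_congr rfl fun i _ => ?_
  rw [koszul_add_self]
  split_ifs with h1 h2
  -- When `l = star l'` both parities agree, so the block is even and its sign squares to `1`; the
  -- correction term keeps the sign already contained in `sdim`.
  · rw [h2, hF.par_star, sdim, sdim, hF.par_star]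
    have : koszul (W.par i.2) (W.par i.2) * koszul (W.par i.2) (W.par i.2) = 1 := by
      generalize W.par i.2 = u
      rcases zmod_two_cases u with rfl | rfl <;> simp [koszul]
    linear_combination (-(1 / 2 * (koszul (W.par i.2) (W.par i.2) * (W.proj (star i.2)).trace))) *
      this
  · rw [sdim, sdim]
    ring
  · rfl

/-- `θ` takes the block `(l, l')` to the block `(star l', star l)`, which has the same weight. Hence
averaging a block over `θ` produces a weight vector of `osp`, and these averages add up to the given
element. -/
theorem IsSelfDual.reductive_osp (hF : W.IsSelfDual F star)
    (he : ∀ c, (e c : ospSpace F) = H c) :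
    ⨆ α : Module.Dual ℂ a, (osp F).weightSpace a α = ⊤ := by
  rw [eq_top_iff]
  intro x _
  have hfix : F.theta (x : Matrix I I ℂ) = x := x.2
  let y : Λ → Λ → ospSpace F := fun l l' => ⟨(1 / 2 : ℂ) •
    (sandwich (W.proj l) (W.proj l') (x : Matrix I I ℂ) +
      F.theta (sandwich (W.proj l) (W.proj l') (x : Matrix I I ℂ))), by
      change F.theta _ = _
      rw [map_smul, map_add, F.theta_isInvolution.involutive, add_comm]
      rfl⟩
  have hx : x = ∑ l, ∑ l', y l l' := by
    refine Subtype.ext ?_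
    simp only [AddSubmonoidClass.coe_finsetSum, y, ← Finset.smul_sum, Finset.sum_add_distrib,
      ← map_sum, W.sum_sandwich]
    rw [hfix, ← two_smul ℂ, smul_smul]
    norm_num
  rw [hx]
  refine Submodule.sum_mem _ fun l _ => Submodule.sum_mem _ fun l' _ => ?_
  refine Submodule.mem_iSup_of_mem (e.constr ℂ (W.wt l - W.wt l')) ?_
  refine (mem_weightSpace_iff e).2 fun c => Subtype.ext ?_
  rw [he, e.constr_basis]
  change superBracket p (H c : Matrix I I ℂ) ((1 / 2 : ℂ) • (_ + _)) = _ • ((1 / 2 : ℂ) • (_ + _))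
  rw [hF.theta_sandwich, map_smul, map_add, W.bracket_sandwich c, W.bracket_sandwich c, hF.wt_star,
    hF.wt_star, smul_comm]
  simp only [Pi.neg_apply, Pi.sub_apply, smul_add, neg_sub_neg]

end orthosymplectic

section sums

open LieSuperalgebra

variable {g : Type} [AddCommGroup g] [Module ℂ g] [FiniteDimensional ℂ g] {L : LieSuperalgebra g}
  {θ : g →ₗ[ℂ] g} {a : Submodule ℂ g} {e : Module.Basis C ℂ a}

open Classical in
/-- Sums over positive restricted roots from a weighted family of weights. -/
theorem sum_multiplicity (hθ : L.IsInvolution θ) (ha : L.IsEvenCartanSubspace θ a)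
    {P : Finset (Module.Dual ℂ a)} (hP : L.IsPositiveHalf a P) {κ : Type} [Fintype κ]
    (wt : κ → C → ℂ) (m : κ → ℂ)
    (hm : ∀ α : Module.Dual ℂ a, (L.multiplicity a α : ℂ) =
      ∑ i, if wt i = (fun c => α (e c)) then m i else 0)
    {V : Type} [AddCommGroup V] [Module ℂ V] {f : (C → ℂ) → V} (hf : ∀ c, f (-c) = f c)
    (hf0 : f 0 = 0) :
    ∑ α ∈ P, (L.multiplicity a α : ℂ) • f (fun c => α (e c)) =
      (1 / 2 : ℂ) • ∑ i, m i • f (wt i) := by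
  have hwt : ∀ i (α : Module.Dual ℂ a), e.constr ℂ (wt i) = α ↔ wt i = fun c => α (e c) := by
    intro i α
    constructor
    · rintro rfl
      ext c
      rw [e.constr_basis]
    · intro h
      refine e.ext fun c => ?_
      rw [e.constr_basis, h]
  have key := sum_smul_weights hθ ha hP (fun i => e.constr ℂ (wt i)) m
    (fun α _ => by rw [hm, Finset.sum_filter]; simp only [hwt])
    (fun α => f fun c => α (e c)) hf0
  have h1 : ∀ i, (fun c => e.constr ℂ (wt i) (e c)) = wt i := fun i => by
    ext c
    rw [e.constr_basis]
  simp only [h1] at key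
  rw [key, Finset.smul_sum]
  refine Finset.sum_congr rfl fun α _ => ?_
  have h2 : f (fun c => (-α) (e c)) = f fun c => α (e c) := hf fun c => α (e c)
  -- The family runs over roots of both signs and `f` is even, so each positive root has been
  -- counted twice.
  rw [h2, ← two_smul ℂ, smul_smul, smul_smul]
  congr 1
  ring

end sums

end WeightDecomposition

/-! ### Tripotent families -/

section tripotent

variable {I : Type} [Fintype I] [DecidableEq I] {p : I → ZMod 2} {C : Type} [Fintype C]
  [DecidableEq C]

theorem sum_zmod_two {M : Type*} [AddCommMonoid M] (f : ZMod 2 → M) : ∑ d, f d = f 0 + f 1 :=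
  Fin.sum_univ_two f

/-- The projection to the part of parity `d` of the superspace. -/
def parityProj (p : I → ZMod 2) (d : ZMod 2) : Matrix I I ℂ :=
  Matrix.diagonal fun i => if p i = d then 1 else 0

theorem sum_parityProj (p : I → ZMod 2) : ∑ d, parityProj p d = 1 := by
  ext i j
  rw [sum_zmod_two, Matrix.add_apply, parityProj, parityProj, Matrix.diagonal_apply,
    Matrix.diagonal_apply, Matrix.one_apply]
  rcases zmod_two_cases (p i) with h | h <;> simp [h]

theorem parityProj_mul_self (p : I → ZMod 2) (d d' : ZMod 2) :
    parityProj p d * parityProj p d' = if d = d' then parityProj p d else 0 := by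
  ext i j
  rw [parityProj, parityProj, Matrix.diagonal_mul_diagonal, Matrix.diagonal_apply]
  by_cases h : d = d'
  · subst h
    rw [if_pos rfl, Matrix.diagonal_apply]
    split_ifs <;> simp
  · by_cases h' : p i = d
    · simp [h, h']
    · simp [h, h']

/-- Matrices `H c` with `H c ^ 3 = H c` and `H c * H c' = 0` for `c ≠ c'`, each acting on the part
of parity `par c` of the superspace. -/
structure IsTripotentFamily (p : I → ZMod 2) (H : C → Matrix I I ℂ) (par : C → ZMod 2) : Prop where
  mul_of_ne : ∀ {c c'}, c ≠ c' → H c * H c' = 0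
  cube : ∀ c, H c * (H c * H c) = H c
  support : ∀ c i j, H c i j ≠ 0 → p i = par c ∧ p j = par c

namespace IsTripotentFamily

variable {H : C → Matrix I I ℂ} {par : C → ZMod 2} (hH : IsTripotentFamily p H par)

theorem sq_mul (hH : IsTripotentFamily p H par) (c c' : C) :
    H c * H c * H c' = if c = c' then H c else 0 := by
  split_ifs with h
  · rw [← h, mul_assoc, hH.cube]
  · rw [mul_assoc, hH.mul_of_ne h, mul_zero]

theorem mul_sq (hH : IsTripotentFamily p H par) (c c' : C) :
    H c * (H c' * H c') = if c = c' then H c else 0 := by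
  split_ifs with h
  · rw [← h, hH.cube]
  · rw [← mul_assoc, hH.mul_of_ne h, zero_mul]

theorem sq_mul_sq (hH : IsTripotentFamily p H par) (c c' : C) :
    H c * H c * (H c' * H c') = if c = c' then H c * H c else 0 := by
  rw [mul_assoc, hH.mul_sq]
  split_ifs <;> simp

theorem mul_eq (hH : IsTripotentFamily p H par) (c c' : C) :
    H c * H c' = if c = c' then H c * H c else 0 := by
  split_ifs with h
  · rw [h]
  · exact hH.mul_of_ne h

theorem parityProj_mul (hH : IsTripotentFamily p H par) (d : ZMod 2) (c : C) :
    parityProj p d * H c = if par c = d then H c else 0 := by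
  ext i j
  rw [parityProj, Matrix.diagonal_mul]
  by_cases h : H c i j = 0
  · split_ifs <;> simp [h]
  · rw [(hH.support c i j h).1]
    split_ifs <;> simp

theorem mul_parityProj (hH : IsTripotentFamily p H par) (d : ZMod 2) (c : C) :
    H c * parityProj p d = if par c = d then H c else 0 := by
  ext i j
  rw [parityProj, Matrix.mul_diagonal]
  by_cases h : H c i j = 0
  · split_ifs <;> simp [h]
  · rw [(hH.support c i j h).2]
    split_ifs <;> simp

theorem support_sq (hH : IsTripotentFamily p H par) (c : C) (i j : I) (h : (H c * H c) i j ≠ 0) :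
    p i = par c ∧ p j = par c := by
  rw [Matrix.mul_apply] at h
  obtain ⟨k, _, hk⟩ := Finset.exists_ne_zero_of_sum_ne_zero h
  exact ⟨(hH.support c i k (left_ne_zero_of_mul hk)).1,
    (hH.support c k j (right_ne_zero_of_mul hk)).2⟩

/-- The projection to the common kernel of the `H c` in parity `d`. -/
def kerProj (_ : IsTripotentFamily p H par) (d : ZMod 2) : Matrix I I ℂ :=
  parityProj p d - ∑ c, if par c = d then H c * H c else 0

theorem kerProj_mul (d : ZMod 2) (c : C) : hH.kerProj d * H c = 0 := by
  rw [kerProj, sub_mul, hH.parityProj_mul, Finset.sum_mul, Finset.sum_eq_single c]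
  · split_ifs
    · rw [hH.sq_mul, if_pos rfl, sub_self]
    · simp
  · intro c' _ h
    split_ifs
    · rw [hH.sq_mul, if_neg h]
    · exact zero_mul _
  · simp

theorem mul_kerProj (d : ZMod 2) (c : C) : H c * hH.kerProj d = 0 := by
  rw [kerProj, mul_sub, hH.mul_parityProj, Finset.mul_sum, Finset.sum_eq_single c]
  · split_ifs
    · rw [hH.mul_sq, if_pos rfl, sub_self]
    · simp
  · intro c' _ h
    split_ifs
    · rw [hH.mul_sq, if_neg (Ne.symm h)]
    · exact mul_zero _
  · simp

theorem kerProj_mul_self (d d' : ZMod 2) :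
    hH.kerProj d * hH.kerProj d' = if d = d' then hH.kerProj d else 0 := by
  have h1 : hH.kerProj d * hH.kerProj d' = hH.kerProj d * parityProj p d' := by
    conv_lhs => rw [kerProj.eq_1 hH d']
    rw [mul_sub, Finset.mul_sum, Finset.sum_eq_zero, sub_zero]
    intro c _
    split_ifs
    · rw [← mul_assoc, hH.kerProj_mul, zero_mul]
    · exact mul_zero _
  rw [h1, kerProj, sub_mul, parityProj_mul_self, Finset.sum_mul]
  split_ifs with h
  · congr 1
    refine Finset.sum_congr rfl fun c _ => ?_
    split_ifs with h'
    · rw [mul_assoc, hH.mul_parityProj, if_pos (h'.trans h)]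
    · exact zero_mul _
  · rw [Finset.sum_eq_zero, sub_zero]
    intro c _
    split_ifs with h'
    · rw [mul_assoc, hH.mul_parityProj, if_neg fun h'' => h (h'.symm.trans h''), mul_zero]
    · exact zero_mul _

/-- The sign of a Boolean. -/
def boolSign (b : Bool) : ℂ := if b then 1 else -1

theorem boolSign_not (b : Bool) : boolSign (!b) = -boolSign b := by cases b <;> simp [boolSign]

/-- The weight decomposition defined by a tripotent family: `H c` has eigenvalues `1`, `-1`, `0`. -/
def decomposition : WeightDecomposition p H ((C × Bool) ⊕ ZMod 2) where
  proj := Sum.elim (fun l => (1 / 2 : ℂ) • (H l.1 * H l.1 + boolSign l.2 • H l.1)) hH.kerProj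
  par := Sum.elim (fun l => par l.1) id
  wt := Sum.elim (fun l => boolSign l.2 • coordForm l.1) 0
  sum_proj := by
    rw [Fintype.sum_sum_type, Fintype.sum_prod_type]
    have h1 : ∀ c, ∑ b, (1 / 2 : ℂ) • (H c * H c + boolSign b • H c) = H c * H c := by
      intro c
      rw [Fintype.sum_bool, ← smul_add]
      simp only [boolSign, if_true, Bool.false_eq_true, if_false]
      module
    have h2 : ∑ d, hH.kerProj d = 1 - ∑ c, H c * H c := by
      simp only [kerProj]
      rw [Finset.sum_sub_distrib, sum_parityProj, Finset.sum_comm]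
      simp
    simp only [Sum.elim_inl, Sum.elim_inr]
    rw [Finset.sum_congr rfl fun c _ => h1 c, h2, add_sub_cancel]
  proj_mul := by
    rintro (⟨c, b⟩ | d) (⟨c', b'⟩ | d')
    · simp only [Sum.elim_inl, smul_mul_assoc, mul_smul_comm, add_mul, mul_add, hH.sq_mul_sq,
        hH.sq_mul, hH.mul_sq, hH.mul_eq c c', Sum.inl.injEq, Prod.mk.injEq]
      by_cases hc : c = c'
      · subst hc
        simp only [if_true, true_and]
        cases b <;> cases b' <;> simp only [boolSign, if_true, Bool.false_eq_true, if_false,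
          reduceCtorEq] <;> module
      · simp [hc]
    · simp only [Sum.elim_inl, Sum.elim_inr, smul_mul_assoc, add_mul, mul_assoc, hH.mul_kerProj,
        mul_zero, smul_zero, add_zero, reduceCtorEq, if_false]
    · simp only [Sum.elim_inl, Sum.elim_inr, mul_smul_comm, mul_add, ← mul_assoc, hH.kerProj_mul,
        zero_mul, smul_zero, add_zero, reduceCtorEq, if_false]
    · simp only [Sum.elim_inr, hH.kerProj_mul_self, Sum.inr.injEq]
  mul_proj := by
    rintro c (⟨c', b⟩ | d)
    · simp only [Sum.elim_inl, Pi.smul_apply, coordForm, mul_smul_comm, mul_add, hH.mul_sq,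
        hH.mul_eq c c']
      by_cases hc : c = c'
      · subst hc
        cases b <;> simp [boolSign] <;> module
      · simp [hc]
    · simp [hH.mul_kerProj]
  proj_mul_vec := by
    rintro c (⟨c', b⟩ | d)
    · simp only [Sum.elim_inl, Pi.smul_apply, coordForm, smul_mul_assoc, add_mul, hH.sq_mul,
        hH.mul_eq c' c]
      by_cases hc : c' = c
      · subst hc
        cases b <;> simp [boolSign] <;> module
      · simp [hc, Ne.symm hc]
    · simp [hH.kerProj_mul]
  support := by
    rintro (⟨c, b⟩ | d) i j h
    · by_contra h'
      have h1 : (H c * H c) i j = 0 := by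
        by_contra h0
        exact h' (hH.support_sq c i j h0)
      have h2 : H c i j = 0 := by
        by_contra h0
        exact h' (hH.support c i j h0)
      exact h (by simp [h1, h2])
    · by_contra h'
      refine h ?_
      simp only [Sum.elim_inr, kerProj, Matrix.sub_apply, parityProj, Matrix.sum_apply]
      have h1 : Matrix.diagonal (fun i => if p i = d then (1 : ℂ) else 0) i j = 0 := by
        rw [Matrix.diagonal_apply]
        split_ifs with hij hd
        · exact absurd ⟨hd, hij ▸ hd⟩ h'
        · rfl
        · rfl
      rw [h1, Finset.sum_eq_zero, sub_zero]
      intro c _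
      split_ifs with hc
      · by_contra h0
        exact h' (hc ▸ hH.support_sq c i j h0)
      · rfl

/-- The duality of the weights. -/
def star : (C × Bool) ⊕ ZMod 2 → (C × Bool) ⊕ ZMod 2 := Sum.map (fun l => (l.1, !l.2)) id

theorem SuperForm.theta_parityProj (F : SuperForm p) (d : ZMod 2) :
    F.theta (parityProj p d) = -parityProj p d := by
  ext i j
  rw [F.theta_apply, parityProj, Matrix.neg_apply, Matrix.diagonal_apply, Matrix.diagonal_apply,
    F.parity]
  by_cases h : i = j
  · subst h
    rw [if_pos rfl, if_pos rfl, CharTwo.add_self_eq_zero, F.ε_sq,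
      show koszul 0 (p i) = 1 by simp [koszul]]
    ring
  · rw [if_neg h, if_neg fun h' => h (F.bijective.injective h').symm]
    ring

theorem mem_matrixPart (hH : IsTripotentFamily p H par) (c : C) : H c ∈ matrixPart p 0 :=
  hH.decomposition.vec_even c

/-- From `θ(H) = H` and the product rule `θ(H²) = -H²`, so up to a sign `θ` interchanges the
spectral projections of `H` for `1` and `-1`. -/
theorem isSelfDual {F : SuperForm p} (hF : ∀ c, F.theta (H c) = H c) :
    hH.decomposition.IsSelfDual F star where
  star_star := by rintro (⟨c, b⟩ | d) <;> simp [star]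
  wt_star := by
    rintro (⟨c, b⟩ | d)
    · simp [star, decomposition, boolSign_not]
    · simp [star, decomposition]
  par_star := by rintro (⟨c, b⟩ | d) <;> rfl
  theta_proj := by
    have h2 : ∀ c, F.theta (H c * H c) = -(H c * H c) := fun c => by
      rw [F.theta_mul_of_even_left (hH.mem_matrixPart c), hF]
    rintro (⟨c, b⟩ | d)
    · change F.theta ((1 / 2 : ℂ) • (H c * H c + boolSign b • H c)) =
        -((1 / 2 : ℂ) • (H c * H c + boolSign (!b) • H c))
      rw [map_smul, map_add, map_smul, h2, hF, boolSign_not]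
      module
    · change F.theta (hH.kerProj d) = -hH.kerProj d
      rw [kerProj, map_sub, map_sum, SuperForm.theta_parityProj, neg_sub', ← Finset.sum_neg_distrib]
      congr 1
      refine Finset.sum_congr rfl fun c _ => ?_
      split_ifs
      · exact h2 c
      · rw [map_zero, neg_zero]

/-- As `str(H) = 0`, the eigenspaces for `1` and `-1` have the same superdimension, namely half of
`str(H²)`. -/
theorem sdim_inl (h0 : ∀ c, superTrace p (H c) = 0) (l : C × Bool) :
    hH.decomposition.sdim (Sum.inl l) = 1 / 2 * superTrace p (H l.1 * H l.1) := by
  rw [← WeightDecomposition.superTrace_proj]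
  change superTrace p ((1 / 2 : ℂ) • (H l.1 * H l.1 + boolSign l.2 • H l.1)) = _
  rw [map_smul, map_add, map_smul, h0, smul_zero, add_zero, smul_eq_mul]

theorem sum_sdim_inr :
    ∑ d, hH.decomposition.sdim (Sum.inr d) =
      superTrace p 1 - ∑ c, superTrace p (H c * H c) := by
  simp only [← WeightDecomposition.superTrace_proj]
  change ∑ d, superTrace p (hH.kerProj d) = _
  simp only [kerProj, map_sub, map_sum]
  rw [Finset.sum_sub_distrib, ← map_sum, sum_parityProj, Finset.sum_comm]
  congr 1
  refine Finset.sum_congr rfl fun c _ => ?_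
  simp [apply_ite (superTrace p)]

section sums

variable {V : Type} [AddCommGroup V] [Module ℂ V] {f : (C → ℂ) → V} {σ : C → ℂ} {τ : ZMod 2 → ℂ}

/-- The weights are `±x_c` and `0`. Among the four sign choices for a pair `c`, `c'`, evenness of
`f` identifies two with `x_c - x_c'` and two with `x_c + x_c'`. Each `x_c` meets the zero weights in
four ways, and differences of zero weights contribute `f 0 = 0`. -/
theorem sum_weights (hf : ∀ c, f (-c) = f c) (hf0 : f 0 = 0) {S : (C × Bool) ⊕ ZMod 2 → ℂ}
    (hσ : ∀ l, S (Sum.inl l) = σ l.1) {s₀ : ℂ} (hs : ∑ d, S (Sum.inr d) = s₀) :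
    ∑ i : ((C × Bool) ⊕ ZMod 2) × ((C × Bool) ⊕ ZMod 2), (S i.1 * S i.2) •
        f (hH.decomposition.wt i.1 - hH.decomposition.wt i.2) =
      (2 : ℂ) • ∑ c, ∑ c', (σ c * σ c') •
        (f (coordForm c - coordForm c') + f (coordForm c + coordForm c')) +
      (4 : ℂ) • ∑ c, (s₀ * σ c) • f (coordForm c) := by
  have hwl : ∀ l, hH.decomposition.wt (Sum.inl l) = boolSign l.2 • coordForm l.1 := fun _ => rfl
  have hwr : ∀ d, hH.decomposition.wt (Sum.inr d) = 0 := fun _ => rfl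
  have e1 : ∀ c c' : C → ℂ, f (-c - c') = f (c + c') := fun c c' => by
    rw [← hf (c + c'), neg_add, sub_eq_add_neg]
  have e2 : ∀ c c' : C → ℂ, f (-c + c') = f (c - c') := fun c c' => by
    rw [← hf (c - c'), neg_sub, sub_eq_add_neg, add_comm]
  have hsum : s₀ = S (Sum.inr 0) + S (Sum.inr 1) := by rw [← hs, sum_zmod_two]
  rw [Fintype.sum_prod_type, Fintype.sum_sum_type, Fintype.sum_prod_type, sum_zmod_two]
  simp only [Fintype.sum_sum_type, Fintype.sum_prod_type, Fintype.sum_bool, hσ, hwl, hwr,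
    sum_zmod_two, boolSign, if_true, Bool.false_eq_true, if_false, one_smul, neg_smul, sub_zero,
    zero_sub, sub_neg_eq_add, hf, hf0, smul_zero, add_zero, e1, e2]
  have e3 : ∀ d c, (S (Sum.inr d) * σ c) • f (coordForm c) =
      (σ c * S (Sum.inr d)) • f (coordForm c) := fun d c => by rw [mul_comm]
  simp only [hsum, add_mul, add_smul, smul_add, Finset.sum_add_distrib, e3]
  module

end sums

end IsTripotentFamily

end tripotent

open LieSuperalgebra

/-! ### Even Cartan subspaces from weight decompositions -/

section cartan

variable {I : Type} [Fintype I] [DecidableEq I] {p : I → ZMod 2} {C Λ : Type} [Fintype C]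
  [DecidableEq C] [Fintype Λ] [DecidableEq Λ]

theorem LieSuperalgebra.bracket_eq_zero_of_mem_span {g : Type*} [AddCommGroup g] [Module ℂ g]
    {L : LieSuperalgebra g} {ι : Type*} {H : ι → g} (h : ∀ i j, L.bracket (H i) (H j) = 0) {x y : g}
    (hx : x ∈ Submodule.span ℂ (Set.range H)) (hy : y ∈ Submodule.span ℂ (Set.range H)) :
    L.bracket x y = 0 := by
  induction hx, hy using Submodule.span_induction₂ with
  | mem_mem x y hx hy =>
    obtain ⟨i, rfl⟩ := hx
    obtain ⟨j, rfl⟩ := hy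
    exact h i j
  | zero_left y hy => simp
  | zero_right x hx => simp
  | add_left x y z _ _ _ h1 h2 => simp [h1, h2]
  | add_right x y z _ _ _ h1 h2 => simp [h1, h2]
  | smul_left r x y _ _ h1 => simp [h1]
  | smul_right r x y _ _ h1 => simp [h1]

theorem neg_of_mem_span {g : Type*} [AddCommGroup g] [Module ℂ g] {θ : g →ₗ[ℂ] g} {ι : Type*}
    {H : ι → g} (h : ∀ i, θ (H i) = -H i) {x : g} (hx : x ∈ Submodule.span ℂ (Set.range H)) :
    θ x = -x := by
  have hle : Submodule.span ℂ (Set.range H) ≤ LinearMap.eqLocus θ (-LinearMap.id) :=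
    Submodule.span_le.2 (by rintro _ ⟨i, rfl⟩; exact h i)
  exact hle hx

theorem WeightDecomposition.isEvenCartanSubspace_gl {H : C → Matrix I I ℂ}
    (W : WeightDecomposition p H Λ) {θ : Matrix I I ℂ →ₗ[ℂ] Matrix I I ℂ}
    (hneg : ∀ c, θ (H c) = -H c)
    (hcent : ∀ x, θ x = -x → (∀ c, H c * x = x * H c) → x ∈ Submodule.span ℂ (Set.range H))
    {e : Module.Basis C ℂ (Submodule.span ℂ (Set.range H))} (he : ∀ c, (e c : Matrix I I ℂ) = H c) :
    (glSuper p).IsEvenCartanSubspace θ (Submodule.span ℂ (Set.range H)) where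
  even := Submodule.span_le.2 (by rintro _ ⟨c, rfl⟩; exact W.vec_even c)
  neg x hx := neg_of_mem_span hneg hx
  comm x hx y hy := bracket_eq_zero_of_mem_span (fun c c' => by
    change superBracket p (H c) (H c') = 0
    rw [superBracket_of_even (W.vec_even c), W.vec_comm c c', sub_self]) hx hy
  centralizer x hx h := by
    refine hcent x hx fun c => ?_
    have h1 : superBracket p (H c) x = 0 := h (H c) (Submodule.subset_span ⟨c, rfl⟩)
    rwa [superBracket_of_even (W.vec_even c), sub_eq_zero] at h1
  reductive := W.reductive_gl he

theorem WeightDecomposition.IsSelfDual.isEvenCartanSubspace_osp {F : SuperForm p}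
    {H : C → ospSpace F} {W : WeightDecomposition p (fun c => (H c : Matrix I I ℂ)) Λ}
    {star : Λ → Λ} (hF : W.IsSelfDual F star) {θ : ospSpace F →ₗ[ℂ] ospSpace F}
    (hneg : ∀ c, θ (H c) = -H c)
    (hcent : ∀ x, θ x = -x → (∀ c, (H c : Matrix I I ℂ) * x = x * H c) →
      x ∈ Submodule.span ℂ (Set.range H))
    {e : Module.Basis C ℂ (Submodule.span ℂ (Set.range H))} (he : ∀ c, (e c : ospSpace F) = H c) :
    (osp F).IsEvenCartanSubspace θ (Submodule.span ℂ (Set.range H)) where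
  even := Submodule.span_le.2 (by rintro _ ⟨c, rfl⟩; exact W.vec_even c)
  neg x hx := neg_of_mem_span hneg hx
  comm x hx y hy := bracket_eq_zero_of_mem_span (fun c c' => Subtype.ext (by
    change superBracket p (H c : Matrix I I ℂ) (H c') = 0
    rw [superBracket_of_even (W.vec_even c), W.vec_comm c c', sub_self])) hx hy
  centralizer x hx h := by
    refine hcent x hx fun c => ?_
    have h1 : superBracket p (H c : Matrix I I ℂ) x = 0 :=
      congrArg Subtype.val (h (H c) (Submodule.subset_span ⟨c, rfl⟩))
    rwa [superBracket_of_even (W.vec_even c), sub_eq_zero] at h1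
  reductive := hF.reductive_osp he

end cartan

namespace IsTripotentFamily

/-! ### Root sums of tripotent families -/

section rootSums

variable {I : Type} [Fintype I] [DecidableEq I] {p : I → ZMod 2} {C : Type} [Fintype C]
  [DecidableEq C] {par : C → ZMod 2}

/-- Duality pairs the eigenvalues `1` and `-1` of the same `H c`, so the difference of weights is
`±2 x_c`; this is the source of the parameter `β`. -/
theorem sum_star {H : C → Matrix I I ℂ} (hH : IsTripotentFamily p H par) {V : Type}
    [AddCommGroup V] [Module ℂ V] {f : (C → ℂ) → V} {σ : C → ℂ} (hf : ∀ c, f (-c) = f c)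
    (hf0 : f 0 = 0) {S : (C × Bool) ⊕ ZMod 2 → ℂ} (hσ : ∀ l, S (Sum.inl l) = σ l.1) :
    ∑ i : ((C × Bool) ⊕ ZMod 2) × ((C × Bool) ⊕ ZMod 2), (if i.1 = star i.2 then S i.1 else 0) •
        f (hH.decomposition.wt i.1 - hH.decomposition.wt i.2) =
      (2 : ℂ) • ∑ c, σ c • f (coordForm c + coordForm c) := by
  have h1 : ∀ c b, f (hH.decomposition.wt (star (Sum.inl (c, b))) -
      hH.decomposition.wt (Sum.inl (c, b))) = f (coordForm c + coordForm c) := by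
    intro c b
    change f (boolSign (!b) • coordForm c - boolSign b • coordForm c) = _
    cases b
    · simp [boolSign]
    · rw [← hf]
      simp [boolSign]
  have h2 : ∀ d, f (hH.decomposition.wt (star (Sum.inr d)) - hH.decomposition.wt (Sum.inr d)) =
      0 := fun d => by
    change f (0 - 0) = 0
    rw [sub_zero, hf0]
  simp only [ite_smul, zero_smul]
  rw [Fintype.sum_prod_type, Finset.sum_comm]
  simp only [Finset.sum_ite_eq', Finset.mem_univ, if_true]
  rw [Fintype.sum_sum_type, Fintype.sum_prod_type]
  have h3 : ∀ c b, S (star (Sum.inl (c, b))) = σ c := fun c b => hσ (c, !b)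
  simp only [h1, h2, h3, smul_zero, Finset.sum_const_zero, add_zero, Fintype.sum_bool,
    Finset.smul_sum]
  exact Finset.sum_congr rfl fun c _ => (two_smul ℂ _).symm

variable {k a₀ β s : ℂ} {w : C → ℂ}

/-- The eigenspaces of `H c` have superdimension `s w_c`. Products of two of them give `s² w_c w_c'
= -k w_c w_c'`, and products with the common kernel give the multiplicity of `x_c`. The forms `2
x_c` come only from diagonal pairs, so `β = 0`. -/
theorem isRootSumBC_gl {H : C → Matrix I I ℂ} (hH : IsTripotentFamily p H par)
    {a : Submodule ℂ (Matrix I I ℂ)} {θ : Matrix I I ℂ →ₗ[ℂ] Matrix I I ℂ}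
    {e : Module.Basis C ℂ a} (he : ∀ c, (e c : Matrix I I ℂ) = H c)
    (hθ : (glSuper p).IsInvolution θ) (ha : (glSuper p).IsEvenCartanSubspace θ a)
    {P : Finset (Module.Dual ℂ a)} (hP : (glSuper p).IsPositiveHalf a P)
    (h0 : ∀ c, superTrace p (H c) = 0) (hw : ∀ c, superTrace p (H c * H c) = 2 * s * w c)
    (hk : s * s = -k) (ha₀ : a₀ = 2 * s * (superTrace p 1 - ∑ c, superTrace p (H c * H c))) :
    (glSuper p).IsRootSumBC e P k a₀ 0 w := by
  intro V _ _ f hf hf0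
  classical
  rw [WeightDecomposition.sum_multiplicity hθ ha hP
    (fun i : ((C × Bool) ⊕ ZMod 2) × ((C × Bool) ⊕ ZMod 2) =>
      hH.decomposition.wt i.1 - hH.decomposition.wt i.2)
    (fun i => hH.decomposition.sdim i.1 * hH.decomposition.sdim i.2)
    (fun α => by convert hH.decomposition.multiplicity_gl he α) hf hf0,
    hH.sum_weights hf hf0 (σ := fun c => s * w c)
      (fun l => by rw [hH.sdim_inl h0, hw]; ring) hH.sum_sdim_inr, smul_add, smul_smul, smul_smul,
    Finset.smul_sum, Finset.smul_sum]
  congr 1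
  · refine Finset.sum_congr rfl fun i _ => ?_
    rw [Finset.smul_sum]
    refine Finset.sum_congr rfl fun j _ => ?_
    rw [smul_smul, ← hk]
    congr 1
    ring
  · refine Finset.sum_congr rfl fun i _ => ?_
    rw [smul_smul, zero_mul, zero_smul, add_zero, ha₀]
    congr 1
    ring

/-- Compared with `gl`, all products are halved, and the trace of `θ` adds `-s w_c / 2` to the
multiplicity of `2 x_c`, which is the value of `β`. -/
theorem isRootSumBC_osp {F : SuperForm p} {H : C → ospSpace F}
    (hH : IsTripotentFamily p (fun c => (H c : Matrix I I ℂ)) par)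
    {a : Submodule ℂ (ospSpace F)} {θ : ospSpace F →ₗ[ℂ] ospSpace F}
    {e : Module.Basis C ℂ a} (he : ∀ c, (e c : ospSpace F) = H c)
    (hθ : (osp F).IsInvolution θ) (ha : (osp F).IsEvenCartanSubspace θ a)
    {P : Finset (Module.Dual ℂ a)} (hP : (osp F).IsPositiveHalf a P)
    (h0 : ∀ c, superTrace p (H c : Matrix I I ℂ) = 0)
    (hw : ∀ c, superTrace p ((H c : Matrix I I ℂ) * H c) = 2 * s * w c)
    (hk : 1 / 2 * (s * s) = -k)
    (ha₀ : a₀ = s * (superTrace p 1 - ∑ c, superTrace p ((H c : Matrix I I ℂ) * H c)))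
    (hβ : β = -(1 / 2) * s) :
    (osp F).IsRootSumBC e P k a₀ β w := by
  intro V _ _ f hf hf0
  classical
  have hd := hH.isSelfDual (F := F) fun c => (H c).2
  have hσ : ∀ l, hH.decomposition.sdim (Sum.inl l) = s * w l.1 := fun l => by
    rw [hH.sdim_inl h0, hw]; ring
  rw [WeightDecomposition.sum_multiplicity hθ ha hP
    (fun i : ((C × Bool) ⊕ ZMod 2) × ((C × Bool) ⊕ ZMod 2) =>
      hH.decomposition.wt i.1 - hH.decomposition.wt i.2)
    (fun i => 1 / 2 * (hH.decomposition.sdim i.1 * hH.decomposition.sdim i.2 -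
      if i.1 = star i.2 then hH.decomposition.sdim i.1 else 0))
    (fun α => by convert hd.multiplicity_osp he α) hf hf0]
  simp only [mul_smul (1 / 2 : ℂ), sub_smul, ← Finset.smul_sum, Finset.sum_sub_distrib]
  rw [hH.sum_weights hf hf0 (σ := fun c => s * w c) hσ hH.sum_sdim_inr,
    hH.sum_star hf hf0 (σ := fun c => s * w c) hσ, Finset.sum_add_distrib, ← add_assoc,
    smul_smul, smul_sub, smul_add, smul_smul, smul_smul, smul_smul, sub_eq_add_neg, ← neg_smul]
  congr 1
  · congr 1
    · rw [Finset.smul_sum]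
      refine Finset.sum_congr rfl fun i _ => ?_
      rw [Finset.smul_sum]
      refine Finset.sum_congr rfl fun j _ => ?_
      rw [smul_smul, ← hk]
      congr 1
      ring
    · rw [Finset.smul_sum]
      refine Finset.sum_congr rfl fun i _ => ?_
      rw [smul_smul, ha₀]
      congr 1
      ring
  · rw [Finset.smul_sum]
    refine Finset.sum_congr rfl fun i _ => ?_
    rw [smul_smul, hβ]
    congr 1
    ring

end rootSums

end IsTripotentFamily

/-! ### Radial parts of tripotent families -/

section wrappers

variable {I : Type} [Fintype I] [DecidableEq I] {p : I → ZMod 2} {n m : ℕ}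
  {par : Fin n ⊕ Fin m → ZMod 2} {d : I → ℂ} {k a₀ β s κ p₀ q₀ r₀ s₀ : ℂ}

/-- A diagonal sign matrix does not change diagonal entries under conjugation, so if the matrix is
negated these entries vanish. -/
theorem superTrace_eq_zero_of_signConj (hd : ∀ i, d i * d i = 1) {x : Matrix I I ℂ}
    (hx : signConj d x = -x) : superTrace p x = 0 := by
  rw [superTrace_apply]
  refine Finset.sum_eq_zero fun i _ => ?_
  have h := congrFun (congrFun hx i) i
  rw [signConj_apply, hd, one_mul, Matrix.neg_apply, self_eq_neg] at h
  rw [h, mul_zero]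

theorem IsTripotentFamily.strForm_eq {C : Type} [DecidableEq C] {par : C → ZMod 2}
    {H : C → Matrix I I ℂ} (hH : IsTripotentFamily p H par) {w : C → ℂ}
    (hw : ∀ c, superTrace p (H c * H c) = 2 * s * w c) (hκ : κ * (2 * s) = 1) (i j : C) :
    strForm p κ (H i) (H j) = if i = j then w i else 0 := by
  change κ * superTrace p (H i * H j) = _
  split_ifs with h
  · rw [← h, hw]
    linear_combination w i * hκ
  · rw [hH.mul_of_ne h, map_zero, mul_zero]

theorem sum_cmsWeight (k : ℂ) : ∑ c : Fin n ⊕ Fin m, cmsWeight k c = n + m * k⁻¹ := by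
  simp [cmsWeight]

/-- The parameter `s` is the superdimension of the `±1` eigenspaces attached to an `x` coordinate,
and `κ = 1 / (2s)` normalises the form so that the `H c` are orthogonal with squares `1` and `k⁻¹`.
The bracket in `ha₀` is the superdimension of the common kernel. -/
theorem IsTripotentFamily.hasConjugateRadialPart_gl {H : Fin n ⊕ Fin m → Matrix I I ℂ}
    (hH : IsTripotentFamily p H par) (hd : ∀ i, d i * d i = 1)
    (hneg : ∀ c, signConj d (H c) = -H c)
    (hcent : ∀ x, signConj d x = -x → (∀ c, H c * x = x * H c) →
      x ∈ Submodule.span ℂ (Set.range H))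
    (hw : ∀ c, superTrace p (H c * H c) = 2 * s * cmsWeight k c) (hκ : κ * (2 * s) = 1)
    (hk : s * s = -k) (ha₀ : a₀ = 2 * s * (superTrace p 1 - 2 * s * (n + m * k⁻¹)))
    (hp : p₀ = -a₀ / 2) (hq : q₀ = k / 2) (hr : r₀ = -a₀ / (2 * k)) (hs : s₀ = 1 / (2 * k)) :
    (glSuper p).HasConjugateRadialPart (signConj d) (strForm p κ) H
      (fun _ _ _ E => cmsBC n m k p₀ q₀ r₀ s₀ E) := by
  have hs0 : s ≠ 0 := fun h => by simp [h] at hκ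
  have hk0 : k ≠ 0 := fun h => hs0 (by simpa [h] using hk)
  have hκ0 : κ ≠ 0 := fun h => by simp [h] at hκ
  have hB := hH.strForm_eq hw hκ
  have hli := linearIndependent_of_gram (fun i => cmsWeight_ne_zero hk0 i) hB
  have he : ∀ c, (Module.Basis.span hli c : Matrix I I ℂ) = H c :=
    fun c => congrArg Subtype.val (Module.Basis.span_apply hli c)
  have hBe : ∀ i j, strForm p κ (Module.Basis.span hli i : Matrix I I ℂ)
      (Module.Basis.span hli j : Matrix I I ℂ) = if i = j then cmsWeight k i else 0 := fun i j => by
    rw [he, he, hB]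
  have hθ := signConj_isInvolution (p := p) hd
  have ha := hH.decomposition.isEvenCartanSubspace_gl hneg hcent he
  refine ⟨hθ, strForm_isInvariantForm κ, strForm_signConj hd κ, strForm_nondegenerate hκ0, ha,
    nondegenerate_of_gram _ (fun i => cmsWeight_ne_zero hk0 i) hBe, Module.Basis.span hli, he,
    fun P hP => ?_⟩
  refine IsRootSumBC.isConjugate hP (a₀ := a₀) (β := 0) hk0 hp (by rw [hq]; ring) hr
    (by rw [hs]; ring) (hH.isRootSumBC_gl he hθ ha hP
      (fun c => superTrace_eq_zero_of_signConj hd (hneg c)) hw hk ?_) hBe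
  rw [ha₀, Finset.sum_congr rfl fun c _ => hw c, ← Finset.mul_sum, sum_cmsWeight]

theorem IsTripotentFamily.hasConjugateRadialPart_osp {F : SuperForm p}
    {H : Fin n ⊕ Fin m → ospSpace F}
    (hH : IsTripotentFamily p (fun c => (H c : Matrix I I ℂ)) par) (hd : ∀ i, d i * d i = 1)
    (hdF : ∀ i j, d (F.τ j) * d (F.τ i) = d i * d j)
    (hneg : ∀ c, signConj d (H c : Matrix I I ℂ) = -H c)
    (hcent : ∀ x : ospSpace F, signConj d (x : Matrix I I ℂ) = -x →
      (∀ c, (H c : Matrix I I ℂ) * x = x * H c) → x ∈ Submodule.span ℂ (Set.range H))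
    (hw : ∀ c, superTrace p ((H c : Matrix I I ℂ) * H c) = 2 * s * cmsWeight k c)
    (hκ : κ * (2 * s) = 1) (hk : 1 / 2 * (s * s) = -k)
    (ha₀ : a₀ = s * (superTrace p 1 - 2 * s * (n + m * k⁻¹))) (hβ : β = -(1 / 2) * s)
    (hp : p₀ = -a₀ / 2) (hq : q₀ = -(β - k) / 2) (hr : r₀ = -a₀ / (2 * k))
    (hs : s₀ = -(β - 1) / (2 * k)) :
    (osp F).HasConjugateRadialPart (ospSignConj F d hdF) ((strForm p κ).restrict _) H
      (fun _ _ _ E => cmsBC n m k p₀ q₀ r₀ s₀ E) := by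
  have hs0 : s ≠ 0 := fun h => by simp [h] at hκ
  have hk0 : k ≠ 0 := fun h => hs0 (by simpa [h] using hk)
  have hκ0 : κ ≠ 0 := fun h => by simp [h] at hκ
  have hB : ∀ i j, (strForm p κ).restrict (ospSpace F) (H i) (H j) =
      if i = j then cmsWeight k i else 0 := hH.strForm_eq hw hκ
  have hli := linearIndependent_of_gram (fun i => cmsWeight_ne_zero hk0 i) hB
  have he : ∀ c, (Module.Basis.span hli c : ospSpace F) = H c :=
    fun c => congrArg Subtype.val (Module.Basis.span_apply hli c)
  have hBe : ∀ i j, (strForm p κ).restrict (ospSpace F) (Module.Basis.span hli i : ospSpace F)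
      (Module.Basis.span hli j : ospSpace F) = if i = j then cmsWeight k i else 0 := fun i j => by
    rw [he, he, hB]
  have hθ : (osp F).IsInvolution (ospSignConj F d hdF) :=
    F.theta_isInvolution.fixed (signConj_isInvolution hd) _
  have ha : (osp F).IsEvenCartanSubspace (ospSignConj F d hdF) (Submodule.span ℂ (Set.range H)) :=
    (hH.isSelfDual (F := F) fun c => (H c).2).isEvenCartanSubspace_osp
      (fun c => Subtype.ext (hneg c)) (fun x hx => hcent x (congrArg Subtype.val hx)) he
  refine ⟨hθ, (strForm_isInvariantForm κ).fixed _, fun x y => strForm_signConj hd κ x y,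
    nondegenerate_fixed F.theta_isInvolution (strForm_nondegenerate hκ0) (strForm_theta F κ), ha,
    nondegenerate_of_gram _ (fun i => cmsWeight_ne_zero hk0 i) hBe, Module.Basis.span hli, he,
    fun P hP => ?_⟩
  refine IsRootSumBC.isConjugate hP (a₀ := a₀) (β := β) hk0 hp hq hr hs
    (hH.isRootSumBC_osp he hθ ha hP
      (fun c => superTrace_eq_zero_of_signConj hd (hneg c)) hw hk ?_ hβ) hBe
  rw [ha₀, Finset.sum_congr rfl fun c _ => hw c, ← Finset.mul_sum, sum_cmsWeight]

end wrappers

/-! ### Pairings of the basis vectors of two blocks -/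

theorem superTrace_single {I : Type} [Fintype I] [DecidableEq I] {p : I → ZMod 2} (i : I) :
    superTrace p (Matrix.single i i 1) = koszul (p i) (p i) := by
  rw [superTrace_apply, Finset.sum_eq_single i]
  · simp
  · intro j _ h
    simp [Ne.symm h]
  · simp

/-- Partial matchings `u k ↔ v k` of the two blocks of a block index, with colours and weights. -/
structure BlockPairing (A B K C : Type) where
  u : K → A
  v : K → B
  α : K → ℂ
  β : K → ℂ
  col : K → C
  u_injective : Function.Injective u
  v_injective : Function.Injective v
  mul_eq_one : ∀ k, α k * β k = 1

namespace BlockPairing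

variable {A B K C : Type} [Fintype A] [Fintype B] [DecidableEq A] [DecidableEq B] [Fintype K]
  [DecidableEq K] [Fintype C] [DecidableEq C] (D : BlockPairing A B K C)

theorem α_ne_zero (k : K) : D.α k ≠ 0 := left_ne_zero_of_mul_eq_one (D.mul_eq_one k)

theorem β_ne_zero (k : K) : D.β k ≠ 0 := right_ne_zero_of_mul_eq_one (D.mul_eq_one k)

/-- The matrix exchanging `u k` and `v k` up to factors. -/
def edge (k : K) : Matrix (A ⊕ B) (A ⊕ B) ℂ :=
  Matrix.single (Sum.inl (D.u k)) (Sum.inr (D.v k)) (D.α k) +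
    Matrix.single (Sum.inr (D.v k)) (Sum.inl (D.u k)) (D.β k)

/-- The projection to the span of `u k` and `v k`. -/
def edgeProj (k : K) : Matrix (A ⊕ B) (A ⊕ B) ℂ :=
  Matrix.single (Sum.inl (D.u k)) (Sum.inl (D.u k)) 1 +
    Matrix.single (Sum.inr (D.v k)) (Sum.inr (D.v k)) 1

/-- The sum of the edges of colour `c`. -/
def vec (c : C) : Matrix (A ⊕ B) (A ⊕ B) ℂ := ∑ k, if D.col k = c then D.edge k else 0

theorem edge_mul_edge (k k' : K) : D.edge k * D.edge k' = if k = k' then D.edgeProj k else 0 := by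
  rw [edge, edge, edgeProj, add_mul, mul_add, mul_add]
  split_ifs with h
  · subst h
    simp [Matrix.single_mul_single_of_ne, D.mul_eq_one, mul_comm (D.β k)]
  · simp [Matrix.single_mul_single_of_ne, D.v_injective.eq_iff, D.u_injective.eq_iff, h]

theorem edge_mul_edgeProj (k k' : K) :
    D.edge k * D.edgeProj k' = if k = k' then D.edge k else 0 := by
  rw [edge, edgeProj, add_mul, mul_add, mul_add]
  split_ifs with h
  · subst h
    simp [Matrix.single_mul_single_of_ne]
  · simp [Matrix.single_mul_single_of_ne, D.v_injective.eq_iff, D.u_injective.eq_iff, h]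

theorem sum_edge_mul {X Y Z : K → Matrix (A ⊕ B) (A ⊕ B) ℂ}
    (h : ∀ k k', X k * Y k' = if k = k' then Z k else 0) (c c' : C) :
    (∑ k, if D.col k = c then X k else 0) * (∑ k, if D.col k = c' then Y k else 0) =
      if c = c' then ∑ k, if D.col k = c then Z k else 0 else 0 := by
  rw [Finset.sum_mul_sum]
  have h1 : ∀ k, ∑ k', (if D.col k = c then X k else 0) * (if D.col k' = c' then Y k' else 0) =
      if c = c' then if D.col k = c then Z k else 0 else 0 := by
    intro k
    rw [Finset.sum_eq_single k]
    · by_cases h2 : D.col k = c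
      · subst h2
        by_cases h3 : D.col k = c'
        · simp [h3, h]
        · simp [h3]
      · simp [h2]
    · intro k' _ hk
      split_ifs <;> simp [h, Ne.symm hk]
    · simp
  rw [Finset.sum_congr rfl fun k _ => h1 k]
  split_ifs <;> simp

theorem vec_mul_vec (c c' : C) : D.vec c * D.vec c' =
    if c = c' then ∑ k, if D.col k = c then D.edgeProj k else 0 else 0 :=
  D.sum_edge_mul D.edge_mul_edge c c'

theorem vec_cube (c : C) : D.vec c * (D.vec c * D.vec c) = D.vec c := by
  rw [vec_mul_vec, if_pos rfl, vec, D.sum_edge_mul D.edge_mul_edgeProj, if_pos rfl]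

theorem edge_apply_ne_zero {k : K} {i j : A ⊕ B} (h : D.edge k i j ≠ 0) :
    (i = Sum.inl (D.u k) ∧ j = Sum.inr (D.v k)) ∨ (i = Sum.inr (D.v k) ∧ j = Sum.inl (D.u k)) := by
  by_contra! h'
  refine h ?_
  rw [edge, Matrix.add_apply, Matrix.single_apply_of_ne, Matrix.single_apply_of_ne, add_zero]
  · rintro ⟨rfl, rfl⟩
    exact h'.2 rfl rfl
  · rintro ⟨rfl, rfl⟩
    exact h'.1 rfl rfl

theorem vec_apply_ne_zero {c : C} {i j : A ⊕ B} (h : D.vec c i j ≠ 0) :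
    ∃ k, D.col k = c ∧ ((i = Sum.inl (D.u k) ∧ j = Sum.inr (D.v k)) ∨
      (i = Sum.inr (D.v k) ∧ j = Sum.inl (D.u k))) := by
  rw [vec, Matrix.sum_apply] at h
  obtain ⟨k, _, hk⟩ := Finset.exists_ne_zero_of_sum_ne_zero h
  by_cases hc : D.col k = c
  · rw [if_pos hc] at hk
    exact ⟨k, hc, D.edge_apply_ne_zero hk⟩
  · rw [if_neg hc] at hk
    exact absurd rfl hk

variable {p : A ⊕ B → ZMod 2} {par : C → ZMod 2}

theorem isTripotentFamily (hu : ∀ k, p (Sum.inl (D.u k)) = par (D.col k))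
    (hv : ∀ k, p (Sum.inr (D.v k)) = par (D.col k)) : IsTripotentFamily p D.vec par where
  mul_of_ne h := by rw [vec_mul_vec, if_neg h]
  cube := D.vec_cube
  support c i j h := by
    obtain ⟨k, rfl, ⟨rfl, rfl⟩ | ⟨rfl, rfl⟩⟩ := D.vec_apply_ne_zero h
    · exact ⟨hu k, hv k⟩
    · exact ⟨hv k, hu k⟩

theorem blockSign_mul_self (i : A ⊕ B) : blockSign i * blockSign i = 1 := by
  rcases i with i | i <;> simp [blockSign]

theorem signConj_vec (c : C) : signConj blockSign (D.vec c) = -D.vec c := by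
  ext i j
  rw [signConj_apply, Matrix.neg_apply]
  by_cases h : D.vec c i j = 0
  · simp [h]
  · obtain ⟨k, -, ⟨rfl, rfl⟩ | ⟨rfl, rfl⟩⟩ := D.vec_apply_ne_zero h <;> simp [blockSign]

theorem superTrace_vec_mul_self (hu : ∀ k, p (Sum.inl (D.u k)) = par (D.col k))
    (hv : ∀ k, p (Sum.inr (D.v k)) = par (D.col k)) (c : C) :
    superTrace p (D.vec c * D.vec c) =
      2 * koszul (par c) (par c) * (∑ k, if D.col k = c then 1 else 0) := by
  rw [vec_mul_vec, if_pos rfl, map_sum, Finset.mul_sum]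
  refine Finset.sum_congr rfl fun k _ => ?_
  split_ifs with h
  · rw [edgeProj, map_add, superTrace_single, superTrace_single, hu, hv, h]
    ring
  · simp

theorem vec_mul_apply (c : C) (x : Matrix (A ⊕ B) (A ⊕ B) ℂ) (i j : A ⊕ B) :
    (D.vec c * x) i j = ∑ k, if D.col k = c then
      ((if i = Sum.inl (D.u k) then D.α k * x (Sum.inr (D.v k)) j else 0) +
        if i = Sum.inr (D.v k) then D.β k * x (Sum.inl (D.u k)) j else 0) else 0 := by
  rw [vec, Finset.sum_mul, Matrix.sum_apply]
  refine Finset.sum_congr rfl fun k _ => ?_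
  split_ifs <;> simp_all [edge, add_mul]

theorem mul_vec_apply (c : C) (x : Matrix (A ⊕ B) (A ⊕ B) ℂ) (i j : A ⊕ B) :
    (x * D.vec c) i j = ∑ k, if D.col k = c then
      ((if j = Sum.inr (D.v k) then x i (Sum.inl (D.u k)) * D.α k else 0) +
        if j = Sum.inl (D.u k) then x i (Sum.inr (D.v k)) * D.β k else 0) else 0 := by
  rw [vec, Finset.mul_sum, Matrix.sum_apply]
  refine Finset.sum_congr rfl fun k _ => ?_
  split_ifs <;> simp_all [edge, mul_add]

theorem vec_mul_inl (c : C) (x : Matrix (A ⊕ B) (A ⊕ B) ℂ) (k : K) (j : A ⊕ B) :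
    (D.vec c * x) (Sum.inl (D.u k)) j =
      if D.col k = c then D.α k * x (Sum.inr (D.v k)) j else 0 := by
  rw [vec_mul_apply, Finset.sum_eq_single k]
  · simp
  · intro k' _ h
    simp [D.u_injective.eq_iff, Ne.symm h]
  · simp

theorem vec_mul_inr (c : C) (x : Matrix (A ⊕ B) (A ⊕ B) ℂ) (k : K) (j : A ⊕ B) :
    (D.vec c * x) (Sum.inr (D.v k)) j =
      if D.col k = c then D.β k * x (Sum.inl (D.u k)) j else 0 := by
  rw [vec_mul_apply, Finset.sum_eq_single k]
  · simp
  · intro k' _ h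
    simp [D.v_injective.eq_iff, Ne.symm h]
  · simp

theorem mul_vec_inr (c : C) (x : Matrix (A ⊕ B) (A ⊕ B) ℂ) (k : K) (i : A ⊕ B) :
    (x * D.vec c) i (Sum.inr (D.v k)) =
      if D.col k = c then x i (Sum.inl (D.u k)) * D.α k else 0 := by
  rw [mul_vec_apply, Finset.sum_eq_single k]
  · simp
  · intro k' _ h
    simp [D.v_injective.eq_iff, Ne.symm h]
  · simp

theorem mul_vec_inl (c : C) (x : Matrix (A ⊕ B) (A ⊕ B) ℂ) (k : K) (i : A ⊕ B) :
    (x * D.vec c) i (Sum.inl (D.u k)) =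
      if D.col k = c then x i (Sum.inr (D.v k)) * D.β k else 0 := by
  rw [mul_vec_apply, Finset.sum_eq_single k]
  · simp
  · intro k' _ h
    simp [D.u_injective.eq_iff, Ne.symm h]
  · simp

theorem vec_mul_inl_of_notMem (c : C) (x : Matrix (A ⊕ B) (A ⊕ B) ℂ) {a : A}
    (ha : a ∉ Set.range D.u) (j : A ⊕ B) : (D.vec c * x) (Sum.inl a) j = 0 := by
  rw [vec_mul_apply]
  refine Finset.sum_eq_zero fun k _ => ?_
  have : a ≠ D.u k := fun h => ha ⟨k, h.symm⟩
  simp [this]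

theorem vec_mul_inr_of_notMem (c : C) (x : Matrix (A ⊕ B) (A ⊕ B) ℂ) {b : B}
    (hb : b ∉ Set.range D.v) (j : A ⊕ B) : (D.vec c * x) (Sum.inr b) j = 0 := by
  rw [vec_mul_apply]
  refine Finset.sum_eq_zero fun k _ => ?_
  have : b ≠ D.v k := fun h => hb ⟨k, h.symm⟩
  simp [this]

theorem mul_vec_inl_of_notMem (c : C) (x : Matrix (A ⊕ B) (A ⊕ B) ℂ) {a : A}
    (ha : a ∉ Set.range D.u) (i : A ⊕ B) : (x * D.vec c) i (Sum.inl a) = 0 := by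
  rw [mul_vec_apply]
  refine Finset.sum_eq_zero fun k _ => ?_
  have : a ≠ D.u k := fun h => ha ⟨k, h.symm⟩
  simp [this]

theorem mul_vec_inr_of_notMem (c : C) (x : Matrix (A ⊕ B) (A ⊕ B) ℂ) {b : B}
    (hb : b ∉ Set.range D.v) (i : A ⊕ B) : (x * D.vec c) i (Sum.inr b) = 0 := by
  rw [mul_vec_apply]
  refine Finset.sum_eq_zero fun k _ => ?_
  have : b ≠ D.v k := fun h => hb ⟨k, h.symm⟩
  simp [this]

theorem apply_swap {x : Matrix (A ⊕ B) (A ⊕ B) ℂ} (hcomm : ∀ c, D.vec c * x = x * D.vec c)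
    {k k' : K} (h : D.col k = D.col k') : D.α k * x (Sum.inr (D.v k)) (Sum.inl (D.u k')) =
      x (Sum.inl (D.u k)) (Sum.inr (D.v k')) * D.β k' := by
  have := congrFun (congrFun (hcomm (D.col k)) (Sum.inl (D.u k))) (Sum.inl (D.u k'))
  rwa [vec_mul_inl, mul_vec_inl, if_pos rfl, if_pos h.symm] at this

/-- A sufficient condition for an element of the centraliser to be a combination of the `vec c`. -/
theorem exists_eq_sum (hcol : Function.Surjective D.col) {x : Matrix (A ⊕ B) (A ⊕ B) ℂ}
    (hx : signConj blockSign x = -x) (hcomm : ∀ c, D.vec c * x = x * D.vec c)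
    (hoff : ∀ k k', k ≠ k' → D.col k = D.col k' →
      x (Sum.inl (D.u k)) (Sum.inr (D.v k')) = 0)
    (hdiag : ∀ k k', D.col k = D.col k' →
      x (Sum.inl (D.u k)) (Sum.inr (D.v k)) * D.α k' =
        x (Sum.inl (D.u k')) (Sum.inr (D.v k')) * D.α k)
    (hun : ∀ a b, a ∉ Set.range D.u → b ∉ Set.range D.v →
      x (Sum.inl a) (Sum.inr b) = 0 ∧ x (Sum.inr b) (Sum.inl a) = 0) :
    ∃ t : C → ℂ, x = ∑ c, t c • D.vec c := by
  have hll : ∀ a a', x (Sum.inl a) (Sum.inl a') = 0 := fun a a' => by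
    have h := congrFun (congrFun hx (Sum.inl a)) (Sum.inl a')
    rw [signConj_apply, Matrix.neg_apply] at h
    simpa [blockSign, self_eq_neg] using h
  have hrr : ∀ b b', x (Sum.inr b) (Sum.inr b') = 0 := fun b b' => by
    have h := congrFun (congrFun hx (Sum.inr b)) (Sum.inr b')
    rw [signConj_apply, Matrix.neg_apply] at h
    simpa [blockSign, self_eq_neg] using h
  have hent : ∀ c i j, (D.vec c * x) i j = (x * D.vec c) i j := fun c i j => by rw [hcomm]
  -- One edge is chosen in every colour; the coefficient of `vec c` is read off from the entry of
  -- `x` there, and `hdiag` makes it independent of the choice.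
  obtain ⟨r, hr⟩ := hcol.hasRightInverse
  let t : C → ℂ := fun c => x (Sum.inl (D.u (r c))) (Sum.inr (D.v (r c))) * D.β (r c)
  have ht : ∀ k, x (Sum.inl (D.u k)) (Sum.inr (D.v k)) = t (D.col k) * D.α k := fun k => by
    have h := hdiag k (r (D.col k)) (hr (D.col k)).symm
    calc _ = x (Sum.inl (D.u k)) (Sum.inr (D.v k)) * D.α (r (D.col k)) * D.β (r (D.col k)) := by
            rw [mul_assoc, D.mul_eq_one, mul_one]
      _ = _ := by rw [h]; ring
  have hsum : ∀ k i, (∑ c, t c • D.vec c) (Sum.inl (D.u k)) i =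
      t (D.col k) * (D.α k * (1 : Matrix (A ⊕ B) (A ⊕ B) ℂ) (Sum.inr (D.v k)) i) := by
    intro k i
    rw [Matrix.sum_apply, Finset.sum_eq_single (D.col k)]
    · rw [Matrix.smul_apply, ← mul_one (D.vec _), vec_mul_inl, if_pos rfl, smul_eq_mul]
    · intro c _ h
      rw [Matrix.smul_apply, ← mul_one (D.vec _), vec_mul_inl, if_neg h.symm, smul_zero]
    · simp
  have hsum' : ∀ k i, (∑ c, t c • D.vec c) (Sum.inr (D.v k)) i =
      t (D.col k) * (D.β k * (1 : Matrix (A ⊕ B) (A ⊕ B) ℂ) (Sum.inl (D.u k)) i) := by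
    intro k i
    rw [Matrix.sum_apply, Finset.sum_eq_single (D.col k)]
    · rw [Matrix.smul_apply, ← mul_one (D.vec _), vec_mul_inr, if_pos rfl, smul_eq_mul]
    · intro c _ h
      rw [Matrix.smul_apply, ← mul_one (D.vec _), vec_mul_inr, if_neg h.symm, smul_zero]
    · simp
  have hzero : ∀ a, a ∉ Set.range D.u → ∀ i, (∑ c, t c • D.vec c) (Sum.inl a) i = 0 := by
    intro a ha i
    rw [Matrix.sum_apply]
    refine Finset.sum_eq_zero fun c _ => ?_
    rw [Matrix.smul_apply, ← mul_one (D.vec _), D.vec_mul_inl_of_notMem c _ ha, smul_zero]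
  have hzero' : ∀ b, b ∉ Set.range D.v → ∀ i, (∑ c, t c • D.vec c) (Sum.inr b) i = 0 := by
    intro b hb i
    rw [Matrix.sum_apply]
    refine Finset.sum_eq_zero fun c _ => ?_
    rw [Matrix.smul_apply, ← mul_one (D.vec _), D.vec_mul_inr_of_notMem c _ hb, smul_zero]
  refine ⟨t, ?_⟩
  ext i j
  rcases i with a | b
  · by_cases ha : a ∈ Set.range D.u
    · obtain ⟨k, rfl⟩ := ha
      rw [hsum]
      rcases j with a' | b'
      · simp [hll]
      by_cases hb : b' ∈ Set.range D.v
      · obtain ⟨k', rfl⟩ := hb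
        by_cases hkk : k = k'
        · subst hkk
          rw [ht]
          simp
        · have h0 : x (Sum.inl (D.u k)) (Sum.inr (D.v k')) = 0 := by
            -- For different colours, the commutation with the vector of colour `col k` forces the
            -- entry to vanish, because the other side of the equation only sees edges of that
            -- colour.
            by_cases hc : D.col k = D.col k'
            · exact hoff k k' hkk hc
            · have := hent (D.col k) (Sum.inr (D.v k)) (Sum.inr (D.v k'))
              rw [vec_mul_inr, mul_vec_inr, if_pos rfl, if_neg (Ne.symm hc)] at this
              exact (mul_eq_zero.1 this).resolve_left (D.β_ne_zero k)
          rw [h0]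
          simp [D.v_injective.eq_iff, hkk]
      · have := hent (D.col k) (Sum.inr (D.v k)) (Sum.inr b')
        rw [vec_mul_inr, D.mul_vec_inr_of_notMem _ _ hb, if_pos rfl] at this
        rw [(mul_eq_zero.1 this).resolve_left (D.β_ne_zero k)]
        have hne : D.v k ≠ b' := fun h => hb ⟨k, h⟩
        simp [hne]
    · rw [hzero a ha]
      rcases j with a' | b'
      · exact hll a a'
      by_cases hb : b' ∈ Set.range D.v
      · obtain ⟨k', rfl⟩ := hb
        have := hent (D.col k') (Sum.inl a) (Sum.inl (D.u k'))
        rw [D.vec_mul_inl_of_notMem _ _ ha, mul_vec_inl, if_pos rfl] at this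
        exact (mul_eq_zero.1 this.symm).resolve_right (D.β_ne_zero k')
      · exact (hun a b' ha hb).1
  · by_cases hb : b ∈ Set.range D.v
    · obtain ⟨k, rfl⟩ := hb
      rw [hsum']
      rcases j with a' | b'
      · by_cases ha : a' ∈ Set.range D.u
        · obtain ⟨k', rfl⟩ := ha
          by_cases hc : D.col k = D.col k'
          · have h1 := D.apply_swap hcomm hc
            by_cases hkk : k = k'
            · subst hkk
              rw [ht, mul_assoc, D.mul_eq_one, mul_one] at h1
              rw [← h1]
              simp only [Matrix.one_apply_eq, mul_one]
              linear_combination (-x (Sum.inr (D.v k)) (Sum.inl (D.u k))) * D.mul_eq_one k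
            · rw [hoff k k' hkk hc, zero_mul] at h1
              rw [(mul_eq_zero.1 h1).resolve_left (D.α_ne_zero k)]
              simp [D.u_injective.eq_iff, hkk]
          · have := hent (D.col k) (Sum.inl (D.u k)) (Sum.inl (D.u k'))
            rw [vec_mul_inl, mul_vec_inl, if_pos rfl, if_neg (Ne.symm hc)] at this
            rw [(mul_eq_zero.1 this).resolve_left (D.α_ne_zero k)]
            have hkk : k ≠ k' := fun h => hc (h ▸ rfl)
            simp [D.u_injective.eq_iff, hkk]
        · have := hent (D.col k) (Sum.inl (D.u k)) (Sum.inl a')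
          rw [vec_mul_inl, D.mul_vec_inl_of_notMem _ _ ha, if_pos rfl] at this
          rw [(mul_eq_zero.1 this).resolve_left (D.α_ne_zero k)]
          have hne : D.u k ≠ a' := fun h => ha ⟨k, h⟩
          simp [hne]
      · simp [hrr]
    · rw [hzero' b hb]
      rcases j with a' | b'
      · by_cases ha : a' ∈ Set.range D.u
        · obtain ⟨k', rfl⟩ := ha
          have := hent (D.col k') (Sum.inr b) (Sum.inr (D.v k'))
          rw [D.vec_mul_inr_of_notMem _ _ hb, mul_vec_inr, if_pos rfl] at this
          exact (mul_eq_zero.1 this.symm).resolve_right (D.α_ne_zero k')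
        · exact (hun a' b ha hb).2
      · exact hrr b b'

end BlockPairing

theorem superTrace_one {I : Type} [Fintype I] [DecidableEq I] (p : I → ZMod 2) :
    superTrace p 1 = ∑ i, koszul (p i) (p i) := by
  simp [superTrace_apply]

/-- Used to express the superdimension of the common kernel, what is left of both blocks after the
matching, by the absolute values in the parameters. -/
theorem cast_abs_sub (a b : ℕ) :
    ((|(a : ℤ) - b| : ℤ) : ℂ) = a + b - 2 * ((min a b : ℕ) : ℂ) := by
  have h : |(a : ℤ) - b| = a + b - 2 * ((min a b : ℕ) : ℤ) := by
    rcases le_total a b with h | h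
    · rw [abs_of_nonpos (by omega), min_eq_left h]
      omega
    · rw [abs_of_nonneg (by omega), min_eq_right h]
      omega
  rw [h, Int.cast_sub, Int.cast_add, Int.cast_mul, Int.cast_natCast, Int.cast_natCast,
    Int.cast_natCast, Int.cast_ofNat]

theorem lt_of_notMem_range_castLE_left {a b : ℕ} {i : Fin a}
    (hi : ∀ k : Fin (min a b), k.castLE (min_le_left a b) ≠ i) : b < a := by
  by_contra! h
  exact hi ⟨i, by omega⟩ (Fin.ext rfl)

theorem lt_of_notMem_range_castLE_right {a b : ℕ} {i : Fin b}
    (hi : ∀ k : Fin (min a b), k.castLE (min_le_right a b) ≠ i) : a < b := by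
  by_contra! h
  exact hi ⟨i, by omega⟩ (Fin.ext rfl)

/-- Under the sign condition the two blocks cannot both contain unmatched vectors. Otherwise the
matrices between the unmatched vectors would commute with all `H c` and could enlarge the
centraliser. -/
theorem false_of_mul_nonneg {n₁ m₁ n₂ m₂ : ℕ} (h : 0 ≤ ((n₁ : ℤ) - n₂) * ((m₁ : ℤ) - m₂))
    (h1 : n₂ < n₁ ∨ m₂ < m₁) (h2 : n₁ < n₂ ∨ m₁ < m₂) : False := by
  rcases h1 with h1 | h1 <;> rcases h2 with h2 | h2
  · omega
  · zify at h1 h2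
    nlinarith
  · zify at h1 h2
    nlinarith
  · omega

theorem rotation_eq {A B : Type} [Fintype A] [Fintype B] [DecidableEq A] [DecidableEq B]
    (u : A) (v : B) : rotation u v = Matrix.single (Sum.inl u) (Sum.inr v) Complex.I +
      Matrix.single (Sum.inr v) (Sum.inl u) (-Complex.I) := by
  rw [rotation, single_neg_entry, sub_eq_add_neg]

/-! ### The pairs of general linear superalgebras -/

section seriesAIII

variable (n₁ m₁ n₂ m₂ : ℕ)

/-- The pairing of the two blocks of `gl(V₁ ⊕ V₂)`. -/
def pairingAIII : BlockPairing (Fin n₁ ⊕ Fin m₁) (Fin n₂ ⊕ Fin m₂)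
    (Fin (min n₁ n₂) ⊕ Fin (min m₁ m₂)) (Fin (min n₁ n₂) ⊕ Fin (min m₁ m₂)) where
  u := Sum.map (Fin.castLE (min_le_left _ _)) (Fin.castLE (min_le_left _ _))
  v := Sum.map (Fin.castLE (min_le_right _ _)) (Fin.castLE (min_le_right _ _))
  α _ := Complex.I
  β _ := -Complex.I
  col := id
  u_injective := (Fin.castLE_injective _).sumMap (Fin.castLE_injective _)
  v_injective := (Fin.castLE_injective _).sumMap (Fin.castLE_injective _)
  mul_eq_one _ := by simp

theorem pairingAIII_vec : (pairingAIII n₁ m₁ n₂ m₂).vec = vectorsAIII n₁ m₁ n₂ m₂ := by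
  ext1 c
  rw [BlockPairing.vec, Finset.sum_eq_single c]
  · rw [if_pos (show (pairingAIII n₁ m₁ n₂ m₂).col c = c from rfl), BlockPairing.edge]
    rcases c with i | j <;> exact (rotation_eq _ _).symm
  · intro k _ h
    exact if_neg h
  · simp

theorem superTrace_one_AIII :
    superTrace (parityAIII n₁ m₁ n₂ m₂) 1 = (n₁ + n₂ : ℂ) - (m₁ + m₂) := by
  simp [superTrace_one, parityAIII, koszul]
  ring

/-- Each coordinate carries one edge, so its eigenspaces are even or odd lines, of superdimension
`1` or `-1`: this is `s = 1` and `k = -1`. The common kernel has superdimension `|n₁ - n₂| - |m₁ -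
m₂|`. -/
theorem hasConjugateRadialPart_AIII (h : 0 ≤ ((n₁ : ℤ) - n₂) * ((m₁ : ℤ) - m₂)) :
    (glSuper (parityAIII n₁ m₁ n₂ m₂)).HasConjugateRadialPart (signConj blockSign)
      (strForm (parityAIII n₁ m₁ n₂ m₂) (1 / 2)) (vectorsAIII n₁ m₁ n₂ m₂)
      (fun _ _ _ E => cmsBC (min n₁ n₂) (min m₁ m₂) (-1)
        ((|(m₁ : ℤ) - m₂| : ℤ) - (|(n₁ : ℤ) - n₂| : ℤ)) (-1 / 2)
        ((|(n₁ : ℤ) - n₂| : ℤ) - (|(m₁ : ℤ) - m₂| : ℤ)) (-1 / 2) E) := by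
  have hu : ∀ k, parityAIII n₁ m₁ n₂ m₂ (Sum.inl ((pairingAIII n₁ m₁ n₂ m₂).u k)) =
      Sum.elim (fun _ => 0) (fun _ => 1) ((pairingAIII n₁ m₁ n₂ m₂).col k) := by
    rintro (k | k) <;> rfl
  have hv : ∀ k, parityAIII n₁ m₁ n₂ m₂ (Sum.inr ((pairingAIII n₁ m₁ n₂ m₂).v k)) =
      Sum.elim (fun _ => 0) (fun _ => 1) ((pairingAIII n₁ m₁ n₂ m₂).col k) := by
    rintro (k | k) <;> rfl
  rw [← pairingAIII_vec]
  refine ((pairingAIII n₁ m₁ n₂ m₂).isTripotentFamily hu hv).hasConjugateRadialPart_gl (s := 1)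
    BlockPairing.blockSign_mul_self (BlockPairing.signConj_vec _) ?_ ?_ (by norm_num) (by norm_num)
    rfl ?_ (by norm_num) ?_ (by norm_num)
  · intro x hx hcomm
    have hun : ∀ a b, a ∉ Set.range (pairingAIII n₁ m₁ n₂ m₂).u →
        b ∉ Set.range (pairingAIII n₁ m₁ n₂ m₂).v → False := by
      intro a b ha hb
      have h1 : n₂ < n₁ ∨ m₂ < m₁ := by
        rcases a with i | i
        · exact Or.inl (lt_of_notMem_range_castLE_left
            fun k hk => ha ⟨Sum.inl k, congrArg Sum.inl hk⟩)
        · exact Or.inr (lt_of_notMem_range_castLE_left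
            fun k hk => ha ⟨Sum.inr k, congrArg Sum.inr hk⟩)
      have h2 : n₁ < n₂ ∨ m₁ < m₂ := by
        rcases b with i | i
        · exact Or.inl (lt_of_notMem_range_castLE_right
            fun k hk => hb ⟨Sum.inl k, congrArg Sum.inl hk⟩)
        · exact Or.inr (lt_of_notMem_range_castLE_right
            fun k hk => hb ⟨Sum.inr k, congrArg Sum.inr hk⟩)
      exact false_of_mul_nonneg h h1 h2
    obtain ⟨t, ht⟩ := (pairingAIII n₁ m₁ n₂ m₂).exists_eq_sum Function.surjective_id hx hcomm
      (fun k k' hk hc => absurd hc hk) (fun k k' hc => by rw [show k = k' from hc])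
      (fun a b ha hb => (hun a b ha hb).elim)
    rw [ht]
    exact Submodule.sum_mem _ fun c _ => Submodule.smul_mem _ _ (Submodule.subset_span ⟨c, rfl⟩)
  · intro c
    rw [BlockPairing.superTrace_vec_mul_self _ hu hv]
    rcases c with i | j <;> simp [pairingAIII, koszul, cmsWeight]
  · rw [superTrace_one_AIII, cast_abs_sub, cast_abs_sub]
    norm_num
    ring
  · rw [superTrace_one_AIII, cast_abs_sub, cast_abs_sub]
    norm_num
    ring

end seriesAIII

theorem mem_span_range_of_coe_eq_sum {V C : Type*} [AddCommGroup V] [Module ℂ V] [Fintype C]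
    {S : Submodule ℂ V} {H : C → S} {x : S} {t : C → ℂ} (h : (x : V) = ∑ c, t c • (H c : V)) :
    x ∈ Submodule.span ℂ (Set.range H) := by
  have : x = ∑ c, t c • H c := Subtype.ext (by simpa using h)
  rw [this]
  exact Submodule.sum_mem _ fun c _ => Submodule.smul_mem _ _ (Submodule.subset_span ⟨c, rfl⟩)

theorem sum_ite_eq_single {K M : Type*} [Fintype K] [AddCommMonoid M] {Q : K → Prop}
    [DecidablePred Q] (k₀ : K) (h : ∀ k, Q k ↔ k = k₀) (f : K → M) :
    (∑ k, if Q k then f k else 0) = f k₀ := by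
  classical
  simp [h]

theorem ospSpace_apply {I : Type} [Fintype I] [DecidableEq I] {p : I → ZMod 2} {F : SuperForm p}
    (x : ospSpace F) (i j : I) : (x : Matrix I I ℂ) i j =
      -(F.ε i * F.ε j * koszul (p i + p j) (p j) * (x : Matrix I I ℂ) (F.τ j) (F.τ i)) :=
  (congrFun (congrFun (show F.theta (x : Matrix I I ℂ) = x from x.2) i) j).symm

/-! ### The pairs of orthosymplectic superalgebras -/

section seriesBDI

variable (n₁ m₁ n₂ m₂ : ℕ)

/-- The pairing of the two blocks of `osp(V₁ ⊕ V₂)`. -/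
def pairingBDI : BlockPairing (AIIndex n₁ m₁) (AIIndex n₂ m₂)
    (AIIndex (min n₁ n₂) (min m₁ m₂)) (Fin (min n₁ n₂) ⊕ Fin (min m₁ m₂)) where
  u := Sum.map (Fin.castLE (min_le_left _ _))
    (Sum.map (Fin.castLE (min_le_left _ _)) (Fin.castLE (min_le_left _ _)))
  v := Sum.map (Fin.castLE (min_le_right _ _))
    (Sum.map (Fin.castLE (min_le_right _ _)) (Fin.castLE (min_le_right _ _)))
  α _ := Complex.I
  β _ := -Complex.I
  col := Sum.map id (Sum.elim id id)
  u_injective := (Fin.castLE_injective _).sumMap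
    ((Fin.castLE_injective _).sumMap (Fin.castLE_injective _))
  v_injective := (Fin.castLE_injective _).sumMap
    ((Fin.castLE_injective _).sumMap (Fin.castLE_injective _))
  mul_eq_one _ := by simp

theorem pairingBDI_vec (c : Fin (min n₁ n₂) ⊕ Fin (min m₁ m₂)) :
    (pairingBDI n₁ m₁ n₂ m₂).vec c = vectorsBDI n₁ m₁ n₂ m₂ c := by
  rcases c with i | j
  · simp [BlockPairing.vec, BlockPairing.edge, pairingBDI, vectorsBDI, rotation_eq]
  · simp only [BlockPairing.vec, BlockPairing.edge, pairingBDI, vectorsBDI, rotation_eq,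
      Fintype.sum_sum_type, Sum.map_inl, Sum.map_inr, Sum.elim_inl, Sum.elim_inr, reduceCtorEq,
      if_false, Finset.sum_const_zero, zero_add, id, Sum.inr.injEq]
    congr 1 <;> exact Fintype.sum_ite_eq' j _

theorem superTrace_one_BDI :
    superTrace (parityBDI n₁ m₁ n₂ m₂) 1 = (n₁ + n₂ : ℂ) - 2 * (m₁ + m₂) := by
  simp [superTrace_one, parityBDI, parityAI, koszul]
  ring

/-- An even coordinate carries one edge and an odd coordinate two, so the eigenspaces have
superdimension `1` and `-2`: this is `s = 1` and `k⁻¹ = -2`. The new point in the centraliser is the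
pair of equally coloured edges, which the relations of `osp` control. -/
theorem hasConjugateRadialPart_BDI (h : 0 ≤ ((n₁ : ℤ) - n₂) * ((m₁ : ℤ) - m₂)) :
    (osp (formBDI n₁ m₁ n₂ m₂)).HasConjugateRadialPart (thetaBDI n₁ m₁ n₂ m₂)
      ((strForm (parityBDI n₁ m₁ n₂ m₂) (1 / 2)).restrict _) (vectorsBDI n₁ m₁ n₂ m₂)
      (fun _ _ _ E => cmsBC (min n₁ n₂) (min m₁ m₂) (-1 / 2)
        ((|(m₁ : ℤ) - m₂| : ℤ) - (|(n₁ : ℤ) - n₂| : ℤ) / 2) 0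
        ((|(n₁ : ℤ) - n₂| : ℤ) - 2 * (|(m₁ : ℤ) - m₂| : ℤ)) (-3 / 2) E) := by
  have hu : ∀ k, parityBDI n₁ m₁ n₂ m₂ (Sum.inl ((pairingBDI n₁ m₁ n₂ m₂).u k)) =
      Sum.elim (fun _ => 0) (fun _ => 1) ((pairingBDI n₁ m₁ n₂ m₂).col k) := by
    rintro (k | k | k) <;> rfl
  have hv : ∀ k, parityBDI n₁ m₁ n₂ m₂ (Sum.inr ((pairingBDI n₁ m₁ n₂ m₂).v k)) =
      Sum.elim (fun _ => 0) (fun _ => 1) ((pairingBDI n₁ m₁ n₂ m₂).col k) := by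
    rintro (k | k | k) <;> rfl
  have hH := (pairingBDI n₁ m₁ n₂ m₂).isTripotentFamily hu hv
  rw [show (pairingBDI n₁ m₁ n₂ m₂).vec = fun c => (vectorsBDI n₁ m₁ n₂ m₂ c).1 from
    funext (pairingBDI_vec n₁ m₁ n₂ m₂)] at hH
  refine hH.hasConjugateRadialPart_osp (s := 1) BlockPairing.blockSign_mul_self _
    (fun c => ?_) ?_ ?_ (by norm_num) (by norm_num) rfl rfl ?_ (by norm_num) ?_ (by norm_num)
  · rw [← pairingBDI_vec]
    exact BlockPairing.signConj_vec _ c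
  · intro x hx hcomm
    simp only [← pairingBDI_vec] at hcomm
    have hun : ∀ a b, a ∉ Set.range (pairingBDI n₁ m₁ n₂ m₂).u →
        b ∉ Set.range (pairingBDI n₁ m₁ n₂ m₂).v → False := by
      intro a b ha hb
      have h1 : n₂ < n₁ ∨ m₂ < m₁ := by
        rcases a with i | i | i
        · exact Or.inl (lt_of_notMem_range_castLE_left
            fun k hk => ha ⟨Sum.inl k, congrArg Sum.inl hk⟩)
        · exact Or.inr (lt_of_notMem_range_castLE_left
            fun k hk => ha ⟨Sum.inr (Sum.inl k), congrArg (fun i => Sum.inr (Sum.inl i)) hk⟩)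
        · exact Or.inr (lt_of_notMem_range_castLE_left
            fun k hk => ha ⟨Sum.inr (Sum.inr k), congrArg (fun i => Sum.inr (Sum.inr i)) hk⟩)
      have h2 : n₁ < n₂ ∨ m₁ < m₂ := by
        rcases b with i | i | i
        · exact Or.inl (lt_of_notMem_range_castLE_right
            fun k hk => hb ⟨Sum.inl k, congrArg Sum.inl hk⟩)
        · exact Or.inr (lt_of_notMem_range_castLE_right
            fun k hk => hb ⟨Sum.inr (Sum.inl k), congrArg (fun i => Sum.inr (Sum.inl i)) hk⟩)
        · exact Or.inr (lt_of_notMem_range_castLE_right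
            fun k hk => hb ⟨Sum.inr (Sum.inr k), congrArg (fun i => Sum.inr (Sum.inr i)) hk⟩)
      exact false_of_mul_nonneg h h1 h2
    have hcol : Function.Surjective (pairingBDI n₁ m₁ n₂ m₂).col := by
      rintro (i | j)
      · exact ⟨Sum.inl i, rfl⟩
      · exact ⟨Sum.inr (Sum.inl j), rfl⟩
    have hswap : ∀ {k k'}, (pairingBDI n₁ m₁ n₂ m₂).col k = (pairingBDI n₁ m₁ n₂ m₂).col k' →
        x.1 (Sum.inr ((pairingBDI n₁ m₁ n₂ m₂).v k))
          (Sum.inl ((pairingBDI n₁ m₁ n₂ m₂).u k')) =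
        -x.1 (Sum.inl ((pairingBDI n₁ m₁ n₂ m₂).u k))
          (Sum.inr ((pairingBDI n₁ m₁ n₂ m₂).v k')) := by
      intro k k' hk
      refine mul_left_cancel₀ Complex.I_ne_zero ?_
      refine ((pairingBDI n₁ m₁ n₂ m₂).apply_swap hcomm hk).trans ?_
      change _ * (-Complex.I) = _
      ring
    -- Distinct edges of the same colour are the two edges of an odd coordinate. The `osp` relation
    -- identifies the mixed entry with its transposed partner, while commutation identifies it with
    -- minus that partner, so it vanishes.
    have hoff : ∀ k k', k ≠ k' →
        (pairingBDI n₁ m₁ n₂ m₂).col k = (pairingBDI n₁ m₁ n₂ m₂).col k' →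
        x.1 (Sum.inl ((pairingBDI n₁ m₁ n₂ m₂).u k))
          (Sum.inr ((pairingBDI n₁ m₁ n₂ m₂).v k')) = 0 := by
      rintro (k | k | k) (k' | k' | k') hne hk
      · exact absurd (congrArg Sum.inl (Sum.inl.inj hk)) hne
      · cases hk
      · cases hk
      · cases hk
      · exact absurd (congrArg (fun i => Sum.inr (Sum.inl i)) (Sum.inr.inj hk)) hne
      · obtain rfl : k = k' := Sum.inr.inj hk
        refine self_eq_neg.1 (Eq.trans ?_ (hswap hk))
        exact (ospSpace_apply x _ _).trans (by simp [pairingBDI, formBDI, formAI, parityBDI,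
          parityAI, koszul, CharTwo.add_self_eq_zero])
      · cases hk
      · obtain rfl : k = k' := Sum.inr.inj hk
        refine self_eq_neg.1 (Eq.trans ?_ (hswap hk))
        exact (ospSpace_apply x _ _).trans (by simp [pairingBDI, formBDI, formAI, parityBDI,
          parityAI, koszul, CharTwo.add_self_eq_zero])
      · exact absurd (congrArg (fun i => Sum.inr (Sum.inr i)) (Sum.inr.inj hk)) hne
    -- The same two relations, applied to the entries along the edges, show that both edges of an
    -- odd coordinate have equal coefficients.
    have hdiag : ∀ k : Fin (min m₁ m₂), x.1 (Sum.inl ((pairingBDI n₁ m₁ n₂ m₂).u (Sum.inr (Sum.inl k))))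
          (Sum.inr ((pairingBDI n₁ m₁ n₂ m₂).v (Sum.inr (Sum.inl k)))) =
        x.1 (Sum.inl ((pairingBDI n₁ m₁ n₂ m₂).u (Sum.inr (Sum.inr k))))
          (Sum.inr ((pairingBDI n₁ m₁ n₂ m₂).v (Sum.inr (Sum.inr k)))) := by
      intro k
      refine Eq.trans ?_ (neg_eq_iff_eq_neg.2 (hswap (k := Sum.inr (Sum.inr k)) rfl))
      exact (ospSpace_apply x _ _).trans (by simp [pairingBDI, formBDI, formAI, parityBDI,
        parityAI, koszul, CharTwo.add_self_eq_zero])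
    obtain ⟨t, ht⟩ := (pairingBDI n₁ m₁ n₂ m₂).exists_eq_sum hcol hx hcomm hoff
      (by
        rintro (k | k | k) (k' | k' | k') hk
        · rw [show k = k' from Sum.inl.inj hk]
        · cases hk
        · cases hk
        · cases hk
        · rw [show k = k' from Sum.inr.inj hk]
        · obtain rfl : k = k' := Sum.inr.inj hk
          exact congrArg (· * Complex.I) (hdiag k)
        · cases hk
        · obtain rfl : k = k' := Sum.inr.inj hk
          exact congrArg (· * Complex.I) (hdiag k).symm
        · rw [show k = k' from Sum.inr.inj hk])
      (fun a b ha hb => (hun a b ha hb).elim)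
    simp only [pairingBDI_vec] at ht
    exact mem_span_range_of_coe_eq_sum ht
  · intro c
    simp only [← pairingBDI_vec]
    rw [BlockPairing.superTrace_vec_mul_self _ hu hv]
    rcases c with i | j
    · simp [pairingBDI, koszul, cmsWeight]
    · have h1 : (∑ k, if (pairingBDI n₁ m₁ n₂ m₂).col k = Sum.inr j then (1 : ℂ) else 0) =
          0 + (1 + 1) := by
        rw [Fintype.sum_sum_type, Fintype.sum_sum_type]
        exact congrArg₂ _ (Finset.sum_eq_zero fun i _ => if_neg (by rintro ⟨⟩))
          (congrArg₂ _ (sum_ite_eq_single j (fun k => Sum.inr_injective.eq_iff) _)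
            (sum_ite_eq_single j (fun k => Sum.inr_injective.eq_iff) _))
      rw [h1]
      simp [koszul, cmsWeight]
      norm_num
  · rw [superTrace_one_BDI, cast_abs_sub, cast_abs_sub]
    norm_num
    ring
  · rw [superTrace_one_BDI, cast_abs_sub, cast_abs_sub]
    norm_num
    ring

end seriesBDI

/-! ### The pair of orthosymplectic and general linear superalgebras -/

section seriesDIII

variable {l n : ℕ}

/-- The index `2i`. -/
def evenIndex (h : 2 * n ≤ l) (i : Fin n) : Fin l := ⟨2 * i, by omega⟩

/-- The index `2i + 1`. -/
def oddIndex (h : 2 * n ≤ l) (i : Fin n) : Fin l := ⟨2 * i + 1, by omega⟩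

variable (m : ℕ) (h : 2 * n ≤ l)

theorem evenIndex_injective : Function.Injective (evenIndex h) := fun i j hij => by
  have := congrArg Fin.val hij
  simp only [evenIndex] at this
  exact Fin.ext (by omega)

theorem oddIndex_injective : Function.Injective (oddIndex h) := fun i j hij => by
  have := congrArg Fin.val hij
  simp only [oddIndex] at this
  exact Fin.ext (by omega)

theorem evenIndex_ne_oddIndex (i j : Fin n) : evenIndex h i ≠ oddIndex h j := fun hij => by
  have := congrArg Fin.val hij
  simp only [evenIndex, oddIndex] at this
  omega

/-- The pairing of `V` and `V^*` in `osp(V ⊕ V^*)`. -/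
def pairingDIII : BlockPairing (Fin l ⊕ Fin m) (Fin l ⊕ Fin m) ((Fin n ⊕ Fin n) ⊕ Fin m)
    (Fin n ⊕ Fin m) where
  u := Sum.map (Sum.elim (evenIndex h) (oddIndex h)) id
  v := Sum.map (Sum.elim (oddIndex h) (evenIndex h)) id
  α := Sum.elim (Sum.elim (fun _ => 1) (fun _ => -1)) (fun _ => 1)
  β := Sum.elim (Sum.elim (fun _ => 1) (fun _ => -1)) (fun _ => 1)
  col := Sum.map (Sum.elim id id) id
  u_injective := ((evenIndex_injective h).sumElim (oddIndex_injective h)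
    (evenIndex_ne_oddIndex h)).sumMap Function.injective_id
  v_injective := ((oddIndex_injective h).sumElim (evenIndex_injective h)
    fun i j => (evenIndex_ne_oddIndex h j i).symm).sumMap Function.injective_id
  mul_eq_one := by rintro ((k | k) | k) <;> simp

theorem pairingDIII_vec (c : Fin n ⊕ Fin m) :
    (pairingDIII m h).vec c = vectorsDIII m h c := by
  rw [BlockPairing.vec, Fintype.sum_sum_type, Fintype.sum_sum_type]
  rcases c with i | j
  · refine (congrArg₂ _ (congrArg₂ _
      (sum_ite_eq_single i (fun k => Sum.inl_injective.eq_iff) _)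
      (sum_ite_eq_single i (fun k => Sum.inl_injective.eq_iff) _))
      (Finset.sum_eq_zero fun k _ => if_neg (by rintro ⟨⟩))).trans ?_
    simp only [BlockPairing.edge, pairingDIII, vectorsDIII, Sum.map_inl, Sum.elim_inl,
      Sum.elim_inr, single_neg_entry, evenIndex, oddIndex]
    abel
  · refine (congrArg₂ _ (congrArg₂ _
      (Finset.sum_eq_zero fun k _ => if_neg (by rintro ⟨⟩))
      (Finset.sum_eq_zero fun k _ => if_neg (by rintro ⟨⟩)))
      (sum_ite_eq_single j (fun k => Sum.inr_injective.eq_iff) _)).trans ?_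
    rw [zero_add, zero_add]
    rfl

theorem superTrace_one_DIII : superTrace (parityDIII l m) 1 = 2 * (l : ℂ) - 2 * m := by
  simp [superTrace_one, parityDIII, koszul]
  ring

/-- On the even vectors the block from `V^*` to `V` is skew-symmetric. Its diagonal vanishes, which
is why the even indices are matched in consecutive pairs. -/
theorem apply_inl_inr_DIII (x : ospSpace (formDIII l m)) (a b : Fin l) :
    x.1 (Sum.inl (Sum.inl a)) (Sum.inr (Sum.inl b)) =
      -x.1 (Sum.inl (Sum.inl b)) (Sum.inr (Sum.inl a)) :=
  (ospSpace_apply x _ _).trans (by simp [formDIII, parityDIII, koszul])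

theorem apply_inr_inl_DIII (x : ospSpace (formDIII l m)) (a b : Fin l) :
    x.1 (Sum.inr (Sum.inl a)) (Sum.inl (Sum.inl b)) =
      -x.1 (Sum.inr (Sum.inl b)) (Sum.inl (Sum.inl a)) :=
  (ospSpace_apply x _ _).trans (by simp [formDIII, parityDIII, koszul])

/-- Both parities of `l` are treated together, with `l - 2n` equal to `0` or `1`. An even coordinate
carries two edges and an odd one a single edge, so the eigenspaces have superdimension `2` and `-1`:
this is `s = 2` and `k = -2`. -/
theorem hasConjugateRadialPart_DIII (hl : l ≤ 2 * n + 1) {p r : ℂ}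
    (hp : p = -(2 * (l - 2 * n))) (hr : r = l - 2 * n) :
    (osp (formDIII l m)).HasConjugateRadialPart (thetaDIII l m)
      ((strForm (parityDIII l m) (1 / 4)).restrict _) (vectorsDIII m h)
      (fun _ _ _ E => cmsBC n m (-2) p (-1 / 2) r (-1 / 2) E) := by
  have hu : ∀ k, parityDIII l m (Sum.inl ((pairingDIII m h).u k)) =
      Sum.elim (fun _ => 0) (fun _ => 1) ((pairingDIII m h).col k) := by
    rintro ((k | k) | k) <;> rfl
  have hv : ∀ k, parityDIII l m (Sum.inr ((pairingDIII m h).v k)) =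
      Sum.elim (fun _ => 0) (fun _ => 1) ((pairingDIII m h).col k) := by
    rintro ((k | k) | k) <;> rfl
  have hH := (pairingDIII m h).isTripotentFamily hu hv
  rw [show (pairingDIII m h).vec = fun c => (vectorsDIII m h c).1 from
    funext (pairingDIII_vec m h)] at hH
  refine hH.hasConjugateRadialPart_osp (s := 2) BlockPairing.blockSign_mul_self _
    (fun c => ?_) ?_ ?_ (by norm_num) (by norm_num) rfl rfl ?_ (by norm_num) ?_ (by norm_num)
  · rw [← pairingDIII_vec]
    exact BlockPairing.signConj_vec _ c
  · intro x hx hcomm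
    simp only [← pairingDIII_vec] at hcomm
    -- Only the last even index can stay unmatched, and it is the same in both blocks. The
    -- corresponding entries lie on the diagonal of a skew-symmetric block and vanish.
    have hun : ∀ a b, a ∉ Set.range (pairingDIII m h).u → b ∉ Set.range (pairingDIII m h).v →
        ∃ i, a = Sum.inl i ∧ b = Sum.inl i := by
      intro a b ha hb
      have key : ∀ i : Fin l, (∀ j, evenIndex h j ≠ i) → (∀ j, oddIndex h j ≠ i) →
          (i : ℕ) = 2 * n := by
        intro i h1 h2
        by_contra hi
        rcases Nat.even_or_odd' (i : ℕ) with ⟨j, hj | hj⟩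
        · exact h1 ⟨j, by omega⟩ (Fin.ext hj.symm)
        · exact h2 ⟨j, by omega⟩ (Fin.ext hj.symm)
      rcases a with i | i
      · rcases b with j | j
        · refine ⟨i, rfl, congrArg Sum.inl (Fin.ext ?_)⟩
          rw [key i (fun k hk => ha ⟨Sum.inl (Sum.inl k), congrArg Sum.inl hk⟩)
            (fun k hk => ha ⟨Sum.inl (Sum.inr k), congrArg Sum.inl hk⟩),
            key j (fun k hk => hb ⟨Sum.inl (Sum.inr k), congrArg Sum.inl hk⟩)
            (fun k hk => hb ⟨Sum.inl (Sum.inl k), congrArg Sum.inl hk⟩)]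
        · exact absurd ⟨Sum.inr j, rfl⟩ hb
      · exact absurd ⟨Sum.inr i, rfl⟩ ha
    have hcol : Function.Surjective (pairingDIII m h).col := by
      rintro (i | j)
      · exact ⟨Sum.inl (Sum.inl i), rfl⟩
      · exact ⟨Sum.inr j, rfl⟩
    obtain ⟨t, ht⟩ := (pairingDIII m h).exists_eq_sum hcol hx hcomm
      (by
        rintro ((k | k) | k) ((k' | k') | k') hne hk
        · exact absurd (congrArg (fun i => Sum.inl (Sum.inl i)) (Sum.inl.inj hk)) hne
        · obtain rfl : k = k' := Sum.inl.inj hk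
          exact self_eq_neg.1 (apply_inl_inr_DIII m x _ _)
        · cases hk
        · obtain rfl : k = k' := Sum.inl.inj hk
          exact self_eq_neg.1 (apply_inl_inr_DIII m x _ _)
        · exact absurd (congrArg (fun i => Sum.inl (Sum.inr i)) (Sum.inl.inj hk)) hne
        · cases hk
        · cases hk
        · cases hk
        · exact absurd (congrArg Sum.inr (Sum.inr.inj hk)) hne)
      (by
        have hd : ∀ k, x.1 (Sum.inl (Sum.inl (evenIndex h k))) (Sum.inr (Sum.inl (oddIndex h k))) *
            -1 = x.1 (Sum.inl (Sum.inl (oddIndex h k))) (Sum.inr (Sum.inl (evenIndex h k))) * 1 :=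
          fun k => by
            rw [apply_inl_inr_DIII]
            ring
        rintro ((k | k) | k) ((k' | k') | k') hk
        · rw [show k = k' from Sum.inl.inj hk]
        · obtain rfl : k = k' := Sum.inl.inj hk
          exact hd k
        · cases hk
        · obtain rfl : k = k' := Sum.inl.inj hk
          exact (hd k).symm
        · rw [show k = k' from Sum.inl.inj hk]
        · cases hk
        · cases hk
        · cases hk
        · rw [show k = k' from Sum.inr.inj hk])
      (by
        intro a b ha hb
        obtain ⟨i, rfl, rfl⟩ := hun a b ha hb
        exact ⟨self_eq_neg.1 (apply_inl_inr_DIII m x i i),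
          self_eq_neg.1 (apply_inr_inl_DIII m x i i)⟩)
    simp only [pairingDIII_vec] at ht
    exact mem_span_range_of_coe_eq_sum ht
  · intro c
    simp only [← pairingDIII_vec]
    rw [BlockPairing.superTrace_vec_mul_self _ hu hv, Fintype.sum_sum_type, Fintype.sum_sum_type]
    rcases c with i | j
    · refine (congrArg (_ * ·) (congrArg₂ _ (congrArg₂ _
        (sum_ite_eq_single i (fun k => Sum.inl_injective.eq_iff) _)
        (sum_ite_eq_single i (fun k => Sum.inl_injective.eq_iff) _))
        (Finset.sum_eq_zero fun k _ => if_neg (by rintro ⟨⟩)))).trans ?_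
      simp [koszul, cmsWeight]
      norm_num
    · refine (congrArg (_ * ·) (congrArg₂ _ (congrArg₂ _
        (Finset.sum_eq_zero fun k _ => if_neg (by rintro ⟨⟩))
        (Finset.sum_eq_zero fun k _ => if_neg (by rintro ⟨⟩)))
        (sum_ite_eq_single j (fun k => Sum.inr_injective.eq_iff) _))).trans ?_
      simp [koszul, cmsWeight]
  · rw [superTrace_one_DIII, hp]
    norm_num
    ring
  · rw [superTrace_one_DIII, hr]
    norm_num
    ring

end seriesDIII

/-! ### The pair of general linear and orthosymplectic superalgebras -/

section seriesAI

variable (n m : ℕ)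

/-- The coordinate to which a basis vector belongs. -/
def coordAI : AIIndex n m → Fin n ⊕ Fin m := Sum.map id (Sum.elim id id)

theorem vectorsAI_eq (c : Fin n ⊕ Fin m) :
    vectorsAI n m c = Matrix.diagonal fun i => if coordAI n m i = c then 1 else 0 := by
  ext i j
  rw [Matrix.diagonal_apply]
  rcases c with c | c <;> rcases i with i | i | i <;> rcases j with j | j | j <;>
    simp [vectorsAI, coordAI, Matrix.single_apply]
  all_goals grind

/-- The weight decomposition of the superspace of dimension `(n | 2m)`. -/
def decompositionAI : WeightDecomposition (parityAI n m) (vectorsAI n m) (Fin n ⊕ Fin m) where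
  proj := vectorsAI n m
  par := Sum.elim (fun _ => 0) (fun _ => 1)
  wt := coordForm
  sum_proj := by
    ext i j
    simp only [vectorsAI_eq, Matrix.sum_apply, Matrix.diagonal_apply, Matrix.one_apply]
    split_ifs <;> simp
  proj_mul := by
    intro c c'
    simp only [vectorsAI_eq, Matrix.diagonal_mul_diagonal]
    split_ifs with h
    · subst h
      simp
    · rw [← Matrix.diagonal_zero]
      congr 1
      ext i
      by_cases h1 : coordAI n m i = c
      · simp [h1, h]
      · simp [h1]
  mul_proj := by
    intro c c'
    simp only [vectorsAI_eq, Matrix.diagonal_mul_diagonal, coordForm, ← Matrix.diagonal_smul]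
    congr 1
    ext i
    by_cases h : c = c'
    · subst h
      simp
    · by_cases h1 : coordAI n m i = c
      · simp [h1, h]
      · simp [h1, h]
  proj_mul_vec := by
    intro c c'
    simp only [vectorsAI_eq, Matrix.diagonal_mul_diagonal, coordForm, ← Matrix.diagonal_smul]
    congr 1
    ext i
    by_cases h : c = c'
    · subst h
      simp
    · by_cases h1 : coordAI n m i = c
      · simp [h1, h]
      · simp [h1, h]
  support := by
    intro c i j h
    rw [vectorsAI_eq, Matrix.diagonal_apply] at h
    rcases c with c | c <;> rcases i with i | i | i <;> rcases j with j | j | j <;>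
      simp_all [coordAI, parityAI]

theorem superTrace_vectorsAI (c : Fin n ⊕ Fin m) :
    superTrace (parityAI n m) (vectorsAI n m c) = cmsWeight (-1 / 2) c := by
  rcases c with c | c
  · simp [vectorsAI, superTrace_single, parityAI, koszul, cmsWeight]
  · simp [vectorsAI, superTrace_single, parityAI, koszul, cmsWeight]
    norm_num

theorem strForm_vectorsAI (i j : Fin n ⊕ Fin m) :
    strForm (parityAI n m) 1 (vectorsAI n m i) (vectorsAI n m j) =
      if i = j then cmsWeight (-1 / 2) i else 0 := by
  change 1 * superTrace (parityAI n m) (vectorsAI n m i * vectorsAI n m j) = _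
  rw [one_mul, show vectorsAI n m i * vectorsAI n m j = if i = j then vectorsAI n m i else 0 from
    (decompositionAI n m).proj_mul i j, ← superTrace_vectorsAI]
  split_ifs
  · rfl
  · exact map_zero _

theorem theta_vectorsAI (c : Fin n ⊕ Fin m) :
    (formAI n m).theta (vectorsAI n m c) = -vectorsAI n m c := by
  rcases c with c | c <;>
    simp [vectorsAI, SuperForm.theta_single, formAI, parityAI, koszul, single_neg_entry]

/-- Commuting with all coordinate projections leaves one entry for each `x_i` and a two by two block
for each `y_j`. On such a block the fixed subalgebra is `sp(2) = sl(2)`, so the `-1` eigenspace of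
`θ` consists of the scalars. -/
theorem mem_span_vectorsAI {x : Matrix (AIIndex n m) (AIIndex n m) ℂ}
    (hx : (formAI n m).theta x = -x) (hcomm : ∀ c, vectorsAI n m c * x = x * vectorsAI n m c) :
    x ∈ Submodule.span ℂ (Set.range (vectorsAI n m)) := by
  have hne : ∀ i j, coordAI n m i ≠ coordAI n m j → x i j = 0 := by
    intro i j h
    have := congrFun (congrFun (hcomm (coordAI n m i)) i) j
    rw [vectorsAI_eq, Matrix.diagonal_mul, Matrix.mul_diagonal, if_pos rfl, if_neg h.symm] at this
    simpa using this
  have hθ : ∀ i j, x i j = (formAI n m).ε i * (formAI n m).ε j *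
      koszul (parityAI n m i + parityAI n m j) (parityAI n m j) *
        x ((formAI n m).τ j) ((formAI n m).τ i) := by
    intro i j
    have := congrFun (congrFun hx i) j
    rw [SuperForm.theta_apply, Matrix.neg_apply, neg_inj] at this
    exact this.symm
  have h1 : ∀ k, x (Sum.inr (Sum.inl k)) (Sum.inr (Sum.inr k)) = 0 := fun k =>
    self_eq_neg.1 ((hθ _ _).trans (by
      simp [formAI, parityAI, koszul, CharTwo.add_self_eq_zero]))
  have h2 : ∀ k, x (Sum.inr (Sum.inr k)) (Sum.inr (Sum.inl k)) = 0 := fun k =>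
    self_eq_neg.1 ((hθ _ _).trans (by
      simp [formAI, parityAI, koszul, CharTwo.add_self_eq_zero]))
  have h3 : ∀ k, x (Sum.inr (Sum.inr k)) (Sum.inr (Sum.inr k)) =
      x (Sum.inr (Sum.inl k)) (Sum.inr (Sum.inl k)) := fun k => (hθ _ _).trans (by
    simp [formAI, parityAI, koszul, CharTwo.add_self_eq_zero])
  have hsum : x = ∑ c, (Sum.elim (fun i => x (Sum.inl i) (Sum.inl i))
      (fun k => x (Sum.inr (Sum.inl k)) (Sum.inr (Sum.inl k))) c : ℂ) • vectorsAI n m c := by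
    ext i j
    rw [Matrix.sum_apply, Finset.sum_eq_single (coordAI n m i)]
    · rw [Matrix.smul_apply, vectorsAI_eq, Matrix.diagonal_apply, if_pos rfl, smul_eq_mul]
      split_ifs with h
      · subst h
        rcases i with i | i | i
        · exact (mul_one _).symm
        · exact (mul_one _).symm
        · exact (h3 i).trans (mul_one _).symm
      · rw [mul_zero]
        by_cases hc : coordAI n m i = coordAI n m j
        · rcases i with i | i | i <;> rcases j with j | j | j
          · exact absurd (congrArg Sum.inl (Sum.inl.inj hc)) h
          · cases hc
          · cases hc
          · cases hc
          · exact absurd (congrArg (fun i => Sum.inr (Sum.inl i)) (Sum.inr.inj hc)) h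
          · obtain rfl : i = j := Sum.inr.inj hc
            exact h1 i
          · cases hc
          · obtain rfl : i = j := Sum.inr.inj hc
            exact h2 i
          · exact absurd (congrArg (fun i => Sum.inr (Sum.inr i)) (Sum.inr.inj hc)) h
        · exact hne i j hc
    · intro c _ hc
      rw [Matrix.smul_apply, vectorsAI_eq, Matrix.diagonal_apply, if_neg hc.symm]
      simp
    · simp
  rw [hsum]
  exact Submodule.sum_mem _ fun c _ => Submodule.smul_mem _ _ (Submodule.subset_span ⟨c, rfl⟩)

theorem isEvenCartanSubspace_AI
    {e : Module.Basis (Fin n ⊕ Fin m) ℂ (Submodule.span ℂ (Set.range (vectorsAI n m)))}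
    (he : ∀ i, (e i).1 = vectorsAI n m i) :
    (glSuper (parityAI n m)).IsEvenCartanSubspace (formAI n m).theta
      (Submodule.span ℂ (Set.range (vectorsAI n m))) :=
  (decompositionAI n m).isEvenCartanSubspace_gl (theta_vectorsAI n m)
    (fun _ => mem_span_vectorsAI n m) he

/-- The coordinate vectors are themselves the weight projections, with supertraces `1` and `-2`, the
weights `w_i` for `k = -1/2`. The factor one half from passing to positive roots is `-k`. -/
theorem isRootSumA_AI
    {e : Module.Basis (Fin n ⊕ Fin m) ℂ (Submodule.span ℂ (Set.range (vectorsAI n m)))}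
    (he : ∀ i, (e i).1 = vectorsAI n m i)
    {P : Finset (Module.Dual ℂ (Submodule.span ℂ (Set.range (vectorsAI n m))))}
    (hP : (glSuper (parityAI n m)).IsPositiveHalf _ P) :
    (glSuper (parityAI n m)).IsRootSumA e P (-1 / 2) (cmsWeight (-1 / 2)) := by
  intro V _ _ f hf hf0
  classical
  have hS : ∀ c, (decompositionAI n m).sdim c = cmsWeight (-1 / 2) c := fun c =>
    ((decompositionAI n m).superTrace_proj c).symm.trans (superTrace_vectorsAI n m c)
  rw [WeightDecomposition.sum_multiplicity (formAI n m).theta_isInvolution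
    (isEvenCartanSubspace_AI n m he) hP
    (fun i : (Fin n ⊕ Fin m) × (Fin n ⊕ Fin m) =>
      (decompositionAI n m).wt i.1 - (decompositionAI n m).wt i.2)
    (fun i => (decompositionAI n m).sdim i.1 * (decompositionAI n m).sdim i.2)
    (fun α => by convert (decompositionAI n m).multiplicity_gl he α) hf hf0,
    Fintype.sum_prod_type, Finset.smul_sum]
  refine Finset.sum_congr rfl fun i _ => ?_
  rw [Finset.smul_sum]
  refine Finset.sum_congr rfl fun j _ => ?_
  rw [smul_smul, hS, hS]
  refine congrArg₂ _ ?_ rfl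
  ring

theorem hasConjugateRadialPart_AI :
    (glSuper (parityAI n m)).HasConjugateRadialPart (formAI n m).theta
      (strForm (parityAI n m) 1) (vectorsAI n m) (fun _ _ _ E => cmsA n m (-1 / 2) E) := by
  have hk : (-1 / 2 : ℂ) ≠ 0 := by norm_num
  have hli := linearIndependent_of_gram (fun i => cmsWeight_ne_zero hk i) (strForm_vectorsAI n m)
  have he : ∀ c, (Module.Basis.span hli c).1 = vectorsAI n m c :=
    fun c => congrArg Subtype.val (Module.Basis.span_apply hli c)
  have hBe : ∀ i j, strForm (parityAI n m) 1 (Module.Basis.span hli i).1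
      (Module.Basis.span hli j).1 = if i = j then cmsWeight (-1 / 2) i else 0 := fun i j => by
    rw [he, he, strForm_vectorsAI]
  exact ⟨(formAI n m).theta_isInvolution, strForm_isInvariantForm 1, strForm_theta _ 1,
    strForm_nondegenerate one_ne_zero, isEvenCartanSubspace_AI n m he,
    nondegenerate_of_gram _ (fun i => cmsWeight_ne_zero hk i) hBe, Module.Basis.span hli, he,
    fun P hP => (isRootSumA_AI n m he hP).isConjugate hP hk hBe⟩

theorem radialPart_apply_AI
    (e : Module.Basis (Fin n ⊕ Fin m) ℂ (Submodule.span ℂ (Set.range (vectorsAI n m))))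
    (he : ∀ i, (e i).1 = vectorsAI n m i)
    (P : Finset (Module.Dual ℂ (Submodule.span ℂ (Set.range (vectorsAI n m)))))
    (hP : (glSuper (parityAI n m)).IsPositiveHalf _ P) (f : (glSuper (parityAI n m)).Loc e) :
    ((glSuper (parityAI n m)).radialPart e (strForm (parityAI n m) 1) P).apply
        ((glSuper (parityAI n m)).locDeriv e) f =
      4 * cmsAExp n m (-1 / 2) ((glSuper (parityAI n m)).expLoc e)
        ((glSuper (parityAI n m)).locDeriv e) f :=
  (isRootSumA_AI n m he hP).radialPart_apply hP (by norm_num)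
    (fun i j => by rw [he, he, strForm_vectorsAI]) f

end seriesAI

end RadialPart

end

theorem mainTheorem10 :
    -- `U(g) = S(a) + k U(g) + U(g) k`
    (∀ {g : Type*} [AddCommGroup g] [Module ℂ g] [FiniteDimensional ℂ g]
      (L : RadialPart.LieSuperalgebra g) (θ : g →ₗ[ℂ] g) (a : Submodule ℂ g),
      L.IsInvolution θ → ∀ ha : L.IsEvenCartanSubspace θ a,
        LinearMap.range ha.symToEnv.toLinearMap ⊔ L.kSpan θ = ⊤) ∧
    -- the radial part of the Laplace–Beltrami operator
    (∀ {g : Type*} [AddCommGroup g] [Module ℂ g] [FiniteDimensional ℂ g]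
      (L : RadialPart.LieSuperalgebra g) (θ : g →ₗ[ℂ] g) (a : Submodule ℂ g)
      (B : LinearMap.BilinForm ℂ g) (hB : B.Nondegenerate),
      L.IsInvolution θ → ∀ ha : L.IsEvenCartanSubspace θ a,
      L.IsInvariantForm B → (B.restrict a).Nondegenerate →
      (L.IsSimple ∨ ∀ x y, B (θ x) (θ y) = B x y) →
      ∀ {κ : Type*} [Fintype κ] [DecidableEq κ] (b : Module.Basis κ ℂ g)
        {ι : Type*} [Fintype ι] [DecidableEq ι] (e : Module.Basis ι ℂ a)
        (P : Finset (Module.Dual ℂ a)), L.IsPositiveHalf a P →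
      ∀ f : Module.Dual ℂ L.Enveloping, L.IsZonal θ f →
        L.IsZonal θ (RadialPart.LieSuperalgebra.laplaceBeltrami (L.casimir B hB b) f) ∧
        RadialPart.LieSuperalgebra.restriction e ha
            (RadialPart.LieSuperalgebra.laplaceBeltrami (L.casimir B hB b) f) =
          (L.radialPart e B P).apply (L.locDeriv e)
            (RadialPart.LieSuperalgebra.restriction e ha f)) ∧
    -- `(gl(n, 2m), osp(n, 2m))`
    (∀ n m : ℕ,
      (RadialPart.glSuper (RadialPart.parityAI n m)).HasConjugateRadialPart
        (RadialPart.formAI n m).theta (RadialPart.strForm (RadialPart.parityAI n m) 1)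
        (RadialPart.vectorsAI n m)
        (fun _ _ _ E => RadialPart.cmsA n m (-1 / 2) E) ∧
      ∀ e : Module.Basis (Fin n ⊕ Fin m) ℂ
          (Submodule.span ℂ (Set.range (RadialPart.vectorsAI n m))),
        (∀ i, (e i : Matrix _ _ ℂ) = RadialPart.vectorsAI n m i) →
        ∀ P, (RadialPart.glSuper (RadialPart.parityAI n m)).IsPositiveHalf _ P →
        ∀ f, ((RadialPart.glSuper (RadialPart.parityAI n m)).radialPart e
            (RadialPart.strForm (RadialPart.parityAI n m) 1) P).apply
            ((RadialPart.glSuper (RadialPart.parityAI n m)).locDeriv e) f =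
          4 * RadialPart.cmsAExp n m (-1 / 2)
            ((RadialPart.glSuper (RadialPart.parityAI n m)).expLoc e)
            ((RadialPart.glSuper (RadialPart.parityAI n m)).locDeriv e) f) ∧
    -- `(gl(n₁ + n₂, m₁ + m₂), gl(n₁, m₁) ⊕ gl(n₂, m₂))`
    (∀ n₁ m₁ n₂ m₂ : ℕ, 0 ≤ ((n₁ : ℤ) - n₂) * ((m₁ : ℤ) - m₂) →
      (RadialPart.glSuper (RadialPart.parityAIII n₁ m₁ n₂ m₂)).HasConjugateRadialPart
        (RadialPart.signConj RadialPart.blockSign)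
        (RadialPart.strForm (RadialPart.parityAIII n₁ m₁ n₂ m₂) (1 / 2))
        (RadialPart.vectorsAIII n₁ m₁ n₂ m₂)
        (fun _ _ _ E => RadialPart.cmsBC (min n₁ n₂) (min m₁ m₂) (-1)
          ((|(m₁ : ℤ) - m₂| : ℤ) - (|(n₁ : ℤ) - n₂| : ℤ)) (-1 / 2)
          ((|(n₁ : ℤ) - n₂| : ℤ) - (|(m₁ : ℤ) - m₂| : ℤ)) (-1 / 2) E)) ∧
    -- `(osp(n₁ + n₂, 2m₁ + 2m₂), osp(n₁, 2m₁) ⊕ osp(n₂, 2m₂))`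
    (∀ n₁ m₁ n₂ m₂ : ℕ, 0 ≤ ((n₁ : ℤ) - n₂) * ((m₁ : ℤ) - m₂) →
      (RadialPart.osp (RadialPart.formBDI n₁ m₁ n₂ m₂)).HasConjugateRadialPart
        (RadialPart.thetaBDI n₁ m₁ n₂ m₂)
        ((RadialPart.strForm (RadialPart.parityBDI n₁ m₁ n₂ m₂) (1 / 2)).restrict _)
        (RadialPart.vectorsBDI n₁ m₁ n₂ m₂)
        (fun _ _ _ E => RadialPart.cmsBC (min n₁ n₂) (min m₁ m₂) (-1 / 2)
          ((|(m₁ : ℤ) - m₂| : ℤ) - (|(n₁ : ℤ) - n₂| : ℤ) / 2) 0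
          ((|(n₁ : ℤ) - n₂| : ℤ) - 2 * (|(m₁ : ℤ) - m₂| : ℤ)) (-3 / 2) E)) ∧
    -- `(osp(4n, 2m), gl(2n, m))`
    (∀ n m : ℕ,
      (RadialPart.osp (RadialPart.formDIII (2 * n) m)).HasConjugateRadialPart
        (RadialPart.thetaDIII (2 * n) m)
        ((RadialPart.strForm (RadialPart.parityDIII (2 * n) m) (1 / 4)).restrict _)
        (RadialPart.vectorsDIII m (le_refl (2 * n)))
        (fun _ _ _ E => RadialPart.cmsBC n m (-2) 0 (-1 / 2) 0 (-1 / 2) E)) ∧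
    -- `(osp(4n + 2, 2m), gl(2n + 1, m))`
    (∀ n m : ℕ,
      (RadialPart.osp (RadialPart.formDIII (2 * n + 1) m)).HasConjugateRadialPart
        (RadialPart.thetaDIII (2 * n + 1) m)
        ((RadialPart.strForm (RadialPart.parityDIII (2 * n + 1) m) (1 / 4)).restrict _)
        (RadialPart.vectorsDIII m (Nat.le_succ (2 * n)))
        (fun _ _ _ E => RadialPart.cmsBC n m (-2) (-2) (-1 / 2) 1 (-1 / 2) E)) := by
  refine ⟨fun L θ a hθ ha => RadialPart.LieSuperalgebra.range_symToEnv_sup_kSpan hθ ha, ?_, ?_, ?_, ?_, ?_, ?_⟩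
  · intro g _ _ _ L θ a B hB hθ ha hinv hBa hs κ _ _ b ι _ _ e P hP f hf
    have hBθ : ∀ x y, B (θ x) (θ y) = B x y := by
      rcases hs with hs | hs
      · exact hs.theta_invariant hθ ha hB hinv hBa
      · exact hs
    exact ⟨hf.laplaceBeltrami_casimir b hinv,
      RadialPart.LieSuperalgebra.restriction_laplaceBeltrami e ha hθ hf hinv hB hBθ hBa b hP⟩
  · exact fun n m => ⟨RadialPart.hasConjugateRadialPart_AI n m, RadialPart.radialPart_apply_AI n m⟩
  · exact fun n₁ m₁ n₂ m₂ h => RadialPart.hasConjugateRadialPart_AIII n₁ m₁ n₂ m₂ h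
  · exact fun n₁ m₁ n₂ m₂ h => RadialPart.hasConjugateRadialPart_BDI n₁ m₁ n₂ m₂ h
  · exact fun n m => RadialPart.hasConjugateRadialPart_DIII m le_rfl (by omega) (by simp) (by simp)
  · exact fun n m => RadialPart.hasConjugateRadialPart_DIII m (Nat.le_succ _) (by omega)
      (by push_cast; ring) (by push_cast; ring)
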